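/- Setting. For a circle with centre $(c_1,c_2)$ and radius $R>0$ in $\mathbb{R}^2$, call the points $(c_1\pm R,c_2)$ (where the tangent line is vertical) its vertical poles and $(c_1,c_2\pm R)$ its horizontal poles. An MBC arrangement is a pair $(\mathcal{S},D)$ of a finite set $\mathcal{S}$ of circles and a bounded connected component $D$ of $\mathbb{R}^2\setminus\bigcup\mathcal{S}$ such that $\overline{D}$ meets every circle of $\mathcal{S}$, and at each point of $\overline{D}$ lying on two distinct circles of $\mathcal{S}$ (a double point) these two circles are transverse, no third circle of $\mathcal{S}$ passes, and no circle of $\mathcal{S}$ has a vertical or horizontal pole. Its Poincaré–Reeb V-digraph $W_D$ (for the first coordinate) is the quotient space of $\overline{D}$ in which two points are identified if they lie in the same connected component of $\overline{D}\cap\{x_1=c\}$ for some $c$; let $q_D$ be the quotient map. Its vertices are the classes containing a vertical pole of a circle of $\mathcal{S}$ or a double point; they are labelled by the value $m_D$ of the first coordinate; its edges are the connected components of the complement of the vertex set, oriented by increasing first coordinate. An isomorphism of V-digraphs is a homeomorphism that is smooth on edges, maps the vertex set onto the vertex set, preserves the orientations of the edges and preserves the order (with equalities) of the labels of the vertices.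 A vertical pole $p=(p_1,p_2)\in\overline{D}$ of a circle of $\mathcal{S}$ is of I-type if $(p_1-\epsilon,p_2)\notin\overline{D}$ for all sufficiently small $\epsilon>0$, and of II-type otherwise. Let $p$ be a vertical pole of I-type, and suppose that the connected component containing $p$ of $\overline{D}\cap\{x_1=p_1\}$ is $\{p_1\}\times[l,u]$ with $l<p_2<u$. Put $v_0=q_D(p)$. Theorem. (A) There are finite sequences $l=x_{l,0}<x_{l,1}<\dots<x_{l,a}=u$ and $l=x_{r,0}<x_{r,1}<\dots<x_{r,b}=u$, with only $u$ common to $\{x_{l,j}\}_{j=1}^a$ and $\{x_{r,j}\}_{j=1}^b$, such that the points $(p_1,x_{l,j})$, $0<j<a$, are exactly the vertical poles of I-type in the segment, the points $(p_1,x_{r,j})$, $0<j<b$, are exactly those of II-type, all points of the segment other than the points $(p_1,x_{l,j})$, $0\le j\le a$, and $(p_1,x_{r,j})$, $0\le j\le b$, are neither poles nor double points, the edges entering $v_0$ are $e_{l,1},\dots,e_{l,a}$, where $\overline{q_D^{-1}(e_{l,j})}\cap\{x_1=p_1\}=\{p_1\}\times[x_{l,j-1},x_{l,j}]$ (edges being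 open), and the edges departing from $v_0$ are $e_{r,1},\dots,e_{r,b}$, where $\overline{q_D^{-1}(e_{r,j})}\cap\{x_1=p_1\}=\{p_1\}\times[x_{r,j-1},x_{r,j}]$. There are indices $1\le j_0<a$ with $x_{l,j_0}=p_2$ and $1\le k_0\le b$ with $x_{r,k_0-1}<p_2<x_{r,k_0}$. (B) Given real numbers $\alpha<p_1<\beta$, modify $W_D$ as follows. Relabel $v_0$ by $\beta$. Add a vertex $v_1$ in the edge $e_{l,j_0}$ and a vertex $v_2$ in the edge $e_{l,j_0+1}$, both labelled $\alpha$. If $j_0\ne 1$ or $k_0\neq 1$ or $(p_1,l)$ is a double point, add a vertex $v_3$ labelled $p_1$ between $v_1$ and $v_0$. If $j_0+1\neq a$ or $k_0\ne b$ or $(p_1,u)$ is a double point, add a vertex $v_4$ labelled $p_1$ between $v_2$ and $v_0$. Let the edges $e_{l,j}$ enter $v_3$ for $j<j_0$ and $v_4$ for $j>j_0+1$, instead of $v_0$. Let the edges $e_{r,j}$ depart from $v_3$ for $j<k_0$ and from $v_4$ for $j>k_0$, instead of $v_0$. Everything else is unchanged. There are $\delta,\rho>0$ such that for all $\alpha\in(p_1-\delta,p_1)$,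 $\beta\in(p_1,p_1+\delta)$ and $0<r<\rho$ the following hold. In the modified digraph labels strictly increase along all edges. If $\mathcal{S}'$ is $\mathcal{S}$ together with the circle of radius $r$ centred at $p$, and $D'$ is $D$ minus the closed disk of radius $r$ centred at $p$, then $(\mathcal{S}',D')$ is an MBC arrangement, and its Poincaré–Reeb V-digraph $W_{D'}$ is isomorphic to the modified V-digraph. -/

import Mathlib

open Set Filter Topology

noncomputable section

/-! ## Circles in the plane and arrangements -/

/-- The Euclidean plane; `x 0` and `x 1` are the first and the second coordinate. -/
abbrev Plane : Type := EuclideanSpace ℝ (Fin 2)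

/-- A circle in the plane, given by its centre and its positive radius. -/
structure PlaneCircle where
  center : Plane
  radius : ℝ
  radius_pos : 0 < radius

namespace PlaneCircle

/-- The set of points of the circle. -/
def carrier (C : PlaneCircle) : Set Plane := Metric.sphere C.center C.radius

/-- The tangent line (as a linear subspace) of the circle at one of its points `q`. -/
def tangent (C : PlaneCircle) (q : Plane) : Submodule ℝ Plane :=
  (Submodule.span ℝ {q - C.center})ᗮ

/-- A vertical pole: a point of the circle at which the tangent line is vertical. -/
def IsVerticalPole (C : PlaneCircle) (q : Plane) : Prop :=
  q = !₂[C.center 0 + C.radius, C.center 1] ∨ q = !₂[C.center 0 - C.radius, C.center 1]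

/-- A horizontal pole: a point of the circle at which the tangent line is horizontal. -/
def IsHorizontalPole (C : PlaneCircle) (q : Plane) : Prop :=
  q = !₂[C.center 0, C.center 1 + C.radius] ∨ q = !₂[C.center 0, C.center 1 - C.radius]

end PlaneCircle

/-- `q` lies on two distinct circles of the family `S`. -/
def IsDoublePoint (S : Set PlaneCircle) (q : Plane) : Prop :=
  ∃ C₁ ∈ S, ∃ C₂ ∈ S, C₁ ≠ C₂ ∧ q ∈ C₁.carrier ∧ q ∈ C₂.carrier

/-- Arrangements of circles for Morse-Bott functions (MBC arrangements). -/
structure IsMBC (S : Set PlaneCircle) (D : Set Plane) : Prop where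
  finite : S.Finite
  /-- `D` is a connected component of the complement of the union of the circles. -/
  component : ∃ x ∈ (⋃ C ∈ S, C.carrier)ᶜ, D = connectedComponentIn (⋃ C ∈ S, C.carrier)ᶜ x
  bounded : Bornology.IsBounded D
  meets : ∀ C ∈ S, (closure D ∩ C.carrier).Nonempty
  transverse : ∀ C₁ ∈ S, ∀ C₂ ∈ S, C₁ ≠ C₂ → ∀ q ∈ closure D ∩ (C₁.carrier ∩ C₂.carrier),
    C₁.tangent q ⊔ C₂.tangent q = ⊤
  no_triple : ∀ C₁ ∈ S, ∀ C₂ ∈ S, C₁ ≠ C₂ → ∀ q ∈ closure D ∩ (C₁.carrier ∩ C₂.carrier),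
    ∀ C₃ ∈ S, q ∈ C₃.carrier → C₃ = C₁ ∨ C₃ = C₂
  not_pole : ∀ q ∈ closure D, IsDoublePoint S q →
    ∀ C ∈ S, ¬ C.IsVerticalPole q ∧ ¬ C.IsHorizontalPole q

/-- A vertical pole of I-type of the arrangement: a vertical pole `q`, in the closure of the
region, such that the points directly to the left of `q` and close to `q` are outside of the
closure of the region. -/
def IsTypeIPole (S : Set PlaneCircle) (D : Set Plane) (q : Plane) : Prop :=
  q ∈ closure D ∧ (∃ C ∈ S, C.IsVerticalPole q) ∧
    ∀ᶠ ε : ℝ in 𝓝[>] 0, !₂[q 0 - ε, q 1] ∉ closure D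

/-- A vertical pole of II-type: one that is not of I-type. -/
def IsTypeIIPole (S : Set PlaneCircle) (D : Set Plane) (q : Plane) : Prop :=
  q ∈ closure D ∧ (∃ C ∈ S, C.IsVerticalPole q) ∧ ¬ IsTypeIPole S D q

/-! ## V-digraphs -/

/-- Spaces with a marked set of vertices and a real function. For an oriented V-graph, `vert` is
the set of `0`-cells, the open edges are the connected components of the complement of `vert`,
`height` restricts on `vert` to the labelling, and each edge is oriented, and given a smooth
coordinate, by `height`. -/
structure VSpace where
  X : Type
  [top : TopologicalSpace X]
  vert : Set X
  height : X → ℝ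

attribute [instance] VSpace.top

/-- Isomorphism of oriented V-graphs: a homeomorphism that maps the vertex set onto the vertex
set, is on each edge an orientation preserving smooth map, and preserves the order of the
values at the vertices. -/
structure VSpace.Iso (A B : VSpace) where
  toHomeo : A.X ≃ₜ B.X
  image_vert : toHomeo '' A.vert = B.vert
  smooth_on_edge : ∀ x ∈ A.vertᶜ, ∃ g : ℝ → ℝ, ContDiff ℝ (⊤ : ℕ∞) g ∧ (∀ s, 0 < deriv g s) ∧
    ∀ y ∈ connectedComponentIn A.vertᶜ x, B.height (toHomeo y) = g (A.height y)
  order : ∀ u ∈ A.vert, ∀ v ∈ A.vert,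
    A.height u ≤ A.height v ↔ B.height (toHomeo u) ≤ B.height (toHomeo v)

/-- Combinatorial data of a V-digraph (multiple edges allowed). -/
structure VDigraph where
  V : Type
  E : Type
  src : E → V
  tgt : E → V
  label : V → ℝ

namespace VDigraph

/-- The orientation is compatible with the labels. -/
def Compatible (G : VDigraph) : Prop := ∀ e, G.label (G.src e) < G.label (G.tgt e)

/-- Gluing the two ends of each edge to its source and its target. -/
inductive Glue (G : VDigraph) : G.V ⊕ (G.E × unitInterval) → G.V ⊕ (G.E × unitInterval) → Prop
  | src (e : G.E) : Glue G (Sum.inr (e, 0)) (Sum.inl (G.src e))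
  | tgt (e : G.E) : Glue G (Sum.inr (e, 1)) (Sum.inl (G.tgt e))

/-- The underlying `1`-dimensional complex. -/
def Complex (G : VDigraph) : Type := Quot G.Glue

/-- The quotient topology, vertices and edges being discrete. -/
instance (G : VDigraph) : TopologicalSpace G.Complex :=
  letI : TopologicalSpace G.V := ⊥
  letI : TopologicalSpace G.E := ⊥
  inferInstanceAs (TopologicalSpace (Quot G.Glue))

/-- The labels, interpolated affinely along the edges. -/
def complexHeight (G : VDigraph) : G.Complex → ℝ :=
  Quot.lift
    (Sum.elim G.label
      (fun z => (1 - (z.2 : ℝ)) * G.label (G.src z.1) + (z.2 : ℝ) * G.label (G.tgt z.1)))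
    (by
      intro x y h
      cases h <;> simp)

/-- The geometric realization of a V-digraph. -/
def realize (G : VDigraph) : VSpace where
  X := G.Complex
  vert := range fun v : G.V => (Quot.mk G.Glue (Sum.inl v) : G.Complex)
  height := G.complexHeight

end VDigraph

/-! ## The Poincaré-Reeb V-digraph for the first projection -/

/-- The connected component of `x` in the fibre through `x` of the first projection on `closure D`.
-/
def fiberComp (D : Set Plane) (x : closure D) : Set Plane :=
  connectedComponentIn (closure D ∩ {z | z 0 = (x : Plane) 0}) x

lemma mem_fiberComp (D : Set Plane) (x : closure D) : (x : Plane) ∈ fiberComp D x :=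
  mem_connectedComponentIn ⟨x.2, rfl⟩

/-- Two points are identified if they lie in the same component of the same fibre. -/
def reebSetoid (D : Set Plane) : Setoid (closure D) := Setoid.ker (fiberComp D)

/-- The Poincaré-Reeb space, with the quotient topology. -/
abbrev ReebSpace (D : Set Plane) : Type := Quotient (reebSetoid D)

/-- The quotient map. -/
def reebMk (D : Set Plane) (x : closure D) : ReebSpace D := Quotient.mk (reebSetoid D) x

/-- The function induced by the first coordinate. -/
def reebHeight (D : Set Plane) : ReebSpace D → ℝ :=
  Quotient.lift (fun x : closure D => (x : Plane) 0) (by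
    intro x y h
    have h' : fiberComp D x = fiberComp D y := h
    have hx : (x : Plane) ∈ fiberComp D y := h' ▸ mem_fiberComp D x
    exact (connectedComponentIn_subset _ _ hx).2)

/-- The vertices: classes that contain a vertical pole of a circle or a point of two distinct
circles. -/
def reebVert (S : Set PlaneCircle) (D : Set Plane) : Set (ReebSpace D) :=
  {w | ∃ x : closure D, reebMk D x = w ∧
    ((∃ C ∈ S, C.IsVerticalPole x) ∨ IsDoublePoint S x)}

/-- The Poincaré-Reeb V-digraph of the arrangement for the first projection. -/
def reebGraph (S : Set PlaneCircle) (D : Set Plane) : VSpace where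
  X := ReebSpace D
  vert := reebVert S D
  height := reebHeight D

/-- The vertices of the Poincaré-Reeb V-digraph, as a type. -/
abbrev ReebVertex (S : Set PlaneCircle) (D : Set Plane) : Type := {w : ReebSpace D // w ∈ reebVert S D}

/-- The vertex given by a vertical pole in the closure of the region. -/
def poleVertex {S : Set PlaneCircle} {D : Set Plane} {p : Plane} (hp : p ∈ closure D)
    (hS : ∃ C ∈ S, C.IsVerticalPole p) : ReebVertex S D :=
  ⟨reebMk D ⟨p, hp⟩, ⟨p, hp⟩, rfl, Or.inl hS⟩

/-- An edge of the Poincaré-Reeb V-digraph: a connected component of the complement of the vertex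
set, together with the end it departs from and the end it enters. -/
structure ReebEdge (S : Set PlaneCircle) (D : Set Plane) where
  carrier : Set (ReebSpace D)
  component : ∃ w ∈ (reebVert S D)ᶜ, carrier = connectedComponentIn (reebVert S D)ᶜ w
  src : ReebVertex S D
  tgt : ReebVertex S D
  src_mem : src.1 ∈ closure carrier
  tgt_mem : tgt.1 ∈ closure carrier
  src_lt : ∀ w ∈ carrier, reebHeight D src.1 < reebHeight D w
  lt_tgt : ∀ w ∈ carrier, reebHeight D w < reebHeight D tgt.1

/-- The second coordinates of the points of the vertical line with first coordinate `c` that are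
limits of points of the region lying over the open edge `e`. -/
def ReebEdge.limitFiber {S : Set PlaneCircle} {D : Set Plane} (e : ReebEdge S D) (c : ℝ) : Set ℝ :=
  {t | !₂[c, t] ∈ closure (Subtype.val '' (reebMk D ⁻¹' e.carrier) : Set Plane)}

/-! ## The modified V-digraph -/

/-- The edges at the vertex `v₀`, listed from bottom to top, for the vertical segment with first
coordinate `p 0` and second coordinate between `lo` and `hi`: the segment is cut by the vertical
poles of I-type into the limits of the edges entering `v₀`, and by those of II-type into the limits
of the edges departing from `v₀`. -/
structure SegmentData (S : Set PlaneCircle) (D : Set Plane) (p : Plane) (lo hi : ℝ)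
    (v₀ : ReebVertex S D) where
  a : ℕ
  b : ℕ
  xl : ℕ → ℝ
  xr : ℕ → ℝ
  xl_mono : StrictMonoOn xl (Iic a)
  xr_mono : StrictMonoOn xr (Iic b)
  xl_zero : xl 0 = lo
  xr_zero : xr 0 = lo
  xl_last : xl a = hi
  xr_last : xr b = hi
  inter : xl '' Icc 1 a ∩ xr '' Icc 1 b = {hi}
  poles_l : xl '' Ioo 0 a = {t | t ∈ Icc lo hi ∧ IsTypeIPole S D !₂[p 0, t]}
  poles_r : xr '' Ioo 0 b = {t | t ∈ Icc lo hi ∧ IsTypeIIPole S D !₂[p 0, t]}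
  regular : ∀ t ∈ Icc lo hi, t ∉ xl '' Iic a → t ∉ xr '' Iic b →
    ¬ IsDoublePoint S !₂[p 0, t] ∧
      ∀ C ∈ S, ¬ C.IsVerticalPole !₂[p 0, t] ∧ ¬ C.IsHorizontalPole !₂[p 0, t]
  /-- The edges entering `v₀`. -/
  el : Icc 1 a ≃ {e : ReebEdge S D // e.tgt = v₀}
  /-- The edges departing from `v₀`. -/
  er : Icc 1 b ≃ {e : ReebEdge S D // e.src = v₀}
  el_fiber : ∀ j : Icc 1 a, (el j).1.limitFiber (p 0) = Icc (xl (j.1 - 1)) (xl j.1)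
  er_fiber : ∀ j : Icc 1 b, (er j).1.limitFiber (p 0) = Icc (xr (j.1 - 1)) (xr j.1)
  /-- The position of `p` among the poles of I-type. -/
  j₀ : ℕ
  one_le_j₀ : 1 ≤ j₀
  j₀_lt : j₀ < a
  xl_j₀ : xl j₀ = p 1
  /-- The position of `p` among the edges departing from `v₀`. -/
  k₀ : ℕ
  one_le_k₀ : 1 ≤ k₀
  k₀_le : k₀ ≤ b
  xr_lt : xr (k₀ - 1) < p 1
  lt_xr : p 1 < xr k₀

namespace SegmentData

variable {S : Set PlaneCircle} {D : Set Plane} {p : Plane} {lo hi : ℝ} {v₀ : ReebVertex S D}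

/-- The part of the segment below `p` contains another vertical pole, or ends in a point of two
circles; then the new vertex `v₃` is present. -/
def HasV3 (F : SegmentData S D p lo hi v₀) : Prop :=
  1 < F.j₀ ∨ 1 < F.k₀ ∨ IsDoublePoint S !₂[p 0, lo]

/-- The part of the segment above `p` contains another vertical pole, or ends in a point of two
circles; then the new vertex `v₄` is present. -/
def HasV4 (F : SegmentData S D p lo hi v₀) : Prop :=
  F.j₀ + 1 < F.a ∨ F.k₀ < F.b ∨ IsDoublePoint S !₂[p 0, hi]

/-- The added vertices. -/
inductive NewVertex (F : SegmentData S D p lo hi v₀) : Type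
  | v1 : NewVertex F
  | v2 : NewVertex F
  | v3 : F.HasV3 → NewVertex F
  | v4 : F.HasV4 → NewVertex F

/-- The added edges: the one departing from `v₁`, the one departing from `v₂`, the one from `v₃` to
`v₀` and the one from `v₄` to `v₀`. -/
inductive NewEdge (F : SegmentData S D p lo hi v₀) : Type
  | from1 : NewEdge F
  | from2 : NewEdge F
  | from3 : F.HasV3 → NewEdge F
  | from4 : F.HasV4 → NewEdge F

open Classical in
/-- The labels: `α` at `v₁` and `v₂`, `β` at `v₀`, the old value of `v₀` at `v₃` and `v₄`, and the
old values elsewhere. -/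
def newLabel (F : SegmentData S D p lo hi v₀) (α β : ℝ) : ReebVertex S D ⊕ F.NewVertex → ℝ
  | Sum.inl v => if v = v₀ then β else reebHeight D v.1
  | Sum.inr .v1 => α
  | Sum.inr .v2 => α
  | Sum.inr (.v3 _) => reebHeight D v₀.1
  | Sum.inr (.v4 _) => reebHeight D v₀.1

open Classical in
/-- Where an old edge departs from after the modification: the edges departing from `v₀` below
(above) the one whose limit contains `p` are moved to `v₃` (to `v₄`). -/
def oldSrc (F : SegmentData S D p lo hi v₀) (e : ReebEdge S D) : ReebVertex S D ⊕ F.NewVertex :=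
  if h : e.src = v₀ then
    if h1 : (F.er.symm ⟨e, h⟩).1 < F.k₀ then
      Sum.inr (.v3 (Or.inr (Or.inl (lt_of_le_of_lt (F.er.symm ⟨e, h⟩).2.1 h1))))
    else if h2 : F.k₀ < (F.er.symm ⟨e, h⟩).1 then
      Sum.inr (.v4 (Or.inr (Or.inl (lt_of_lt_of_le h2 (F.er.symm ⟨e, h⟩).2.2))))
    else Sum.inl v₀
  else Sum.inl e.src

open Classical in
/-- What an old edge enters after the modification: the two edges entering `v₀` next to `p` are cut
at `v₁` and `v₂`, and the edges entering `v₀` below (above) these two are moved to `v₃` (to `v₄`). -/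
def oldTgt (F : SegmentData S D p lo hi v₀) (e : ReebEdge S D) : ReebVertex S D ⊕ F.NewVertex :=
  if h : e.tgt = v₀ then
    if h1 : (F.el.symm ⟨e, h⟩).1 < F.j₀ then
      Sum.inr (.v3 (Or.inl (lt_of_le_of_lt (F.el.symm ⟨e, h⟩).2.1 h1)))
    else if h2 : F.j₀ + 1 < (F.el.symm ⟨e, h⟩).1 then
      Sum.inr (.v4 (Or.inl (lt_of_lt_of_le h2 (F.el.symm ⟨e, h⟩).2.2)))
    else if (F.el.symm ⟨e, h⟩).1 = F.j₀ then Sum.inr .v1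
    else Sum.inr .v2
  else Sum.inl e.tgt

/-- The sources of the added edges. -/
def newSrc (F : SegmentData S D p lo hi v₀) : F.NewEdge → ReebVertex S D ⊕ F.NewVertex
  | .from1 => Sum.inr .v1
  | .from2 => Sum.inr .v2
  | .from3 h => Sum.inr (.v3 h)
  | .from4 h => Sum.inr (.v4 h)

open Classical in
/-- The targets of the added edges: `v₃` lies between `v₁` and `v₀` and `v₄` lies between `v₂` and
`v₀`, if present. -/
def newTgt (F : SegmentData S D p lo hi v₀) : F.NewEdge → ReebVertex S D ⊕ F.NewVertex
  | .from1 => if h : F.HasV3 then Sum.inr (.v3 h) else Sum.inl v₀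
  | .from2 => if h : F.HasV4 then Sum.inr (.v4 h) else Sum.inl v₀
  | .from3 _ => Sum.inl v₀
  | .from4 _ => Sum.inl v₀

/-- The modified V-digraph. -/
def modified (F : SegmentData S D p lo hi v₀) (α β : ℝ) : VDigraph where
  V := ReebVertex S D ⊕ F.NewVertex
  E := ReebEdge S D ⊕ F.NewEdge
  src := Sum.elim F.oldSrc F.newSrc
  tgt := Sum.elim F.oldTgt F.newTgt
  label := F.newLabel α β

end SegmentData

end

/-! A component of a fibre of the first coordinate on `closure D` is a vertical segment, so two
points are identified exactly when the segment between them stays in `closure D` (`Vis`). A segment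
without vertical poles and double points runs between two open half-circles and has its interior in
`D` (`Reg`, `exists_reg`). By compactness of the segment this configuration persists over nearby
abscissae, and a limit of such segments which is not a vertex is again one of them. Hence the edges
are the maximal families of regular segments (`Strip`), and each is the image of the graph of its
lower boundary over an open interval.

For (A), look at the segment through `p` from one side. The circles come close to it only at its
ends and at the poles inside it. At an end on two circles the two arcs are ordered on each side,
since two circles meet in finitely many points, and the inner arc bounds the region. At an interior
pole the region is outside of the circle, because the segment continues above and below. A right
pole, from which both half-circles leave to the left, is then of I-type, and a left pole is of
II-type. So the regular segments on the left fill the gaps between consecutive I-type poles, those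
on the right the gaps between consecutive II-type poles (`IsFiber.exists_gaps`), and each gap gives
one edge at `v₀`.

For (B), choose `ρ` so small that the ball of radius `ρ` around `p` meets only the circle `C` with
right pole `p`, that `D` is the outside of `C` there, and that no vertex height other than `p 0` is
within `ρ` of `p 0` (`PoleContext`). Then this ball meets only `v₀`, the two entering edges next to
`p`, and the edge departing at `p`. Pushing points of `D` radially away from `p` keeps them in `D`
as long as they stay in the ball, so removing the disk leaves a connected set, whose closure is
`closure D` without the open disk (`LocalPole.isMBC_insert`). If `R` is the radius of `C`, the new
circle meets `C` over the abscissa `p 0 - r ^ 2 / (2 * R)` in two points, which become `v₁` and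
`v₂`. Its right pole represents the relabelled `v₀`, and its left pole is inside `C`, hence lost.
Over `p 0` the disk leaves a lower and an upper segment, and such a segment is a vertex precisely if
it contains a pole or a double point: these are `v₃` and `v₄`.

So every vertex of the modified digraph is represented by a point and every edge by the graph of a
function. Once the classes of these are shown to be distinct and to exhaust the new space,
`nonempty_iso_reebGraph` gives a continuous bijection from a compact complex onto a Hausdorff space.
Only the order of the labels is compared, and the open intervals of length `ρ` on both sides of `p
0` contain no height of an old vertex, so `α` and `β` are free there. -/

noncomputable section

/-! ## Points and circles in coordinates -/

/-- The point of the plane with the given coordinates. -/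
def pt (x y : ℝ) : Plane := !₂[x, y]

@[simp] lemma pt_zero (x y : ℝ) : pt x y 0 = x := by simp [pt]
@[simp] lemma pt_one (x y : ℝ) : pt x y 1 = y := by simp [pt]

lemma plane_ext {z w : Plane} (h0 : z 0 = w 0) (h1 : z 1 = w 1) : z = w := by
  ext i; fin_cases i <;> assumption

lemma pt_eta (z : Plane) : pt (z 0) (z 1) = z := plane_ext (by simp) (by simp)

lemma continuous_coord (i : Fin 2) : Continuous fun z : Plane => z i := by fun_prop

lemma continuous_pt : Continuous fun q : ℝ × ℝ => pt q.1 q.2 := by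
  unfold pt
  refine (PiLp.continuous_toLp 2 _).comp ?_
  refine continuous_pi fun i => ?_
  fin_cases i
  · exact continuous_fst
  · exact continuous_snd

lemma Continuous.pt {X : Type*} [TopologicalSpace X] {f g : X → ℝ} (hf : Continuous f)
    (hg : Continuous g) : Continuous fun x => pt (f x) (g x) :=
  continuous_pt.comp (hf.prodMk hg)

lemma norm_sq_plane (z : Plane) : ‖z‖ ^ 2 = z 0 ^ 2 + z 1 ^ 2 := by
  rw [EuclideanSpace.norm_sq_eq, Fin.sum_univ_two]; simp

lemma dist_sq_plane (z w : Plane) : dist z w ^ 2 = (z 0 - w 0) ^ 2 + (z 1 - w 1) ^ 2 := by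
  rw [dist_eq_norm, norm_sq_plane]; simp

lemma mem_ball_plane {z p : Plane} {r : ℝ} (hr : 0 < r) :
    z ∈ Metric.ball p r ↔ (z 0 - p 0) ^ 2 + (z 1 - p 1) ^ 2 < r ^ 2 := by
  rw [Metric.mem_ball, ← dist_sq_plane, sq_lt_sq₀ dist_nonneg hr.le]

/-- The power of a point with respect to a circle. -/
def pw (C : PlaneCircle) (z : Plane) : ℝ :=
  (z 0 - C.center 0) ^ 2 + (z 1 - C.center 1) ^ 2 - C.radius ^ 2

lemma continuous_pw (C : PlaneCircle) : Continuous (pw C) := by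
  unfold pw
  have h0 := continuous_coord 0
  have h1 := continuous_coord 1
  fun_prop

lemma pw_eq_dist (C : PlaneCircle) (z : Plane) : pw C z = dist z C.center ^ 2 - C.radius ^ 2 := by
  rw [dist_sq_plane, pw]

lemma mem_carrier {C : PlaneCircle} {z : Plane} : z ∈ C.carrier ↔ pw C z = 0 := by
  rw [PlaneCircle.carrier, Metric.mem_sphere, pw_eq_dist, sub_eq_zero,
    sq_eq_sq₀ dist_nonneg C.radius_pos.le]

lemma isClosed_carrier (C : PlaneCircle) : IsClosed C.carrier := Metric.isClosed_sphere

/-- Full horizontal distance from the centre leaves nothing for the vertical term of the power. This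
form treats both poles at once. -/
lemma isVerticalPole_iff {C : PlaneCircle} {z : Plane} :
    C.IsVerticalPole z ↔ pw C z = 0 ∧ (z 0 - C.center 0) ^ 2 = C.radius ^ 2 := by
  constructor
  · rintro (h | h) <;> subst h <;> simp [pw]
  · rintro ⟨h, h'⟩
    have h1 : z 1 = C.center 1 := by
      have : (z 1 - C.center 1) ^ 2 = 0 := by unfold pw at h; linarith
      exact sub_eq_zero.1 (pow_eq_zero_iff two_ne_zero |>.1 this)
    rcases sq_eq_sq_iff_eq_or_eq_neg.1 h' with h2 | h2
    · exact Or.inl (plane_ext (by simp; linarith) (by simp [h1]))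
    · exact Or.inr (plane_ext (by simp; linarith) (by simp [h1]))

/-- Distinct circles meet in a finite set. -/
lemma finite_inter_carrier {C₁ C₂ : PlaneCircle} (h : C₁ ≠ C₂) :
    (C₁.carrier ∩ C₂.carrier).Finite := by
  by_cases hc : C₁.center = C₂.center
  · convert Set.finite_empty
    rw [Set.eq_empty_iff_forall_notMem]
    rintro z ⟨h1, h2⟩
    apply h
    have : C₁.radius = C₂.radius := by
      rw [PlaneCircle.carrier, Metric.mem_sphere] at h1 h2
      rw [← h1, ← h2, hc]
    cases C₁; cases C₂; simp_all
  · by_cases hs : (C₁.carrier ∩ C₂.carrier).Subsingleton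
    · exact hs.finite
    · rw [Set.not_subsingleton_iff] at hs
      obtain ⟨a, ha, b, hb, hab⟩ := hs
      refine Set.Finite.subset (Set.toFinite {a, b}) fun z hz => ?_
      have hd : Module.finrank ℝ Plane = 2 := by simp
      exact EuclideanGeometry.eq_of_dist_eq_of_dist_eq_of_finrank_eq_two hd hc hab
        ha.1 hb.1 hz.1 ha.2 hb.2 hz.2

/-! ## Arcs -/

/-- An upper (`s = 1`) or lower (`s = -1`) half of a circle. -/
structure Arc where
  C : PlaneCircle
  s : ℝ
  hs : s = 1 ∨ s = -1

namespace Arc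

/-- Half of the length of the chord over `x`. -/
def g (A : Arc) (x : ℝ) : ℝ := √(A.C.radius ^ 2 - (x - A.C.center 0) ^ 2)

/-- The function whose graph is the arc. -/
def f (A : Arc) (x : ℝ) : ℝ := A.C.center 1 + A.s * A.g x

/-- The open interval under the arc. -/
def Dom (A : Arc) (x : ℝ) : Prop := (x - A.C.center 0) ^ 2 < A.C.radius ^ 2

lemma s_mul_s (A : Arc) : A.s * A.s = 1 := by
  rcases A.hs with h | h <;> rw [h] <;> norm_num

/-- No domain is needed: `√` vanishes at negative arguments, so the arc is extended by the constant
height of the centre. -/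
lemma continuous_g (A : Arc) : Continuous A.g := by unfold g; fun_prop

lemma continuous_f (A : Arc) : Continuous A.f := by
  have := A.continuous_g
  unfold f; fun_prop

lemma g_pos {A : Arc} {x : ℝ} (h : A.Dom x) : 0 < A.g x := by
  unfold Dom at h; exact Real.sqrt_pos.2 (by linarith)

lemma g_nonneg (A : Arc) (x : ℝ) : 0 ≤ A.g x := Real.sqrt_nonneg _

lemma g_sq {A : Arc} {x : ℝ} (h : (x - A.C.center 0) ^ 2 ≤ A.C.radius ^ 2) :
    A.g x ^ 2 = A.C.radius ^ 2 - (x - A.C.center 0) ^ 2 := Real.sq_sqrt (by linarith)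

lemma isOpen_dom (A : Arc) : IsOpen {x | A.Dom x} := by
  unfold Dom; exact isOpen_lt (by fun_prop) (by fun_prop)

lemma eventually_dom {A : Arc} {x : ℝ} (h : A.Dom x) : ∀ᶠ y in 𝓝 x, A.Dom y :=
  A.isOpen_dom.mem_nhds h

/-- On a vertical line the power is a quadratic polynomial in the height whose roots are the two
arcs; the second factor is the signed distance to the opposite arc. -/
lemma pw_eq {A : Arc} {z : Plane} (h : (z 0 - A.C.center 0) ^ 2 ≤ A.C.radius ^ 2) :
    pw A.C z = (z 1 - A.f (z 0)) * ((z 1 - A.f (z 0)) + 2 * A.s * A.g (z 0)) := by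
  have h1 := g_sq h
  have h2 := A.s_mul_s
  unfold pw f
  linear_combination h1 + A.g (z 0) ^ 2 * h2

lemma mem_carrier_f {A : Arc} {x : ℝ} (h : (x - A.C.center 0) ^ 2 ≤ A.C.radius ^ 2) :
    pt x (A.f x) ∈ A.C.carrier := by
  rw [mem_carrier, pw_eq (by simpa using h)]; simp

lemma exists_of_mem {C : PlaneCircle} {z : Plane} (h : z ∈ C.carrier) :
    ∃ A : Arc, A.C = C ∧ A.f (z 0) = z 1 := by
  have hp := mem_carrier.1 h
  unfold pw at hp
  have hr : C.radius ^ 2 - (z 0 - C.center 0) ^ 2 = (z 1 - C.center 1) ^ 2 := by linarith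
  rcases le_total 0 (z 1 - C.center 1) with h1 | h1
  · refine ⟨⟨C, 1, Or.inl rfl⟩, rfl, ?_⟩
    simp only [f, g, hr, Real.sqrt_sq h1]; ring
  · refine ⟨⟨C, -1, Or.inr rfl⟩, rfl, ?_⟩
    simp only [f, g, hr, Real.sqrt_sq_eq_abs, abs_of_nonpos h1]; ring

lemma ext_of {A B : Arc} (h : A.C = B.C) (hs : A.s = B.s) : A = B := by
  cases A; cases B; simp_all

/-- The two arcs of a circle meet only over its vertical poles. -/
lemma eq_of_f_eq {A B : Arc} {x : ℝ} (h : A.C = B.C) (hA : A.Dom x) (hf : A.f x = B.f x) :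
    A = B := by
  have hg := g_pos hA
  have hgg : A.g x = B.g x := by unfold g; rw [h]
  refine ext_of h ?_
  unfold f at hf
  rw [← hgg, h] at hf
  exact mul_right_cancel₀ hg.ne' (add_left_cancel hf)

lemma sq_le_of_mem {C : PlaneCircle} {z : Plane} (h : z ∈ C.carrier) :
    (z 0 - C.center 0) ^ 2 ≤ C.radius ^ 2 := by
  have hp := mem_carrier.1 h
  unfold pw at hp
  nlinarith [sq_nonneg (z 1 - C.center 1)]

lemma dom_of_not_isVerticalPole {A : Arc} {z : Plane} (h : z ∈ A.C.carrier)
    (hn : ¬ A.C.IsVerticalPole z) : A.Dom (z 0) := by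
  refine lt_of_le_of_ne (sq_le_of_mem h) fun h' => hn ?_
  exact isVerticalPole_iff.2 ⟨mem_carrier.1 h, h'⟩

/-- Near a point of the open arc, the other arc of the circle is away. -/
lemma eventually_factor_pos {A : Arc} {x : ℝ} (h : A.Dom x) :
    ∀ᶠ z in 𝓝 (pt x (A.f x)), A.Dom (z 0) ∧ 0 < A.s * (z 1 - A.f (z 0)) + 2 * A.g (z 0) := by
  have h0 : ContinuousAt (fun z : Plane => z 0) (pt x (A.f x)) := (continuous_coord 0).continuousAt
  have h1 := continuous_coord 1
  have h2 := A.continuous_f.comp (continuous_coord 0)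
  have h3 := A.continuous_g.comp (continuous_coord 0)
  refine (h0.eventually (by simpa using eventually_dom h)).and ?_
  have : Continuous fun z : Plane => A.s * (z 1 - A.f (z 0)) + 2 * A.g (z 0) := by
    have := h1.sub h2
    exact (continuous_const.mul this).add (continuous_const.mul h3)
  refine this.continuousAt.eventually (lt_mem_nhds ?_)
  simpa using g_pos h

/-- Near a point of the open arc, the circle coincides with the arc. -/
lemma eventually_eq_of_mem {A : Arc} {x : ℝ} (h : A.Dom x) :
    ∀ᶠ z in 𝓝 (pt x (A.f x)), z ∈ A.C.carrier → z 1 = A.f (z 0) := by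
  filter_upwards [eventually_factor_pos h] with z hz hm
  have h1 := mem_carrier.1 hm
  rw [pw_eq hz.1.le] at h1
  rcases mul_eq_zero.1 h1 with h2 | h2
  · linarith
  · exfalso
    have := A.s_mul_s
    have h3 : A.s * ((z 1 - A.f (z 0)) + 2 * A.s * A.g (z 0)) = 0 := by rw [h2]; ring
    have h4 : A.s * (z 1 - A.f (z 0)) + 2 * A.g (z 0) = 0 := by
      linear_combination h3 - 2 * A.g (z 0) * this
    linarith [hz.2]

/-- The region `D` is above (`υ = 1`) or below (`υ = -1`) the arc, locally at the arc. -/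
def Side (D : Set Plane) (A : Arc) (υ : ℝ) : Prop := ∀ z ∈ D, 0 < υ * A.s * pw A.C z

lemma Side.closure {D : Set Plane} {A : Arc} {υ : ℝ} (h : A.Side D υ) {z : Plane}
    (hz : z ∈ closure D) : 0 ≤ υ * A.s * pw A.C z := by
  have hc : IsClosed {z | 0 ≤ υ * A.s * pw A.C z} :=
    isClosed_le continuous_const (continuous_const.mul (continuous_pw _))
  exact closure_minimal (fun w hw => (h w hw).le) hc hz

/-- Near the open arc the factor of the power that belongs to the opposite arc has a fixed sign, so
the sign of the power is that of the height over the arc. -/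
lemma Side.eventually {D : Set Plane} {A : Arc} {υ : ℝ} (h : A.Side D υ) {x : ℝ} (hx : A.Dom x) :
    ∀ᶠ z in 𝓝 (pt x (A.f x)), z ∈ _root_.closure D → 0 ≤ υ * (z 1 - A.f (z 0)) := by
  filter_upwards [eventually_factor_pos hx] with z hz hm
  have h1 := h.closure hm
  rw [pw_eq hz.1.le] at h1
  have h2 : 0 ≤ (υ * (z 1 - A.f (z 0))) * (A.s * (z 1 - A.f (z 0)) + 2 * A.g (z 0)) := by
    have := A.s_mul_s
    convert h1 using 1
    linear_combination (-2 * υ * (z 1 - A.f (z 0)) * A.g (z 0)) * this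
  exact nonneg_of_mul_nonneg_left h2 hz.2

end Arc

/-! ## The region -/

namespace IsMBC

variable {S : Set PlaneCircle} {D : Set Plane}

lemma isOpen_compl (h : IsMBC S D) : IsOpen (⋃ C ∈ S, C.carrier)ᶜ :=
  (h.finite.isClosed_biUnion fun C _ => isClosed_carrier C).isOpen_compl

lemma isOpen (h : IsMBC S D) : IsOpen D := by
  obtain ⟨x, -, rfl⟩ := h.component
  exact h.isOpen_compl.connectedComponentIn

lemma isPreconnected (h : IsMBC S D) : IsPreconnected D := by
  obtain ⟨x, -, rfl⟩ := h.component
  exact isPreconnected_connectedComponentIn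

lemma nonempty (h : IsMBC S D) : D.Nonempty := by
  obtain ⟨x, hx, rfl⟩ := h.component
  exact ⟨x, mem_connectedComponentIn hx⟩

lemma notMem_carrier (h : IsMBC S D) {z : Plane} (hz : z ∈ D) {C : PlaneCircle} (hC : C ∈ S) :
    z ∉ C.carrier := by
  obtain ⟨x, -, rfl⟩ := h.component
  have := connectedComponentIn_subset _ _ hz
  simp only [mem_compl_iff, mem_iUnion, not_exists] at this
  exact this C hC

lemma subset_of_isPreconnected (h : IsMBC S D) {T : Set Plane} (hT : IsPreconnected T)
    (hS : ∀ z ∈ T, ∀ C ∈ S, z ∉ C.carrier) (hD : (T ∩ D).Nonempty) : T ⊆ D := by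
  obtain ⟨x, hx, rfl⟩ := h.component
  obtain ⟨y, hyT, hyD⟩ := hD
  rw [connectedComponentIn_eq hyD]
  refine hT.subset_connectedComponentIn hyT fun z hz => ?_
  simp only [mem_compl_iff, mem_iUnion, not_exists]
  exact hS z hz

lemma isCompact_closure (h : IsMBC S D) : IsCompact (closure D) := h.bounded.isCompact_closure

/-- A small ball around such a point avoids all circles and meets `D`; being connected, it is
contained in `D`. -/
lemma mem_of_notMem_carrier (h : IsMBC S D) {z : Plane} (hz : z ∈ closure D)
    (hS : ∀ C ∈ S, z ∉ C.carrier) : z ∈ D := by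
  have hz' : z ∈ (⋃ C ∈ S, C.carrier)ᶜ := by simpa using hS
  obtain ⟨ε, hε, hb⟩ := Metric.isOpen_iff.1 h.isOpen_compl z hz'
  refine h.subset_of_isPreconnected (convex_ball z ε).isPreconnected (fun w hw C hC hwC => ?_)
    ?_ (Metric.mem_ball_self hε)
  · exact hb hw (mem_biUnion hC hwC)
  · exact mem_closure_iff.1 hz _ Metric.isOpen_ball (Metric.mem_ball_self hε)

/-- A circle has the region on one of its sides. -/
lemma exists_sign (h : IsMBC S D) {C : PlaneCircle} (hC : C ∈ S) :
    ∃ κ : ℝ, (κ = 1 ∨ κ = -1) ∧ ∀ z ∈ D, 0 < κ * pw C z := by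
  have hne : ∀ z ∈ D, pw C z ≠ 0 := fun z hz h0 => h.notMem_carrier hz hC (mem_carrier.2 h0)
  obtain ⟨z₀, hz₀⟩ := h.nonempty
  have himg : IsPreconnected (pw C '' D) := h.isPreconnected.image _ (continuous_pw C).continuousOn
  have key : ∀ z ∈ D, ∀ w ∈ D, 0 < pw C z → pw C w < 0 → False := by
    intro z hz w hw h1 h2
    obtain ⟨v, hv, hv0⟩ := himg.Icc_subset (mem_image_of_mem _ hw) (mem_image_of_mem _ hz)
      ⟨h2.le, h1.le⟩
    exact hne v hv hv0
  rcases lt_or_gt_of_ne (hne z₀ hz₀) with h0 | h0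
  · refine ⟨-1, Or.inr rfl, fun z hz => ?_⟩
    rcases lt_or_gt_of_ne (hne z hz) with h1 | h1
    · linarith
    · exact (key z hz z₀ hz₀ h1 h0).elim
  · refine ⟨1, Or.inl rfl, fun z hz => ?_⟩
    rcases lt_or_gt_of_ne (hne z hz) with h1 | h1
    · exact (key z₀ hz₀ z hz h0 h1).elim
    · linarith

lemma exists_side (h : IsMBC S D) {A : Arc} (hA : A.C ∈ S) :
    ∃ υ : ℝ, (υ = 1 ∨ υ = -1) ∧ A.Side D υ := by
  obtain ⟨κ, hκ, hD⟩ := h.exists_sign hA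
  refine ⟨κ * A.s, ?_, fun z hz => ?_⟩
  · rcases hκ with rfl | rfl <;> rcases A.hs with h' | h' <;> simp [h']
  · have := hD z hz
    have h2 := A.s_mul_s
    calc 0 < κ * pw A.C z := this
      _ = _ := by linear_combination (-κ * pw A.C z) * h2

lemma eventually_notMem (h : IsMBC S D) (q : Plane) :
    ∀ᶠ z in 𝓝 q, ∀ C ∈ S, q ∉ C.carrier → z ∉ C.carrier := by
  rw [Filter.eventually_all_finite h.finite]
  intro C _
  by_cases hq : q ∈ C.carrier
  · simp [hq]
  · filter_upwards [(isClosed_carrier C).isOpen_compl.mem_nhds hq] with z hz _ using hz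

/-- Near a point on exactly one circle, the region is a side of this circle. -/
lemma eventually_mem (h : IsMBC S D) {q : Plane} (hq : q ∈ closure D) {C : PlaneCircle}
    (hqC : q ∈ C.carrier) (huniq : ∀ C' ∈ S, q ∈ C'.carrier → C' = C)
    {κ : ℝ} (hκ : κ = 1 ∨ κ = -1) (hD : ∀ z ∈ D, 0 < κ * pw C z) :
    ∀ᶠ z in 𝓝 q, 0 < κ * pw C z → z ∈ D := by
  obtain ⟨ε₀, hε₀, hb⟩ := Metric.eventually_nhds_iff_ball.1 (h.eventually_notMem q)
  have hR := C.radius_pos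
  have hav : ∀ z ∈ Metric.ball q ε₀, 0 < κ * pw C z → ∀ C' ∈ S, z ∉ C'.carrier := by
    intro z hz hpz C' hC' hzC
    by_cases hqC' : q ∈ C'.carrier
    · rw [huniq C' hC' hqC', mem_carrier] at hzC
      rw [hzC] at hpz; simp at hpz
    · exact hb z hz C' hC' hqC' hzC
  rcases hκ with rfl | rfl
  · -- the region is outside
    -- A third of `ε₀` leaves room for a translation by `2 * ε`; a value below the radius keeps the
    -- product with the outward normal `n` positive on the `ε`-ball.
    set ε := min (ε₀ / 3) (C.radius / 2) with hεdef
    have hε : 0 < ε := by positivity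
    have hε1 : 3 * ε ≤ ε₀ := by have := min_le_left (ε₀ / 3) (C.radius / 2); linarith
    have hε2 : ε < C.radius := by have := min_le_right (ε₀ / 3) (C.radius / 2); linarith
    set n : Plane := (C.radius)⁻¹ • (q - C.center) with hn
    have hqc : ‖q - C.center‖ = C.radius := by
      rw [← dist_eq_norm]; exact hqC
    have hnn : ‖n‖ = 1 := by
      rw [hn, norm_smul, hqc, Real.norm_of_nonneg (inv_nonneg.2 hR.le), inv_mul_cancel₀ hR.ne']
    have hqn : inner ℝ (q - C.center) n = C.radius := by
      rw [hn, inner_smul_right, real_inner_self_eq_norm_sq, hqc]; field_simp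
    have hin : ∀ z ∈ Metric.ball q ε, C.radius - ε < inner ℝ (z - C.center) n := by
      intro z hz
      have h1 : inner ℝ (z - C.center) n = inner ℝ (z - q) n + C.radius := by
        rw [← hqn, ← inner_add_left]; congr 1; abel
      have h2 := abs_le.1 ((abs_real_inner_le_norm (z - q) n).trans_eq (by rw [hnn, mul_one]))
      have h3 : ‖z - q‖ < ε := by rwa [← dist_eq_norm]
      linarith [h2.1]
    set H : Set Plane := Metric.ball q (3 * ε) ∩ {z | C.radius < inner ℝ (z - C.center) n} with hH
    have hHc : Convex ℝ H := by
      refine (convex_ball _ _).inter ?_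
      have : {z : Plane | C.radius < inner ℝ (z - C.center) n} =
          {z : Plane | C.radius + inner ℝ C.center n < innerSL ℝ n z} := by
        ext z; simp only [mem_ofPred_eq, inner_sub_left, innerSL_apply_apply]
        rw [real_inner_comm n z]
        constructor <;> intro h <;> linarith
      rw [this]
      exact convex_halfSpace_gt (innerSL ℝ n).isLinear _
    have hHpw : ∀ z ∈ H, 0 < pw C z := by
      rintro z ⟨-, hz⟩
      have h1 : C.radius < ‖z - C.center‖ := by
        refine lt_of_lt_of_le hz ((real_inner_le_norm _ _).trans_eq (by rw [hnn, mul_one]))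
      rw [pw_eq_dist, dist_eq_norm]; nlinarith
    -- The outside of `C` is not convex near `q`, but `H`, the part beyond the tangent, is. A
    -- translation by `2 * ε` along `n` carries every point of the `ε`-ball into `H` and does not
    -- decrease the power on the way, so `H` together with these segments is connected and avoids
    -- all circles.
    set T : Set Plane := H ∪ {w | ∃ z ∈ Metric.ball q ε, 0 < pw C z ∧
      w ∈ segment ℝ z (z + (2 * ε) • n)} with hT
    have hend : ∀ z ∈ Metric.ball q ε, z + (2 * ε) • n ∈ H := by
      intro z hz
      refine ⟨?_, ?_⟩
      · rw [Metric.mem_ball, dist_eq_norm]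
        have : z + (2 * ε) • n - q = (z - q) + (2 * ε) • n := by abel
        rw [this]
        refine (norm_add_le _ _).trans_lt ?_
        rw [norm_smul, hnn, Real.norm_of_nonneg (by positivity), ← dist_eq_norm]
        have := Metric.mem_ball.1 hz
        linarith
      · have : z + (2 * ε) • n - C.center = (z - C.center) + (2 * ε) • n := by abel
        simp only [mem_ofPred_eq, this, inner_add_left, inner_smul_left, real_inner_self_eq_norm_sq,
          hnn]
        have := hin z hz
        simp only [conj_trivial]
        linarith
    have hTav : ∀ w ∈ T, w ∈ Metric.ball q ε₀ ∧ 0 < pw C w := by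
      rintro w (hw | ⟨z, hz, hpz, hw⟩)
      · exact ⟨Metric.ball_subset_ball hε1 hw.1, hHpw w hw⟩
      · constructor
        · have h1 : segment ℝ z (z + (2 * ε) • n) ⊆ Metric.ball q (3 * ε) :=
            (convex_ball q (3 * ε)).segment_subset
              (Metric.ball_subset_ball (by linarith) hz) (hend z hz).1
          exact Metric.ball_subset_ball hε1 (h1 hw)
        · rw [segment_eq_image'] at hw
          obtain ⟨θ, hθ, rfl⟩ := hw
          have h1 := hin z hz
          have h2 : z + θ • (z + (2 * ε) • n - z) - C.center =
            (z - C.center) + (θ * (2 * ε)) • n := by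
            rw [add_sub_cancel_left, smul_smul]; abel
          rw [pw_eq_dist, dist_eq_norm] at hpz ⊢
          rw [h2, norm_add_sq_real, inner_smul_right]
          have h3 : 0 ≤ θ * (2 * ε) := mul_nonneg hθ.1 (by positivity)
          have h4 : 0 < inner ℝ (z - C.center) n := by linarith
          nlinarith [mul_nonneg h3 h4.le, sq_nonneg ‖(θ * (2 * ε)) • n‖]
    have hTc : IsPreconnected T := by
      have hq0 : q + (2 * ε) • n ∈ H := hend q (Metric.mem_ball_self hε)
      refine isPreconnected_of_forall (q + (2 * ε) • n) ?_
      rintro w (hw | ⟨z, hz, hpz, hw⟩)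
      · exact ⟨H, subset_union_left, hq0, hw, hHc.isPreconnected⟩
      · refine ⟨H ∪ segment ℝ z (z + (2 * ε) • n), ?_, Or.inl hq0, Or.inr hw, ?_⟩
        · exact union_subset_union_right _ fun v hv => ⟨z, hz, hpz, hv⟩
        · exact hHc.isPreconnected.union (z + (2 * ε) • n) (hend z hz) (right_mem_segment _ _ _)
            (convex_segment _ _).isPreconnected
    have hTD : T ⊆ D := by
      refine h.subset_of_isPreconnected hTc (fun z hz => ?_) ?_
      · have := hTav z hz
        exact hav z this.1 (by linarith [this.2])
      · obtain ⟨w, hw1, hw2⟩ := mem_closure_iff.1 hq _ Metric.isOpen_ball (Metric.mem_ball_self hε)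
        have := hD w hw2
        exact ⟨w, Or.inr ⟨w, hw1, by linarith, left_mem_segment _ _ _⟩, hw2⟩
    filter_upwards [Metric.ball_mem_nhds q hε] with z hz hpz
    exact hTD (Or.inr ⟨z, hz, by linarith, left_mem_segment _ _ _⟩)
  · -- the region is inside
    have hTD : Metric.ball q ε₀ ∩ Metric.ball C.center C.radius ⊆ D := by
      have hiff : ∀ z : Plane, z ∈ Metric.ball C.center C.radius ↔ 0 < -1 * pw C z := by
        intro z
        rw [pw_eq_dist, Metric.mem_ball, ← sq_lt_sq₀ dist_nonneg hR.le]
        constructor <;> intro h <;> linarith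
      refine h.subset_of_isPreconnected
        ((convex_ball _ _).inter (convex_ball _ _)).isPreconnected (fun z hz => ?_) ?_
      · exact hav z hz.1 ((hiff z).1 hz.2)
      · obtain ⟨w, hw1, hw2⟩ := mem_closure_iff.1 hq _ Metric.isOpen_ball (Metric.mem_ball_self hε₀)
        exact ⟨w, ⟨hw1, (hiff w).2 (hD w hw2)⟩, hw2⟩
    filter_upwards [Metric.ball_mem_nhds q hε₀] with z hz hpz
    refine hTD ⟨hz, ?_⟩
    rw [pw_eq_dist] at hpz
    rw [Metric.mem_ball, ← sq_lt_sq₀ dist_nonneg hR.le]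
    linarith

end IsMBC

/-! ## Vertical segments and fibres -/

/-- The vertical segment between `a` and `b` is contained in `K`. -/
def Vis (K : Set Plane) (a b : Plane) : Prop :=
  a 0 = b 0 ∧ ∀ t ∈ uIcc (a 1) (b 1), pt (a 0) t ∈ K

namespace Vis

variable {K K' : Set Plane} {a b c : Plane}

lemma symm (h : Vis K a b) : Vis K b a :=
  ⟨h.1.symm, fun t ht => h.1 ▸ h.2 t (uIcc_comm (b 1) (a 1) ▸ ht)⟩

lemma trans (h : Vis K a b) (h' : Vis K b c) : Vis K a c := by
  refine ⟨h.1.trans h'.1, fun t ht => ?_⟩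
  rcases uIcc_subset_uIcc_union_uIcc (b := b 1) ht with h1 | h1
  · exact h.2 t h1
  · rw [h.1]; exact h'.2 t h1

lemma mono (h : Vis K a b) (hK : K ⊆ K') : Vis K' a b := ⟨h.1, fun t ht => hK (h.2 t ht)⟩

lemma left_mem (h : Vis K a b) : a ∈ K := by
  have := h.2 (a 1) left_mem_uIcc
  rwa [pt_eta] at this

lemma right_mem (h : Vis K a b) : b ∈ K := h.symm.left_mem

lemma refl (h : a ∈ K) : Vis K a a := by
  refine ⟨rfl, fun t ht => ?_⟩
  rw [uIcc_self, mem_singleton_iff] at ht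
  rw [ht, pt_eta]; exact h

lemma of_Icc {x y y' l u : ℝ} (h : ∀ t ∈ Icc l u, pt x t ∈ K) (hy : y ∈ Icc l u)
    (hy' : y' ∈ Icc l u) : Vis K (pt x y) (pt x y') := by
  refine ⟨by simp, fun t ht => ?_⟩
  simp only [pt_zero, pt_one] at ht ⊢
  exact h t (uIcc_subset_Icc hy hy' ht)

end Vis

/-- Connected subsets of a line are intervals. From here on components of fibres are handled through
`Vis` only. -/
lemma mem_connectedComponentIn_iff {K : Set Plane} {a b : Plane} (ha : a ∈ K) :
    b ∈ connectedComponentIn (K ∩ {z | z 0 = a 0}) a ↔ Vis K a b := by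
  have haF : a ∈ K ∩ {z : Plane | z 0 = a 0} := ⟨ha, rfl⟩
  constructor
  · intro hb
    have hsub := connectedComponentIn_subset (K ∩ {z : Plane | z 0 = a 0}) a
    refine ⟨(hsub hb).2.symm, fun t ht => ?_⟩
    have hp : IsPreconnected ((fun z : Plane => z 1) ''
        connectedComponentIn (K ∩ {z : Plane | z 0 = a 0}) a) :=
      isPreconnected_connectedComponentIn.image _ (continuous_coord 1).continuousOn
    obtain ⟨w, hw, rfl⟩ := hp.ordConnected.uIcc_subset
      (mem_image_of_mem _ (mem_connectedComponentIn haF)) (mem_image_of_mem _ hb) ht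
    have h2 := hsub hw
    have h3 : w 0 = a 0 := h2.2
    simp only [← h3, pt_eta]
    exact h2.1
  · intro h
    have hp : IsPreconnected ((fun t => pt (a 0) t) '' uIcc (a 1) (b 1)) :=
      isPreconnected_uIcc.image _ (continuous_const.pt continuous_id).continuousOn
    refine hp.subset_connectedComponentIn ⟨a 1, left_mem_uIcc, pt_eta a⟩ ?_
      ⟨b 1, right_mem_uIcc, ?_⟩
    · rintro _ ⟨t, ht, rfl⟩
      exact ⟨h.2 t ht, by simp⟩
    · show pt (a 0) (b 1) = b
      rw [h.1, pt_eta]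

lemma reebMk_eq_iff {D : Set Plane} {x y : closure D} :
    reebMk D x = reebMk D y ↔ Vis (closure D) x y := by
  have h0 : reebMk D x = reebMk D y ↔ fiberComp D x = fiberComp D y := Quotient.eq
  rw [h0, ← mem_connectedComponentIn_iff x.2]
  constructor
  · intro h
    have := mem_fiberComp D y
    rw [← h] at this
    exact this
  · intro h
    have h1 : (y : Plane) 0 = (x : Plane) 0 := (connectedComponentIn_subset _ _ h).2
    unfold fiberComp
    rw [h1]
    exact connectedComponentIn_eq h

lemma reebMk_surjective (D : Set Plane) : Function.Surjective (reebMk D) :=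
  Quotient.mk_surjective

lemma isQuotientMap_reebMk (D : Set Plane) : IsQuotientMap (reebMk D) := isQuotientMap_quotient_mk'

lemma continuous_reebMk (D : Set Plane) : Continuous (reebMk D) := continuous_quotient_mk'

@[simp] lemma reebHeight_mk (D : Set Plane) (x : closure D) :
    reebHeight D (reebMk D x) = (x : Plane) 0 := rfl

lemma continuous_reebHeight (D : Set Plane) : Continuous (reebHeight D) :=
  (isQuotientMap_reebMk D).continuous_iff.2 ((continuous_coord 0).comp continuous_subtype_val)

lemma preimage_image_reebMk {D : Set Plane} {U : Set (closure D)}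
    (hs : ∀ a ∈ U, ∀ b : closure D, Vis (closure D) a b → b ∈ U) :
    reebMk D ⁻¹' (reebMk D '' U) = U := by
  ext b
  constructor
  · rintro ⟨a, ha, hab⟩
    exact hs a ha b (reebMk_eq_iff.1 hab)
  · exact fun hb => ⟨b, hb, rfl⟩

lemma isOpen_image_reebMk {D : Set Plane} {U : Set (closure D)} (hU : IsOpen U)
    (hs : ∀ a ∈ U, ∀ b : closure D, Vis (closure D) a b → b ∈ U) : IsOpen (reebMk D '' U) := by
  rw [← (isQuotientMap_reebMk D).isOpen_preimage, preimage_image_reebMk hs]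
  exact hU

/-- The Poincaré-Reeb space is Hausdorff. -/
instance instT2SpaceReeb (D : Set Plane) : T2Space (ReebSpace D) := by
  refine ⟨fun v w hvw => ?_⟩
  obtain ⟨a, rfl⟩ := reebMk_surjective D v
  obtain ⟨b, rfl⟩ := reebMk_surjective D w
  by_cases h0 : (a : Plane) 0 = (b : Plane) 0
  swap
  · exact separated_by_continuous (continuous_reebHeight D) h0
  have hn : ¬ Vis (closure D) a b := fun h => hvw (reebMk_eq_iff.2 h)
  have : ∃ t ∈ uIcc ((a : Plane) 1) ((b : Plane) 1), pt ((a : Plane) 0) t ∉ closure D := by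
    by_contra! hc
    exact hn ⟨h0, hc⟩
  obtain ⟨t, ht, htK⟩ := this
  -- The gap at height `t` persists over nearby abscissae. No segment in `closure D` crosses it, so
  -- the points below it and the points above it form two saturated open sets, which separate the
  -- classes.
  have hO : IsOpen {x : ℝ | pt x t ∉ closure D} :=
    isClosed_closure.isOpen_compl.preimage (continuous_id.pt continuous_const)
  have hc0 : Continuous fun z : closure D => (z : Plane) 0 :=
    (continuous_coord 0).comp continuous_subtype_val
  have hc1 : Continuous fun z : closure D => (z : Plane) 1 :=
    (continuous_coord 1).comp continuous_subtype_val
  have hlt : IsOpen (reebMk D '' {z : closure D | pt ((z : Plane) 0) t ∉ closure D ∧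
      (z : Plane) 1 < t}) := by
    refine isOpen_image_reebMk ((hO.preimage hc0).inter (isOpen_lt hc1 continuous_const)) ?_
    rintro z ⟨hz1, hz2⟩ z' hv
    refine ⟨by rw [← hv.1]; exact hz1, ?_⟩
    by_contra! hle
    exact hz1 (hv.2 t (mem_uIcc.2 (Or.inl ⟨hz2.le, hle⟩)))
  have hgt : IsOpen (reebMk D '' {z : closure D | pt ((z : Plane) 0) t ∉ closure D ∧
      t < (z : Plane) 1}) := by
    refine isOpen_image_reebMk ((hO.preimage hc0).inter (isOpen_lt continuous_const hc1)) ?_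
    rintro z ⟨hz1, hz2⟩ z' hv
    refine ⟨by rw [← hv.1]; exact hz1, ?_⟩
    by_contra! hle
    exact hz1 (hv.2 t (mem_uIcc.2 (Or.inr ⟨hle, hz2.le⟩)))
  have hdis : Disjoint (reebMk D '' {z : closure D | pt ((z : Plane) 0) t ∉ closure D ∧
      (z : Plane) 1 < t}) (reebMk D '' {z : closure D | pt ((z : Plane) 0) t ∉ closure D ∧
      t < (z : Plane) 1}) := by
    rw [Set.disjoint_left]
    rintro _ ⟨z, ⟨hz1, hz2⟩, rfl⟩ ⟨z', ⟨hz1', hz2'⟩, he⟩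
    have hv := reebMk_eq_iff.1 he
    exact hz1' (hv.2 t (mem_uIcc.2 (Or.inr ⟨hz2.le, hz2'.le⟩)))
  have hta : (a : Plane) 1 ≠ t := by
    rintro rfl
    rw [pt_eta] at htK; exact htK a.2
  have htb : (b : Plane) 1 ≠ t := by
    rintro rfl
    rw [h0, pt_eta] at htK; exact htK b.2
  have htK' : pt ((b : Plane) 0) t ∉ closure D := h0 ▸ htK
  rcases mem_uIcc.1 ht with h | h
  · exact ⟨_, _, hlt, hgt, ⟨a, ⟨htK, lt_of_le_of_ne h.1 hta⟩, rfl⟩,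
      ⟨b, ⟨htK', lt_of_le_of_ne h.2 htb.symm⟩, rfl⟩, hdis⟩
  · exact ⟨_, _, hgt, hlt, ⟨a, ⟨htK, lt_of_le_of_ne h.2 hta.symm⟩, rfl⟩,
      ⟨b, ⟨htK', lt_of_le_of_ne h.1 htb⟩, rfl⟩, hdis.symm⟩

/-- `{x} × [l, u]` is a connected component of a fibre of the first projection on `K`. -/
structure IsFiber (K : Set Plane) (x l u : ℝ) : Prop where
  le : l ≤ u
  mem : ∀ t ∈ Icc l u, pt x t ∈ K
  low : ∀ t < l, ∃ t' ∈ Ico t l, pt x t' ∉ K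
  up : ∀ t > u, ∃ t' ∈ Ioc u t, pt x t' ∉ K

namespace IsFiber

variable {K : Set Plane} {x l u l' u' : ℝ}

lemma vis_iff (h : IsFiber K x l u) {y : ℝ} (hy : y ∈ Icc l u) {b : Plane} :
    Vis K (pt x y) b ↔ b 0 = x ∧ b 1 ∈ Icc l u := by
  constructor
  · rintro ⟨h0, h1⟩
    simp only [pt_zero, pt_one] at h0 h1
    refine ⟨h0.symm, ?_, ?_⟩
    · by_contra! hlt
      obtain ⟨t, ht, htK⟩ := h.low _ hlt
      exact htK (h1 t (mem_uIcc.2 (Or.inr ⟨ht.1, ht.2.le.trans hy.1⟩)))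
    · by_contra! hlt
      obtain ⟨t, ht, htK⟩ := h.up _ hlt
      exact htK (h1 t (mem_uIcc.2 (Or.inl ⟨hy.2.trans ht.1.le, ht.2⟩)))
  · rintro ⟨h0, h1⟩
    have := Vis.of_Icc h.mem hy h1
    rwa [← h0, pt_eta, h0] at this

lemma eq_of_mem (h : IsFiber K x l u) (h' : IsFiber K x l' u') {y : ℝ} (hy : y ∈ Icc l u)
    (hy' : y ∈ Icc l' u') : l = l' ∧ u = u' := by
  have key : ∀ t, t ∈ Icc l u ↔ t ∈ Icc l' u' := fun t => by
    have h1 := h.vis_iff hy (b := pt x t)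
    have h2 := h'.vis_iff hy' (b := pt x t)
    simp only [pt_zero, pt_one, true_and] at h1 h2
    rw [← h1, ← h2]
  have h1 := (key l).1 ⟨le_rfl, h.le⟩
  have h2 := (key l').2 ⟨le_rfl, h'.le⟩
  have h3 := (key u).1 ⟨h.le, le_rfl⟩
  have h4 := (key u').2 ⟨h'.le, le_rfl⟩
  exact ⟨le_antisymm h2.1 h1.1, le_antisymm h3.2 h4.2⟩

end IsFiber

/-- The ends are the infimum and the supremum of the heights visible from `z`. Compactness makes
them finite and puts the end points into `K`. -/
lemma exists_isFiber {K : Set Plane} (hK : IsCompact K) {z : Plane} (hz : z ∈ K) :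
    ∃ l u, z 1 ∈ Icc l u ∧ IsFiber K (z 0) l u := by
  set x := z 0 with hx
  set J : Set ℝ := {t | Vis K z (pt x t)} with hJ
  have hzJ : z 1 ∈ J := by
    show Vis K z (pt x (z 1))
    rw [hx, pt_eta]; exact Vis.refl hz
  have hJK : ∀ t ∈ J, pt x t ∈ K := fun t ht => ht.right_mem
  have hcl : IsClosed {t : ℝ | pt x t ∈ K} :=
    hK.isClosed.preimage (continuous_const.pt continuous_id)
  have hbd : IsCompact ((fun w : Plane => w 1) '' K) := hK.image (continuous_coord 1)
  have hsub : J ⊆ (fun w : Plane => w 1) '' K := fun t ht => ⟨pt x t, hJK t ht, by simp⟩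
  have hba : BddAbove J := hbd.bddAbove.mono hsub
  have hbb : BddBelow J := hbd.bddBelow.mono hsub
  have hl : sInf J ≤ z 1 := csInf_le hbb hzJ
  have hu : z 1 ≤ sSup J := le_csSup hba hzJ
  have hmem : ∀ t ∈ Icc (sInf J) (sSup J), pt x t ∈ K := by
    intro t ht
    rcases lt_trichotomy t (z 1) with h | h | h
    · rcases eq_or_lt_of_le ht.1 with h1 | h1
      · have : t ∈ closure J := h1 ▸ csInf_mem_closure ⟨_, hzJ⟩ hbb
        exact closure_minimal hJK hcl this
      · obtain ⟨t', ht', hlt⟩ := exists_lt_of_csInf_lt ⟨_, hzJ⟩ h1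
        exact ht'.2 t (mem_uIcc.2 (Or.inr ⟨by simpa using hlt.le, h.le⟩))
    · exact h ▸ hJK _ hzJ
    · rcases eq_or_lt_of_le ht.2 with h1 | h1
      · have : t ∈ closure J := h1 ▸ csSup_mem_closure ⟨_, hzJ⟩ hba
        exact closure_minimal hJK hcl this
      · obtain ⟨t', ht', hlt⟩ := exists_lt_of_lt_csSup ⟨_, hzJ⟩ h1
        exact ht'.2 t (mem_uIcc.2 (Or.inl ⟨h.le, by simpa using hlt.le⟩))
  have hext : ∀ t, (∀ t' ∈ uIcc (z 1) t, pt x t' ∈ K) → t ∈ J := by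
    intro t ht
    exact ⟨by simp [hx], fun t' ht' => ht t' (by simpa using ht')⟩
  refine ⟨sInf J, sSup J, ⟨hl, hu⟩, hl.trans hu, hmem, fun t ht => ?_, fun t ht => ?_⟩
  · by_contra! hc
    have : t ∈ J := hext t fun t' ht' => by
      rw [uIcc_of_ge (ht.le.trans hl)] at ht'
      rcases lt_or_ge t' (sInf J) with h | h
      · exact hc t' ⟨ht'.1, h⟩
      · exact hmem t' ⟨h, ht'.2.trans hu⟩
    exact absurd (csInf_le hbb this) (not_le.2 ht)
  · by_contra! hc
    have : t ∈ J := hext t fun t' ht' => by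
      rw [uIcc_of_le (hu.trans ht.le)] at ht'
      rcases lt_or_ge (sSup J) t' with h | h
      · exact hc t' ⟨h, ht'.2⟩
      · exact hmem t' ⟨hl.trans ht'.1, h⟩
    exact absurd (le_csSup hba this) (not_le.2 ht)

/-! ## Regular fibres -/

/-- Points of `closure D` arbitrarily close above (below) a point of an arc determine the side. -/
lemma Arc.side_of_frequently {S : Set PlaneCircle} {D : Set Plane} (h : IsMBC S D) {A : Arc}
    (hA : A.C ∈ S) {x : ℝ} (hx : A.Dom x) {υ : ℝ} (hυ : υ = 1 ∨ υ = -1)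
    (hf : ∃ᶠ t in 𝓝[>] (0 : ℝ), pt x (A.f x + υ * t) ∈ closure D) : A.Side D υ := by
  obtain ⟨υ', hυ', hs⟩ := h.exists_side hA
  have hc : Tendsto (fun t : ℝ => pt x (A.f x + υ * t)) (𝓝[>] 0) (𝓝 (pt x (A.f x))) := by
    have : Continuous fun t : ℝ => pt x (A.f x + υ * t) := continuous_const.pt (by fun_prop)
    have h2 := this.tendsto 0
    simp only [mul_zero, add_zero] at h2
    exact h2.mono_left nhdsWithin_le_nhds
  obtain ⟨t, htK, h1, ht⟩ :=
    (hf.and_eventually ((hc.eventually (hs.eventually hx)).and self_mem_nhdsWithin)).exists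
  have h2 := h1 htK
  simp only [pt_one, pt_zero, add_sub_cancel_left] at h2
  have ht : (0 : ℝ) < t := ht
  have : υ = υ' := by
    rcases hυ with rfl | rfl <;> rcases hυ' with rfl | rfl <;> first | rfl | (exfalso; linarith)
  exact this ▸ hs

/-- The fibre over `x` between the arcs `A` and `B` contains no vertical pole and no double point.
-/
structure Reg (S : Set PlaneCircle) (D : Set Plane) (A B : Arc) (x : ℝ) : Prop where
  memA : A.C ∈ S
  memB : B.C ∈ S
  domA : A.Dom x
  domB : B.Dom x
  lt : A.f x < B.f x
  mem : ∀ y ∈ Ioo (A.f x) (B.f x), pt x y ∈ D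
  ndA : ¬ IsDoublePoint S (pt x (A.f x))
  ndB : ¬ IsDoublePoint S (pt x (B.f x))

namespace Reg

variable {S : Set PlaneCircle} {D : Set Plane} {A B A' B' : Arc} {x : ℝ}

lemma mem_closure (h : Reg S D A B x) {y : ℝ} (hy : y ∈ Icc (A.f x) (B.f x)) :
    pt x y ∈ closure D := by
  rw [← closure_Ioo h.lt.ne] at hy
  exact map_mem_closure (continuous_const.pt continuous_id) hy h.mem

lemma sideA (hM : IsMBC S D) (h : Reg S D A B x) : A.Side D 1 := by
  refine Arc.side_of_frequently hM h.memA h.domA (Or.inl rfl) (Eventually.frequently ?_)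
  filter_upwards [Ioo_mem_nhdsGT (show (0 : ℝ) < B.f x - A.f x by linarith [h.lt])] with t ht
  exact subset_closure (h.mem _ ⟨by linarith [ht.1], by linarith [ht.2]⟩)

lemma sideB (hM : IsMBC S D) (h : Reg S D A B x) : B.Side D (-1) := by
  refine Arc.side_of_frequently hM h.memB h.domB (Or.inr rfl) (Eventually.frequently ?_)
  filter_upwards [Ioo_mem_nhdsGT (show (0 : ℝ) < B.f x - A.f x by linarith [h.lt])] with t ht
  exact subset_closure (h.mem _ ⟨by linarith [ht.2], by linarith [ht.1]⟩)

/-- Away from an end this is continuity of the arc. At an end it is the side of the arc on which the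
region lies. -/
lemma eventually_between (hM : IsMBC S D) (h : Reg S D A B x) {y : ℝ}
    (hy : y ∈ Icc (A.f x) (B.f x)) :
    ∀ᶠ z in 𝓝 (pt x y), z ∈ closure D → z 1 ∈ Icc (A.f (z 0)) (B.f (z 0)) := by
  have hA : ∀ᶠ z in 𝓝 (pt x y), z ∈ closure D → A.f (z 0) ≤ z 1 := by
    rcases eq_or_lt_of_le hy.1 with h1 | h1
    · filter_upwards [h1 ▸ (h.sideA hM).eventually h.domA] with z hz hzK
      linarith [hz hzK]
    · have : Continuous fun z : Plane => z 1 - A.f (z 0) :=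
        (continuous_coord 1).sub (A.continuous_f.comp (continuous_coord 0))
      filter_upwards [this.continuousAt.eventually (lt_mem_nhds (a := 0) (by simpa using h1))]
        with z hz _
      linarith
  have hB : ∀ᶠ z in 𝓝 (pt x y), z ∈ closure D → z 1 ≤ B.f (z 0) := by
    rcases eq_or_lt_of_le hy.2 with h1 | h1
    · filter_upwards [h1 ▸ (h.sideB hM).eventually h.domB] with z hz hzK
      linarith [hz hzK]
    · have : Continuous fun z : Plane => B.f (z 0) - z 1 :=
        (B.continuous_f.comp (continuous_coord 0)).sub (continuous_coord 1)
      filter_upwards [this.continuousAt.eventually (lt_mem_nhds (a := 0) (by simpa using h1))]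
        with z hz _
      linarith
  filter_upwards [hA, hB] with z h1 h2 hz using ⟨h1 hz, h2 hz⟩

lemma isFiber (hM : IsMBC S D) (h : Reg S D A B x) : IsFiber (closure D) x (A.f x) (B.f x) := by
  refine ⟨h.lt.le, fun t ht => h.mem_closure ht, fun t ht => ?_, fun t ht => ?_⟩
  · have hc : Tendsto (fun s => pt x s) (𝓝[<] (A.f x)) (𝓝 (pt x (A.f x))) :=
      ((continuous_const.pt continuous_id).tendsto _).mono_left nhdsWithin_le_nhds
    obtain ⟨s, hs, hs'⟩ := ((hc.eventually (h.eventually_between hM ⟨le_rfl, h.lt.le⟩)).and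
      (Ico_mem_nhdsLT ht)).exists
    refine ⟨s, hs', fun hK => ?_⟩
    have := (hs hK).1
    simp only [pt_zero, pt_one] at this
    linarith [hs'.2]
  · have hc : Tendsto (fun s => pt x s) (𝓝[>] (B.f x)) (𝓝 (pt x (B.f x))) :=
      ((continuous_const.pt continuous_id).tendsto _).mono_left nhdsWithin_le_nhds
    obtain ⟨s, hs, hs'⟩ := ((hc.eventually (h.eventually_between hM ⟨h.lt.le, le_rfl⟩)).and
      (Ioc_mem_nhdsGT ht)).exists
    refine ⟨s, hs', fun hK => ?_⟩
    have := (hs hK).2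
    simp only [pt_zero, pt_one] at this
    linarith [hs'.1]

/-- The circles meet a regular fibre only in its ends. -/
lemma eq_of_mem_carrier (hM : IsMBC S D) (h : Reg S D A B x) {y : ℝ}
    (hy : y ∈ Icc (A.f x) (B.f x)) {C : PlaneCircle} (hC : C ∈ S) (hyC : pt x y ∈ C.carrier) :
    (C = A.C ∧ y = A.f x) ∨ (C = B.C ∧ y = B.f x) := by
  rcases eq_or_lt_of_le hy.1 with h1 | h1
  · refine Or.inl ⟨?_, h1.symm⟩
    by_contra hne
    exact h.ndA ⟨C, hC, A.C, h.memA, hne, h1 ▸ hyC, Arc.mem_carrier_f h.domA.le⟩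
  rcases eq_or_lt_of_le hy.2 with h2 | h2
  · refine Or.inr ⟨?_, h2⟩
    by_contra hne
    exact h.ndB ⟨C, hC, B.C, h.memB, hne, h2 ▸ hyC, Arc.mem_carrier_f h.domB.le⟩
  exact (hM.notMem_carrier (h.mem y ⟨h1, h2⟩) hC hyC).elim

lemma notMem_reebVert (hM : IsMBC S D) (h : Reg S D A B x) {z : closure D} (hx : (z : Plane) 0 = x)
    (hz : (z : Plane) 1 ∈ Icc (A.f x) (B.f x)) : reebMk D z ∉ reebVert S D := by
  rintro ⟨w, hw, hpd⟩
  have hv := (reebMk_eq_iff.1 hw).symm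
  rw [← pt_eta z, hx, (h.isFiber hM).vis_iff hz] at hv
  have hwe : (w : Plane) = pt x ((w : Plane) 1) := by rw [← hv.1, pt_eta]
  rw [hwe] at hpd
  rcases hpd with ⟨C, hC, hp⟩ | ⟨C₁, h1, C₂, h2, hne, hm1, hm2⟩
  · have hp' := isVerticalPole_iff.1 hp
    rcases h.eq_of_mem_carrier hM hv.2 hC (mem_carrier.2 hp'.1) with ⟨rfl, -⟩ | ⟨rfl, -⟩
    · have := h.domA; unfold Arc.Dom at this; simp only [pt_zero] at hp'; linarith [hp'.2]
    · have := h.domB; unfold Arc.Dom at this; simp only [pt_zero] at hp'; linarith [hp'.2]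
  · have hlt := h.lt
    rcases h.eq_of_mem_carrier hM hv.2 h1 hm1 with ⟨ha, ha'⟩ | ⟨ha, ha'⟩ <;>
    rcases h.eq_of_mem_carrier hM hv.2 h2 hm2 with ⟨hb, hb'⟩ | ⟨hb, hb'⟩
    · exact hne (ha.trans hb.symm)
    · linarith
    · linarith
    · exact hne (ha.trans hb.symm)

/-- Both pairs of arcs bound the same fibre. Its ends are no double points, so the circles agree,
and the two halves of one circle differ over the open interval. -/
lemma unique (hM : IsMBC S D) (h : Reg S D A B x) (h' : Reg S D A' B' x) {y : ℝ}
    (hy : y ∈ Icc (A.f x) (B.f x)) (hy' : y ∈ Icc (A'.f x) (B'.f x)) : A = A' ∧ B = B' := by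
  obtain ⟨e1, e2⟩ := (h.isFiber hM).eq_of_mem (h'.isFiber hM) hy hy'
  constructor
  · refine Arc.eq_of_f_eq ?_ h.domA e1
    by_contra hne
    exact h.ndA ⟨_, h.memA, _, h'.memA, hne, Arc.mem_carrier_f h.domA.le,
      e1 ▸ Arc.mem_carrier_f h'.domA.le⟩
  · refine Arc.eq_of_f_eq ?_ h.domB e2
    by_contra hne
    exact h.ndB ⟨_, h.memB, _, h'.memB, hne, Arc.mem_carrier_f h.domB.le,
      e2 ▸ Arc.mem_carrier_f h'.domB.le⟩

end Reg

/-- If the circles come near the segment over `x₀` between two arcs, on the side `σ`, only in the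
arcs, then the fibres between the arcs on this side are regular. -/
lemma eventually_reg_of_segment {S : Set PlaneCircle} {D : Set Plane} (hM : IsMBC S D) {A B : Arc}
    (hA : A.C ∈ S) (hB : B.C ∈ S) {x₀ : ℝ} {σ : Set ℝ}
    (hAd : ∀ᶠ x in 𝓝 x₀, x ∈ σ → A.Dom x) (hBd : ∀ᶠ x in 𝓝 x₀, x ∈ σ → B.Dom x)
    (hlt : A.f x₀ < B.f x₀) {y₀ : ℝ} (hy₀ : y₀ ∈ Ioo (A.f x₀) (B.f x₀)) (hy₀D : pt x₀ y₀ ∈ D)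
    (H : ∀ y ∈ Icc (A.f x₀) (B.f x₀), ∀ C ∈ S, ∀ᶠ z in 𝓝 (pt x₀ y), z 0 ∈ σ →
      z 1 ∈ Icc (A.f (z 0)) (B.f (z 0)) → z ∈ C.carrier →
      (C = A.C ∧ z 1 = A.f (z 0)) ∨ (C = B.C ∧ z 1 = B.f (z 0))) :
    ∀ᶠ x in 𝓝 x₀, x ∈ σ → Reg S D A B x := by
  -- The segments over different abscissae have different ends; the parameter `θ` identifies all of
  -- them with one compact interval, over which the local hypothesis `H` becomes uniform in `x`.
  set m : ℝ → ℝ → ℝ := fun x θ => (1 - θ) * A.f x + θ * B.f x with hm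
  have hmc : Continuous fun q : ℝ × ℝ => pt q.1 (m q.1 q.2) := by
    have h1 := A.continuous_f
    have h2 := B.continuous_f
    exact continuous_fst.pt (by fun_prop)
  have hltx : ∀ᶠ x in 𝓝 x₀, A.f x < B.f x :=
    A.continuous_f.continuousAt.eventually_lt B.continuous_f.continuousAt hlt
  have hmI : ∀ x, A.f x ≤ B.f x → ∀ θ ∈ Icc (0 : ℝ) 1, m x θ ∈ Icc (A.f x) (B.f x) := by
    intro x hx θ hθ
    constructor <;> simp only [hm] <;> nlinarith [hθ.1, hθ.2]
  have key : ∀ᶠ x in 𝓝 x₀, ∀ θ ∈ Icc (0 : ℝ) 1, (x ∈ σ → m x θ ∈ Icc (A.f x) (B.f x) →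
      ∀ C ∈ S, pt x (m x θ) ∈ C.carrier →
      (C = A.C ∧ m x θ = A.f x) ∨ (C = B.C ∧ m x θ = B.f x)) := by
    refine isCompact_Icc.eventually_forall_of_forall_eventually
      (P := fun x θ => x ∈ σ → m x θ ∈ Icc (A.f x) (B.f x) →
      ∀ C ∈ S, pt x (m x θ) ∈ C.carrier →
      (C = A.C ∧ m x θ = A.f x) ∨ (C = B.C ∧ m x θ = B.f x)) fun θ hθ => ?_
    have h1 : ∀ᶠ z in 𝓝 (pt x₀ (m x₀ θ)), ∀ C ∈ S, z 0 ∈ σ →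
      z 1 ∈ Icc (A.f (z 0)) (B.f (z 0)) → z ∈ C.carrier →
      (C = A.C ∧ z 1 = A.f (z 0)) ∨ (C = B.C ∧ z 1 = B.f (z 0)) :=
      (Filter.eventually_all_finite hM.finite).2 fun C hC => H _ (hmI x₀ hlt.le θ hθ) C hC
    filter_upwards [(hmc.tendsto (x₀, θ)).eventually h1] with q hq hσ hI C hC hqC
    simpa using hq C hC (by simpa using hσ) (by simpa using hI) hqC
  have hD : ∀ᶠ x in 𝓝 x₀, pt x y₀ ∈ D :=
    (continuous_id.pt continuous_const).continuousAt.eventually (hM.isOpen.mem_nhds hy₀D)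
  have hy1 : ∀ᶠ x in 𝓝 x₀, A.f x < y₀ := A.continuous_f.continuousAt.eventually (gt_mem_nhds hy₀.1)
  have hy2 : ∀ᶠ x in 𝓝 x₀, y₀ < B.f x := B.continuous_f.continuousAt.eventually (lt_mem_nhds hy₀.2)
  filter_upwards [key, hltx, hD, hy1, hy2, hAd, hBd] with x hk hl hxD h1 h2 hdA hdB hσ
  have hk' : ∀ y ∈ Icc (A.f x) (B.f x), ∀ C ∈ S, pt x y ∈ C.carrier →
      (C = A.C ∧ y = A.f x) ∨ (C = B.C ∧ y = B.f x) := by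
    intro y hy C hC hyC
    have hpos : 0 < B.f x - A.f x := by linarith
    have hmy : m x ((y - A.f x) / (B.f x - A.f x)) = y := by
      simp only [hm]; field_simp; ring
    have := hk ((y - A.f x) / (B.f x - A.f x))
      ⟨div_nonneg (by linarith [hy.1]) hpos.le, (div_le_one hpos).2 (by linarith [hy.2])⟩ hσ
    rw [hmy] at this
    exact this hy C hC hyC
  have hnd : ∀ y ∈ Icc (A.f x) (B.f x), ¬ IsDoublePoint S (pt x y) := by
    rintro y hy ⟨C₁, h1, C₂, h2, hne, hm1, hm2⟩
    rcases hk' y hy C₁ h1 hm1 with ⟨ha, ha'⟩ | ⟨ha, ha'⟩ <;>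
    rcases hk' y hy C₂ h2 hm2 with ⟨hb, hb'⟩ | ⟨hb, hb'⟩
    · exact hne (ha.trans hb.symm)
    · linarith
    · linarith
    · exact hne (ha.trans hb.symm)
  refine ⟨hA, hB, hdA hσ, hdB hσ, hl, ?_, hnd _ ⟨le_rfl, hl.le⟩, hnd _ ⟨hl.le, le_rfl⟩⟩
  -- The open segment is connected, avoids all circles, and passes through the point at height `y₀`,
  -- which is in `D` because `D` is open.
  have hsub : (fun y => pt x y) '' Ioo (A.f x) (B.f x) ⊆ D := by
    refine hM.subset_of_isPreconnected
      (isPreconnected_Ioo.image _ (continuous_const.pt continuous_id).continuousOn) ?_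
      ⟨pt x y₀, ⟨y₀, ⟨h1, h2⟩, rfl⟩, hxD⟩
    rintro _ ⟨y, hy, rfl⟩ C hC hyC
    rcases hk' y (Ioo_subset_Icc_self hy) C hC hyC with ⟨-, h⟩ | ⟨-, h⟩
    · linarith [hy.1]
    · linarith [hy.2]
  exact fun y hy => hsub ⟨y, hy, rfl⟩

/-- Regular fibres are stable. -/
lemma Reg.eventually {S : Set PlaneCircle} {D : Set Plane} (hM : IsMBC S D) {A B : Arc} {x : ℝ}
    (h : Reg S D A B x) : ∀ᶠ x' in 𝓝 x, Reg S D A B x' := by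
  have hmid : (A.f x + B.f x) / 2 ∈ Ioo (A.f x) (B.f x) := by
    constructor <;> linarith [h.lt]
  have := eventually_reg_of_segment hM h.memA h.memB (σ := univ) (x₀ := x)
    ((Arc.eventually_dom h.domA).mono fun _ h _ => h)
    ((Arc.eventually_dom h.domB).mono fun _ h _ => h) h.lt hmid (h.mem _ hmid) ?_
  · exact this.mono fun _ h => h trivial
  intro y hy C hC
  by_cases hyC : pt x y ∈ C.carrier
  · rcases h.eq_of_mem_carrier hM hy hC hyC with ⟨rfl, rfl⟩ | ⟨rfl, rfl⟩
    · filter_upwards [Arc.eventually_eq_of_mem h.domA] with z hz _ _ hzC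
      exact Or.inl ⟨rfl, hz hzC⟩
    · filter_upwards [Arc.eventually_eq_of_mem h.domB] with z hz _ _ hzC
      exact Or.inr ⟨rfl, hz hzC⟩
  · filter_upwards [(isClosed_carrier C).isOpen_compl.mem_nhds hyC] with z hz _ _ hzC
    exact (hz hzC).elim

/-! ## The ends of a fibre -/

/-- `(x, y)` is the lower (`υ = 1`) or the upper (`υ = -1`) end of a nondegenerate fibre. -/
structure IsEnd (K : Set Plane) (x y υ : ℝ) : Prop where
  sign : υ = 1 ∨ υ = -1
  mem : pt x y ∈ K
  outside : ∃ᶠ t in 𝓝[>] (0 : ℝ), pt x (y - υ * t) ∉ K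
  inside : ∀ᶠ t in 𝓝[>] (0 : ℝ), pt x (y + υ * t) ∈ K

lemma frequently_nhdsGT_zero {p : ℝ → Prop} (h : ∀ ε > 0, ∃ t ∈ Ioc 0 ε, p t) :
    ∃ᶠ t in 𝓝[>] (0 : ℝ), p t := by
  rw [(nhdsGT_basis (0 : ℝ)).frequently_iff]
  intro ε hε
  obtain ⟨t, ht, hp⟩ := h (ε / 2) (half_pos hε)
  exact ⟨t, ⟨ht.1, by linarith [ht.2]⟩, hp⟩

namespace IsFiber

variable {K : Set Plane} {x l u : ℝ}

lemma frequently_low (h : IsFiber K x l u) : ∃ᶠ t in 𝓝[>] (0 : ℝ), pt x (l - 1 * t) ∉ K := by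
  refine frequently_nhdsGT_zero fun ε hε => ?_
  obtain ⟨t', ht', hK⟩ := h.low (l - ε) (by linarith)
  exact ⟨l - t', ⟨by linarith [ht'.2], by linarith [ht'.1]⟩, by convert hK using 2; ring_nf⟩

lemma frequently_up (h : IsFiber K x l u) : ∃ᶠ t in 𝓝[>] (0 : ℝ), pt x (u - -1 * t) ∉ K := by
  refine frequently_nhdsGT_zero fun ε hε => ?_
  obtain ⟨t', ht', hK⟩ := h.up (u + ε) (by linarith)
  exact ⟨t' - u, ⟨by linarith [ht'.1], by linarith [ht'.2]⟩, by convert hK using 2; ring_nf⟩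

lemma isEnd_low (h : IsFiber K x l u) (hlt : l < u) : IsEnd K x l 1 := by
  refine ⟨Or.inl rfl, h.mem _ ⟨le_rfl, h.le⟩, h.frequently_low, ?_⟩
  filter_upwards [Ioo_mem_nhdsGT (show (0 : ℝ) < u - l by linarith)] with t ht
  exact h.mem _ ⟨by linarith [ht.1], by linarith [ht.2]⟩

lemma isEnd_up (h : IsFiber K x l u) (hlt : l < u) : IsEnd K x u (-1) := by
  refine ⟨Or.inr rfl, h.mem _ ⟨h.le, le_rfl⟩, h.frequently_up, ?_⟩
  filter_upwards [Ioo_mem_nhdsGT (show (0 : ℝ) < u - l by linarith)] with t ht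
  exact h.mem _ ⟨by linarith [ht.2], by linarith [ht.1]⟩

end IsFiber

section Fibers

variable {S : Set PlaneCircle} {D : Set Plane}

lemma tendsto_pt_vertical (x y c : ℝ) :
    Tendsto (fun t : ℝ => pt x (y + c * t)) (𝓝[>] 0) (𝓝 (pt x y)) := by
  have : Continuous fun t : ℝ => pt x (y + c * t) := continuous_const.pt (by fun_prop)
  have h2 := this.tendsto 0
  simp only [mul_zero, add_zero] at h2
  exact h2.mono_left nhdsWithin_le_nhds

lemma tendsto_pt_vertical' (x y c : ℝ) :
    Tendsto (fun t : ℝ => pt x (y - c * t)) (𝓝[>] 0) (𝓝 (pt x y)) := by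
  simpa [sub_eq_add_neg] using tendsto_pt_vertical x y (-c)

/-- A vertical pole in the closure of the region lies on one circle only. -/
lemma IsMBC.eq_of_pole (hM : IsMBC S D) {q : Plane} (hq : q ∈ closure D) {C : PlaneCircle}
    (hC : C ∈ S) (hp : C.IsVerticalPole q) : ∀ C' ∈ S, q ∈ C'.carrier → C' = C := by
  intro C' hC' hqC'
  by_contra hne
  have hqC : q ∈ C.carrier := mem_carrier.2 (isVerticalPole_iff.1 hp).1
  exact (hM.not_pole q hq ⟨C', hC', C, hC, hne, hqC', hqC⟩ C hC).1 hp

/-- On the vertical line through a vertical pole, all other points are outside of the circle. -/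
lemma pw_pole_vertical {C : PlaneCircle} {x y : ℝ} (hp : C.IsVerticalPole (pt x y)) (t : ℝ) :
    pw C (pt x (y + t)) = t ^ 2 := by
  obtain ⟨h1, h2⟩ := isVerticalPole_iff.1 hp
  unfold pw at h1 ⊢
  simp only [pt_zero, pt_one] at h1 h2 ⊢
  have : y - C.center 1 = 0 := by
    refine pow_eq_zero_iff two_ne_zero |>.1 ?_
    linarith
  have hy : y = C.center 1 := by linarith
  rw [hy]; linarith

/-- A vertical pole with a neighbouring point of the closure of the region above or below it: the
region is outside of the circle. -/
lemma IsMBC.outside_of_pole (hM : IsMBC S D) {x y : ℝ} {C : PlaneCircle}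
    (hC : C ∈ S) (hp : C.IsVerticalPole (pt x y)) {y' : ℝ} (hy : y' ≠ y)
    (hy' : pt x y' ∈ closure D) : ∀ z ∈ D, 0 < pw C z := by
  obtain ⟨κ, hκ, hD⟩ := hM.exists_sign hC
  rcases hκ with rfl | rfl
  · simpa using hD
  · exfalso
    have hc : IsClosed {z | 0 ≤ -1 * pw C z} :=
      isClosed_le continuous_const (continuous_const.mul (continuous_pw _))
    have h1 : (0 : ℝ) ≤ -1 * pw C (pt x y') :=
      closure_minimal (fun w hw => (hD w hw).le) hc hy'
    have h2 := pw_pole_vertical hp (y' - y)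
    rw [add_sub_cancel] at h2
    rw [h2] at h1
    have : 0 < (y' - y) ^ 2 := by
      have : y' - y ≠ 0 := sub_ne_zero.2 hy
      positivity
    linarith

/-- Interior points of a fibre are in the region or vertical poles. -/
lemma IsFiber.mem_or_pole (hM : IsMBC S D) {x l u : ℝ} (h : IsFiber (closure D) x l u) {t : ℝ}
    (ht : t ∈ Ioo l u) : pt x t ∈ D ∨ ∃ C ∈ S, C.IsVerticalPole (pt x t) := by
  by_contra! hcon
  obtain ⟨hD, hnp⟩ := hcon
  have hK : pt x t ∈ closure D := h.mem t (Ioo_subset_Icc_self ht)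
  have : ∃ C ∈ S, pt x t ∈ C.carrier := by
    by_contra! hno
    exact hD (hM.mem_of_notMem_carrier hK hno)
  obtain ⟨C, hC, htC⟩ := this
  obtain ⟨A, rfl, hAf⟩ := Arc.exists_of_mem htC
  have hdom := Arc.dom_of_not_isVerticalPole htC (hnp A.C hC)
  simp only [pt_zero, pt_one] at hAf hdom
  -- The point is on an open arc with the region on one side only, but the fibre continues on both
  -- sides: the points at the heights `t - υ * s` give the contradiction.
  obtain ⟨υ, hυ, hs⟩ := hM.exists_side hC
  have h1 := (tendsto_pt_vertical' x t υ).eventually (hAf ▸ hs.eventually hdom)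
  have h2 : ∀ᶠ s in 𝓝[>] (0 : ℝ), pt x (t - υ * s) ∈ closure D := by
    filter_upwards [Ioo_mem_nhdsGT (show (0 : ℝ) < u - t by linarith [ht.2]),
      Ioo_mem_nhdsGT (show (0 : ℝ) < t - l by linarith [ht.1])] with s hs1 hs2
    refine h.mem _ ?_
    rcases hυ with rfl | rfl
    · exact ⟨by linarith [hs2.2], by linarith [hs2.1, ht.2]⟩
    · exact ⟨by linarith [hs1.1, ht.1], by linarith [hs1.2]⟩
  obtain ⟨s, ⟨h3, h4⟩, h5⟩ := ((h1.and h2).and self_mem_nhdsWithin).exists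
  have h6 := h3 h4
  have h5 : (0 : ℝ) < s := h5
  simp only [pt_zero, pt_one, hAf] at h6
  have h7 : υ * υ = 1 := by rcases hυ with rfl | rfl <;> norm_num
  nlinarith

lemma IsMBC.exists_carrier_of_frequently (hM : IsMBC S D) {x y υ : ℝ} (hK : pt x y ∈ closure D)
    (ho : ∃ᶠ t in 𝓝[>] (0 : ℝ), pt x (y - υ * t) ∉ closure D) :
    ∃ C ∈ S, pt x y ∈ C.carrier := by
  by_contra! hno
  have hD := hM.mem_of_notMem_carrier hK hno
  have h1 := (tendsto_pt_vertical' x y υ).eventually (hM.isOpen.mem_nhds hD)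
  obtain ⟨t, h2, h3⟩ := (ho.and_eventually h1).exists
  exact h2 (subset_closure h3)

namespace IsEnd

variable {x y υ : ℝ}

lemma exists_carrier (hM : IsMBC S D) (h : IsEnd (closure D) x y υ) :
    ∃ C ∈ S, pt x y ∈ C.carrier := hM.exists_carrier_of_frequently h.mem h.outside

/-- At a pole with points of the fibre next to it the region is the outside of the circle. The
vertical line through the pole is outside on both sides of it, so the fibre would not end there. -/
lemma not_isVerticalPole (hM : IsMBC S D) (h : IsEnd (closure D) x y υ) :
    ∀ C ∈ S, ¬ C.IsVerticalPole (pt x y) := by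
  intro C hC hp
  have hυ : υ ≠ 0 := by rcases h.sign with rfl | rfl <;> norm_num
  obtain ⟨t, h1, h2⟩ := (h.inside.and self_mem_nhdsWithin).exists
  have h2 : (0 : ℝ) < t := h2
  have hout := hM.outside_of_pole hC hp (y' := y + υ * t) (by simp [hυ, h2.ne']) h1
  have hqC : pt x y ∈ C.carrier := mem_carrier.2 (isVerticalPole_iff.1 hp).1
  have hev := hM.eventually_mem h.mem hqC (hM.eq_of_pole h.mem hC hp) (κ := 1) (Or.inl rfl)
    (by simpa using hout)
  obtain ⟨s, ⟨h3, h4⟩, h5⟩ := ((h.outside.and_eventually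
    ((tendsto_pt_vertical' x y υ).eventually hev)).and_eventually self_mem_nhdsWithin).exists
  have h5 : (0 : ℝ) < s := h5
  refine h3 (subset_closure (h4 ?_))
  rw [sub_eq_add_neg, pw_pole_vertical hp]
  have : -(υ * s) ≠ 0 := by simp [hυ, h5.ne']
  positivity

/-- The arc of a circle through the end of a fibre. -/
lemma exists_arc (hM : IsMBC S D) (h : IsEnd (closure D) x y υ) {C : PlaneCircle} (hC : C ∈ S)
    (hyC : pt x y ∈ C.carrier) :
    ∃ A : Arc, A.C = C ∧ A.f x = y ∧ A.Dom x ∧ A.Side D υ := by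
  obtain ⟨A, rfl, hAf⟩ := Arc.exists_of_mem hyC
  have hdom := Arc.dom_of_not_isVerticalPole hyC (h.not_isVerticalPole hM A.C hC)
  simp only [pt_zero, pt_one] at hAf hdom
  refine ⟨A, rfl, hAf, hdom, Arc.side_of_frequently hM hC hdom h.sign ?_⟩
  rw [hAf]; exact h.inside.frequently

end IsEnd

/-- A fibre which is not a vertex is regular. -/
lemma exists_reg (hM : IsMBC S D) {z : closure D} (hz : reebMk D z ∉ reebVert S D) :
    ∃ A B : Arc, Reg S D A B ((z : Plane) 0) ∧
      (z : Plane) 1 ∈ Icc (A.f ((z : Plane) 0)) (B.f ((z : Plane) 0)) := by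
  obtain ⟨l, u, hzI, hf⟩ := exists_isFiber hM.isCompact_closure z.2
  set x := (z : Plane) 0 with hx
  have hnv : ∀ t ∈ Icc l u, (∀ C ∈ S, ¬ C.IsVerticalPole (pt x t)) ∧ ¬ IsDoublePoint S (pt x t) := by
    intro t ht
    have hv : Vis (closure D) (pt x t) z := (hf.vis_iff ht).2 ⟨hx.symm, hzI⟩
    have hn : ¬ ((∃ C ∈ S, C.IsVerticalPole (pt x t)) ∨ IsDoublePoint S (pt x t)) := fun hh =>
      hz ⟨⟨pt x t, hf.mem t ht⟩, reebMk_eq_iff.2 hv, hh⟩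
    push Not at hn
    exact hn
  -- A one-point fibre that is neither a pole nor a double point lies on an open arc of a single
  -- circle. Near it `D` is a side of this arc, hence contains points directly above or directly
  -- below it.
  have hlt : l < u := by
    refine lt_of_le_of_ne hf.le fun hlu => ?_
    have hlI : l ∈ Icc l u := ⟨le_rfl, hf.le⟩
    obtain ⟨C, hC, hlC⟩ := hM.exists_carrier_of_frequently (hf.mem l hlI) hf.frequently_low
    obtain ⟨A, rfl, hAf⟩ := Arc.exists_of_mem hlC
    have hdom := Arc.dom_of_not_isVerticalPole hlC ((hnv l hlI).1 A.C hC)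
    simp only [pt_zero, pt_one] at hAf hdom
    obtain ⟨υ, hυ, hs⟩ := hM.exists_side hC
    have hυ2 : υ * υ = 1 := by rcases hυ with rfl | rfl <;> norm_num
    have huniq : ∀ C' ∈ S, pt x l ∈ C'.carrier → C' = A.C := by
      intro C' hC' hC'l
      by_contra hne
      exact (hnv l hlI).2 ⟨C', hC', A.C, hC, hne, hC'l, hlC⟩
    have hev := hM.eventually_mem (hf.mem l hlI) hlC huniq (κ := υ * A.s)
      (by rcases hυ with rfl | rfl <;> rcases A.hs with h | h <;> simp [h]) hs
    have hs2 := A.s_mul_s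
    have h1 : ∀ᶠ t in 𝓝[>] (0 : ℝ), pt x (l + υ * t) ∈ D := by
      have hpos := (tendsto_pt_vertical x l υ).eventually (hAf ▸ Arc.eventually_factor_pos hdom)
      filter_upwards [(tendsto_pt_vertical x l υ).eventually hev, hpos, self_mem_nhdsWithin]
        with t ht1 ht2 ht3
      have ht3 : (0 : ℝ) < t := ht3
      refine ht1 ?_
      simp only [pt_zero, pt_one, hAf, add_sub_cancel_left] at ht2
      rw [Arc.pw_eq (by simpa using hdom.le)]
      simp only [pt_zero, pt_one, hAf, add_sub_cancel_left]
      have : υ * A.s * (υ * t * (υ * t + 2 * A.s * A.g x)) = t * (A.s * (υ * t) + 2 * A.g x) := by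
        linear_combination (A.s * t * (υ * t + 2 * A.s * A.g x)) * hυ2 + (2 * t * A.g x) * hs2
      rw [this]
      exact mul_pos ht3 ht2.2
    rcases hυ with rfl | rfl
    · obtain ⟨t, h2, h3⟩ := (hf.frequently_up.and_eventually h1).exists
      refine h2 (subset_closure ?_)
      convert h3 using 2
      rw [hlu]; ring_nf
    · obtain ⟨t, h2, h3⟩ := (hf.frequently_low.and_eventually h1).exists
      refine h2 (subset_closure ?_)
      convert h3 using 2
      ring_nf
  have hE1 := hf.isEnd_low hlt
  have hE2 := hf.isEnd_up hlt
  obtain ⟨C, hC, hlC⟩ := hE1.exists_carrier hM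
  obtain ⟨C', hC', huC⟩ := hE2.exists_carrier hM
  obtain ⟨A, rfl, hAf, hAd, -⟩ := hE1.exists_arc hM hC hlC
  obtain ⟨B, rfl, hBf, hBd, -⟩ := hE2.exists_arc hM hC' huC
  refine ⟨A, B, ⟨hC, hC', hAd, hBd, by rw [hAf, hBf]; exact hlt, fun y hy => ?_, ?_, ?_⟩, ?_⟩
  · rw [hAf, hBf] at hy
    rcases hf.mem_or_pole hM hy with h | ⟨C, hC, h⟩
    · exact h
    · exact ((hnv y (Ioo_subset_Icc_self hy)).1 C hC h).elim
  · rw [hAf]; exact (hnv l ⟨le_rfl, hf.le⟩).2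
  · rw [hBf]; exact (hnv u ⟨hf.le, le_rfl⟩).2
  · rw [hAf, hBf]; exact hzI

/-- A family of regular fibres extends through the fibres which are not vertices. -/
lemma reg_of_frequently (hM : IsMBC S D) {A B : Arc} {x : ℝ}
    (hf : ∃ᶠ x' in 𝓝 x, Reg S D A B x') (hK : pt x (A.f x) ∈ closure D)
    (hnv : reebMk D ⟨_, hK⟩ ∉ reebVert S D) : Reg S D A B x := by
  -- The fibre over `x` is regular for some pair of arcs, and this pair persists nearby. Uniqueness
  -- over an abscissa where the given pair is regular too identifies the two pairs.
  obtain ⟨A', B', hr, hI⟩ := exists_reg hM hnv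
  simp only [pt_zero, pt_one] at hr hI
  have hc : Continuous fun x' => pt x' (A.f x') := continuous_id.pt A.continuous_f
  obtain ⟨x', h1, h2, h3⟩ := (hf.and_eventually ((hr.eventually hM).and
    ((hc.tendsto x).eventually (hr.eventually_between hM hI)))).exists
  have h4 := h3 (h1.mem_closure ⟨le_rfl, h1.lt.le⟩)
  simp only [pt_zero, pt_one] at h4
  obtain ⟨rfl, rfl⟩ := h1.unique hM h2 ⟨le_rfl, h1.lt.le⟩ h4
  exact hr

end Fibers

/-! ## Strips and edges -/

/-- The image in the Poincaré-Reeb space of the graph of a function over an interval, extended by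
constants. -/
def reebCurve {D : Set Plane} {s t : ℝ} (hst : s ≤ t) {y : ℝ → ℝ}
    (hK : ∀ x ∈ Icc s t, pt x (y x) ∈ closure D) (x : ℝ) : ReebSpace D :=
  reebMk D ⟨pt (projIcc s t hst x) (y (projIcc s t hst x)), hK _ (projIcc s t hst x).2⟩

lemma continuous_reebCurve {D : Set Plane} {s t : ℝ} (hst : s ≤ t) {y : ℝ → ℝ}
    (hK : ∀ x ∈ Icc s t, pt x (y x) ∈ closure D) (hy : ContinuousOn y (Icc s t)) :
    Continuous (reebCurve hst hK) := by
  refine (continuous_reebMk D).comp (Continuous.subtype_mk ?_ _)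
  have h1 : Continuous fun x => (projIcc s t hst x : ℝ) :=
    continuous_subtype_val.comp continuous_projIcc
  exact h1.pt (hy.comp_continuous h1 fun x => (projIcc s t hst x).2)

lemma reebCurve_of_mem {D : Set Plane} {s t : ℝ} (hst : s ≤ t) {y : ℝ → ℝ}
    (hK : ∀ x ∈ Icc s t, pt x (y x) ∈ closure D) {x : ℝ} (hx : x ∈ Icc s t) :
    reebCurve hst hK x = reebMk D ⟨pt x (y x), hK x hx⟩ := by
  unfold reebCurve
  congr 2
  rw [projIcc_of_mem hst hx]

lemma exists_first_failure {P : ℝ → Prop} (hP : IsOpen {x | P x}) {x₀ x₁ : ℝ}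
    (h0 : P x₀) (h1 : ¬ P x₁) (hlt : x₀ < x₁) : ∃ t > x₀, ¬ P t ∧ ∀ x ∈ Ico x₀ t, P x := by
  have hcl : IsClosed {x | x₀ ≤ x ∧ ¬ P x} :=
    isClosed_Ici.inter hP.isClosed_compl
  have hbb : BddBelow {x | x₀ ≤ x ∧ ¬ P x} := ⟨x₀, fun x hx => hx.1⟩
  have hmem := hcl.csInf_mem ⟨x₁, hlt.le, h1⟩ hbb
  refine ⟨_, lt_of_le_of_ne hmem.1 fun h => hmem.2 (h ▸ h0), hmem.2, fun x hx => ?_⟩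
  by_contra hPx
  exact absurd (csInf_le hbb ⟨hx.1, hPx⟩) (not_le.2 hx.2)

lemma exists_last_failure {P : ℝ → Prop} (hP : IsOpen {x | P x}) {x₀ x₁ : ℝ}
    (h0 : P x₀) (h1 : ¬ P x₁) (hlt : x₁ < x₀) : ∃ t < x₀, ¬ P t ∧ ∀ x ∈ Ioc t x₀, P x := by
  obtain ⟨t, ht, hPt, h⟩ := exists_first_failure (P := fun x => P (-x)) (x₀ := -x₀) (x₁ := -x₁)
    (hP.preimage continuous_neg) (by simpa using h0) (by simpa using h1) (by linarith)
  refine ⟨-t, by linarith, hPt, fun x hx => ?_⟩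
  simpa using h (-x) ⟨by linarith [hx.2], by linarith [hx.1]⟩

/-- A maximal interval of regular fibres between two arcs. -/
structure Strip (S : Set PlaneCircle) (D : Set Plane) where
  A : Arc
  B : Arc
  s : ℝ
  t : ℝ
  lt : s < t
  reg : ∀ x ∈ Ioo s t, Reg S D A B x
  vert_s : ∀ h : pt s (A.f s) ∈ closure D, reebMk D ⟨_, h⟩ ∈ reebVert S D
  vert_t : ∀ h : pt t (A.f t) ∈ closure D, reebMk D ⟨_, h⟩ ∈ reebVert S D

/-- Every regular fibre is in a strip. -/
lemma Reg.exists_strip {S : Set PlaneCircle} {D : Set Plane} (hM : IsMBC S D) {A B : Arc} {x : ℝ}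
    (h : Reg S D A B x) : ∃ T : Strip S D, T.A = A ∧ T.B = B ∧ x ∈ Ioo T.s T.t := by
  have hop : IsOpen {x | Reg S D A B x} := isOpen_iff_mem_nhds.2 fun x hx => hx.eventually hM
  -- Since `D` is bounded, regularity fails at `M + 1` and at `-M - 1`. The failures nearest to `x`
  -- are the ends of the strip; they are vertices because a limit of regular fibres which is not a
  -- vertex is regular.
  obtain ⟨M, hMb⟩ := (hM.isCompact_closure.image (continuous_coord 0)).isBounded.exists_norm_le
  have hb : ∀ x, Reg S D A B x → |x| ≤ M := fun x hx =>
    hMb x ⟨pt x (A.f x), hx.mem_closure ⟨le_rfl, hx.lt.le⟩, by simp⟩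
  have hx := abs_le.1 (hb x h)
  obtain ⟨t, hxt, hPt, ht⟩ := exists_first_failure hop h (x₁ := M + 1)
    (fun h' => by linarith [(abs_le.1 (hb _ h')).2]) (by linarith)
  obtain ⟨s, hsx, hPs, hs⟩ := exists_last_failure hop h (x₁ := -M - 1)
    (fun h' => by linarith [(abs_le.1 (hb _ h')).1]) (by linarith)
  have hreg : ∀ x' ∈ Ioo s t, Reg S D A B x' := by
    intro x' hx'
    rcases le_total x' x with h1 | h1
    · exact hs x' ⟨hx'.1, h1⟩
    · exact ht x' ⟨h1, hx'.2⟩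
  have hst : s < t := hsx.trans hxt
  refine ⟨⟨A, B, s, t, hst, hreg, fun hK => ?_, fun hK => ?_⟩, rfl, rfl, hsx, hxt⟩
  · by_contra hnv
    refine hPs (reg_of_frequently hM ?_ hK hnv)
    have : ∃ᶠ x' in 𝓝[>] s, Reg S D A B x' :=
      Eventually.frequently (by filter_upwards [Ioo_mem_nhdsGT hst] with x' hx' using hreg x' hx')
    exact this.filter_mono nhdsWithin_le_nhds
  · by_contra hnv
    refine hPt (reg_of_frequently hM ?_ hK hnv)
    have : ∃ᶠ x' in 𝓝[<] t, Reg S D A B x' :=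
      Eventually.frequently (by filter_upwards [Ioo_mem_nhdsLT hst] with x' hx' using hreg x' hx')
    exact this.filter_mono nhdsWithin_le_nhds

namespace Strip

variable {S : Set PlaneCircle} {D : Set Plane}

/-- Over the ends of the interval regularity is lost. A fixed convex combination of the two arcs is
a continuous curve, so membership passes to the limit. -/
lemma mem_closure (T : Strip S D) {x y : ℝ} (hx : x ∈ Icc T.s T.t)
    (hy : y ∈ Icc (T.A.f x) (T.B.f x)) : pt x y ∈ closure D := by
  obtain ⟨θ, hθ, rfl⟩ : ∃ θ ∈ Icc (0 : ℝ) 1, (1 - θ) * T.A.f x + θ * T.B.f x = y := by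
    rw [← segment_eq_Icc (hy.1.trans hy.2), segment_eq_image] at hy
    simpa using hy
  rw [← closure_Ioo T.lt.ne] at hx
  have hc : Continuous fun x => pt x ((1 - θ) * T.A.f x + θ * T.B.f x) := by
    have h1 := T.A.continuous_f
    have h2 := T.B.continuous_f
    exact continuous_id.pt (by fun_prop)
  have := map_mem_closure hc hx (t := closure D) fun x' hx' => by
    have hl := (T.reg x' hx').lt
    refine (T.reg x' hx').mem_closure ⟨?_, ?_⟩ <;> nlinarith [hθ.1, hθ.2]
  rwa [closure_closure] at this

lemma le (T : Strip S D) {x : ℝ} (hx : x ∈ Icc T.s T.t) : T.A.f x ≤ T.B.f x := by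
  rw [← closure_Ioo T.lt.ne] at hx
  have hc : IsClosed {x | T.A.f x ≤ T.B.f x} := isClosed_le T.A.continuous_f T.B.continuous_f
  exact closure_minimal (fun x' hx' => (T.reg x' hx').lt.le) hc hx

lemma memA (T : Strip S D) {x : ℝ} (hx : x ∈ Icc T.s T.t) : pt x (T.A.f x) ∈ closure D :=
  T.mem_closure hx ⟨le_rfl, T.le hx⟩

lemma memB (T : Strip S D) {x : ℝ} (hx : x ∈ Icc T.s T.t) : pt x (T.B.f x) ∈ closure D :=
  T.mem_closure hx ⟨T.le hx, le_rfl⟩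

lemma left_mem (T : Strip S D) : T.s ∈ Icc T.s T.t := ⟨le_rfl, T.lt.le⟩
lemma right_mem (T : Strip S D) : T.t ∈ Icc T.s T.t := ⟨T.lt.le, le_rfl⟩

lemma A_mem (T : Strip S D) : T.A.C ∈ S := by
  obtain ⟨x, hx⟩ := exists_between T.lt
  exact (T.reg x hx).memA

lemma B_mem (T : Strip S D) : T.B.C ∈ S := by
  obtain ⟨x, hx⟩ := exists_between T.lt
  exact (T.reg x hx).memB

/-- The closed domain of an arc contains the closed interval of a strip bounded by it. -/
lemma sq_le_A (T : Strip S D) {x : ℝ} (hx : x ∈ Icc T.s T.t) :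
    (x - T.A.C.center 0) ^ 2 ≤ T.A.C.radius ^ 2 := by
  rw [← closure_Ioo T.lt.ne] at hx
  have hc : IsClosed {x | (x - T.A.C.center 0) ^ 2 ≤ T.A.C.radius ^ 2} :=
    isClosed_le (by fun_prop) (by fun_prop)
  exact closure_minimal (fun x' hx' => (T.reg x' hx').domA.le) hc hx

lemma sq_le_B (T : Strip S D) {x : ℝ} (hx : x ∈ Icc T.s T.t) :
    (x - T.B.C.center 0) ^ 2 ≤ T.B.C.radius ^ 2 := by
  rw [← closure_Ioo T.lt.ne] at hx
  have hc : IsClosed {x | (x - T.B.C.center 0) ^ 2 ≤ T.B.C.radius ^ 2} :=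
    isClosed_le (by fun_prop) (by fun_prop)
  exact closure_minimal (fun x' hx' => (T.reg x' hx').domB.le) hc hx

/-- The points of the closure of the region in the open strip. -/
def region (T : Strip S D) : Set (closure D) :=
  {z | (z : Plane) 0 ∈ Ioo T.s T.t ∧
    (z : Plane) 1 ∈ Icc (T.A.f ((z : Plane) 0)) (T.B.f ((z : Plane) 0))}

/-- The edge of the Poincaré-Reeb space given by a strip, as a set. -/
def carrier (T : Strip S D) : Set (ReebSpace D) := reebMk D '' T.region

lemma region_saturated (hM : IsMBC S D) (T : Strip S D) :
    ∀ a ∈ T.region, ∀ b : closure D, Vis (closure D) a b → b ∈ T.region := by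
  rintro a ⟨h0, h1⟩ b hv
  rw [← pt_eta a, ((T.reg _ h0).isFiber hM).vis_iff h1] at hv
  exact ⟨hv.1 ▸ h0, by rw [hv.1]; exact hv.2⟩

lemma mk_mem_carrier_iff (hM : IsMBC S D) (T : Strip S D) {z : closure D} :
    reebMk D z ∈ T.carrier ↔ z ∈ T.region := by
  rw [← mem_preimage, carrier, preimage_image_reebMk (T.region_saturated hM)]

lemma isOpen_carrier (hM : IsMBC S D) (T : Strip S D) : IsOpen T.carrier := by
  refine isOpen_image_reebMk (isOpen_iff_mem_nhds.2 ?_) (T.region_saturated hM)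
  rintro a ⟨h0, h1⟩
  have h2 := (T.reg _ h0).eventually_between hM h1
  rw [pt_eta] at h2
  have h3 : ∀ᶠ z in 𝓝 (a : Plane), z 0 ∈ Ioo T.s T.t :=
    (continuous_coord 0).continuousAt.eventually (Ioo_mem_nhds h0.1 h0.2)
  filter_upwards [continuous_subtype_val.continuousAt.eventually h2,
    continuous_subtype_val.continuousAt.eventually h3] with z hz hz'
  exact ⟨hz', hz z.2⟩

lemma carrier_subset (hM : IsMBC S D) (T : Strip S D) : T.carrier ⊆ (reebVert S D)ᶜ := by
  rintro _ ⟨z, ⟨h0, h1⟩, rfl⟩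
  exact (T.reg _ h0).notMem_reebVert hM rfl h1

/-- The lower boundary of a strip gives a curve in the Poincaré-Reeb space. -/
def curve (T : Strip S D) : ℝ → ReebSpace D :=
  reebCurve T.lt.le fun _ hx => T.memA hx

lemma continuous_curve (T : Strip S D) : Continuous T.curve :=
  continuous_reebCurve _ _ T.A.continuous_f.continuousOn

lemma curve_of_mem (T : Strip S D) {x : ℝ} (hx : x ∈ Icc T.s T.t) :
    T.curve x = reebMk D ⟨pt x (T.A.f x), T.memA hx⟩ := reebCurve_of_mem _ _ hx

lemma mk_eq_curve (T : Strip S D) {z : closure D} (h0 : (z : Plane) 0 ∈ Icc T.s T.t)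
    (h1 : (z : Plane) 1 ∈ Icc (T.A.f ((z : Plane) 0)) (T.B.f ((z : Plane) 0))) :
    reebMk D z = T.curve ((z : Plane) 0) := by
  rw [T.curve_of_mem h0, reebMk_eq_iff]
  have := Vis.of_Icc (K := closure D) (fun t ht => T.mem_closure h0 ht) h1 ⟨le_rfl, T.le h0⟩
  rwa [pt_eta] at this

lemma image_curve (T : Strip S D) : T.curve '' Ioo T.s T.t = T.carrier := by
  ext w
  constructor
  · rintro ⟨x, hx, rfl⟩
    have hx' := Ioo_subset_Icc_self hx
    rw [T.curve_of_mem hx']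
    exact ⟨_, ⟨by simpa using hx, by simpa using T.le hx'⟩, rfl⟩
  · rintro ⟨z, ⟨h0, h1⟩, rfl⟩
    exact ⟨_, h0, (T.mk_eq_curve (Ioo_subset_Icc_self h0) h1).symm⟩

/-- The curve over the closed interval has a compact image, which is closed because the space is
Hausdorff. Only the two ends of the curve are added. -/
lemma closure_carrier_subset (T : Strip S D) :
    closure T.carrier ⊆ T.carrier ∪ {T.curve T.s, T.curve T.t} := by
  have h1 : closure T.carrier ⊆ T.curve '' Icc T.s T.t := by
    refine closure_minimal ?_ (isCompact_Icc.image T.continuous_curve).isClosed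
    rw [← T.image_curve]; exact image_mono Ioo_subset_Icc_self
  refine h1.trans ?_
  rintro _ ⟨x, hx, rfl⟩
  rcases eq_or_lt_of_le hx.1 with h | h
  · right; left; rw [h]
  rcases eq_or_lt_of_le hx.2 with h' | h'
  · right; right; rw [h']; rfl
  · left; rw [← T.image_curve]; exact ⟨x, ⟨h, h'⟩, rfl⟩

lemma curve_s_mem (T : Strip S D) : T.curve T.s ∈ reebVert S D := by
  rw [T.curve_of_mem T.left_mem]; exact T.vert_s _

lemma curve_t_mem (T : Strip S D) : T.curve T.t ∈ reebVert S D := by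
  rw [T.curve_of_mem T.right_mem]; exact T.vert_t _

lemma reebHeight_curve (T : Strip S D) {x : ℝ} (hx : x ∈ Icc T.s T.t) :
    reebHeight D (T.curve x) = x := by
  rw [T.curve_of_mem hx]; simp

/-- The carrier is connected and open, and it is closed in the complement of the vertices, since the
only limit points to be added are vertices. -/
lemma carrier_eq_component (hM : IsMBC S D) (T : Strip S D) {w : ReebSpace D}
    (hw : w ∈ T.carrier) : T.carrier = connectedComponentIn (reebVert S D)ᶜ w := by
  have hpre : IsPreconnected T.carrier := by
    rw [← T.image_curve]; exact isPreconnected_Ioo.image _ T.continuous_curve.continuousOn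
  refine Subset.antisymm (hpre.subset_connectedComponentIn hw (T.carrier_subset hM)) ?_
  refine isPreconnected_connectedComponentIn.subset_of_closure_inter_subset (T.isOpen_carrier hM)
    ⟨w, mem_connectedComponentIn (T.carrier_subset hM hw), hw⟩ ?_
  rintro v ⟨hv, hv'⟩
  have hnv := connectedComponentIn_subset _ _ hv'
  rcases T.closure_carrier_subset hv with h | h | h
  · exact h
  · exact (hnv (h ▸ T.curve_s_mem)).elim
  · rw [mem_singleton_iff] at h
    exact (hnv (h ▸ T.curve_t_mem)).elim

/-- The edge given by a strip. -/
def edge (hM : IsMBC S D) (T : Strip S D) : ReebEdge S D where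
  carrier := T.carrier
  component := by
    obtain ⟨x, hx⟩ := exists_between T.lt
    have hw : T.curve x ∈ T.carrier := T.image_curve ▸ mem_image_of_mem _ hx
    exact ⟨_, T.carrier_subset hM hw, T.carrier_eq_component hM hw⟩
  src := ⟨T.curve T.s, T.curve_s_mem⟩
  tgt := ⟨T.curve T.t, T.curve_t_mem⟩
  src_mem := by
    rw [← T.image_curve]
    refine image_closure_subset_closure_image T.continuous_curve (mem_image_of_mem _ ?_)
    rw [closure_Ioo T.lt.ne]; exact T.left_mem
  tgt_mem := by
    rw [← T.image_curve]
    refine image_closure_subset_closure_image T.continuous_curve (mem_image_of_mem _ ?_)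
    rw [closure_Ioo T.lt.ne]; exact T.right_mem
  src_lt := by
    rw [← T.image_curve]
    rintro _ ⟨x, hx, rfl⟩
    rw [T.reebHeight_curve T.left_mem, T.reebHeight_curve (Ioo_subset_Icc_self hx)]
    exact hx.1
  lt_tgt := by
    rw [← T.image_curve]
    rintro _ ⟨x, hx, rfl⟩
    rw [T.reebHeight_curve T.right_mem, T.reebHeight_curve (Ioo_subset_Icc_self hx)]
    exact hx.2

/-- Source and target are vertices in the closure of the carrier, hence ends of the curve, and the
height decides which end is which. So an edge is determined by its carrier. -/
lemma edge_eq (hM : IsMBC S D) (T : Strip S D) {e : ReebEdge S D} (h : e.carrier = T.carrier) :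
    e = T.edge hM := by
  obtain ⟨x, hx⟩ := exists_between T.lt
  have hw : T.curve x ∈ e.carrier := by rw [h, ← T.image_curve]; exact mem_image_of_mem _ hx
  have hsrc : e.src = (T.edge hM).src := by
    have h1 := e.src_mem
    have h2 := e.src_lt _ hw
    rw [h] at h1
    rw [T.reebHeight_curve (Ioo_subset_Icc_self hx)] at h2
    rcases T.closure_carrier_subset h1 with h' | h' | h'
    · exact (T.carrier_subset hM h' e.src.2).elim
    · exact Subtype.ext h'
    · rw [mem_singleton_iff] at h'
      rw [h', T.reebHeight_curve T.right_mem] at h2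
      exact absurd hx.2 (not_lt.2 h2.le)
  have htgt : e.tgt = (T.edge hM).tgt := by
    have h1 := e.tgt_mem
    have h2 := e.lt_tgt _ hw
    rw [h] at h1
    rw [T.reebHeight_curve (Ioo_subset_Icc_self hx)] at h2
    rcases T.closure_carrier_subset h1 with h' | h' | h'
    · exact (T.carrier_subset hM h' e.tgt.2).elim
    · rw [h', T.reebHeight_curve T.left_mem] at h2
      exact absurd hx.1 (not_lt.2 h2.le)
    · exact Subtype.ext h'
  obtain ⟨c, hc, s, t, h1, h2, h3, h4⟩ := e
  obtain rfl : c = T.carrier := h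
  obtain rfl : s = _ := hsrc
  obtain rfl : t = _ := htgt
  rfl

lemma exists_of_notMem (hM : IsMBC S D) {z : closure D} (hz : reebMk D z ∉ reebVert S D) :
    ∃ T : Strip S D, z ∈ T.region := by
  obtain ⟨A, B, hr, hI⟩ := exists_reg hM hz
  obtain ⟨T, rfl, rfl, hx⟩ := hr.exists_strip hM
  exact ⟨T, hx, hI⟩

end Strip

/-- Every edge is given by a strip. -/
lemma ReebEdge.exists_strip {S : Set PlaneCircle} {D : Set Plane} (hM : IsMBC S D)
    (e : ReebEdge S D) : ∃ T : Strip S D, e = T.edge hM := by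
  obtain ⟨w, hw, he⟩ := e.component
  obtain ⟨z, rfl⟩ := reebMk_surjective D w
  obtain ⟨T, hT⟩ := Strip.exists_of_notMem hM hw
  exact ⟨T, T.edge_eq hM (he.trans (T.carrier_eq_component hM ⟨z, hT, rfl⟩).symm)⟩

/-- A strip of an edge. -/
def ReebEdge.strip {S : Set PlaneCircle} {D : Set Plane} (hM : IsMBC S D) (e : ReebEdge S D) :
    Strip S D := (e.exists_strip hM).choose

lemma ReebEdge.strip_edge {S : Set PlaneCircle} {D : Set Plane} (hM : IsMBC S D)
    (e : ReebEdge S D) : (e.strip hM).edge hM = e := (e.exists_strip hM).choose_spec.symm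

/-- Edges with a common point are equal. -/
lemma Strip.edge_eq_edge {S : Set PlaneCircle} {D : Set Plane} (hM : IsMBC S D)
    {T T' : Strip S D} {z : closure D} (h : z ∈ T.region) (h' : z ∈ T'.region) :
    T.edge hM = T'.edge hM :=
  T'.edge_eq hM ((T.carrier_eq_component hM ⟨z, h, rfl⟩).trans
    (T'.carrier_eq_component hM ⟨z, h', rfl⟩).symm)

lemma finite_arcs {S : Set PlaneCircle} (hS : S.Finite) : {A : Arc | A.C ∈ S}.Finite := by
  refine ((hS.image fun C => (⟨C, 1, Or.inl rfl⟩ : Arc)).union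
    (hS.image fun C => (⟨C, -1, Or.inr rfl⟩ : Arc))).subset fun A hA => ?_
  rcases A.hs with h | h
  · exact Or.inl ⟨A.C, hA, Arc.ext_of rfl h.symm⟩
  · exact Or.inr ⟨A.C, hA, Arc.ext_of rfl h.symm⟩

lemma finite_reebVert {S : Set PlaneCircle} {D : Set Plane} (hM : IsMBC S D) :
    (reebVert S D).Finite := by
  have h1 : {q : Plane | ∃ C ∈ S, C.IsVerticalPole q}.Finite := by
    have : {q : Plane | ∃ C ∈ S, C.IsVerticalPole q} = ⋃ C ∈ S, {q | C.IsVerticalPole q} := by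
      ext; simp
    rw [this]
    exact hM.finite.biUnion fun C _ => Set.toFinite ({_, _} : Set Plane)
  have h2 : {q : Plane | IsDoublePoint S q}.Finite := by
    have : {q : Plane | IsDoublePoint S q} ⊆
        ⋃ C₁ ∈ S, ⋃ C₂ ∈ S, {q | C₁ ≠ C₂ ∧ q ∈ C₁.carrier ∩ C₂.carrier} := by
      rintro q ⟨C₁, hC₁, C₂, hC₂, h⟩
      exact mem_biUnion hC₁ (mem_biUnion hC₂ h)
    refine Finite.subset (hM.finite.biUnion fun C₁ _ => hM.finite.biUnion fun C₂ _ => ?_) this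
    by_cases hne : C₁ = C₂
    · simp [hne]
    · exact (finite_inter_carrier hne).subset fun q hq => hq.2
  have h3 := ((h1.union h2).preimage (Subtype.val_injective (p := (· ∈ closure D))).injOn).image
    (reebMk D)
  exact h3.subset fun w ⟨x, hx, h⟩ => ⟨x, h, hx⟩

/-- An edge is determined by its two arcs and its source: strips with the same arcs and the same
left end overlap just to the right of this end. -/
lemma finite_reebEdge {S : Set PlaneCircle} {D : Set Plane} (hM : IsMBC S D) :
    Finite (ReebEdge S D) := by
  have := (finite_arcs hM.finite).to_subtype
  have := (finite_reebVert hM).to_subtype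
  let φ : ReebEdge S D → {A : Arc | A.C ∈ S} × {A : Arc | A.C ∈ S} × ReebVertex S D := fun e =>
    (⟨(e.strip hM).A, (e.strip hM).A_mem⟩, ⟨(e.strip hM).B, (e.strip hM).B_mem⟩, e.src)
  refine Finite.of_injective φ fun e e' h => ?_
  simp only [φ, Prod.mk.injEq, Subtype.mk.injEq] at h
  obtain ⟨hA, hB, hs⟩ := h
  rw [← e.strip_edge hM, ← e'.strip_edge hM] at hs ⊢
  set T := e.strip hM
  set T' := e'.strip hM
  have hs' : T.s = T'.s := by
    have := congrArg (fun v : ReebVertex S D => reebHeight D v.1) hs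
    simpa [Strip.edge, T.reebHeight_curve T.left_mem, T'.reebHeight_curve T'.left_mem] using this
  obtain ⟨x, hx1, hx2⟩ := exists_between (lt_min T.lt (hs' ▸ T'.lt : T.s < T'.t))
  have hx : x ∈ Ioo T.s T.t := ⟨hx1, hx2.trans_le (min_le_left _ _)⟩
  have hx' : x ∈ Ioo T'.s T'.t := ⟨hs' ▸ hx1, hx2.trans_le (min_le_right _ _)⟩
  refine Strip.edge_eq_edge hM (z := ⟨_, T.memA (Ioo_subset_Icc_self hx)⟩) ⟨?_, ?_⟩ ⟨?_, ?_⟩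
  · simpa using hx
  · simpa using (T.reg x hx).lt.le
  · simpa using hx'
  · simpa [hA] using (T'.reg x hx').lt.le

/-! ## The neighbourhood of a nondegenerate fibre -/

/-- The open half-line to the left (`τ = 1`) or to the right (`τ = -1`) of `x₀`. -/
def halfLine (τ x₀ : ℝ) : Set ℝ := {x | 0 < τ * (x₀ - x)}

lemma convex_halfLine (τ x₀ : ℝ) : Convex ℝ (halfLine τ x₀) := by
  intro a ha b hb u v hu hv huv
  simp only [halfLine, mem_ofPred_eq, smul_eq_mul] at *
  have : τ * (x₀ - (u * a + v * b)) = u * (τ * (x₀ - a)) + v * (τ * (x₀ - b)) := by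
    linear_combination (-τ * x₀) * huv
  rw [this]
  rcases eq_or_lt_of_le hu with h | h
  · have : v = 1 := by linarith
    subst this; rw [← h]; linarith
  · have := mul_pos h ha
    have := mul_nonneg hv hb.le
    linarith

lemma halfLine_subset_ne (τ x₀ : ℝ) : halfLine τ x₀ ⊆ {x₀}ᶜ := by
  rintro x hx rfl
  simp [halfLine] at hx

lemma pos_or_neg_of_isPreconnected {T : Set ℝ} (hT : IsPreconnected T) {h : ℝ → ℝ}
    (hc : Continuous h) (h0 : ∀ x ∈ T, h x ≠ 0) : (∀ x ∈ T, 0 < h x) ∨ (∀ x ∈ T, h x < 0) := by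
  by_contra! hcon
  obtain ⟨⟨a, ha, ha'⟩, ⟨b, hb, hb'⟩⟩ := hcon
  obtain ⟨c, hc', hc0⟩ := (hT.image _ hc.continuousOn).Icc_subset (mem_image_of_mem _ ha)
    (mem_image_of_mem _ hb) ⟨ha', hb'⟩
  exact h0 c hc' hc0

/-- Near a point, arcs of distinct circles are comparable on each side. -/
lemma Arc.comparable {A A' : Arc} (hne : A.C ≠ A'.C) {x₀ τ : ℝ} (hA : A.Dom x₀)
    (hA' : A'.Dom x₀) :
    (∀ᶠ x in 𝓝 x₀, x ∈ halfLine τ x₀ → 0 < A.f x - A'.f x) ∨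
    (∀ᶠ x in 𝓝 x₀, x ∈ halfLine τ x₀ → 0 < A'.f x - A.f x) := by
  have hfin : ((fun z : Plane => z 0) '' (A.C.carrier ∩ A'.C.carrier)).Finite :=
    (finite_inter_carrier hne).image _
  -- A zero of the difference is the abscissa of one of finitely many common points, so none other
  -- than `x₀` is close to `x₀`; on each side the difference then keeps its sign.
  have h1 : ∀ᶠ x in 𝓝 x₀, x ∈ ({x₀} : Set ℝ)ᶜ → A.f x - A'.f x ≠ 0 := by
    have h2 : ∀ᶠ x in 𝓝 x₀, x ∉ ((fun z : Plane => z 0) '' (A.C.carrier ∩ A'.C.carrier)) \ {x₀} :=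
      (hfin.subset sdiff_subset).isClosed.isOpen_compl.mem_nhds (by simp)
    filter_upwards [h2, eventually_dom hA, eventually_dom hA'] with x hx hd hd' hne' h0
    refine hx ⟨⟨pt x (A.f x), ⟨mem_carrier_f hd.le, ?_⟩, by simp⟩, hne'⟩
    rw [sub_eq_zero.1 h0]; exact mem_carrier_f hd'.le
  obtain ⟨ε, hε, hb⟩ := Metric.eventually_nhds_iff_ball.1 h1
  have hpre : IsPreconnected (Metric.ball x₀ ε ∩ halfLine τ x₀) :=
    ((convex_ball x₀ ε).inter (convex_halfLine τ x₀)).isPreconnected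
  rcases pos_or_neg_of_isPreconnected hpre (A.continuous_f.sub A'.continuous_f)
    fun x hx => hb x hx.1 (halfLine_subset_ne _ _ hx.2) with h | h
  · exact Or.inl (by filter_upwards [Metric.ball_mem_nhds x₀ hε] with x hx hx' using h x ⟨hx, hx'⟩)
  · refine Or.inr ?_
    filter_upwards [Metric.ball_mem_nhds x₀ hε] with x hx hx'
    have := h x ⟨hx, hx'⟩
    simp only [Pi.sub_apply] at this
    linarith

/-- On one side of a point of the plane, the circles meet the upper (`υ = 1`) or lower (`υ = -1`)
side of the arc `A` only in the arc. -/
structure ArcEnd (S : Set PlaneCircle) (τ x₀ y υ : ℝ) (A : Arc) : Prop where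
  memS : A.C ∈ S
  f_eq : A.f x₀ = y
  dom : ∀ᶠ x in 𝓝 x₀, x ∈ halfLine τ x₀ → A.Dom x
  only : ∀ C ∈ S, ∀ᶠ z in 𝓝 (pt x₀ y), z 0 ∈ halfLine τ x₀ → 0 ≤ υ * (z 1 - A.f (z 0)) →
    z ∈ C.carrier → C = A.C ∧ z 1 = A.f (z 0)

/-- `(x₀, t)` is the right (`τ = 1`) or left (`τ = -1`) vertical pole of a circle. -/
def SidePole (S : Set PlaneCircle) (τ x₀ t : ℝ) : Prop :=
  ∃ C ∈ S, C.center 0 + τ * C.radius = x₀ ∧ C.center 1 = t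

section

variable {S : Set PlaneCircle} {D : Set Plane}

lemma eventually_pt_fst {x₀ y : ℝ} {P : ℝ → Prop} (h : ∀ᶠ x in 𝓝 x₀, P x) :
    ∀ᶠ z in 𝓝 (pt x₀ y), P (z 0) :=
  (continuous_coord 0).continuousAt.eventually (by simpa using h)

lemma SidePole.pole {τ x₀ t : ℝ} (hτ : τ = 1 ∨ τ = -1) {C : PlaneCircle}
    (h : C.center 0 + τ * C.radius = x₀ ∧ C.center 1 = t) : C.IsVerticalPole (pt x₀ t) := by
  obtain ⟨rfl, rfl⟩ := h
  rcases hτ with rfl | rfl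
  · left; exact plane_ext (by simp) (by simp)
  · right; exact plane_ext (by simp; ring) (by simp)

lemma sidePole_of_pole {x₀ t : ℝ} {C : PlaneCircle} (hC : C ∈ S)
    (h : C.IsVerticalPole (pt x₀ t)) : SidePole S 1 x₀ t ∨ SidePole S (-1) x₀ t := by
  rcases h with h | h
  · left
    have h0 := congrArg (fun z : Plane => z 0) h
    have h1 := congrArg (fun z : Plane => z 1) h
    simp at h0 h1
    exact ⟨C, hC, by linarith, h1.symm⟩
  · right
    have h0 := congrArg (fun z : Plane => z 0) h
    have h1 := congrArg (fun z : Plane => z 1) h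
    simp at h0 h1
    exact ⟨C, hC, by linarith, h1.symm⟩

/-- The power of a point on the horizontal line through a vertical pole. -/
lemma pw_pole_horizontal {C : PlaneCircle} {τ x₀ t : ℝ} (hτ : τ = 1 ∨ τ = -1)
    (h : C.center 0 + τ * C.radius = x₀ ∧ C.center 1 = t) (x : ℝ) :
    pw C (pt x t) = (x - x₀) * (x - x₀ + 2 * τ * C.radius) := by
  obtain ⟨rfl, rfl⟩ := h
  unfold pw
  rcases hτ with rfl | rfl <;> simp <;> ring

/-- The arc at an end of a fibre which bounds the region on a given side. -/
lemma IsEnd.exists_arcEnd (hM : IsMBC S D) {x₀ y υ : ℝ} (h : IsEnd (closure D) x₀ y υ) (τ : ℝ) :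
    ∃ A, ArcEnd S τ x₀ y υ A ∧ ∀ᶠ z in 𝓝 (pt x₀ y), z ∈ closure D → z 0 ∈ halfLine τ x₀ →
      0 ≤ υ * (z 1 - A.f (z 0)) := by
  -- The arc to take is the innermost one on the side `τ`: arcs of other circles through the end are
  -- then strictly beyond it and do not meet the part where the region lies.
  suffices hmain : ∃ A : Arc, A.C ∈ S ∧ A.f x₀ = y ∧ A.Dom x₀ ∧ A.Side D υ ∧
      ∀ A' : Arc, A'.C ∈ S → A'.f x₀ = y → A'.Dom x₀ → A'.C ≠ A.C →
        ∀ᶠ x in 𝓝 x₀, x ∈ halfLine τ x₀ → 0 < υ * (A.f x - A'.f x) by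
    obtain ⟨A, hAS, hAf, hAd, hAs, hA⟩ := hmain
    refine ⟨A, ⟨hAS, hAf, (Arc.eventually_dom hAd).mono fun _ h _ => h, fun C hC => ?_⟩, ?_⟩
    · by_cases hyC : pt x₀ y ∈ C.carrier
      · obtain ⟨A', rfl, hA'f, hA'd, -⟩ := h.exists_arc hM hC hyC
        have hev := Arc.eventually_eq_of_mem hA'd
        rw [hA'f] at hev
        by_cases hCC : A'.C = A.C
        · have : A' = A := Arc.eq_of_f_eq hCC hA'd (hA'f.trans hAf.symm)
          subst this
          filter_upwards [hev] with z hz _ _ hzC using ⟨rfl, hz hzC⟩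
        · filter_upwards [hev, eventually_pt_fst (hA A' hC hA'f hA'd hCC)] with z hz hz' hσ hge hzC
          exfalso
          have h1 := hz' hσ
          rw [← hz hzC] at h1
          have : υ * (A.f (z 0) - z 1) = -(υ * (z 1 - A.f (z 0))) := by ring
          linarith
      · filter_upwards [(isClosed_carrier C).isOpen_compl.mem_nhds hyC] with z hz _ _ hzC
        exact (hz hzC).elim
    · have := hAs.eventually hAd
      rw [hAf] at this
      filter_upwards [this] with z hz hK _ using hz hK
  obtain ⟨C, hC, hyC⟩ := h.exists_carrier hM
  obtain ⟨A, rfl, hAf, hAd, hAs⟩ := h.exists_arc hM hC hyC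
  -- At a double point only two arcs compete, because no third circle passes. Which of them is the
  -- inner one may depend on `τ`.
  by_cases hex : ∃ C' ∈ S, C' ≠ A.C ∧ pt x₀ y ∈ C'.carrier
  · obtain ⟨C', hC', hne, hyC'⟩ := hex
    obtain ⟨A', rfl, hA'f, hA'd, hA's⟩ := h.exists_arc hM hC' hyC'
    have hthird : ∀ A'' : Arc, A''.C ∈ S → A''.f x₀ = y → A''.Dom x₀ → A'' = A ∨ A'' = A' := by
      intro A'' h1 h2 h3
      have hm : pt x₀ y ∈ A''.C.carrier := h2 ▸ Arc.mem_carrier_f h3.le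
      rcases hM.no_triple A.C hC A'.C hC' (Ne.symm hne) _ ⟨h.mem, hyC, hyC'⟩ A''.C h1 hm with h4 | h4
      · exact Or.inl (Arc.eq_of_f_eq h4 h3 (h2.trans hAf.symm))
      · exact Or.inr (Arc.eq_of_f_eq h4 h3 (h2.trans hA'f.symm))
    have hcmp : (∀ᶠ x in 𝓝 x₀, x ∈ halfLine τ x₀ → 0 < υ * (A.f x - A'.f x)) ∨
        (∀ᶠ x in 𝓝 x₀, x ∈ halfLine τ x₀ → 0 < υ * (A'.f x - A.f x)) := by
      rcases h.sign with rfl | rfl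
      · simpa using Arc.comparable (τ := τ) (Ne.symm hne) hAd hA'd
      · simpa using Arc.comparable (τ := τ) hne hA'd hAd
    rcases hcmp with hc | hc
    · refine ⟨A, hC, hAf, hAd, hAs, fun A'' h1 h2 h3 h4 => ?_⟩
      rcases hthird A'' h1 h2 h3 with rfl | rfl
      · exact (h4 rfl).elim
      · exact hc
    · refine ⟨A', hC', hA'f, hA'd, hA's, fun A'' h1 h2 h3 h4 => ?_⟩
      rcases hthird A'' h1 h2 h3 with rfl | rfl
      · exact hc
      · exact (h4 rfl).elim
  · push Not at hex
    refine ⟨A, hC, hAf, hAd, hAs, fun A' h1 h2 h3 h4 => (hex A'.C h1 h4 ?_).elim⟩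
    rw [← h2]; exact Arc.mem_carrier_f h3.le

/-- The two arcs at a vertical pole in the interior of a fibre. -/
lemma SidePole.exists_arcEnd (hM : IsMBC S D) {τ x₀ t : ℝ} (hτ : τ = 1 ∨ τ = -1)
    (h : SidePole S τ x₀ t) (hK : pt x₀ t ∈ closure D) {t' : ℝ} (ht' : t' ≠ t)
    (hK' : pt x₀ t' ∈ closure D) :
    ∃ A B : Arc, ArcEnd S τ x₀ t 1 A ∧ ArcEnd S τ x₀ t (-1) B ∧
      ∀ᶠ z in 𝓝 (pt x₀ t), z ∈ closure D → z 0 ∈ halfLine τ x₀ →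
        A.f (z 0) ≤ z 1 ∨ z 1 ≤ B.f (z 0) := by
  obtain ⟨C, hC, hCp⟩ := h
  have hp := SidePole.pole hτ hCp
  have hR := C.radius_pos
  have hout := hM.outside_of_pole hC hp ht' hK'
  have huniq := hM.eq_of_pole hK hC hp
  -- Both halves of `C` leave the pole on the side `τ`. The region is outside of `C`, so the upper
  -- half bounds from below what lies above the pole, and the lower half bounds from above what lies
  -- below it.
  set A : Arc := ⟨C, 1, Or.inl rfl⟩ with hA
  set B : Arc := ⟨C, -1, Or.inr rfl⟩ with hB
  have hg : A.g x₀ = 0 := by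
    have := (isVerticalPole_iff.1 hp).2
    simp only [pt_zero] at this
    simp only [Arc.g, hA, this, sub_self, Real.sqrt_zero]
  have hgAB : A.g = B.g := rfl
  have hdom : ∀ᶠ x in 𝓝 x₀, x ∈ halfLine τ x₀ → (x - C.center 0) ^ 2 < C.radius ^ 2 := by
    filter_upwards [Metric.ball_mem_nhds x₀ hR] with x hx hσ
    rw [Metric.mem_ball, Real.dist_eq] at hx
    have hx2 := abs_lt.1 hx
    simp only [halfLine, mem_ofPred_eq] at hσ
    obtain ⟨h1, -⟩ := hCp
    rcases hτ with rfl | rfl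
    · exact sq_lt_sq' (by linarith) (by linarith)
    · exact sq_lt_sq' (by linarith) (by linarith)
  have honly : ∀ C' ∈ S, C' ≠ C → ∀ᶠ z in 𝓝 (pt x₀ t), z ∉ C'.carrier := by
    intro C' hC' hne
    exact (isClosed_carrier C').isOpen_compl.mem_nhds fun hm => hne (huniq C' hC' hm)
  have hCz : ∀ z : Plane, (z 0 - C.center 0) ^ 2 < C.radius ^ 2 →
      pw C z = (z 1 - A.f (z 0)) * (z 1 - B.f (z 0)) := by
    intro z hz
    rw [show C = A.C from rfl, Arc.pw_eq (A := A) hz.le]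
    simp only [Arc.f, ← hgAB]
    simp only [hA, hB]; ring
  have hAB : ∀ x, B.f x ≤ A.f x := by
    intro x
    have := A.g_nonneg x
    simp only [Arc.f, ← hgAB]; simp only [hA, hB] at this ⊢
    linarith
  refine ⟨A, B, ⟨hC, ?_, hdom, fun C' hC' => ?_⟩, ⟨hC, ?_, hdom, fun C' hC' => ?_⟩, ?_⟩
  · simp only [Arc.f, hg]; simp [hA, hCp.2]
  · by_cases hCC : C' = C
    · subst hCC
      filter_upwards [eventually_pt_fst hdom] with z hz hσ hge hzC
      refine ⟨rfl, ?_⟩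
      have h1 := mem_carrier.1 hzC
      rw [hCz z (hz hσ)] at h1
      rcases mul_eq_zero.1 h1 with h2 | h2
      · linarith
      · have := hAB (z 0); linarith
    · filter_upwards [honly C' hC' hCC] with z hz _ _ hzC using (hz hzC).elim
  · simp only [Arc.f, ← hgAB, hg]; simp [hB, hCp.2]
  · by_cases hCC : C' = C
    · subst hCC
      filter_upwards [eventually_pt_fst hdom] with z hz hσ hge hzC
      refine ⟨rfl, ?_⟩
      have h1 := mem_carrier.1 hzC
      rw [hCz z (hz hσ)] at h1
      rcases mul_eq_zero.1 h1 with h2 | h2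
      · have := hAB (z 0); linarith
      · linarith
    · filter_upwards [honly C' hC' hCC] with z hz _ _ hzC using (hz hzC).elim
  · filter_upwards [eventually_pt_fst hdom] with z hz hzK hσ
    have h1 : 0 ≤ pw C z :=
      closure_minimal (fun w hw => (hout w hw).le)
        (isClosed_le continuous_const (continuous_pw C)) hzK
    rw [hCz z (hz hσ)] at h1
    by_contra! hcon
    nlinarith [hcon.1, hcon.2]

/-- The part of a fibre between two arcs without a vertical pole of the given side in between is
the limit of regular fibres. -/
lemma IsFiber.eventually_reg (hM : IsMBC S D) {x₀ lo hi τ : ℝ} (hτ : τ = 1 ∨ τ = -1)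
    (hf : IsFiber (closure D) x₀ lo hi) {y₀ y₁ : ℝ} (h0 : lo ≤ y₀) (hlt : y₀ < y₁) (h1 : y₁ ≤ hi)
    {A B : Arc} (hA : ArcEnd S τ x₀ y₀ 1 A) (hB : ArcEnd S τ x₀ y₁ (-1) B)
    (hno : ∀ t ∈ Ioo y₀ y₁, ¬ SidePole S τ x₀ t) :
    ∀ᶠ x in 𝓝 x₀, x ∈ halfLine τ x₀ → Reg S D A B x := by
  have hAf := hA.f_eq
  have hBf := hB.f_eq
  have hint : ∀ t ∈ Ioo y₀ y₁, t ∈ Ioo lo hi := fun t ht =>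
    ⟨h0.trans_lt ht.1, ht.2.trans_le h1⟩
  obtain ⟨y, hy, hyD⟩ : ∃ y ∈ Ioo y₀ y₁, pt x₀ y ∈ D := by
    have hfin : {t : ℝ | ∃ C ∈ S, C.IsVerticalPole (pt x₀ t)}.Finite := by
      refine (hM.finite.image fun C => C.center 1).subset ?_
      rintro t ⟨C, hC, hp⟩
      rcases sidePole_of_pole (S := {C}) rfl hp with ⟨C', rfl, -, h⟩ | ⟨C', rfl, -, h⟩ <;>
      exact ⟨_, hC, h⟩
    obtain ⟨y, hy, hyn⟩ := (Ioo_infinite hlt).exists_notMem_finite hfin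
    exact ⟨y, hy, (hf.mem_or_pole hM (hint y hy)).resolve_right hyn⟩
  refine eventually_reg_of_segment hM hA.memS hB.memS hA.dom hB.dom (by rw [hAf, hBf]; exact hlt)
    (y₀ := y) (by rw [hAf, hBf]; exact hy) hyD ?_
  rw [hAf, hBf]
  intro t ht C hC
  rcases eq_or_lt_of_le ht.1 with h2 | h2
  · subst h2
    filter_upwards [hA.only C hC] with z hz hσ hI hzC
    exact Or.inl (hz hσ (by linarith [hI.1]) hzC)
  rcases eq_or_lt_of_le ht.2 with h3 | h3
  · subst h3
    filter_upwards [hB.only C hC] with z hz hσ hI hzC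
    exact Or.inr (hz hσ (by linarith [hI.2]) hzC)
  rcases hf.mem_or_pole hM (hint t ⟨h2, h3⟩) with hD | ⟨C', hC', hp⟩
  · filter_upwards [hM.isOpen.mem_nhds hD] with z hz _ _ hzC
    exact (hM.notMem_carrier hz hC hzC).elim
  · have hK := hf.mem t (Ioo_subset_Icc_self (hint t ⟨h2, h3⟩))
    by_cases hCC : C = C'
    · subst hCC
      -- A pole inside the gap is not on the side `τ` of its circle, so it is the opposite pole, and
      -- the whole circle lies on the other side of the line over `x₀`.
      have hq : C.center 0 - τ * C.radius = x₀ := by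
        rcases sidePole_of_pole (S := {C}) rfl hp with ⟨C', rfl, h, h'⟩ | ⟨C', rfl, h, h'⟩ <;>
        rcases hτ with rfl | rfl
        · exact (hno t ⟨h2, h3⟩ ⟨_, hC, h, h'⟩).elim
        · linarith
        · linarith
        · exact (hno t ⟨h2, h3⟩ ⟨_, hC, h, h'⟩).elim
      refine Eventually.of_forall fun z hσ _ hzC => ?_
      exfalso
      have h4 := Arc.sq_le_of_mem hzC
      have hR := C.radius_pos
      simp only [halfLine, mem_ofPred_eq] at hσ
      have h5 := abs_le_of_sq_le_sq' h4 hR.le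
      rcases hτ with rfl | rfl <;> linarith [h5.1, h5.2]
    · filter_upwards [(isClosed_carrier C).isOpen_compl.mem_nhds fun hm =>
        hCC (hM.eq_of_pole hK hC' hp C hC hm)] with z hz _ _ hzC
      exact (hz hzC).elim

/-- The fibre continues past a pole, so the region is outside of its circle. The points directly to
the left of a right pole are inside of the circle, hence outside of the closure; those to the left
of a left pole are outside of the circle, hence in `D`. The ends of the fibre are no poles. -/
lemma IsFiber.isTypeIPole_iff (hM : IsMBC S D) {x₀ lo hi : ℝ} (hlt : lo < hi)
    (hf : IsFiber (closure D) x₀ lo hi) {t : ℝ} (ht : t ∈ Icc lo hi) :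
    (IsTypeIPole S D (pt x₀ t) ↔ t ∈ Ioo lo hi ∧ SidePole S 1 x₀ t) ∧
    (IsTypeIIPole S D (pt x₀ t) ↔ t ∈ Ioo lo hi ∧ SidePole S (-1) x₀ t) := by
  have hK := hf.mem t ht
  have hIoo : (∃ C ∈ S, C.IsVerticalPole (pt x₀ t)) → t ∈ Ioo lo hi := by
    rintro ⟨C, hC, hp⟩
    refine ⟨lt_of_le_of_ne ht.1 ?_, lt_of_le_of_ne ht.2 ?_⟩
    · rintro rfl; exact (hf.isEnd_low hlt).not_isVerticalPole hM C hC hp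
    · rintro rfl; exact (hf.isEnd_up hlt).not_isVerticalPole hM C hC hp
  have hout : ∀ C ∈ S, C.IsVerticalPole (pt x₀ t) → ∀ z ∈ D, 0 < pw C z := by
    intro C hC hp
    have ht' := hIoo ⟨C, hC, hp⟩
    exact hM.outside_of_pole hC hp ht'.1.ne (hf.mem lo ⟨le_rfl, hf.le⟩)
  have hI : SidePole S 1 x₀ t → IsTypeIPole S D (pt x₀ t) := by
    rintro ⟨C, hC, hCp⟩
    have hp := SidePole.pole (Or.inl rfl) hCp
    refine ⟨hK, ⟨C, hC, hp⟩, ?_⟩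
    filter_upwards [Ioo_mem_nhdsGT C.radius_pos] with ε hε hmem
    have h1 : 0 ≤ pw C (pt (x₀ - ε) t) := by
      refine closure_minimal (fun w hw => (hout C hC hp w hw).le)
        (isClosed_le continuous_const (continuous_pw C)) ?_
      simpa [pt] using hmem
    rw [pw_pole_horizontal (Or.inl rfl) hCp] at h1
    nlinarith [hε.1, hε.2]
  have hII : SidePole S (-1) x₀ t → ¬ IsTypeIPole S D (pt x₀ t) := by
    rintro ⟨C, hC, hCp⟩ hT
    have hp := SidePole.pole (Or.inr rfl) hCp
    have hev := hM.eventually_mem hK (mem_carrier.2 (isVerticalPole_iff.1 hp).1)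
      (hM.eq_of_pole hK hC hp) (κ := 1) (Or.inl rfl) (by simpa using hout C hC hp)
    have hc : Tendsto (fun ε : ℝ => pt (x₀ - ε) t) (𝓝[>] 0) (𝓝 (pt x₀ t)) := by
      have : Continuous fun ε : ℝ => pt (x₀ - ε) t := (by fun_prop : Continuous fun ε : ℝ =>
        x₀ - ε).pt continuous_const
      have h2 := this.tendsto 0
      simp only [sub_zero] at h2
      exact h2.mono_left nhdsWithin_le_nhds
    obtain ⟨ε, ⟨h1, h2⟩, h3⟩ := ((hT.2.2.and (hc.eventually hev)).and self_mem_nhdsWithin).exists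
    have h3 : (0 : ℝ) < ε := h3
    refine h1 (subset_closure ?_)
    have : pt (x₀ - ε) t ∈ D := by
      refine h2 ?_
      rw [pw_pole_horizontal (Or.inr rfl) hCp]
      nlinarith [C.radius_pos]
    simpa [pt] using this
  constructor
  · constructor
    · rintro h
      obtain ⟨C, hC, hp⟩ := h.2.1
      refine ⟨hIoo h.2.1, (sidePole_of_pole hC hp).resolve_right fun h' => hII h' h⟩
    · exact fun h => hI h.2
  · constructor
    · rintro ⟨-, ⟨C, hC, hp⟩, h⟩
      refine ⟨hIoo ⟨C, hC, hp⟩, (sidePole_of_pole hC hp).resolve_left fun h' => h (hI h')⟩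
    · rintro ⟨-, h⟩
      obtain ⟨C, hC, hCp⟩ := id h
      exact ⟨hK, ⟨C, hC, SidePole.pole (Or.inr rfl) hCp⟩, hII h⟩

lemma not_sidePole_both (hM : IsMBC S D) {x₀ t : ℝ} (hK : pt x₀ t ∈ closure D)
    (h : SidePole S 1 x₀ t) (h' : SidePole S (-1) x₀ t) : False := by
  obtain ⟨C, hC, hCp⟩ := h
  obtain ⟨C', hC', hCp'⟩ := h'
  have hp := SidePole.pole (Or.inl rfl) hCp
  have hp' := SidePole.pole (Or.inr rfl) hCp'
  obtain rfl := hM.eq_of_pole hK hC hp C' hC' (mem_carrier.2 (isVerticalPole_iff.1 hp').1)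
  linarith [C'.radius_pos, hCp.1, hCp'.1]

end

/-! ## Subdivisions of an interval -/

/-- A strictly increasing enumeration of a finite set with least element `lo` and greatest element
`hi`. -/
lemma exists_enumeration {Q : Set ℝ} (hQ : Q.Finite) {lo hi : ℝ} (hlt : lo < hi)
    (hsub : Q ⊆ Ioo lo hi) : ∃ (a : ℕ) (x : ℕ → ℝ), StrictMonoOn x (Iic a) ∧ x 0 = lo ∧ x a = hi ∧
      x '' Ioo 0 a = Q := by
  classical
  set F : Finset ℝ := insert lo (insert hi hQ.toFinset) with hF
  have hloF : lo ∈ F := by simp [hF]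
  have hhiF : hi ∈ F := by simp [hF]
  have hFI : ∀ q ∈ F, lo ≤ q ∧ q ≤ hi := by
    intro q hq
    simp only [hF, Finset.mem_insert, Finite.mem_toFinset] at hq
    rcases hq with rfl | rfl | hq
    · exact ⟨le_rfl, hlt.le⟩
    · exact ⟨hlt.le, le_rfl⟩
    · exact ⟨(hsub hq).1.le, (hsub hq).2.le⟩
  have hcard : 0 < F.card := Finset.card_pos.2 ⟨lo, hloF⟩
  set e := F.orderEmbOfFin rfl with he
  set x : ℕ → ℝ := fun i => if h : i < F.card then e ⟨i, h⟩ else 0 with hx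
  have hxe : ∀ i (h : i < F.card), x i = e ⟨i, h⟩ := fun i h => by simp [hx, h]
  have hmem : ∀ i, i < F.card → x i ∈ F := fun i h => by
    rw [hxe i h]; exact F.orderEmbOfFin_mem rfl _
  have hsurj : ∀ q ∈ F, ∃ i, i < F.card ∧ x i = q := by
    intro q hq
    have : q ∈ Set.range e := by rw [he, Finset.range_orderEmbOfFin]; exact hq
    obtain ⟨i, rfl⟩ := this
    exact ⟨i, i.2, hxe _ i.2⟩
  have hmono : StrictMonoOn x (Iic (F.card - 1)) := by
    intro i hi' j hj hij
    simp only [mem_Iic] at hi' hj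
    rw [hxe i (by omega), hxe j (by omega)]
    exact e.strictMono hij
  have hx0 : x 0 = lo := by
    obtain ⟨i, hi1, hi2⟩ := hsurj lo hloF
    rcases Nat.eq_zero_or_pos i with rfl | h
    · exact hi2
    · have h1 := hmono (show 0 ∈ Iic (F.card - 1) by simp) (show i ∈ Iic (F.card - 1) by
        simp only [mem_Iic]; omega) h
      have := (hFI _ (hmem 0 hcard)).1
      linarith
  have hxa : x (F.card - 1) = hi := by
    obtain ⟨i, hi1, hi2⟩ := hsurj hi hhiF
    rcases eq_or_lt_of_le (show i ≤ F.card - 1 by omega) with rfl | h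
    · exact hi2
    · have h1 := hmono (show i ∈ Iic (F.card - 1) from h.le) (show F.card - 1 ∈ Iic (F.card - 1) by
        simp) h
      have := (hFI _ (hmem (F.card - 1) (by omega))).2
      linarith
  refine ⟨F.card - 1, x, hmono, hx0, hxa, ?_⟩
  ext q
  constructor
  · rintro ⟨i, ⟨h1, h2⟩, rfl⟩
    have hm := hmem i (by omega)
    simp only [hF, Finset.mem_insert, Finite.mem_toFinset] at hm
    have h3 := hmono (show 0 ∈ Iic (F.card - 1) by simp) (show i ∈ Iic (F.card - 1) from h2.le) h1
    have h4 := hmono (show i ∈ Iic (F.card - 1) from h2.le)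
      (show F.card - 1 ∈ Iic (F.card - 1) by simp) h2
    rcases hm with h | h | h
    · rw [h, hx0] at h3; exact absurd h3 (lt_irrefl _)
    · rw [h, hxa] at h4; exact absurd h4 (lt_irrefl _)
    · exact h
  · intro hq
    obtain ⟨i, h1, rfl⟩ := hsurj q (by simp [hF, hq])
    have h2 := hsub hq
    refine ⟨i, ⟨Nat.pos_of_ne_zero ?_, lt_of_le_of_ne (by omega) ?_⟩, rfl⟩
    · rintro rfl; exact h2.1.ne hx0.symm
    · rintro rfl; exact h2.2.ne hxa

lemma exists_between_of_enumeration {a : ℕ} {x : ℕ → ℝ} {y : ℝ}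
    (h0 : x 0 ≤ y) (ha : y ≤ x a) (hn : ∀ i ≤ a, x i ≠ y) :
    ∃ j, 1 ≤ j ∧ j ≤ a ∧ x (j - 1) < y ∧ y < x j := by
  classical
  have hex : ∃ j, y ≤ x j := ⟨a, ha⟩
  have h1 := Nat.find_spec hex
  have hle : Nat.find hex ≤ a := Nat.find_min' hex ha
  have hpos : 0 < Nat.find hex := by
    rw [Nat.pos_iff_ne_zero]
    intro h
    rw [h] at h1
    exact hn 0 (Nat.zero_le _) (le_antisymm h0 h1)
  have h2 := Nat.find_min hex (show Nat.find hex - 1 < Nat.find hex by omega)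
  exact ⟨Nat.find hex, hpos, hle, not_le.1 h2, lt_of_le_of_ne h1 (hn _ hle).symm⟩

section

variable {S : Set PlaneCircle} {D : Set Plane}

/-- The strips on one side of a nondegenerate fibre. -/
lemma IsFiber.exists_gaps (hM : IsMBC S D) {x₀ lo hi τ : ℝ} (hτ : τ = 1 ∨ τ = -1) (hlt : lo < hi)
    (hf : IsFiber (closure D) x₀ lo hi) :
    ∃ (a : ℕ) (x : ℕ → ℝ) (A B : ℕ → Arc), StrictMonoOn x (Iic a) ∧ x 0 = lo ∧ x a = hi ∧
      x '' Ioo 0 a = {t | t ∈ Ioo lo hi ∧ SidePole S τ x₀ t} ∧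
      (∀ j ∈ Icc 1 a, (A j).f x₀ = x (j - 1) ∧ (B j).f x₀ = x j ∧
        ∀ᶠ x' in 𝓝 x₀, x' ∈ halfLine τ x₀ → Reg S D (A j) (B j) x') ∧
      ∀ y ∈ Icc lo hi, ∀ᶠ z in 𝓝 (pt x₀ y), z ∈ closure D → z 0 ∈ halfLine τ x₀ →
        ∃ j ∈ Icc 1 a, z 1 ∈ Icc ((A j).f (z 0)) ((B j).f (z 0)) := by
  have hfin : {t | t ∈ Ioo lo hi ∧ SidePole S τ x₀ t}.Finite := by
    refine (hM.finite.image fun C => C.center 1).subset ?_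
    rintro t ⟨-, C, hC, -, h⟩
    exact ⟨C, hC, h⟩
  obtain ⟨a, x, hmono, hx0, hxa, himg⟩ := exists_enumeration hfin hlt fun t ht => ht.1
  obtain ⟨Al, hAl, hAlc⟩ := (hf.isEnd_low hlt).exists_arcEnd hM τ
  obtain ⟨Bh, hBh, hBhc⟩ := (hf.isEnd_up hlt).exists_arcEnd hM τ
  have hpole : ∀ t : ℝ, ∃ AB : Arc × Arc, t ∈ Ioo lo hi ∧ SidePole S τ x₀ t →
      ArcEnd S τ x₀ t 1 AB.1 ∧ ArcEnd S τ x₀ t (-1) AB.2 ∧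
      ∀ᶠ z in 𝓝 (pt x₀ t), z ∈ closure D → z 0 ∈ halfLine τ x₀ →
        AB.1.f (z 0) ≤ z 1 ∨ z 1 ≤ AB.2.f (z 0) := by
    intro t
    by_cases ht : t ∈ Ioo lo hi ∧ SidePole S τ x₀ t
    · obtain ⟨A, B, h⟩ := ht.2.exists_arcEnd hM hτ (hf.mem t (Ioo_subset_Icc_self ht.1))
        (ht.1.1.ne) (hf.mem lo ⟨le_rfl, hf.le⟩)
      exact ⟨(A, B), fun _ => h⟩
    -- At a height that is not a pole the pair is irrelevant; any value makes the choice total.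
    · exact ⟨(Al, Bh), fun h => (ht h).elim⟩
  choose AB hAB using hpole
  have ha : 1 ≤ a := by
    rw [Nat.one_le_iff_ne_zero]
    rintro rfl
    exact hlt.ne (hx0.symm.trans hxa)
  have hin : ∀ i, 0 < i → i < a → x i ∈ Ioo lo hi ∧ SidePole S τ x₀ (x i) := fun i h1 h2 => by
    have : x i ∈ x '' Ioo 0 a := ⟨i, ⟨h1, h2⟩, rfl⟩
    rwa [himg] at this
  have hxle : ∀ i ≤ a, lo ≤ x i ∧ x i ≤ hi := by
    intro i hi'
    rw [← hx0, ← hxa]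
    exact ⟨hmono.monotoneOn (by simp) hi' (Nat.zero_le _), hmono.monotoneOn hi' (by simp) hi'⟩
  -- Gap number `j` lies between `x (j - 1)` and `x j`. Its lower arc starts at the lower end of the
  -- fibre if `j = 1` and at the pole below the gap otherwise; its upper arc belongs to the upper
  -- end if `j = a` and to the pole above it otherwise.
  set A : ℕ → Arc := fun j => if j = 1 then Al else (AB (x (j - 1))).1 with hA
  set B : ℕ → Arc := fun j => if j = a then Bh else (AB (x j)).2 with hB
  have hAE : ∀ j ∈ Icc 1 a, ArcEnd S τ x₀ (x (j - 1)) 1 (A j) := by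
    rintro j ⟨h1, h2⟩
    by_cases hj : j = 1
    · subst hj; simp only [hA, if_true, le_refl, tsub_eq_zero_of_le, hx0]; exact hAl
    · simp only [hA, if_neg hj]
      exact (hAB _ (hin (j - 1) (by omega) (by omega))).1
  have hBE : ∀ j ∈ Icc 1 a, ArcEnd S τ x₀ (x j) (-1) (B j) := by
    rintro j ⟨h1, h2⟩
    by_cases hj : j = a
    · subst hj; simp only [hB, if_true, hxa]; exact hBh
    · simp only [hB, if_neg hj]
      exact (hAB _ (hin j (by omega) (by omega))).2.1
  have hstep : ∀ j ∈ Icc 1 a, x (j - 1) < x j := fun j hj =>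
    hmono (show j - 1 ∈ Iic a by have := hj.2; simp only [mem_Iic]; omega) hj.2
      (by have := hj.1; omega)
  have habove : ∀ j ∈ Icc 1 a, ∀ y, x (j - 1) < y → ∀ᶠ z in 𝓝 (pt x₀ y), (A j).f (z 0) ≤ z 1 := by
    intro j hj y hy
    have hc : Continuous fun z : Plane => z 1 - (A j).f (z 0) :=
      (continuous_coord 1).sub ((A j).continuous_f.comp (continuous_coord 0))
    filter_upwards [hc.continuousAt.eventually (lt_mem_nhds (a := 0)
      (by simp [(hAE j hj).f_eq, hy]))] with z hz
    linarith
  have hbelow : ∀ j ∈ Icc 1 a, ∀ y, y < x j → ∀ᶠ z in 𝓝 (pt x₀ y), z 1 ≤ (B j).f (z 0) := by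
    intro j hj y hy
    have hc : Continuous fun z : Plane => (B j).f (z 0) - z 1 :=
      ((B j).continuous_f.comp (continuous_coord 0)).sub (continuous_coord 1)
    filter_upwards [hc.continuousAt.eventually (lt_mem_nhds (a := 0)
      (by simp [(hBE j hj).f_eq, hy]))] with z hz
    linarith
  refine ⟨a, x, A, B, hmono, hx0, hxa, himg, fun j hj => ⟨(hAE j hj).f_eq, (hBE j hj).f_eq, ?_⟩, ?_⟩
  · have hj1 : j - 1 ∈ Iic a := by have := hj.2; simp only [mem_Iic]; omega
    refine hf.eventually_reg hM hτ (hxle (j - 1) hj1).1 (hstep j hj)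
      (hxle j hj.2).2 (hAE j hj) (hBE j hj) fun t ht hsp => ?_
    have htI : t ∈ Ioo lo hi :=
      ⟨(hxle (j - 1) hj1).1.trans_lt ht.1, ht.2.trans_le (hxle j hj.2).2⟩
    have : t ∈ x '' Ioo 0 a := himg ▸ ⟨htI, hsp⟩
    obtain ⟨i, hi', rfl⟩ := this
    have h1 := (hmono.lt_iff_lt hj1 (show i ∈ Iic a from hi'.2.le)).1 ht.1
    have h2 := (hmono.lt_iff_lt (show i ∈ Iic a from hi'.2.le) (show j ∈ Iic a from hj.2)).1 ht.2
    omega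
  · intro y hy
    -- Strictly inside a gap continuity of the arcs suffices. At an end or at a pole the position of
    -- the region relative to the arcs there decides between the gaps.
    by_cases hex : ∃ i ≤ a, x i = y
    · obtain ⟨i, hia, rfl⟩ := hex
      rcases Nat.eq_zero_or_pos i with rfl | hi0
      · have h1 : (1 : ℕ) ∈ Icc 1 a := ⟨le_rfl, ha⟩
        have hlow : ∀ᶠ z in 𝓝 (pt x₀ (x 0)), z ∈ closure D → z 0 ∈ halfLine τ x₀ →
            0 ≤ 1 * (z 1 - (A 1).f (z 0)) := by
          rw [hx0]; simpa [hA] using hAlc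
        filter_upwards [hlow, hbelow 1 h1 _ (hstep 1 h1)] with z hz1 hz2 hK hσ
        exact ⟨1, h1, by linarith [hz1 hK hσ], hz2⟩
      rcases eq_or_lt_of_le hia with rfl | hia
      · have h1 : i ∈ Icc 1 i := ⟨ha, le_rfl⟩
        have hup : ∀ᶠ z in 𝓝 (pt x₀ (x i)), z ∈ closure D → z 0 ∈ halfLine τ x₀ →
            0 ≤ -1 * (z 1 - (B i).f (z 0)) := by
          rw [hxa]; simpa [hB] using hBhc
        filter_upwards [hup, habove i h1 _ (hstep i h1)] with z hz1 hz2 hK hσ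
        exact ⟨i, h1, hz2, by linarith [hz1 hK hσ]⟩
      · have hi1 : i ∈ Icc 1 a := ⟨hi0, hia.le⟩
        have hi2 : i + 1 ∈ Icc 1 a := ⟨by omega, hia⟩
        have hpc := (hAB _ (hin i hi0 hia)).2.2
        have e1 : A (i + 1) = (AB (x i)).1 := by
          simp only [hA, add_tsub_cancel_right]; rw [if_neg (by omega)]
        have e2 : B i = (AB (x i)).2 := by simp only [hB]; rw [if_neg hia.ne]
        rw [← e1, ← e2] at hpc
        filter_upwards [hpc, habove i hi1 _ (hstep i hi1),
          hbelow (i + 1) hi2 _ (by simpa using hstep (i + 1) hi2)] with z hz1 hz2 hz3 hK hσ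
        rcases hz1 hK hσ with h | h
        · exact ⟨i + 1, hi2, h, hz3⟩
        · exact ⟨i, hi1, hz2, h⟩
    · push Not at hex
      obtain ⟨j, hj1, hj2, h1, h2⟩ := exists_between_of_enumeration (hx0 ▸ hy.1) (hxa ▸ hy.2) hex
      filter_upwards [habove j ⟨hj1, hj2⟩ y h1, hbelow j ⟨hj1, hj2⟩ y h2] with z hz1 hz2 _ _
      exact ⟨j, ⟨hj1, hj2⟩, hz1, hz2⟩

end

/-! ## The edges at a nondegenerate fibre -/

section

variable {S : Set PlaneCircle} {D : Set Plane}

/-- Lying between the two arcs is a closed condition, and conversely each convex combination of the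
arcs approaches its value over `c`. -/
lemma Strip.limitFiber_edge (hM : IsMBC S D) (T : Strip S D) {c : ℝ} (hc : c ∈ Icc T.s T.t) :
    (T.edge hM).limitFiber c = Icc (T.A.f c) (T.B.f c) := by
  have hset : (reebMk D ⁻¹' (T.edge hM).carrier) = T.region := by
    ext z; exact T.mk_mem_carrier_iff hM
  ext y
  show pt c y ∈ closure (Subtype.val '' (reebMk D ⁻¹' (T.edge hM).carrier)) ↔ _
  rw [hset]
  constructor
  · intro h
    have hcl : IsClosed {z : Plane | T.A.f (z 0) ≤ z 1 ∧ z 1 ≤ T.B.f (z 0)} :=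
      (isClosed_le (T.A.continuous_f.comp (continuous_coord 0)) (continuous_coord 1)).inter
        (isClosed_le (continuous_coord 1) (T.B.continuous_f.comp (continuous_coord 0)))
    have := closure_minimal (s := Subtype.val '' T.region) ?_ hcl h
    · simpa using this
    · rintro _ ⟨z, hz, rfl⟩
      exact hz.2
  · intro hy
    obtain ⟨θ, hθ, rfl⟩ : ∃ θ ∈ Icc (0 : ℝ) 1, (1 - θ) * T.A.f c + θ * T.B.f c = y := by
      rw [← segment_eq_Icc (hy.1.trans hy.2), segment_eq_image] at hy
      simpa using hy
    rw [← closure_Ioo T.lt.ne] at hc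
    have hcont : Continuous fun x => pt x ((1 - θ) * T.A.f x + θ * T.B.f x) := by
      have h1 := T.A.continuous_f
      have h2 := T.B.continuous_f
      exact continuous_id.pt (by fun_prop)
    refine map_mem_closure (f := fun x => pt x ((1 - θ) * T.A.f x + θ * T.B.f x)) hcont hc
      fun x hx => ?_
    have hl := (T.reg x hx).lt
    have hm : (1 - θ) * T.A.f x + θ * T.B.f x ∈ Icc (T.A.f x) (T.B.f x) := by
      constructor <;> nlinarith [hθ.1, hθ.2]
    exact ⟨⟨_, (T.reg x hx).mem_closure hm⟩, ⟨by simpa using hx, by simpa using hm⟩, rfl⟩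

/-- Regular fibres with limit in the vertex `v₀` from the left belong to a strip entering `v₀`. -/
lemma exists_strip_entering (hM : IsMBC S D) {x₀ : ℝ} {A B : Arc}
    (hr : ∀ᶠ x in 𝓝 x₀, x ∈ halfLine 1 x₀ → Reg S D A B x)
    (hv : ∀ h : pt x₀ (A.f x₀) ∈ closure D, reebMk D ⟨_, h⟩ ∈ reebVert S D) :
    ∃ T : Strip S D, T.A = A ∧ T.B = B ∧ T.t = x₀ := by
  obtain ⟨ε, hε, hb⟩ := Metric.eventually_nhds_iff_ball.1 hr
  have hreg : ∀ x, x₀ - ε < x → x < x₀ → Reg S D A B x := fun x h1 h2 => by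
    refine hb x ?_ (by simp only [halfLine, mem_ofPred_eq]; linarith)
    rw [Metric.mem_ball, Real.dist_eq, abs_lt]; constructor <;> linarith
  obtain ⟨T, rfl, rfl, hT⟩ := (hreg (x₀ - ε / 2) (by linarith) (by linarith)).exists_strip hM
  refine ⟨T, rfl, rfl, ?_⟩
  -- The strip cannot end before `x₀`, since the fibre there is still regular, and it cannot pass
  -- `x₀`, since that fibre is a vertex.
  rcases lt_trichotomy T.t x₀ with h | h | h
  · exfalso
    have hr := hreg T.t (by linarith [hT.2]) h
    refine hr.notMem_reebVert hM (z := ⟨pt T.t (T.A.f T.t), T.memA T.right_mem⟩) (by simp) ?_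
      (T.vert_t _)
    simpa using hr.lt.le
  · exact h
  · exfalso
    have hr := T.reg x₀ ⟨by linarith [hT.1], h⟩
    have hK := hr.mem_closure ⟨le_rfl, hr.lt.le⟩
    exact hr.notMem_reebVert hM (z := ⟨_, hK⟩) (by simp) (by simpa using hr.lt.le) (hv hK)

/-- Regular fibres with limit in the vertex `v₀` from the right belong to a strip departing from
`v₀`. -/
lemma exists_strip_departing (hM : IsMBC S D) {x₀ : ℝ} {A B : Arc}
    (hr : ∀ᶠ x in 𝓝 x₀, x ∈ halfLine (-1) x₀ → Reg S D A B x)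
    (hv : ∀ h : pt x₀ (A.f x₀) ∈ closure D, reebMk D ⟨_, h⟩ ∈ reebVert S D) :
    ∃ T : Strip S D, T.A = A ∧ T.B = B ∧ T.s = x₀ := by
  obtain ⟨ε, hε, hb⟩ := Metric.eventually_nhds_iff_ball.1 hr
  have hreg : ∀ x, x₀ < x → x < x₀ + ε → Reg S D A B x := fun x h1 h2 => by
    refine hb x ?_ (by simp only [halfLine, mem_ofPred_eq]; linarith)
    rw [Metric.mem_ball, Real.dist_eq, abs_lt]; constructor <;> linarith
  obtain ⟨T, rfl, rfl, hT⟩ := (hreg (x₀ + ε / 2) (by linarith) (by linarith)).exists_strip hM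
  refine ⟨T, rfl, rfl, ?_⟩
  rcases lt_trichotomy T.s x₀ with h | h | h
  · exfalso
    have hr := T.reg x₀ ⟨h, by linarith [hT.2]⟩
    have hK := hr.mem_closure ⟨le_rfl, hr.lt.le⟩
    exact hr.notMem_reebVert hM (z := ⟨_, hK⟩) (by simp) (by simpa using hr.lt.le) (hv hK)
  · exact h
  · exfalso
    have hr := hreg T.s h (by linarith [hT.1])
    refine hr.notMem_reebVert hM (z := ⟨pt T.s (T.A.f T.s), T.memA T.left_mem⟩) (by simp) ?_
      (T.vert_s _)
    simpa using hr.lt.le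

lemma Icc_injOn_of_strictMonoOn {a : ℕ} {x : ℕ → ℝ} (hmono : StrictMonoOn x (Iic a)) {i j : ℕ}
    (hi : i ∈ Icc 1 a) (hj : j ∈ Icc 1 a)
    (h : Icc (x (i - 1)) (x i) = Icc (x (j - 1)) (x j)) : i = j := by
  have h1 : x (i - 1) ≤ x i := hmono.monotoneOn
    (show i - 1 ∈ Iic a by have := hi.2; simp only [mem_Iic]; omega) hi.2 (Nat.sub_le _ _)
  have := (Set.Icc_eq_Icc_iff h1).1 h
  exact hmono.injOn (show i ∈ Iic a from hi.2) (show j ∈ Iic a from hj.2) this.2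

/-- Every gap on the left yields a strip ending over `x₀`, and different gaps have different limits.
Conversely, just before `x₀` the lower boundary of a strip entering `v₀` lies in one of the gaps,
and strips with a common point give the same edge. -/
lemma exists_entering_edges (hM : IsMBC S D) {x₀ lo hi : ℝ} (hlt : lo < hi)
    (hf : IsFiber (closure D) x₀ lo hi) {v₀ : ReebVertex S D}
    (hv₀ : ∀ y ∈ Icc lo hi, ∀ h : pt x₀ y ∈ closure D, reebMk D ⟨_, h⟩ = v₀.1) :
    ∃ (a : ℕ) (x : ℕ → ℝ), StrictMonoOn x (Iic a) ∧ x 0 = lo ∧ x a = hi ∧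
      x '' Ioo 0 a = {t | t ∈ Ioo lo hi ∧ SidePole S 1 x₀ t} ∧
      ∃ el : Icc 1 a ≃ {e : ReebEdge S D // e.tgt = v₀},
        ∀ j : Icc 1 a, (el j).1.limitFiber x₀ = Icc (x (j.1 - 1)) (x j.1) := by
  obtain ⟨a, x, A, B, hmono, hx0, hxa, himg, hgap, hcov⟩ := hf.exists_gaps hM (Or.inl rfl) hlt
  have hxle : ∀ i ≤ a, x i ∈ Icc lo hi := by
    intro i hi'
    rw [← hx0, ← hxa]
    exact ⟨hmono.monotoneOn (by simp) hi' (Nat.zero_le _), hmono.monotoneOn hi' (by simp) hi'⟩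
  have hstrip : ∀ j : Icc 1 a, ∃ T : Strip S D, T.A = A j ∧ T.B = B j ∧ T.t = x₀ := by
    rintro ⟨j, hj⟩
    obtain ⟨h1, h2, h3⟩ := hgap j hj
    refine exists_strip_entering hM h3 fun h => ?_
    rw [hv₀ ((A j).f x₀) (h1 ▸ hxle (j - 1) (by have := hj.2; omega)) h]; exact v₀.2
  choose T hTA hTB hTt using hstrip
  have hT0 : ∀ j, x₀ ∈ Icc (T j).s (T j).t := fun j => hTt j ▸ (T j).right_mem
  have htgt : ∀ j, ((T j).edge hM).tgt = v₀ := by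
    intro j
    refine Subtype.ext ?_
    show (T j).curve (T j).t = v₀.1
    rw [hTt j, (T j).curve_of_mem (hT0 j)]
    refine hv₀ _ ?_ _
    rw [hTA j, (hgap j j.2).1]
    exact hxle _ (by have := j.2.2; omega)
  have hlim : ∀ j : Icc 1 a, ((T j).edge hM).limitFiber x₀ = Icc (x (j.1 - 1)) (x j.1) := by
    intro j
    rw [(T j).limitFiber_edge hM (hT0 j), hTA j, hTB j, (hgap j j.2).1, (hgap j j.2).2.1]
  refine ⟨a, x, hmono, hx0, hxa, himg,
    Equiv.ofBijective (fun j => ⟨(T j).edge hM, htgt j⟩) ⟨fun i j hij => ?_, ?_⟩, hlim⟩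
  · have := congrArg (fun e : {e : ReebEdge S D // e.tgt = v₀} => e.1.limitFiber x₀) hij
    simp only [hlim] at this
    exact Subtype.ext (Icc_injOn_of_strictMonoOn hmono i.2 j.2 this)
  · rintro ⟨e, he⟩
    obtain ⟨T', rfl⟩ := e.exists_strip hM
    have ht' : T'.t = x₀ := by
      have h3 : reebHeight D v₀.1 = x₀ := by
        rw [← hv₀ lo ⟨le_rfl, hlt.le⟩ (hf.mem lo ⟨le_rfl, hlt.le⟩)]; simp
      rw [← h3, ← he]
      exact (T'.reebHeight_curve T'.right_mem).symm
    have hy : T'.A.f x₀ ∈ Icc lo hi := by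
      have h1 : reebMk D ⟨_, T'.memA T'.right_mem⟩ = v₀.1 := by
        rw [← he]; exact (T'.curve_of_mem T'.right_mem).symm
      rw [← hv₀ lo ⟨le_rfl, hlt.le⟩ (hf.mem lo ⟨le_rfl, hlt.le⟩)] at h1
      have h2 := (hf.vis_iff ⟨le_rfl, hlt.le⟩).1 (reebMk_eq_iff.1 h1.symm)
      simpa [ht'] using h2.2
    have hc : Continuous fun x => pt x (T'.A.f x) := continuous_id.pt T'.A.continuous_f
    have h1 := (hc.tendsto x₀).eventually (hcov _ hy)
    have h2 : ∀ᶠ x in 𝓝[<] x₀, x ∈ Ioo T'.s x₀ := Ioo_mem_nhdsLT (ht' ▸ T'.lt)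
    have h3 : ∀ᶠ x in 𝓝 x₀, ∀ j : Icc 1 a, x ∈ Ioi (T j).s := by
      refine Filter.eventually_all.2 fun j => Ioi_mem_nhds ?_
      have := (T j).lt; rwa [hTt j] at this
    obtain ⟨x', ⟨h4, h5⟩, h6⟩ := (((h1.and h3).filter_mono nhdsWithin_le_nhds).and h2).exists
    have hx' : x' ∈ Ioo T'.s T'.t := ht' ▸ h6
    have hK := T'.memA (Ioo_subset_Icc_self hx')
    obtain ⟨j, hj, hI⟩ := h4 hK (by simp [halfLine]; exact h6.2)
    refine ⟨⟨j, hj⟩, Subtype.ext (Strip.edge_eq_edge hM (z := ⟨_, hK⟩) ⟨?_, ?_⟩ ⟨?_, ?_⟩)⟩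
    · simpa [hTt] using ⟨h5 ⟨j, hj⟩, h6.2⟩
    · rw [hTA, hTB]; simpa using hI
    · simpa using hx'
    · simpa using (T'.reg x' hx').lt.le

/-- Mirror image of `exists_entering_edges`. -/
lemma exists_departing_edges (hM : IsMBC S D) {x₀ lo hi : ℝ} (hlt : lo < hi)
    (hf : IsFiber (closure D) x₀ lo hi) {v₀ : ReebVertex S D}
    (hv₀ : ∀ y ∈ Icc lo hi, ∀ h : pt x₀ y ∈ closure D, reebMk D ⟨_, h⟩ = v₀.1) :
    ∃ (a : ℕ) (x : ℕ → ℝ), StrictMonoOn x (Iic a) ∧ x 0 = lo ∧ x a = hi ∧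
      x '' Ioo 0 a = {t | t ∈ Ioo lo hi ∧ SidePole S (-1) x₀ t} ∧
      ∃ er : Icc 1 a ≃ {e : ReebEdge S D // e.src = v₀},
        ∀ j : Icc 1 a, (er j).1.limitFiber x₀ = Icc (x (j.1 - 1)) (x j.1) := by
  obtain ⟨a, x, A, B, hmono, hx0, hxa, himg, hgap, hcov⟩ := hf.exists_gaps hM (Or.inr rfl) hlt
  have hxle : ∀ i ≤ a, x i ∈ Icc lo hi := by
    intro i hi'
    rw [← hx0, ← hxa]
    exact ⟨hmono.monotoneOn (by simp) hi' (Nat.zero_le _), hmono.monotoneOn hi' (by simp) hi'⟩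
  have hstrip : ∀ j : Icc 1 a, ∃ T : Strip S D, T.A = A j ∧ T.B = B j ∧ T.s = x₀ := by
    rintro ⟨j, hj⟩
    obtain ⟨h1, h2, h3⟩ := hgap j hj
    refine exists_strip_departing hM h3 fun h => ?_
    rw [hv₀ ((A j).f x₀) (h1 ▸ hxle (j - 1) (by have := hj.2; omega)) h]; exact v₀.2
  choose T hTA hTB hTt using hstrip
  have hT0 : ∀ j, x₀ ∈ Icc (T j).s (T j).t := fun j => hTt j ▸ (T j).left_mem
  have htgt : ∀ j, ((T j).edge hM).src = v₀ := by
    intro j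
    refine Subtype.ext ?_
    show (T j).curve (T j).s = v₀.1
    rw [hTt j, (T j).curve_of_mem (hT0 j)]
    refine hv₀ _ ?_ _
    rw [hTA j, (hgap j j.2).1]
    exact hxle _ (by have := j.2.2; omega)
  have hlim : ∀ j : Icc 1 a, ((T j).edge hM).limitFiber x₀ = Icc (x (j.1 - 1)) (x j.1) := by
    intro j
    rw [(T j).limitFiber_edge hM (hT0 j), hTA j, hTB j, (hgap j j.2).1, (hgap j j.2).2.1]
  refine ⟨a, x, hmono, hx0, hxa, himg,
    Equiv.ofBijective (fun j => ⟨(T j).edge hM, htgt j⟩) ⟨fun i j hij => ?_, ?_⟩, hlim⟩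
  · have := congrArg (fun e : {e : ReebEdge S D // e.src = v₀} => e.1.limitFiber x₀) hij
    simp only [hlim] at this
    exact Subtype.ext (Icc_injOn_of_strictMonoOn hmono i.2 j.2 this)
  · rintro ⟨e, he⟩
    obtain ⟨T', rfl⟩ := e.exists_strip hM
    have ht' : T'.s = x₀ := by
      have h3 : reebHeight D v₀.1 = x₀ := by
        rw [← hv₀ lo ⟨le_rfl, hlt.le⟩ (hf.mem lo ⟨le_rfl, hlt.le⟩)]; simp
      rw [← h3, ← he]
      exact (T'.reebHeight_curve T'.left_mem).symm
    have hy : T'.A.f x₀ ∈ Icc lo hi := by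
      have h1 : reebMk D ⟨_, T'.memA T'.left_mem⟩ = v₀.1 := by
        rw [← he]; exact (T'.curve_of_mem T'.left_mem).symm
      rw [← hv₀ lo ⟨le_rfl, hlt.le⟩ (hf.mem lo ⟨le_rfl, hlt.le⟩)] at h1
      have h2 := (hf.vis_iff ⟨le_rfl, hlt.le⟩).1 (reebMk_eq_iff.1 h1.symm)
      simpa [ht'] using h2.2
    have hc : Continuous fun x => pt x (T'.A.f x) := continuous_id.pt T'.A.continuous_f
    have h1 := (hc.tendsto x₀).eventually (hcov _ hy)
    have h2 : ∀ᶠ x in 𝓝[>] x₀, x ∈ Ioo x₀ T'.t := Ioo_mem_nhdsGT (ht' ▸ T'.lt)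
    have h3 : ∀ᶠ x in 𝓝 x₀, ∀ j : Icc 1 a, x ∈ Iio (T j).t := by
      refine Filter.eventually_all.2 fun j => Iio_mem_nhds ?_
      have := (T j).lt; rwa [hTt j] at this
    obtain ⟨x', ⟨h4, h5⟩, h6⟩ := (((h1.and h3).filter_mono nhdsWithin_le_nhds).and h2).exists
    have hx' : x' ∈ Ioo T'.s T'.t := ht' ▸ h6
    have hK := T'.memA (Ioo_subset_Icc_self hx')
    obtain ⟨j, hj, hI⟩ := h4 hK (by simp [halfLine]; exact h6.1)
    refine ⟨⟨j, hj⟩, Subtype.ext (Strip.edge_eq_edge hM (z := ⟨_, hK⟩) ⟨?_, ?_⟩ ⟨?_, ?_⟩)⟩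
    · simpa [hTt] using ⟨h6.1, h5 ⟨j, hj⟩⟩
    · rw [hTA, hTB]; simpa using hI
    · simpa using hx'
    · simpa using (T'.reg x' hx').lt.le

lemma vis_of_segment {p : Plane} (hp : p ∈ closure D) {lo hi : ℝ}
    (hseg : connectedComponentIn (closure D ∩ {z | z 0 = p 0}) p =
      {z | z 0 = p 0 ∧ z 1 ∈ Icc lo hi}) (b : Plane) :
    Vis (closure D) p b ↔ b 0 = p 0 ∧ b 1 ∈ Icc lo hi := by
  rw [← mem_connectedComponentIn_iff hp, hseg]; rfl

lemma isFiber_of_segment {p : Plane} (hp : p ∈ closure D) {lo hi : ℝ}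
    (hlo : lo ≤ p 1) (hhi : p 1 ≤ hi)
    (hseg : connectedComponentIn (closure D ∩ {z | z 0 = p 0}) p =
      {z | z 0 = p 0 ∧ z 1 ∈ Icc lo hi}) : IsFiber (closure D) (p 0) lo hi := by
  have hv := vis_of_segment hp hseg
  have hmem : ∀ t ∈ Icc lo hi, pt (p 0) t ∈ closure D := fun t ht =>
    ((hv (pt (p 0) t)).2 (by simpa using ht)).right_mem
  refine ⟨hlo.trans hhi, hmem, fun t ht => ?_, fun t ht => ?_⟩
  · by_contra! hc
    have h1 : Vis (closure D) p (pt (p 0) t) := by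
      refine ⟨by simp, fun t' ht' => ?_⟩
      rw [pt_one, uIcc_of_ge (ht.le.trans hlo)] at ht'
      rcases lt_or_ge t' lo with h | h
      · exact hc t' ⟨ht'.1, h⟩
      · exact hmem t' ⟨h, ht'.2.trans hhi⟩
    have h2 := ((hv _).1 h1).2.1
    simp only [pt_one] at h2
    linarith
  · by_contra! hc
    have h1 : Vis (closure D) p (pt (p 0) t) := by
      refine ⟨by simp, fun t' ht' => ?_⟩
      rw [pt_one, uIcc_of_le (hhi.trans ht.le)] at ht'
      rcases lt_or_ge hi t' with h | h
      · exact hc t' ⟨h, ht'.2⟩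
      · exact hmem t' ⟨hlo.trans ht'.1, h⟩
    have h2 := ((hv _).1 h1).2.2
    simp only [pt_one] at h2
    linarith

/-- The edges at the vertex of a vertical pole of I-type in the interior of its fibre. -/
theorem nonempty_segmentData (hM : IsMBC S D) (p : Plane) (hp : IsTypeIPole S D p)
    (lo hi : ℝ) (hlo : lo < p 1) (hhi : p 1 < hi)
    (hseg : connectedComponentIn (closure D ∩ {z | z 0 = p 0}) p =
      {z | z 0 = p 0 ∧ z 1 ∈ Set.Icc lo hi}) :
    Nonempty (SegmentData S D p lo hi (poleVertex hp.1 hp.2.1)) := by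
  have hlt := hlo.trans hhi
  have hf := isFiber_of_segment hp.1 hlo.le hhi.le hseg
  have hv₀ : ∀ y ∈ Icc lo hi, ∀ h : pt (p 0) y ∈ closure D,
      reebMk D ⟨_, h⟩ = (poleVertex hp.1 hp.2.1 : ReebVertex S D).1 := by
    intro y hy h
    refine (reebMk_eq_iff.2 ?_ : reebMk D ⟨_, h⟩ = reebMk D ⟨p, hp.1⟩)
    exact ((vis_of_segment hp.1 hseg _).2 (by simpa using hy)).symm
  obtain ⟨a, xl, hlm, hl0, hla, hlimg, el, hel⟩ := exists_entering_edges hM hlt hf hv₀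
  obtain ⟨b, xr, hrm, hr0, hrb, hrimg, er, her⟩ := exists_departing_edges hM hlt hf hv₀
  have ha : 1 ≤ a := by
    rw [Nat.one_le_iff_ne_zero]; rintro rfl; exact hlt.ne (hl0.symm.trans hla)
  have hb : 1 ≤ b := by
    rw [Nat.one_le_iff_ne_zero]; rintro rfl; exact hlt.ne (hr0.symm.trans hrb)
  have hinl : ∀ i, 0 < i → i < a → xl i ∈ Ioo lo hi ∧ SidePole S 1 (p 0) (xl i) := fun i h1 h2 => by
    have : xl i ∈ xl '' Ioo 0 a := ⟨i, ⟨h1, h2⟩, rfl⟩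
    rwa [hlimg] at this
  have hinr : ∀ i, 0 < i → i < b → xr i ∈ Ioo lo hi ∧ SidePole S (-1) (p 0) (xr i) :=
    fun i h1 h2 => by
      have : xr i ∈ xr '' Ioo 0 b := ⟨i, ⟨h1, h2⟩, rfl⟩
      rwa [hrimg] at this
  have hp1 : p 1 ∈ Ioo lo hi := ⟨hlo, hhi⟩
  have hpp : SidePole S 1 (p 0) (p 1) := by
    refine (((hf.isTypeIPole_iff hM hlt (Ioo_subset_Icc_self hp1)).1).1 ?_).2
    rw [pt_eta]; exact hp
  obtain ⟨j₀, ⟨hj1, hj2⟩, hj⟩ : p 1 ∈ xl '' Ioo 0 a := hlimg ▸ ⟨hp1, hpp⟩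
  -- The height of `p` is no point of the subdivision on the right: `p` is a right pole, and a point
  -- of the closure cannot be a right and a left pole.
  obtain ⟨k₀, hk1, hk2, hk3, hk4⟩ := exists_between_of_enumeration (x := xr) (y := p 1) (a := b)
    (hr0 ▸ hlo.le) (hrb ▸ hhi.le) (by
      intro i hi' h
      rcases Nat.eq_zero_or_pos i with rfl | h0
      · rw [hr0] at h; exact hlo.ne h
      rcases eq_or_lt_of_le hi' with rfl | h1
      · rw [hrb] at h; exact hhi.ne h.symm
      · have := (hinr i h0 h1).2
        rw [h] at this
        exact not_sidePole_both hM (hf.mem _ (Ioo_subset_Icc_self hp1)) hpp this)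
  refine ⟨⟨a, b, xl, xr, hlm, hrm, hl0, hr0, hla, hrb, ?_, ?_, ?_, ?_, el, er, hel, her, j₀, hj1, hj2,
    hj, k₀, hk1, hk2, hk3, hk4⟩⟩
  · ext t
    constructor
    · rintro ⟨⟨i, ⟨hi1, hi2⟩, rfl⟩, ⟨k, ⟨hk1', hk2'⟩, hk⟩⟩
      rcases eq_or_lt_of_le hi2 with rfl | h
      · exact hla
      rcases eq_or_lt_of_le hk2' with rfl | h'
      · rw [← hk]; exact hrb
      exfalso
      have h1 := hinl i hi1 h
      have h2 := hinr k hk1' h'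
      rw [hk] at h2
      exact not_sidePole_both hM (hf.mem _ (Ioo_subset_Icc_self h1.1)) h1.2 h2.2
    · rintro rfl
      exact ⟨⟨a, ⟨ha, le_rfl⟩, hla⟩, ⟨b, ⟨hb, le_rfl⟩, hrb⟩⟩
  · rw [hlimg]
    ext t
    constructor
    · intro h
      have h1 := Ioo_subset_Icc_self h.1
      exact ⟨h1, (hf.isTypeIPole_iff hM hlt h1).1.2 h⟩
    · rintro ⟨h1, h2⟩
      exact (hf.isTypeIPole_iff hM hlt h1).1.1 h2
  · rw [hrimg]
    ext t
    constructor
    · intro h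
      have h1 := Ioo_subset_Icc_self h.1
      exact ⟨h1, (hf.isTypeIPole_iff hM hlt h1).2.2 h⟩
    · rintro ⟨h1, h2⟩
      exact (hf.isTypeIPole_iff hM hlt h1).2.1 h2
  · intro t ht hnl hnr
    have htI : t ∈ Ioo lo hi := by
      refine ⟨lt_of_le_of_ne ht.1 ?_, lt_of_le_of_ne ht.2 ?_⟩
      · rintro rfl; exact hnl ⟨0, Nat.zero_le _, hl0⟩
      · rintro rfl; exact hnl ⟨a, mem_Iic.2 le_rfl, hla⟩
    have hD : pt (p 0) t ∈ D := by
      refine (hf.mem_or_pole hM htI).resolve_right ?_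
      rintro ⟨C, hC, hpole⟩
      rcases sidePole_of_pole hC hpole with h | h
      · have : t ∈ xl '' Ioo 0 a := hlimg ▸ ⟨htI, h⟩
        obtain ⟨i, hi', rfl⟩ := this
        exact hnl ⟨i, hi'.2.le, rfl⟩
      · have : t ∈ xr '' Ioo 0 b := hrimg ▸ ⟨htI, h⟩
        obtain ⟨i, hi', rfl⟩ := this
        exact hnr ⟨i, hi'.2.le, rfl⟩
    have hno : ∀ C ∈ S, pt (p 0) t ∉ C.carrier := fun C hC => hM.notMem_carrier hD hC
    refine ⟨?_, fun C hC => ⟨?_, ?_⟩⟩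
    · rintro ⟨C₁, h1, -, -, -, h2, -⟩
      exact hno C₁ h1 h2
    · intro h
      exact hno C hC (mem_carrier.2 (isVerticalPole_iff.1 h).1)
    · intro h
      refine hno C hC (mem_carrier.2 ?_)
      rcases h with h | h
      · have : pt (p 0) t = _ := h
        rw [this]; simp [pw]
      · have : pt (p 0) t = _ := h
        rw [this]; simp [pw]

end

/-! ## Isomorphisms from the realization of a V-digraph -/

namespace VDigraph

variable (G : VDigraph)

/-- The union of the open edges in a set of edges. -/
def openEdges (M : Set G.E) : Set G.Complex :=
  {x | ∃ e ∈ M, ∃ t : unitInterval, (t : ℝ) ∈ Ioo (0 : ℝ) 1 ∧ Quot.mk G.Glue (Sum.inr (e, t)) = x}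

/-- The gluing only touches the parameters `0` and `1`, so the class of an interior point of an edge
is a singleton. This gives the openness of the open edges. -/
lemma glue_interior {G : VDigraph} {e : G.E} {t : unitInterval} (ht : (t : ℝ) ∈ Ioo (0 : ℝ) 1)
    {x y : G.V ⊕ (G.E × unitInterval)} (h : Relation.EqvGen G.Glue x y) :
    x = Sum.inr (e, t) ↔ y = Sum.inr (e, t) := by
  induction h with
  | rel x y h =>
    have h0 : t ≠ 0 := by rintro rfl; simp at ht
    have h1 : t ≠ 1 := by rintro rfl; simp at ht
    cases h with
    | src e' =>
      refine ⟨fun h => ?_, fun h => by simp at h⟩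
      simp only [Sum.inr.injEq, Prod.mk.injEq] at h
      exact (h0 h.2.symm).elim
    | tgt e' =>
      refine ⟨fun h => ?_, fun h => by simp at h⟩
      simp only [Sum.inr.injEq, Prod.mk.injEq] at h
      exact (h1 h.2.symm).elim
  | refl x => exact Iff.rfl
  | symm x y _ ih => exact ih.symm
  | trans x y z _ _ ih ih' => exact ih.trans ih'

lemma isOpen_openEdges (M : Set G.E) : IsOpen (G.openEdges M) := by
  let _ : TopologicalSpace G.V := ⊥
  let _ : TopologicalSpace G.E := ⊥
  have : DiscreteTopology G.E := ⟨rfl⟩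
  have hq : IsQuotientMap (Quot.mk G.Glue : G.V ⊕ (G.E × unitInterval) → G.Complex) :=
    isQuotientMap_quot_mk
  refine hq.isOpen_preimage.1 ?_
  have : (Quot.mk G.Glue : G.V ⊕ (G.E × unitInterval) → G.Complex) ⁻¹' G.openEdges M =
      Sum.inr '' (M ×ˢ ((fun t : unitInterval => (t : ℝ)) ⁻¹' Ioo 0 1)) := by
    ext z
    constructor
    · rintro ⟨e, he, t, ht, h⟩
      have h1 := Quot.eqvGen_exact h
      have h2 := (glue_interior ht h1).1 rfl
      exact ⟨(e, t), ⟨he, ht⟩, h2.symm⟩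
    · rintro ⟨⟨e, t⟩, ⟨he, ht⟩, rfl⟩
      exact ⟨e, he, t, ht, rfl⟩
  rw [this]
  exact isOpenMap_inr _ ((isOpen_discrete M).prod (isOpen_Ioo.preimage continuous_subtype_val))

lemma complex_cases (x : G.Complex) : (∃ v, x = Quot.mk G.Glue (Sum.inl v)) ∨
    ∃ (e : G.E) (t : unitInterval), (t : ℝ) ∈ Ioo (0 : ℝ) 1 ∧
      x = Quot.mk G.Glue (Sum.inr (e, t)) := by
  induction x using Quot.ind with
  | mk z =>
    rcases z with v | ⟨e, t⟩
    · exact Or.inl ⟨v, rfl⟩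
    rcases eq_or_lt_of_le t.2.1 with h0 | h0
    · left
      have : t = 0 := Subtype.ext h0.symm
      subst this
      exact ⟨_, Quot.sound (Glue.src e)⟩
    rcases eq_or_lt_of_le t.2.2 with h1 | h1
    · left
      have : t = 1 := Subtype.ext h1
      subst this
      exact ⟨_, Quot.sound (Glue.tgt e)⟩
    · exact Or.inr ⟨e, t, ⟨h0, h1⟩, rfl⟩

/-- A finite V-digraph is isomorphic to a space in which its vertices and edges are given by points
and curves. -/
theorem nonempty_iso [Finite G.V] [Finite G.E] (B : VSpace) [T2Space B.X] (φ : G.V → B.X)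
    (hφ : Function.Injective φ) (hrange : range φ = B.vert) (γ : G.E → ℝ → B.X)
    (hγ : ∀ e, Continuous (γ e)) (h0 : ∀ e, γ e 0 = φ (G.src e)) (h1 : ∀ e, γ e 1 = φ (G.tgt e))
    (hnv : ∀ e, ∀ t ∈ Ioo (0 : ℝ) 1, γ e t ∉ B.vert)
    (hinj : ∀ e e', ∀ t ∈ Ioo (0 : ℝ) 1, ∀ t' ∈ Ioo (0 : ℝ) 1, γ e t = γ e' t' → e = e' ∧ t = t')
    (hcov : ∀ w ∉ B.vert, ∃ e, ∃ t ∈ Ioo (0 : ℝ) 1, γ e t = w)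
    (hheight : ∀ e, ∀ t ∈ Ioo (0 : ℝ) 1, B.height (γ e t) =
      (1 - t) * B.height (φ (G.src e)) + t * B.height (φ (G.tgt e)))
    (hG : G.Compatible) (hB : ∀ e, B.height (φ (G.src e)) < B.height (φ (G.tgt e)))
    (horder : ∀ u v, G.label u ≤ G.label v ↔ B.height (φ u) ≤ B.height (φ v)) :
    Nonempty (VSpace.Iso G.realize B) := by
  let _ : TopologicalSpace G.V := ⊥
  let _ : TopologicalSpace G.E := ⊥
  have : DiscreteTopology G.V := ⟨rfl⟩
  have : DiscreteTopology G.E := ⟨rfl⟩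
  let F₀ : G.V ⊕ (G.E × unitInterval) → B.X := Sum.elim φ fun z => γ z.1 z.2
  have hF₀ : ∀ x y, G.Glue x y → F₀ x = F₀ y := by
    intro x y h
    cases h with
    | src e => simpa [F₀] using h0 e
    | tgt e => simpa [F₀] using h1 e
  let F : G.Complex → B.X := Quot.lift F₀ hF₀
  have hF₀c : Continuous F₀ := by
    refine continuous_sumElim.2 ⟨continuous_of_discreteTopology, ?_⟩
    rw [continuous_prod_of_discrete_left]
    exact fun e => (hγ e).comp continuous_subtype_val
  have hFc : Continuous F := continuous_quot_lift hF₀ hF₀c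
  have : CompactSpace G.Complex := inferInstanceAs (CompactSpace (Quot G.Glue))
  have hFl : ∀ v, F (Quot.mk G.Glue (Sum.inl v)) = φ v := fun v => rfl
  have hFr : ∀ e t, F (Quot.mk G.Glue (Sum.inr (e, t))) = γ e t := fun e t => rfl
  have hφv : ∀ v, φ v ∈ B.vert := fun v => hrange ▸ mem_range_self v
  have hFinj : Function.Injective F := by
    intro x y hxy
    rcases G.complex_cases x with ⟨u, rfl⟩ | ⟨e, t, ht, rfl⟩ <;>
    rcases G.complex_cases y with ⟨v, rfl⟩ | ⟨e', t', ht', rfl⟩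
    · rw [hFl, hFl] at hxy; rw [hφ hxy]
    · rw [hFl, hFr] at hxy; exact (hnv e' _ ht' (hxy ▸ hφv u)).elim
    · rw [hFl, hFr] at hxy; exact (hnv e _ ht (hxy ▸ hφv v)).elim
    · rw [hFr, hFr] at hxy
      obtain ⟨rfl, h⟩ := hinj e e' _ ht _ ht' hxy
      rw [Subtype.ext h]
  have hFsurj : Function.Surjective F := by
    intro w
    by_cases hw : w ∈ B.vert
    · obtain ⟨v, rfl⟩ := hrange ▸ hw
      exact ⟨(Quot.mk G.Glue (Sum.inl v) : G.Complex), rfl⟩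
    · obtain ⟨e, t, ht, rfl⟩ := hcov w hw
      exact ⟨Quot.mk G.Glue (Sum.inr (e, ⟨t, Ioo_subset_Icc_self ht⟩)), rfl⟩
  -- Finitely many vertices and edges make the complex compact, and the target is Hausdorff, so the
  -- continuous bijection is a homeomorphism.
  let Φ : G.Complex ≃ₜ B.X :=
    Continuous.homeoOfEquivCompactToT2 (f := Equiv.ofBijective F ⟨hFinj, hFsurj⟩) hFc
  refine ⟨⟨Φ, ?_, ?_, ?_⟩⟩
  · rw [← hrange]
    ext w
    constructor
    · rintro ⟨_, ⟨v, rfl⟩, rfl⟩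
      exact ⟨v, rfl⟩
    · rintro ⟨v, rfl⟩
      exact ⟨_, ⟨v, rfl⟩, rfl⟩
  · intro x hx
    rcases G.complex_cases x with ⟨v, rfl⟩ | ⟨e, t, ht, rfl⟩
    · exact (hx ⟨v, rfl⟩).elim
    -- One open edge and the union of the others are disjoint open sets that cover the complement of
    -- the vertices. Only this inclusion of the component is needed.
    have hcomp : connectedComponentIn (G.realize.vert)ᶜ
        (Quot.mk G.Glue (Sum.inr (e, t)) : G.Complex) ⊆ G.openEdges {e} := by
      refine isPreconnected_connectedComponentIn.subset_left_of_subset_union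
        (G.isOpen_openEdges {e}) (G.isOpen_openEdges {e}ᶜ) ?_ ?_
        ⟨_, mem_connectedComponentIn hx, e, rfl, t, ht, rfl⟩
      · refine Set.disjoint_left.2 ?_
        rintro _ ⟨e', he', t', ht', rfl⟩ ⟨e'', he'', t'', ht'', h⟩
        have := congrArg F h
        rw [hFr, hFr] at this
        obtain ⟨rfl, -⟩ := hinj _ _ _ ht'' _ ht' this
        exact he'' he'
      · intro y hy
        rcases G.complex_cases y with ⟨v, rfl⟩ | ⟨e', t', ht', rfl⟩
        · exact (connectedComponentIn_subset _ _ hy ⟨v, rfl⟩).elim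
        · by_cases h : e' = e
          · exact Or.inl ⟨e', h, t', ht', rfl⟩
          · exact Or.inr ⟨e', h, t', ht', rfl⟩
    set ls := G.label (G.src e)
    set lt := G.label (G.tgt e)
    set hs := B.height (φ (G.src e))
    set ht' := B.height (φ (G.tgt e))
    have hl : 0 < lt - ls := sub_pos.2 (hG e)
    have hh : 0 < ht' - hs := sub_pos.2 (hB e)
    -- Both heights are affine in the parameter of the edge, so they are related by the affine map
    -- that takes the labels of the ends to the heights of the ends; `hG` and `hB` make its slope
    -- positive.
    refine ⟨fun a => hs + (ht' - hs) / (lt - ls) * (a - ls), by fun_prop, fun a => ?_, fun y hy => ?_⟩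
    · have : HasDerivAt (fun a => hs + (ht' - hs) / (lt - ls) * (a - ls))
          ((ht' - hs) / (lt - ls) * 1) a :=
        (((hasDerivAt_id a).sub_const ls).const_mul _).const_add _
      rw [this.deriv, mul_one]
      exact div_pos hh hl
    · obtain ⟨e', he', t', ht'', rfl⟩ := hcomp hy
      obtain rfl : e' = e := he'
      have hA : G.realize.height (Quot.mk G.Glue (Sum.inr (e', t')) : G.Complex) =
        (1 - (t' : ℝ)) * ls + (t' : ℝ) * lt := rfl
      have hB' : B.height (Φ (Quot.mk G.Glue (Sum.inr (e', t')) : G.Complex)) =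
        (1 - (t' : ℝ)) * hs + (t' : ℝ) * ht' := hheight e' t' ht''
      rw [hA]
      refine hB'.trans ?_
      field_simp
      ring
  · rintro _ ⟨u, rfl⟩ _ ⟨v, rfl⟩
    exact horder u v

end VDigraph

/-- A finite V-digraph is isomorphic to the Poincaré-Reeb V-digraph of an arrangement if its
vertices are represented by points and its edges by graphs of functions. -/
theorem nonempty_iso_reebGraph {S : Set PlaneCircle} {D : Set Plane} (G : VDigraph)
    [Finite G.V] [Finite G.E] (v : G.V → Plane) (y : G.E → ℝ → ℝ)
    (hv : ∀ u, v u ∈ closure D)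
    (hlt : ∀ e, v (G.src e) 0 < v (G.tgt e) 0)
    (hy : ∀ e, ContinuousOn (y e) (Icc (v (G.src e) 0) (v (G.tgt e) 0)))
    (hK : ∀ e, ∀ x ∈ Icc (v (G.src e) 0) (v (G.tgt e) 0), pt x (y e x) ∈ closure D)
    (hsrc : ∀ e, Vis (closure D) (v (G.src e)) (pt (v (G.src e) 0) (y e (v (G.src e) 0))))
    (htgt : ∀ e, Vis (closure D) (v (G.tgt e)) (pt (v (G.tgt e) 0) (y e (v (G.tgt e) 0))))
    (hinjv : ∀ u u', Vis (closure D) (v u) (v u') → u = u')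
    (hvert : ∀ z : closure D, reebMk D z ∈ reebVert S D ↔ ∃ u, Vis (closure D) (v u) z)
    (hno : ∀ e, ∀ x ∈ Ioo (v (G.src e) 0) (v (G.tgt e) 0), ∀ u,
      ¬ Vis (closure D) (v u) (pt x (y e x)))
    (hinj : ∀ e e', ∀ x ∈ Ioo (v (G.src e) 0) (v (G.tgt e) 0),
      x ∈ Ioo (v (G.src e') 0) (v (G.tgt e') 0) →
      Vis (closure D) (pt x (y e x)) (pt x (y e' x)) → e = e')
    (hcov : ∀ z ∈ closure D, (∀ u, ¬ Vis (closure D) (v u) z) →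
      ∃ e, z 0 ∈ Ioo (v (G.src e) 0) (v (G.tgt e) 0) ∧ Vis (closure D) (pt (z 0) (y e (z 0))) z)
    (hG : G.Compatible) (horder : ∀ u u', G.label u ≤ G.label u' ↔ v u 0 ≤ v u' 0) :
    Nonempty (VSpace.Iso G.realize (reebGraph S D)) := by
  let φ : G.V → ReebSpace D := fun u => reebMk D ⟨v u, hv u⟩
  -- The affine change of parameter makes the height along the curve the interpolation required by
  -- `nonempty_iso`.
  let l : G.E → ℝ → ℝ := fun e t => (1 - t) * v (G.src e) 0 + t * v (G.tgt e) 0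
  let γ : G.E → ℝ → ReebSpace D := fun e t => reebCurve (hlt e).le (hK e) (l e t)
  have hlI : ∀ e, ∀ t ∈ Icc (0 : ℝ) 1, l e t ∈ Icc (v (G.src e) 0) (v (G.tgt e) 0) := by
    intro e t ht
    have := hlt e
    constructor <;> simp only [l] <;> nlinarith [ht.1, ht.2]
  have hlO : ∀ e, ∀ t ∈ Ioo (0 : ℝ) 1, l e t ∈ Ioo (v (G.src e) 0) (v (G.tgt e) 0) := by
    intro e t ht
    have := hlt e
    constructor <;> simp only [l] <;> nlinarith [ht.1, ht.2]
  have hγ : ∀ e, ∀ t (ht : t ∈ Icc (0 : ℝ) 1), γ e t =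
      reebMk D ⟨pt (l e t) (y e (l e t)), hK e _ (hlI e t ht)⟩ := fun e t ht =>
    reebCurve_of_mem _ _ (hlI e t ht)
  have hφV : ∀ w ∈ reebVert S D, ∃ u, φ u = w := by
    intro w hw
    obtain ⟨z, rfl⟩ := reebMk_surjective D w
    obtain ⟨u, hu⟩ := (hvert z).1 hw
    exact ⟨u, reebMk_eq_iff.2 hu⟩
  have hVφ : ∀ u, φ u ∈ reebVert S D := fun u => (hvert _).2 ⟨u, Vis.refl (hv u)⟩
  have : T2Space (reebGraph S D).X := instT2SpaceReeb D
  refine G.nonempty_iso (reebGraph S D) φ (fun u u' h => hinjv u u' (reebMk_eq_iff.1 h))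
    (Subset.antisymm ?_ hφV) γ (fun e => ?_) (fun e => ?_) (fun e => ?_) (fun e t ht hw => ?_)
    (fun e e' t ht t' ht' h => ?_) (fun w hw => ?_) (fun e t ht => ?_) hG hlt horder
  · rintro _ ⟨u, rfl⟩; exact hVφ u
  · exact (continuous_reebCurve _ _ (hy e)).comp (by fun_prop)
  · rw [hγ e 0 ⟨le_rfl, zero_le_one⟩]
    refine (reebMk_eq_iff.2 ?_).symm
    simpa [l] using hsrc e
  · rw [hγ e 1 ⟨zero_le_one, le_rfl⟩]
    refine (reebMk_eq_iff.2 ?_).symm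
    simpa [l] using htgt e
  · obtain ⟨u, hu⟩ := hφV _ hw
    rw [hγ e t (Ioo_subset_Icc_self ht)] at hu
    exact hno e _ (hlO e t ht) u (reebMk_eq_iff.1 hu)
  · rw [hγ e t (Ioo_subset_Icc_self ht), hγ e' t' (Ioo_subset_Icc_self ht')] at h
    have h1 := reebMk_eq_iff.1 h
    have h2 : l e t = l e' t' := by simpa using h1.1
    simp only [← h2] at h1
    have h3 := hlO e' t' ht'
    rw [← h2] at h3
    obtain rfl := hinj e e' _ (hlO e t ht) h3 h1
    refine ⟨rfl, ?_⟩
    have h4 : (t - t') * (v (G.tgt e) 0 - v (G.src e) 0) = 0 := by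
      simp only [l] at h2; linarith
    rcases mul_eq_zero.1 h4 with h5 | h5
    · linarith
    · have := hlt e; linarith
  · obtain ⟨z, rfl⟩ := reebMk_surjective D w
    obtain ⟨e, he, hz⟩ := hcov z z.2 fun u hu => hw ((hvert z).2 ⟨u, hu⟩)
    have hpos := sub_pos.2 (hlt e)
    set t := ((z : Plane) 0 - v (G.src e) 0) / (v (G.tgt e) 0 - v (G.src e) 0) with ht
    have htI : t ∈ Ioo (0 : ℝ) 1 :=
      ⟨div_pos (by linarith [he.1]) hpos, (div_lt_one hpos).2 (by linarith [he.2])⟩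
    have hlt' : l e t = (z : Plane) 0 := by
      simp only [l, ht]; field_simp; ring
    refine ⟨e, t, htI, ?_⟩
    rw [hγ e t (Ioo_subset_Icc_self htI)]
    refine reebMk_eq_iff.2 ?_
    simpa [hlt'] using hz
  · rw [hγ e t (Ioo_subset_Icc_self ht)]
    change pt (l e t) (y e (l e t)) 0 = (1 - t) * v (G.src e) 0 + t * v (G.tgt e) 0
    simp [l]

/-! ## Removing a small disk at a vertical pole -/

/-- In the disk of radius `ρ` around the right vertical pole `p` of the circle `C` there is no other
circle, and the region is the outside of `C`. -/
structure LocalPole (S : Set PlaneCircle) (D : Set Plane) (p : Plane) (C : PlaneCircle)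
    (ρ : ℝ) : Prop where
  memS : C ∈ S
  center0 : C.center 0 + C.radius = p 0
  center1 : C.center 1 = p 1
  pos : 0 < ρ
  le : ρ ≤ C.radius
  out : ∀ z ∈ D, 0 < pw C z
  mem : ∀ z ∈ Metric.ball p ρ, 0 < pw C z → z ∈ D
  only : ∀ C' ∈ S, ∀ z ∈ Metric.ball p ρ, z ∈ C'.carrier → C' = C

lemma exists_localPole {S : Set PlaneCircle} {D : Set Plane} (hM : IsMBC S D) {p : Plane}
    (hp : IsTypeIPole S D p) {lo hi : ℝ} (hlo : lo < p 1) (hhi : p 1 < hi)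
    (hf : IsFiber (closure D) (p 0) lo hi) : ∃ C ρ, LocalPole S D p C ρ := by
  have hlt := hlo.trans hhi
  have hpI : p 1 ∈ Icc lo hi := ⟨hlo.le, hhi.le⟩
  have hp' : IsTypeIPole S D (pt (p 0) (p 1)) := by rw [pt_eta]; exact hp
  obtain ⟨-, C, hC, hCp⟩ := (hf.isTypeIPole_iff hM hlt hpI).1.1 hp'
  have hpole := SidePole.pole (Or.inl rfl) hCp
  have hout := hM.outside_of_pole hC hpole hlo.ne (hf.mem lo ⟨le_rfl, hlt.le⟩)
  rw [pt_eta] at hpole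
  have huniq := hM.eq_of_pole hp.1 hC hpole
  have hev := hM.eventually_mem hp.1 (mem_carrier.2 (isVerticalPole_iff.1 hpole).1) huniq
    (κ := 1) (Or.inl rfl) (by simpa using hout)
  obtain ⟨ε, hε, hb⟩ := Metric.eventually_nhds_iff_ball.1 (hev.and (hM.eventually_notMem p))
  -- The bound by the radius keeps the ball to the right of the centre of `C`, so over the part of
  -- it to the left of `p` both halves of `C` are defined.
  refine ⟨C, min ε C.radius, hC, by linarith [hCp.1], hCp.2, lt_min hε C.radius_pos,
    min_le_right _ _, hout, fun z hz hpz => ?_, fun C' hC' z hz hzC => ?_⟩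
  · exact (hb z (Metric.ball_subset_ball (min_le_left _ _) hz)).1 (by linarith)
  · by_contra hne
    exact (hb z (Metric.ball_subset_ball (min_le_left _ _) hz)).2 C' hC'
      (fun h => hne (huniq C' hC' h)) hzC

namespace LocalPole

variable {S : Set PlaneCircle} {D : Set Plane} {p : Plane} {C : PlaneCircle} {ρ r : ℝ}

/-- With origin `p` the power is the squared distance from `p` plus a linear term. It is positive to
the right of `p`, and its behaviour under scaling from `p` can be read off. -/
lemma pw_eq (h : LocalPole S D p C ρ) (z : Plane) :
    pw C z = (z 0 - p 0) ^ 2 + (z 1 - p 1) ^ 2 + 2 * C.radius * (z 0 - p 0) := by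
  unfold pw
  rw [h.center1, ← h.center0]; ring

lemma pw_nonneg (h : LocalPole S D p C ρ) {z : Plane} (hz : z ∈ closure D) : 0 ≤ pw C z :=
  closure_minimal (fun w hw => (h.out w hw).le) (isClosed_le continuous_const (continuous_pw C)) hz

/-- Points of `C` itself are limits of dilated points, with centre of dilation the centre of `C`,
and these are outside of `C`. -/
lemma mem_closure (h : LocalPole S D p C ρ) {z : Plane} (hz : z ∈ Metric.ball p ρ)
    (hpz : 0 ≤ pw C z) : z ∈ closure D := by
  rcases eq_or_lt_of_le hpz with h0 | h0
  swap
  · exact subset_closure (h.mem z hz h0)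
  have hc : Continuous fun t : ℝ => C.center + (1 + t) • (z - C.center) := by fun_prop
  have ht : Tendsto (fun t : ℝ => C.center + (1 + t) • (z - C.center)) (𝓝[>] 0) (𝓝 z) := by
    have := hc.tendsto 0
    simp only [add_zero, one_smul, add_sub_cancel] at this
    exact this.mono_left nhdsWithin_le_nhds
  refine mem_closure_of_tendsto ht ?_
  filter_upwards [ht.eventually (Metric.isOpen_ball.mem_nhds hz), self_mem_nhdsWithin] with t ht1 ht2
  have ht2 : (0 : ℝ) < t := ht2
  refine h.mem _ ht1 ?_
  have hR := C.radius_pos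
  unfold pw at h0 ⊢
  simp only [PiLp.add_apply, PiLp.smul_apply, PiLp.sub_apply, smul_eq_mul, add_sub_cancel_left]
  have h1 : (z 0 - C.center 0) ^ 2 + (z 1 - C.center 1) ^ 2 = C.radius ^ 2 := by linarith
  have h2 : ((1 + t) * (z 0 - C.center 0)) ^ 2 + ((1 + t) * (z 1 - C.center 1)) ^ 2 - C.radius ^ 2
      = ((1 + t) ^ 2 - 1) * C.radius ^ 2 := by
    linear_combination (1 + t) ^ 2 * h1
  rw [h2]
  have : 0 < (1 + t) ^ 2 - 1 := by nlinarith
  positivity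

/-- Pushing points away from `p`. -/
lemma push_mem (h : LocalPole S D p C ρ) {z : Plane} (hz : z ∈ closure D) (hzp : z ≠ p) {s : ℝ}
    (hs : 1 < s) (hsd : s * dist z p < ρ) : p + s • (z - p) ∈ D := by
  refine h.mem _ ?_ ?_
  · rw [Metric.mem_ball, dist_eq_norm, add_sub_cancel_left, norm_smul, ← dist_eq_norm,
      Real.norm_of_nonneg (by linarith)]
    exact hsd
  · have h1 := h.pw_nonneg hz
    rw [h.pw_eq] at h1 ⊢
    simp only [PiLp.add_apply, PiLp.smul_apply, PiLp.sub_apply, smul_eq_mul, add_sub_cancel_left]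
    have h2 : 0 < (z 0 - p 0) ^ 2 + (z 1 - p 1) ^ 2 := by
      rw [← dist_sq_plane]
      have := dist_pos.2 hzp
      positivity
    -- Scaling by `s` from `p` multiplies the power by `s` after adding `s - 1` times the squared
    -- distance from `p`, which makes a nonnegative power positive.
    have h3 : (s * (z 0 - p 0)) ^ 2 + (s * (z 1 - p 1)) ^ 2 + 2 * C.radius * (s * (z 0 - p 0)) =
        s * ((s - 1) * ((z 0 - p 0) ^ 2 + (z 1 - p 1) ^ 2) +
        ((z 0 - p 0) ^ 2 + (z 1 - p 1) ^ 2 + 2 * C.radius * (z 0 - p 0))) := by ring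
    rw [h3]
    have h4 : 0 < (s - 1) * ((z 0 - p 0) ^ 2 + (z 1 - p 1) ^ 2) := mul_pos (by linarith) h2
    exact mul_pos (by linarith) (by linarith)

/-- Points of the closure on the small circle are limits of the points obtained by pushing them away
from `p`; farther points have a neighbourhood disjoint from the disk. -/
lemma closure_sdiff (h : LocalPole S D p C ρ) (hr : 0 < r) (hrρ : r < ρ) :
    closure (D \ Metric.closedBall p r) = closure D \ Metric.ball p r := by
  apply Subset.antisymm
  · refine closure_minimal ?_ (isClosed_closure.sdiff Metric.isOpen_ball)
    exact fun z hz => ⟨subset_closure hz.1, fun hb => hz.2 (Metric.ball_subset_closedBall hb)⟩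
  · rintro z ⟨hz, hzb⟩
    rw [Metric.mem_ball, not_lt] at hzb
    rcases eq_or_lt_of_le hzb with heq | hlt
    · have hzp : z ≠ p := by rintro rfl; simp at heq; linarith
      have hc : Continuous fun t : ℝ => p + (1 + t) • (z - p) := by fun_prop
      have ht : Tendsto (fun t : ℝ => p + (1 + t) • (z - p)) (𝓝[>] 0) (𝓝 z) := by
        have := hc.tendsto 0
        simp only [add_zero, one_smul, add_sub_cancel] at this
        exact this.mono_left nhdsWithin_le_nhds
      refine mem_closure_of_tendsto ht ?_
      have hev : ∀ᶠ t in 𝓝[>] (0 : ℝ), (1 + t) * dist z p < ρ := by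
        have : Continuous fun t : ℝ => (1 + t) * dist z p := by fun_prop
        have h2 := this.tendsto 0
        simp only [add_zero, one_mul] at h2
        exact (h2.mono_left nhdsWithin_le_nhds).eventually (gt_mem_nhds (by rw [← heq]; exact hrρ))
      filter_upwards [hev, self_mem_nhdsWithin] with t ht1 ht2
      have ht2 : (0 : ℝ) < t := ht2
      refine ⟨h.push_mem hz hzp (by linarith) ht1, ?_⟩
      rw [Metric.mem_closedBall, dist_eq_norm, add_sub_cancel_left, norm_smul, ← dist_eq_norm,
        Real.norm_of_nonneg (by linarith), not_le, ← heq]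
      nlinarith
    · rw [mem_closure_iff_nhds] at hz ⊢
      intro U hU
      obtain ⟨w, ⟨hw1, hw2⟩, hw3⟩ := hz _ (Filter.inter_mem hU
        (Metric.isClosed_closedBall.isOpen_compl.mem_nhds (x := z) (by simpa using hlt)))
      exact ⟨w, hw1, hw3, hw2⟩

lemma notMem (h : LocalPole S D p C ρ) : p ∉ D := by
  intro hp
  have := h.out p hp
  rw [h.pw_eq] at this
  simp at this

/-- The radial map `f` pushes `D` out of the disk without leaving `D`, so its image is connected;
each point of the difference is joined to its image by a radial segment in the difference. -/
lemma isPreconnected_sdiff (hM : IsMBC S D) (h : LocalPole S D p C ρ) (hr : 0 < r) (hrρ : r < ρ) :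
    IsPreconnected (D \ Metric.closedBall p r) ∧ (D \ Metric.closedBall p r).Nonempty := by
  have hρ := h.pos
  -- The map `d ↦ r + d * (1 - r / ρ)` takes the distances between `0` and `ρ` onto those between
  -- `r` and `ρ`; from `ρ` on the factor is `1`. The point `p` itself is not in `D`, so the division
  -- is harmless.
  let c : Plane → ℝ := fun z => max 1 ((r + dist z p * (1 - r / ρ)) / dist z p)
  let f : Plane → Plane := fun z => p + c z • (z - p)
  have hne : ∀ z ∈ D, z ≠ p := fun z hz hzp => h.notMem (hzp ▸ hz)
  have hdpos : ∀ z ∈ D, 0 < dist z p := fun z hz => dist_pos.2 (hne z hz)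
  have hcc : ContinuousOn c D := by
    refine continuousOn_const.sup (ContinuousOn.div (by fun_prop) (by fun_prop) fun z hz => ?_)
    exact (hdpos z hz).ne'
  have hfc : ContinuousOn f D :=
    continuousOn_const.add (hcc.smul (continuousOn_id.sub continuousOn_const))
  have hc1 : ∀ z, 1 ≤ c z := fun z => le_max_left _ _
  have hrp : 0 < 1 - r / ρ := by
    rw [sub_pos, div_lt_one hρ]; exact hrρ
  have hdist : ∀ z (s : ℝ), 0 ≤ s → dist (p + s • (z - p)) p = s * dist z p := by
    intro z s hs
    rw [dist_eq_norm, add_sub_cancel_left, norm_smul, ← dist_eq_norm, Real.norm_of_nonneg hs]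
  have hcd : ∀ z ∈ D, r < c z * dist z p := by
    intro z hz
    have hd := hdpos z hz
    have h1 : (r + dist z p * (1 - r / ρ)) / dist z p * dist z p ≤ c z * dist z p :=
      mul_le_mul_of_nonneg_right (le_max_right _ _) hd.le
    rw [div_mul_cancel₀ _ hd.ne'] at h1
    have := mul_pos hd hrp
    linarith
  have hmemD : ∀ z ∈ D, ∀ s ∈ Icc 1 (c z), p + s • (z - p) ∈ D := by
    intro z hz s hs
    rcases eq_or_lt_of_le hs.1 with h1 | h1
    · rw [← h1, one_smul, add_sub_cancel]; exact hz
    have hd := hdpos z hz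
    refine h.push_mem (subset_closure hz) (hne z hz) h1 ?_
    have h2 : 1 < c z := h1.trans_le hs.2
    have h3 : c z = (r + dist z p * (1 - r / ρ)) / dist z p := by
      rcases max_choice (1 : ℝ) ((r + dist z p * (1 - r / ρ)) / dist z p) with h3 | h3
      · exfalso
        have : c z = 1 := h3
        linarith
      · exact h3
    have h4 : c z * dist z p = r + dist z p * (1 - r / ρ) := by
      rw [h3, div_mul_cancel₀ _ hd.ne']
    have h5 : dist z p < ρ := by
      have h6 : dist z p < r + dist z p * (1 - r / ρ) := by
        rw [← h4]; nlinarith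
      have h7 : dist z p * (r / ρ) < r := by linarith
      rw [mul_div_assoc', div_lt_iff₀ hρ] at h7
      nlinarith
    calc s * dist z p ≤ c z * dist z p := mul_le_mul_of_nonneg_right hs.2 hd.le
      _ = r + dist z p * (1 - r / ρ) := h4
      _ < r + ρ * (1 - r / ρ) := by have := mul_lt_mul_of_pos_right h5 hrp; linarith
      _ = ρ := by field_simp; ring
  have hfD : ∀ z ∈ D, f z ∈ D \ Metric.closedBall p r := by
    intro z hz
    refine ⟨hmemD z hz _ ⟨hc1 z, le_rfl⟩, ?_⟩
    rw [Metric.mem_closedBall, not_le, hdist z _ (by linarith [hc1 z])]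
    exact hcd z hz
  obtain ⟨z₀, hz₀⟩ := hM.nonempty
  refine ⟨isPreconnected_of_forall (f z₀) fun y hy => ?_, ⟨_, hfD z₀ hz₀⟩⟩
  have hyr : r < dist y p := by simpa using hy.2
  have hcs : Continuous fun s : ℝ => p + s • (y - p) := by fun_prop
  refine ⟨f '' D ∪ (fun s : ℝ => p + s • (y - p)) '' Icc 1 (c y), ?_, Or.inl ⟨z₀, hz₀, rfl⟩,
    Or.inr ⟨1, ⟨le_rfl, hc1 y⟩, by simp⟩, ?_⟩
  · rintro _ (⟨z, hz, rfl⟩ | ⟨s, hs, rfl⟩)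
    · exact hfD z hz
    · refine ⟨hmemD y hy.1 s hs, ?_⟩
      rw [Metric.mem_closedBall, not_le, hdist y s (by linarith [hs.1])]
      nlinarith [hs.1]
  · exact (hM.isPreconnected.image f hfc).union (f y) ⟨y, hy.1, rfl⟩
      ⟨c y, ⟨hc1 y, le_rfl⟩, rfl⟩ (isPreconnected_Icc.image _ hcs.continuousOn)

/-- The intersection points of `C` with the small circle. -/
lemma of_mem_sphere (h : LocalPole S D p C ρ) (hr : 0 < r) (hrρ : r < ρ) {q : Plane}
    (hq : q ∈ (⟨p, r, hr⟩ : PlaneCircle).carrier) {C₁ : PlaneCircle} (hC₁ : C₁ ∈ S)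
    (hq₁ : q ∈ C₁.carrier) : C₁ = C ∧ q 0 = p 0 - r ^ 2 / (2 * C.radius) ∧
      (q 1 - p 1) ^ 2 = r ^ 2 - (r ^ 2 / (2 * C.radius)) ^ 2 := by
  have hR := C.radius_pos
  have hb : q ∈ Metric.ball p ρ := by
    have : dist q p = r := hq
    rw [Metric.mem_ball, this]; exact hrρ
  obtain rfl := h.only C₁ hC₁ q hb hq₁
  have h1 := mem_carrier.1 hq₁
  rw [h.pw_eq] at h1
  have h2 := mem_carrier.1 hq
  simp only [pw] at h2
  -- Subtracting the two equations leaves the radical axis, a vertical line since both centres are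
  -- at the same height.
  have h3 : 2 * C₁.radius * (q 0 - p 0) = - r ^ 2 := by linarith
  have h4 : q 0 - p 0 = - (r ^ 2 / (2 * C₁.radius)) := by
    field_simp; linarith
  refine ⟨rfl, by linarith, ?_⟩
  rw [h4] at h2
  linarith

lemma chord_pos (h : LocalPole S D p C ρ) (hr : 0 < r) (hrρ : r < ρ) :
    0 < r ^ 2 - (r ^ 2 / (2 * C.radius)) ^ 2 := by
  have hR := C.radius_pos
  have h1 : r ^ 2 / (2 * C.radius) < r := by
    rw [div_lt_iff₀ (by positivity)]
    nlinarith [h.le]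
  have h2 : 0 < r ^ 2 / (2 * C.radius) := by positivity
  nlinarith

/-- The points of the two circles. -/
lemma inter_mem (h : LocalPole S D p C ρ) (hr : 0 < r) (hrρ : r < ρ) {y : ℝ}
    (hy : (y - p 1) ^ 2 = r ^ 2 - (r ^ 2 / (2 * C.radius)) ^ 2) :
    pt (p 0 - r ^ 2 / (2 * C.radius)) y ∈ (⟨p, r, hr⟩ : PlaneCircle).carrier ∧
    pt (p 0 - r ^ 2 / (2 * C.radius)) y ∈ C.carrier ∧
    pt (p 0 - r ^ 2 / (2 * C.radius)) y ∈ closure (D \ Metric.closedBall p r) := by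
  have hR := C.radius_pos
  have h1 : pt (p 0 - r ^ 2 / (2 * C.radius)) y ∈ (⟨p, r, hr⟩ : PlaneCircle).carrier := by
    rw [mem_carrier]; simp only [pw, pt_zero, pt_one, hy]; ring
  have h2 : pw C (pt (p 0 - r ^ 2 / (2 * C.radius)) y) = 0 := by
    rw [h.pw_eq]; simp only [pt_zero, pt_one, hy]; field_simp; ring
  have hd : dist (pt (p 0 - r ^ 2 / (2 * C.radius)) y) p = r := h1
  refine ⟨h1, mem_carrier.2 h2, ?_⟩
  rw [h.closure_sdiff hr hrρ]
  refine ⟨h.mem_closure ?_ h2.ge, ?_⟩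
  · rw [Metric.mem_ball, hd]; exact hrρ
  · rw [Metric.mem_ball, hd]; exact lt_irrefl r

lemma horizontalPole_mem {C : PlaneCircle} {q : Plane} (hq : C.IsHorizontalPole q) :
    q ∈ C.carrier ∧ q 0 = C.center 0 := by
  rcases hq with rfl | rfl <;> exact ⟨by rw [mem_carrier]; simp [pw], by simp⟩

lemma verticalPole_mem {C : PlaneCircle} {q : Plane} (hq : C.IsVerticalPole q) :
    q ∈ C.carrier ∧ q 1 = C.center 1 := by
  rcases hq with rfl | rfl <;> exact ⟨by rw [mem_carrier]; simp [pw], by simp⟩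

/-- The two normals at `q` have the same nonzero second coordinate and different first coordinates,
so the normal lines meet only in `0`. -/
lemma tangent_sup_eq_top {C₁ C₂ : PlaneCircle} {q : Plane} (h1 : C₁.center 1 = C₂.center 1)
    (hq : q 1 ≠ C₁.center 1) (h0 : C₁.center 0 ≠ C₂.center 0) :
    C₁.tangent q ⊔ C₂.tangent q = ⊤ := by
  rw [← Submodule.orthogonal_eq_bot_iff, ← Submodule.inf_orthogonal, PlaneCircle.tangent,
    PlaneCircle.tangent, Submodule.orthogonal_orthogonal, Submodule.orthogonal_orthogonal,
    Submodule.eq_bot_iff]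
  rintro x ⟨hx1, hx2⟩
  obtain ⟨s, rfl⟩ := Submodule.mem_span_singleton.1 hx1
  obtain ⟨t, ht⟩ := Submodule.mem_span_singleton.1 hx2
  have e0 := congrArg (fun z : Plane => z 0) ht
  have e1 := congrArg (fun z : Plane => z 1) ht
  simp only [PiLp.smul_apply, PiLp.sub_apply, smul_eq_mul] at e0 e1
  rw [← h1] at e1
  have hts : t = s := mul_right_cancel₀ (sub_ne_zero.2 hq) e1
  subst hts
  have h2 : t * (C₁.center 0 - C₂.center 0) = 0 := by linarith
  rcases mul_eq_zero.1 h2 with h3 | h3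
  · rw [h3, zero_smul]
  · exact (h0 (sub_eq_zero.1 h3)).elim

/-- Removing the disk gives an arrangement again. -/
theorem isMBC_insert (hM : IsMBC S D) (h : LocalPole S D p C ρ) (hr : 0 < r) (hrρ : r < ρ) :
    IsMBC (insert ⟨p, r, hr⟩ S) (D \ Metric.closedBall p r) := by
  set C' : PlaneCircle := ⟨p, r, hr⟩ with hC'
  have hR := C.radius_pos
  have hcl := h.closure_sdiff hr hrρ
  have hcp := h.chord_pos hr hrρ
  have hmono : closure (D \ Metric.closedBall p r) ⊆ closure D := closure_mono sdiff_subset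
  have hsph : ∀ q : Plane, q ∈ C'.carrier ↔ dist q p = r := fun q => Iff.rfl
  have hball : ∀ q ∈ C'.carrier, q ∈ Metric.ball p ρ := fun q hq => by
    rw [Metric.mem_ball, (hsph q).1 hq]; exact hrρ
  -- The half chord is positive, so the common points are off the horizontal diameter. This gives
  -- transversality and excludes vertical poles.
  have hq1 : ∀ q ∈ C'.carrier, ∀ C₁ ∈ S, q ∈ C₁.carrier → q 1 ≠ p 1 := by
    intro q hq C₁ hC₁ hqC₁ heq
    have := (h.of_mem_sphere hr hrρ hq hC₁ hqC₁).2.2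
    rw [heq, sub_self] at this
    linarith
  obtain ⟨hpre, hne⟩ := h.isPreconnected_sdiff hM hr hrρ
  refine ⟨hM.finite.insert _, ?_, hM.bounded.subset sdiff_subset, ?_, ?_, ?_, ?_⟩
  · obtain ⟨x, hx⟩ := hne
    have hsub : D \ Metric.closedBall p r ⊆ (⋃ C ∈ insert C' S, C.carrier)ᶜ := by
      intro z hz
      simp only [mem_compl_iff, mem_iUnion, not_exists]
      rintro C₁ (rfl | hC₁) hzC
      · exact hz.2 (Metric.sphere_subset_closedBall hzC)
      · exact hM.notMem_carrier hz.1 hC₁ hzC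
    refine ⟨x, hsub hx, Subset.antisymm (hpre.subset_connectedComponentIn hx hsub) ?_⟩
    have hcs := connectedComponentIn_subset (⋃ C ∈ insert C' S, C.carrier)ᶜ x
    have hxm := mem_connectedComponentIn (hsub hx)
    have hav : ∀ z ∈ connectedComponentIn (⋃ C ∈ insert C' S, C.carrier)ᶜ x,
        ∀ C₁ ∈ insert C' S, z ∉ C₁.carrier := by
      intro z hz
      have := hcs hz
      simpa only [mem_compl_iff, mem_iUnion, not_exists] using this
    intro z hz
    refine ⟨hM.subset_of_isPreconnected isPreconnected_connectedComponentIn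
      (fun w hw C₁ hC₁ => hav w hw C₁ (Or.inr hC₁)) ⟨x, hxm, hx.1⟩ hz, fun hzb => ?_⟩
    have hxr : r ≤ dist x p := by
      have := hx.2
      rw [Metric.mem_closedBall, not_le] at this
      exact this.le
    -- A connected set with points inside and outside of the disk meets the new circle.
    obtain ⟨w, hw, hwr⟩ := (isPreconnected_connectedComponentIn.image (fun w => dist w p)
      (by fun_prop : Continuous fun w : Plane => dist w p).continuousOn).Icc_subset
      (mem_image_of_mem _ hz) (mem_image_of_mem _ hxm) ⟨hzb, hxr⟩
    exact hav w hw C' (Or.inl rfl) hwr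
  -- The upper common point shows that the new circle and `C` both meet the new closure. Any other
  -- circle stays out of the ball of radius `ρ`, so its old witness survives.
  · have hy : ((p 1 + √(r ^ 2 - (r ^ 2 / (2 * C.radius)) ^ 2)) - p 1) ^ 2 =
        r ^ 2 - (r ^ 2 / (2 * C.radius)) ^ 2 := by
      rw [add_sub_cancel_left, Real.sq_sqrt hcp.le]
    obtain ⟨h1, h2, h3⟩ := h.inter_mem hr hrρ hy
    rintro C₁ (rfl | hC₁)
    · exact ⟨_, h3, h1⟩
    · by_cases hCC : C₁ = C
      · exact ⟨_, h3, hCC ▸ h2⟩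
      · obtain ⟨z, hz, hzC⟩ := hM.meets C₁ hC₁
        refine ⟨z, ?_, hzC⟩
        rw [hcl]
        exact ⟨hz, fun hb => hCC (h.only C₁ hC₁ z (Metric.ball_subset_ball hrρ.le hb) hzC)⟩
  · have h0 : C'.center 0 ≠ C.center 0 := by
      show p 0 ≠ C.center 0
      rw [← h.center0]; linarith
    have h1 : C'.center 1 = C.center 1 := h.center1.symm
    rintro C₁ (rfl | hC₁) C₂ (rfl | hC₂) hne q ⟨hq, hqa, hqb⟩
    · exact (hne rfl).elim
    · obtain rfl := (h.of_mem_sphere hr hrρ hqa hC₂ hqb).1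
      exact tangent_sup_eq_top h1 (hq1 q hqa _ hC₂ hqb) h0
    · obtain rfl := (h.of_mem_sphere hr hrρ hqb hC₁ hqa).1
      rw [sup_comm]
      exact tangent_sup_eq_top h1 (hq1 q hqb _ hC₁ hqa) h0
    · exact hM.transverse C₁ hC₁ C₂ hC₂ hne q ⟨hmono hq, hqa, hqb⟩
  · rintro C₁ (rfl | hC₁) C₂ (rfl | hC₂) hne q ⟨hq, hqa, hqb⟩ C₃ (rfl | hC₃) hqc
    · exact (hne rfl).elim
    · exact (hne rfl).elim
    · exact Or.inl rfl
    · right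
      rw [(h.of_mem_sphere hr hrρ hqa hC₃ hqc).1, (h.of_mem_sphere hr hrρ hqa hC₂ hqb).1]
    · exact Or.inr rfl
    · left
      rw [(h.of_mem_sphere hr hrρ hqb hC₃ hqc).1, (h.of_mem_sphere hr hrρ hqb hC₁ hqa).1]
    · exact (hne ((h.of_mem_sphere hr hrρ hqc hC₁ hqa).1.trans
        (h.of_mem_sphere hr hrρ hqc hC₂ hqb).1.symm)).elim
    · exact hM.no_triple C₁ hC₁ C₂ hC₂ hne q ⟨hmono hq, hqa, hqb⟩ C₃ hC₃ hqc
  -- The new double points are not at the common height of the two centres, hence no vertical poles,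
  -- and their abscissa is strictly between those of the centres, hence they are no horizontal
  -- poles.
  · have key : ∀ q : Plane, q ∈ C'.carrier → ∀ C₁ ∈ S, q ∈ C₁.carrier → ∀ C₃ ∈ insert C' S,
        ¬ C₃.IsVerticalPole q ∧ ¬ C₃.IsHorizontalPole q := by
      intro q hq C₁ hC₁ hqC₁ C₃ hC₃
      have hne1 := hq1 q hq C₁ hC₁ hqC₁
      have hq0 := (h.of_mem_sphere hr hrρ hq hC₁ hqC₁).2.1
      have hpos : 0 < r ^ 2 / (2 * C.radius) := by positivity
      have hlt : r ^ 2 / (2 * C.radius) < C.radius := by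
        rw [div_lt_iff₀ (by positivity)]
        nlinarith [h.le]
      rcases hC₃ with rfl | hC₃
      · refine ⟨fun hp => hne1 (verticalPole_mem hp).2, fun hp => ?_⟩
        have : q 0 = p 0 := (horizontalPole_mem hp).2
        linarith
      · refine ⟨fun hp => ?_, fun hp => ?_⟩
        · obtain ⟨hm, h2⟩ := verticalPole_mem hp
          rw [(h.of_mem_sphere hr hrρ hq hC₃ hm).1, h.center1] at h2
          exact hne1 h2
        · obtain ⟨hm, h2⟩ := horizontalPole_mem hp
          rw [(h.of_mem_sphere hr hrρ hq hC₃ hm).1] at h2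
          have := h.center0
          linarith
    rintro q hq ⟨C₁, hC₁, C₂, hC₂, hne, hqa, hqb⟩ C₃ hC₃
    rcases hC₁ with rfl | hC₁
    · rcases hC₂ with rfl | hC₂
      · exact (hne rfl).elim
      · exact key q hqa C₂ hC₂ hqb C₃ hC₃
    · rcases hC₂ with rfl | hC₂
      · exact key q hqb C₁ hC₁ hqa C₃ hC₃
      · rcases hC₃ with rfl | hC₃
        · have hnot : q ∉ C'.carrier := fun hm => hne
            ((h.of_mem_sphere hr hrρ hm hC₁ hqa).1.trans (h.of_mem_sphere hr hrρ hm hC₂ hqb).1.symm)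
          exact ⟨fun hp => hnot (verticalPole_mem hp).1, fun hp => hnot (horizontalPole_mem hp).1⟩
        · exact hM.not_pole q (hmono hq) ⟨C₁, hC₁, C₂, hC₂, hne, hqa, hqb⟩ C₃ hC₃

end LocalPole

/-! ## The strips at a vertical pole -/

lemma LocalPole.mono {S : Set PlaneCircle} {D : Set Plane} {p : Plane} {C : PlaneCircle}
    {ρ ρ' : ℝ} (h : LocalPole S D p C ρ) (h0 : 0 < ρ') (hle : ρ' ≤ ρ) : LocalPole S D p C ρ' :=
  ⟨h.memS, h.center0, h.center1, h0, hle.trans h.le, h.out,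
    fun z hz => h.mem z (Metric.ball_subset_ball hle hz),
    fun C' hC' z hz => h.only C' hC' z (Metric.ball_subset_ball hle hz)⟩

/-- A vertical pole in the interior of a fibre, with a neighbourhood in which there is no other
vertex of the Poincaré-Reeb graph. -/
structure PoleContext (S : Set PlaneCircle) (D : Set Plane) (p : Plane) (lo hi : ℝ)
    (C : PlaneCircle) (ρ : ℝ) : Prop where
  mbc : IsMBC S D
  mem : p ∈ closure D
  lo_lt : lo < p 1
  lt_hi : p 1 < hi
  fib : IsFiber (closure D) (p 0) lo hi
  loc : LocalPole S D p C ρ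
  far : ∀ w ∈ reebVert S D, p 0 - ρ < reebHeight D w → reebHeight D w < p 0 + ρ →
    reebHeight D w = p 0

/-- The two strips entering the fibre of `p` next to `p` and the strip departing from it at `p`. -/
structure PoleStrips (S : Set PlaneCircle) (D : Set Plane) (p : Plane) (T₁ T₂ T₃ : Strip S D) :
    Prop where
  t₁ : T₁.t = p 0
  t₂ : T₂.t = p 0
  s₃ : T₃.s = p 0
  A₁ : T₁.A.f (p 0) < p 1
  B₁ : T₁.B.f (p 0) = p 1
  A₂ : T₂.A.f (p 0) = p 1
  B₂ : p 1 < T₂.B.f (p 0)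
  A₃ : T₃.A.f (p 0) < p 1
  B₃ : p 1 < T₃.B.f (p 0)

namespace PoleContext

variable {S : Set PlaneCircle} {D : Set Plane} {p : Plane} {lo hi : ℝ} {C : PlaneCircle} {ρ : ℝ}

lemma vis_iff (c : PoleContext S D p lo hi C ρ) {b : Plane} :
    Vis (closure D) p b ↔ b 0 = p 0 ∧ b 1 ∈ Icc lo hi := by
  rw [← c.fib.vis_iff (y := p 1) ⟨c.lo_lt.le, c.lt_hi.le⟩, pt_eta]

/-- Other points of circles on the vertical line through `p` are away from `p`. -/
lemma le_abs (c : PoleContext S D p lo hi C ρ) {C₁ : PlaneCircle} (hC₁ : C₁ ∈ S) {y : ℝ}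
    (hy : pt (p 0) y ∈ C₁.carrier) (hne : y ≠ p 1) : ρ ≤ |y - p 1| := by
  by_contra! hlt
  have hb : pt (p 0) y ∈ Metric.ball p ρ := by
    rw [mem_ball_plane c.loc.pos]
    simp only [pt_zero, pt_one, sub_self]
    have := sq_lt_sq' (neg_lt_of_abs_lt hlt) (lt_of_abs_lt hlt)
    linarith
  obtain rfl := c.loc.only C₁ hC₁ _ hb hy
  have h1 := mem_carrier.1 hy
  rw [c.loc.pw_eq] at h1
  simp only [pt_zero, pt_one, sub_self] at h1
  have : (y - p 1) ^ 2 = 0 := by linarith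
  exact hne (sub_eq_zero.1 (pow_eq_zero_iff two_ne_zero |>.1 this))

lemma le_sub (c : PoleContext S D p lo hi C ρ) {C₁ : PlaneCircle} (hC₁ : C₁ ∈ S) {y : ℝ}
    (hy : pt (p 0) y ∈ C₁.carrier) (hlt : y < p 1) : y ≤ p 1 - ρ := by
  have := c.le_abs hC₁ hy hlt.ne
  rw [abs_of_neg (by linarith)] at this
  linarith

lemma add_le (c : PoleContext S D p lo hi C ρ) {C₁ : PlaneCircle} (hC₁ : C₁ ∈ S) {y : ℝ}
    (hy : pt (p 0) y ∈ C₁.carrier) (hlt : p 1 < y) : p 1 + ρ ≤ y := by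
  have := c.le_abs hC₁ hy hlt.ne'
  rw [abs_of_pos (by linarith)] at this
  linarith

lemma lo_le (c : PoleContext S D p lo hi C ρ) : lo ≤ p 1 - ρ := by
  obtain ⟨C₁, hC₁, h⟩ := (c.fib.isEnd_low (c.lo_lt.trans c.lt_hi)).exists_carrier c.mbc
  exact c.le_sub hC₁ h c.lo_lt

lemma le_hi (c : PoleContext S D p lo hi C ρ) : p 1 + ρ ≤ hi := by
  obtain ⟨C₁, hC₁, h⟩ := (c.fib.isEnd_up (c.lo_lt.trans c.lt_hi)).exists_carrier c.mbc
  exact c.add_le hC₁ h c.lt_hi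

/-- Heights of vertices other than the height of `p` are far away. -/
lemma height_far (c : PoleContext S D p lo hi C ρ) {w : ReebSpace D} (hw : w ∈ reebVert S D) :
    reebHeight D w ≤ p 0 - ρ ∨ reebHeight D w = p 0 ∨ p 0 + ρ ≤ reebHeight D w := by
  by_contra! h
  exact h.2.1 (c.far w hw h.1 h.2.2)

lemma le_of_lt_height (c : PoleContext S D p lo hi C ρ) {w : ReebSpace D} (hw : w ∈ reebVert S D)
    (h : reebHeight D w < p 0) : reebHeight D w ≤ p 0 - ρ := by
  have := c.loc.pos
  rcases c.height_far hw with h1 | h1 | h1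
  · exact h1
  · linarith
  · linarith

lemma le_of_height_lt (c : PoleContext S D p lo hi C ρ) {w : ReebSpace D} (hw : w ∈ reebVert S D)
    (h : p 0 < reebHeight D w) : p 0 + ρ ≤ reebHeight D w := by
  have := c.loc.pos
  rcases c.height_far hw with h1 | h1 | h1
  · linarith
  · linarith
  · exact h1

/-- The points of the horizontal line through `p` to the left of `p` are inside of `C`. -/
lemma horizontal_notMem (c : PoleContext S D p lo hi C ρ) {x : ℝ} (h1 : p 0 - ρ < x)
    (h2 : x < p 0) : pt x (p 1) ∉ closure D := by
  intro h
  have h3 := c.loc.pw_nonneg h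
  rw [c.loc.pw_eq] at h3
  simp only [pt_zero, pt_one, sub_self] at h3
  have := c.loc.le
  nlinarith

variable {T₁ T₂ T₃ : Strip S D}

lemma s₁_le (c : PoleContext S D p lo hi C ρ) (P : PoleStrips S D p T₁ T₂ T₃) :
    T₁.s ≤ p 0 - ρ := by
  have := c.le_of_lt_height T₁.curve_s_mem
  rw [T₁.reebHeight_curve T₁.left_mem] at this
  exact this (P.t₁ ▸ T₁.lt)

lemma s₂_le (c : PoleContext S D p lo hi C ρ) (P : PoleStrips S D p T₁ T₂ T₃) :
    T₂.s ≤ p 0 - ρ := by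
  have := c.le_of_lt_height T₂.curve_s_mem
  rw [T₂.reebHeight_curve T₂.left_mem] at this
  exact this (P.t₂ ▸ T₂.lt)

lemma le_t₃ (c : PoleContext S D p lo hi C ρ) (P : PoleStrips S D p T₁ T₂ T₃) :
    p 0 + ρ ≤ T₃.t := by
  have := c.le_of_height_lt T₃.curve_t_mem
  rw [T₃.reebHeight_curve T₃.right_mem] at this
  exact this (P.s₃ ▸ T₃.lt)

/-- This arc ends at `p`, where only `C` passes. The region is outside of `C` and below the arc, so
the arc is the lower half. -/
lemma B₁_arc (c : PoleContext S D p lo hi C ρ) (P : PoleStrips S D p T₁ T₂ T₃) :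
    T₁.B.C = C ∧ T₁.B.s = -1 := by
  have h0 : p 0 ∈ Icc T₁.s T₁.t := P.t₁ ▸ T₁.right_mem
  have hC : T₁.B.C = C := by
    refine c.loc.only _ T₁.B_mem p (Metric.mem_ball_self c.loc.pos) ?_
    have := Arc.mem_carrier_f (T₁.sq_le_B h0)
    rwa [P.B₁, pt_eta] at this
  refine ⟨hC, ?_⟩
  obtain ⟨x, hx⟩ := exists_between T₁.lt
  obtain ⟨z, hz⟩ := c.mbc.nonempty
  have h1 := (T₁.reg x hx).sideB c.mbc z hz
  have h2 := c.loc.out z hz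
  rw [hC] at h1
  rcases T₁.B.hs with h | h
  · rw [h] at h1; linarith
  · exact h

lemma A₂_arc (c : PoleContext S D p lo hi C ρ) (P : PoleStrips S D p T₁ T₂ T₃) :
    T₂.A.C = C ∧ T₂.A.s = 1 := by
  have h0 : p 0 ∈ Icc T₂.s T₂.t := P.t₂ ▸ T₂.right_mem
  have hC : T₂.A.C = C := by
    refine c.loc.only _ T₂.A_mem p (Metric.mem_ball_self c.loc.pos) ?_
    have := Arc.mem_carrier_f (T₂.sq_le_A h0)
    rwa [P.A₂, pt_eta] at this
  refine ⟨hC, ?_⟩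
  obtain ⟨x, hx⟩ := exists_between T₂.lt
  obtain ⟨z, hz⟩ := c.mbc.nonempty
  have h1 := (T₂.reg x hx).sideA c.mbc z hz
  have h2 := c.loc.out z hz
  rw [hC] at h1
  rcases T₂.A.hs with h | h
  · exact h
  · rw [h] at h1; linarith

lemma B₁_le (c : PoleContext S D p lo hi C ρ) (P : PoleStrips S D p T₁ T₂ T₃) (x : ℝ) :
    T₁.B.f x ≤ p 1 := by
  obtain ⟨h1, h2⟩ := c.B₁_arc P
  have := T₁.B.g_nonneg x
  unfold Arc.f
  rw [h1, h2, c.loc.center1]; linarith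

lemma le_A₂ (c : PoleContext S D p lo hi C ρ) (P : PoleStrips S D p T₁ T₂ T₃) (x : ℝ) :
    p 1 ≤ T₂.A.f x := by
  obtain ⟨h1, h2⟩ := c.A₂_arc P
  have := T₂.A.g_nonneg x
  unfold Arc.f
  rw [h1, h2, c.loc.center1]; linarith

/-- To the left of `p` the two halves of `C` are the boundaries of the strips next to `p`. So being
outside of `C` means being above `T₂.A` or below `T₁.B`. -/
lemma pw_eq_mul (c : PoleContext S D p lo hi C ρ) (P : PoleStrips S D p T₁ T₂ T₃) {z : Plane}
    (h1 : p 0 - ρ < z 0) (h2 : z 0 < p 0) :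
    pw C z = (z 1 - T₂.A.f (z 0)) * (z 1 - T₁.B.f (z 0)) := by
  obtain ⟨h3, h4⟩ := c.B₁_arc P
  obtain ⟨h5, h6⟩ := c.A₂_arc P
  have hle := c.loc.le
  have hc := c.loc.center0
  have hsq : (z 0 - T₂.A.C.center 0) ^ 2 ≤ T₂.A.C.radius ^ 2 := by
    rw [h5]; exact (sq_lt_sq' (by linarith) (by linarith)).le
  rw [← h5, Arc.pw_eq hsq]
  have hg : T₁.B.g (z 0) = T₂.A.g (z 0) := by unfold Arc.g; rw [h3, h5]
  unfold Arc.f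
  rw [h3, h5, h4, h6, hg]; ring

/-- A point of an arc on the same vertical line as a point of the disk, and between this point and
the horizontal line through `p`, belongs to the circle `C`. -/
lemma eq_of_between (c : PoleContext S D p lo hi C ρ) {A : Arc} (hA : A.C ∈ S) {z : Plane}
    (hz : z ∈ Metric.ball p ρ) (hd : (z 0 - A.C.center 0) ^ 2 ≤ A.C.radius ^ 2)
    (hb : |A.f (z 0) - p 1| ≤ |z 1 - p 1|) : pw C (pt (z 0) (A.f (z 0))) = 0 := by
  have h1 : pt (z 0) (A.f (z 0)) ∈ Metric.ball p ρ := by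
    rw [mem_ball_plane c.loc.pos] at hz ⊢
    simp only [pt_zero, pt_one]
    have := sq_le_sq.2 hb
    linarith
  have h2 := Arc.mem_carrier_f hd
  rw [c.loc.only A.C hA _ h1 h2] at h2
  exact mem_carrier.1 h2

lemma abs_coord_lt (c : PoleContext S D p lo hi C ρ) {z : Plane} (hz : z ∈ Metric.ball p ρ) :
    p 0 - ρ < z 0 ∧ z 0 < p 0 + ρ ∧ p 1 - ρ < z 1 ∧ z 1 < p 1 + ρ := by
  rw [mem_ball_plane c.loc.pos] at hz
  have h0 := abs_lt_of_sq_lt_sq' (show (z 0 - p 0) ^ 2 < ρ ^ 2 by nlinarith) c.loc.pos.le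
  have h1 := abs_lt_of_sq_lt_sq' (show (z 1 - p 1) ^ 2 < ρ ^ 2 by nlinarith) c.loc.pos.le
  refine ⟨?_, ?_, ?_, ?_⟩ <;> linarith [h0.1, h0.2, h1.1, h1.2]

/-- The point is outside of `C`, hence beyond one of its halves in the direction of a strip. If it
were also beyond the far boundary of the strip, that boundary would enter the ball and belong to `C`
there, which is impossible. -/
lemma ball_left (c : PoleContext S D p lo hi C ρ) (P : PoleStrips S D p T₁ T₂ T₃)
    {z : closure D} (hz : (z : Plane) ∈ Metric.ball p ρ) (hlt : (z : Plane) 0 < p 0) :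
    z ∈ T₁.region ∨ z ∈ T₂.region := by
  obtain ⟨h1, -, -, -⟩ := c.abs_coord_lt hz
  have hx₁ : (z : Plane) 0 ∈ Ioo T₁.s T₁.t := ⟨(c.s₁_le P).trans_lt h1, P.t₁ ▸ hlt⟩
  have hx₂ : (z : Plane) 0 ∈ Ioo T₂.s T₂.t := ⟨(c.s₂_le P).trans_lt h1, P.t₂ ▸ hlt⟩
  have hpw := c.loc.pw_nonneg z.2
  rw [c.pw_eq_mul P h1 hlt] at hpw
  have hB := c.B₁_le P ((z : Plane) 0)
  have hA := c.le_A₂ P ((z : Plane) 0)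
  have hr₁ := T₁.reg _ hx₁
  have hr₂ := T₂.reg _ hx₂
  rcases le_or_gt ((z : Plane) 1) (T₁.B.f ((z : Plane) 0)) with h | h
  · left
    refine ⟨hx₁, ?_, h⟩
    by_contra! hcon
    have h0 := c.eq_of_between T₁.A_mem hz hr₁.domA.le (by
      rw [abs_of_nonpos (by linarith [hr₁.lt]), abs_of_nonpos (by linarith [hr₁.lt])]; linarith)
    rw [c.pw_eq_mul P (by simpa using h1) (by simpa using hlt)] at h0
    simp only [pt_zero, pt_one] at h0
    have := hr₁.lt
    nlinarith
  · right
    have h' : T₂.A.f ((z : Plane) 0) ≤ (z : Plane) 1 := by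
      by_contra! hcon
      nlinarith
    refine ⟨hx₂, h', ?_⟩
    by_contra! hcon
    have h0 := c.eq_of_between T₂.B_mem hz hr₂.domB.le (by
      rw [abs_of_nonneg (by linarith [hr₂.lt]), abs_of_nonneg (by linarith [hr₂.lt])]; linarith)
    rw [c.pw_eq_mul P (by simpa using h1) (by simpa using hlt)] at h0
    simp only [pt_zero, pt_one] at h0
    have := hr₂.lt
    nlinarith

/-- To the right of `p`, an arc in the boundary of the strip departing at `p` does not cross the
horizontal line through `p`. -/
lemma arc_ne (c : PoleContext S D p lo hi C ρ) {A : Arc} (hA : A.C ∈ S) {x : ℝ}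
    (hx0 : p 0 ≤ x) (hx : x < p 0 + ρ) (hd : (x - A.C.center 0) ^ 2 ≤ A.C.radius ^ 2)
    (hne : A.f (p 0) ≠ p 1) : A.f x ≠ p 1 := by
  intro heq
  have hρ := c.loc.pos
  have hb : pt x (p 1) ∈ Metric.ball p ρ := by
    rw [mem_ball_plane hρ]; simp only [pt_zero, pt_one, sub_self]; nlinarith
  have h1 := Arc.mem_carrier_f hd
  rw [heq] at h1
  rw [c.loc.only A.C hA _ hb h1, mem_carrier, c.loc.pw_eq] at h1
  simp only [pt_zero, pt_one, sub_self] at h1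
  have hR := C.radius_pos
  have : x = p 0 := by
    by_contra hne'
    have : 0 < x - p 0 := by
      have := lt_of_le_of_ne hx0 (Ne.symm hne')
      linarith
    nlinarith [mul_pos hR this, sq_nonneg (x - p 0)]
  rw [this] at heq
  exact hne heq

/-- Over `p 0` the two arcs are on different sides of the height of `p`; by the intermediate value
theorem and `arc_ne` they stay there. -/
lemma strip₃_between (c : PoleContext S D p lo hi C ρ) (P : PoleStrips S D p T₁ T₂ T₃) {x : ℝ}
    (hx0 : p 0 ≤ x) (hx : x < p 0 + ρ) : T₃.A.f x < p 1 ∧ p 1 < T₃.B.f x := by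
  have hmem : ∀ x' ∈ Icc (p 0) x, x' ∈ Icc T₃.s T₃.t := fun x' hx' =>
    ⟨P.s₃ ▸ hx'.1, (hx'.2.trans hx.le).trans (c.le_t₃ P)⟩
  constructor
  · by_contra! hcon
    obtain ⟨x', hx', h⟩ := isPreconnected_Icc.intermediate_value (left_mem_Icc.2 hx0)
      (right_mem_Icc.2 hx0) T₃.A.continuous_f.continuousOn ⟨P.A₃.le, hcon⟩
    exact c.arc_ne T₃.A_mem hx'.1 (hx'.2.trans_lt hx) (T₃.sq_le_A (hmem x' hx')) P.A₃.ne h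
  · by_contra! hcon
    obtain ⟨x', hx', h⟩ := isPreconnected_Icc.intermediate_value (right_mem_Icc.2 hx0)
      (left_mem_Icc.2 hx0) T₃.B.continuous_f.continuousOn ⟨hcon, P.B₃.le⟩
    exact c.arc_ne T₃.B_mem hx'.1 (hx'.2.trans_lt hx) (T₃.sq_le_B (hmem x' hx')) P.B₃.ne' h

/-- A point of the ball beyond a boundary of the strip would force that boundary to be on `C`, but
`C` has no points to the right of `p`. -/
lemma ball_right (c : PoleContext S D p lo hi C ρ) (P : PoleStrips S D p T₁ T₂ T₃)
    {z : closure D} (hz : (z : Plane) ∈ Metric.ball p ρ) (hlt : p 0 < (z : Plane) 0) :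
    z ∈ T₃.region := by
  obtain ⟨-, h1, -, -⟩ := c.abs_coord_lt hz
  have hx : (z : Plane) 0 ∈ Ioo T₃.s T₃.t := ⟨P.s₃ ▸ hlt, h1.trans_le (c.le_t₃ P)⟩
  obtain ⟨hA, hB⟩ := c.strip₃_between P hlt.le h1
  have hr := T₃.reg _ hx
  have hpos : ∀ y, pw C (pt ((z : Plane) 0) y) ≠ 0 := by
    intro y h0
    rw [c.loc.pw_eq] at h0
    simp only [pt_zero, pt_one] at h0
    have := mul_pos C.radius_pos (sub_pos.2 hlt)
    nlinarith [sq_nonneg ((z : Plane) 0 - p 0), sq_nonneg (y - p 1)]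
  refine ⟨hx, ?_, ?_⟩
  · by_contra! hcon
    exact hpos _ (c.eq_of_between T₃.A_mem hz hr.domA.le (by
      rw [abs_of_nonpos (by linarith), abs_of_nonpos (by linarith)]; linarith))
  · by_contra! hcon
    exact hpos _ (c.eq_of_between T₃.B_mem hz hr.domB.le (by
      rw [abs_of_nonneg (by linarith), abs_of_nonneg (by linarith)]; linarith))

lemma ball_mid (c : PoleContext S D p lo hi C ρ) {z : Plane} (hz : z ∈ Metric.ball p ρ)
    (h0 : z 0 = p 0) : Vis (closure D) p z := by
  obtain ⟨-, -, h1, h2⟩ := c.abs_coord_lt hz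
  exact c.vis_iff.2 ⟨h0, by linarith [c.lo_le], by linarith [c.le_hi]⟩

end PoleContext

/-! ## Vertical segments in the complement of a disk -/

section Disk

variable {K : Set Plane} {a b p : Plane} {r : ℝ}

lemma Vis.sdiff (h : Vis K a b) (hb : ∀ z, Vis K a z → z ∉ Metric.ball p r) :
    Vis (K \ Metric.ball p r) a b := by
  refine ⟨h.1, fun t ht => ⟨h.2 t ht, hb _ ⟨by simp, fun s hs => ?_⟩⟩⟩
  simp only [pt_one] at hs
  exact h.2 s (uIcc_subset_uIcc left_mem_uIcc ht hs)

lemma Vis.sdiff_of_le_abs (hr : 0 < r) (h : Vis K a b) (h0 : r ≤ |a 0 - p 0|) :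
    Vis (K \ Metric.ball p r) a b := by
  refine h.sdiff fun z hz hzb => ?_
  rw [mem_ball_plane hr, ← hz.1] at hzb
  have h1 : r ^ 2 ≤ |a 0 - p 0| ^ 2 := pow_le_pow_left₀ hr.le h0 2
  rw [sq_abs] at h1
  nlinarith [sq_nonneg (z 1 - p 1)]

/-- Two points outside of the disk and on the same side of its horizontal diameter. -/
lemma Vis.sdiff_of_same_side (hr : 0 < r) (h : Vis K a b) (ha : a ∉ Metric.ball p r)
    (hb : b ∉ Metric.ball p r) (hs : (a 1 ≤ p 1 ∧ b 1 ≤ p 1) ∨ (p 1 ≤ a 1 ∧ p 1 ≤ b 1)) :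
    Vis (K \ Metric.ball p r) a b := by
  refine ⟨h.1, fun t ht => ⟨h.2 t ht, fun hb' => ?_⟩⟩
  rw [mem_ball_plane hr] at ha hb hb'
  rw [← h.1] at hb
  simp only [pt_zero, pt_one] at hb'
  rcases mem_uIcc.1 ht with ⟨h1, h2⟩ | ⟨h1, h2⟩ <;> rcases hs with ⟨h3, h4⟩ | ⟨h3, h4⟩ <;>
    exact ha (by nlinarith)

/-- A vertical segment in `K` cannot cross a height at which `K` has a gap. Next to the disk this
separates what is below it from what is above it. -/
lemma Vis.same_side (h : Vis K a b) (h0 : pt (a 0) (p 1) ∉ K) :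
    (a 1 < p 1 ∧ b 1 < p 1) ∨ (p 1 < a 1 ∧ p 1 < b 1) := by
  have h1 : p 1 ∉ uIcc (a 1) (b 1) := fun h1 => h0 (h.2 _ h1)
  rw [mem_uIcc] at h1
  push Not at h1
  rcases lt_trichotomy (a 1) (p 1) with h2 | h2 | h2
  · exact Or.inl ⟨h2, h1.1 h2.le⟩
  · have := h1.1 h2.le
    have := h1.2
    by_contra
    grind
  · right
    refine ⟨h2, ?_⟩
    by_contra! h3
    exact absurd (h1.2 h3) (not_lt.2 h2.le)

end Disk

/-! ## The edges at the removed disk -/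

section Edge

variable {S : Set PlaneCircle} {D : Set Plane} (hM : IsMBC S D) (e : ReebEdge S D)

lemma ReebEdge.src_eq : e.src.1 = (e.strip hM).curve (e.strip hM).s := by
  conv_lhs => rw [← e.strip_edge hM]
  rfl

lemma ReebEdge.tgt_eq : e.tgt.1 = (e.strip hM).curve (e.strip hM).t := by
  conv_lhs => rw [← e.strip_edge hM]
  rfl

lemma ReebEdge.strip_s : (e.strip hM).s = reebHeight D e.src.1 := by
  rw [e.src_eq hM, Strip.reebHeight_curve _ (Strip.left_mem _)]

lemma ReebEdge.strip_t : (e.strip hM).t = reebHeight D e.tgt.1 := by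
  rw [e.tgt_eq hM, Strip.reebHeight_curve _ (Strip.right_mem _)]

lemma ReebEdge.limitFiber_strip {x : ℝ} (hx : x ∈ Icc (e.strip hM).s (e.strip hM).t) :
    e.limitFiber x = Icc ((e.strip hM).A.f x) ((e.strip hM).B.f x) := by
  conv_lhs => rw [← e.strip_edge hM]
  exact Strip.limitFiber_edge hM _ hx

lemma ReebEdge.eq_of_region {e e' : ReebEdge S D} {z : closure D}
    (h : z ∈ (e.strip hM).region) (h' : z ∈ (e'.strip hM).region) : e = e' := by
  rw [← e.strip_edge hM, ← e'.strip_edge hM]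
  exact Strip.edge_eq_edge hM h h'

lemma ReebEdge.exists_region {z : closure D} (hz : reebMk D z ∉ reebVert S D) :
    ∃ e : ReebEdge S D, z ∈ (e.strip hM).region := by
  obtain ⟨T, hT⟩ := Strip.exists_of_notMem hM hz
  refine ⟨T.edge hM, ?_⟩
  rw [← Strip.mk_mem_carrier_iff hM]
  have h1 : ((T.edge hM).strip hM).carrier = T.carrier :=
    congrArg ReebEdge.carrier ((T.edge hM).strip_edge hM)
  rw [h1, Strip.mk_mem_carrier_iff hM]
  exact hT

lemma Strip.region_of_vis (hM : IsMBC S D) (T : Strip S D) {z w : closure D} (h : z ∈ T.region)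
    (hv : Vis (closure D) z w) : w ∈ T.region := by
  rw [← T.mk_mem_carrier_iff hM] at h ⊢
  rwa [← reebMk_eq_iff.2 hv]

lemma Strip.notMem_vert (hM : IsMBC S D) (T : Strip S D) {z : closure D} (h : z ∈ T.region) :
    reebMk D z ∉ reebVert S D :=
  T.carrier_subset hM ((T.mk_mem_carrier_iff hM).2 h)

end Edge

/-! ### Positions of the edges at `v₀` relative to the disk. -/

namespace SegmentData

variable {S : Set PlaneCircle} {D : Set Plane} {p : Plane} {lo hi : ℝ} {v₀ : ReebVertex S D}

/-- The edge entering `v₀` directly below `p`. -/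
def edge₁ (F : SegmentData S D p lo hi v₀) : ReebEdge S D :=
  (F.el ⟨F.j₀, F.one_le_j₀, F.j₀_lt.le⟩).1

/-- The edge entering `v₀` directly above `p`. -/
def edge₂ (F : SegmentData S D p lo hi v₀) : ReebEdge S D :=
  (F.el ⟨F.j₀ + 1, Nat.le_add_left _ _, F.j₀_lt⟩).1

/-- The edge departing from `v₀` at `p`. -/
def edge₃ (F : SegmentData S D p lo hi v₀) : ReebEdge S D :=
  (F.er ⟨F.k₀, F.one_le_k₀, F.k₀_le⟩).1

end SegmentData

/-- A vertical pole in the interior of a fibre, and a small disk centred at it. -/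
structure DiskContext (S : Set PlaneCircle) (D : Set Plane) (p : Plane) (lo hi : ℝ)
    (C : PlaneCircle) (ρ : ℝ) (v₀ : ReebVertex S D) (F : SegmentData S D p lo hi v₀)
    (r : ℝ) : Prop extends PoleContext S D p lo hi C ρ where
  v₀_eq : v₀.1 = reebMk D ⟨p, mem⟩
  r_pos : 0 < r
  r_lt : r < ρ

namespace DiskContext

variable {S : Set PlaneCircle} {D : Set Plane} {p : Plane} {lo hi : ℝ} {C : PlaneCircle} {ρ : ℝ}
  {v₀ : ReebVertex S D} {F : SegmentData S D p lo hi v₀} {r : ℝ}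

lemma height_v₀ (d : DiskContext S D p lo hi C ρ v₀ F r) : reebHeight D v₀.1 = p 0 := by
  rw [d.v₀_eq, reebHeight_mk]

lemma mk_eq_v₀ (d : DiskContext S D p lo hi C ρ v₀ F r) {z : closure D} :
    reebMk D z = v₀.1 ↔ (z : Plane) 0 = p 0 ∧ (z : Plane) 1 ∈ Icc lo hi := by
  rw [d.v₀_eq, eq_comm, reebMk_eq_iff]
  exact d.vis_iff

lemma vis_mid (d : DiskContext S D p lo hi C ρ v₀ F r) {y y' : ℝ} (hy : y ∈ Icc lo hi)
    (hy' : y' ∈ Icc lo hi) : Vis (closure D) (pt (p 0) y) (pt (p 0) y') :=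
  Vis.of_Icc d.fib.mem hy hy'

section el

variable (d : DiskContext S D p lo hi C ρ v₀ F r) {e : ReebEdge S D}

lemma t_eq (h : e.tgt = v₀) : (e.strip d.mbc).t = p 0 := by
  rw [e.strip_t, h, d.height_v₀]

lemma s_eq (h : e.src = v₀) : (e.strip d.mbc).s = p 0 := by
  rw [e.strip_s, h, d.height_v₀]

/-- The data `F` are arbitrary; comparing limit intervals recovers the heights at which the arcs of
the numbered edges end. -/
lemma el_ends (j : Icc 1 F.a) :
    ((F.el j).1.strip d.mbc).A.f (p 0) = F.xl (j.1 - 1) ∧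
    ((F.el j).1.strip d.mbc).B.f (p 0) = F.xl j.1 := by
  have hm : p 0 ∈ Icc ((F.el j).1.strip d.mbc).s ((F.el j).1.strip d.mbc).t := by
    have := ((F.el j).1.strip d.mbc).right_mem
    rwa [d.t_eq (F.el j).2] at this ⊢
  have h := F.el_fiber j
  rw [(F.el j).1.limitFiber_strip d.mbc hm] at h
  exact (Icc_eq_Icc_iff (Strip.le _ hm)).1 h

lemma er_ends (j : Icc 1 F.b) :
    ((F.er j).1.strip d.mbc).A.f (p 0) = F.xr (j.1 - 1) ∧
    ((F.er j).1.strip d.mbc).B.f (p 0) = F.xr j.1 := by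
  have hm : p 0 ∈ Icc ((F.er j).1.strip d.mbc).s ((F.er j).1.strip d.mbc).t := by
    have := ((F.er j).1.strip d.mbc).left_mem
    rwa [d.s_eq (F.er j).2] at this ⊢
  have h := F.er_fiber j
  rw [(F.er j).1.limitFiber_strip d.mbc hm] at h
  exact (Icc_eq_Icc_iff (Strip.le _ hm)).1 h

end el

end DiskContext

namespace SegmentData

variable {S : Set PlaneCircle} {D : Set Plane} {p : Plane} {lo hi : ℝ} {v₀ : ReebVertex S D}

lemma xl_mem (F : SegmentData S D p lo hi v₀) {j : ℕ} (h : j ≤ F.a) :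
    F.xl j ∈ Icc lo hi := by
  have h0 := F.xl_mono.monotoneOn (Nat.zero_le F.a) h (Nat.zero_le j)
  have h1 := F.xl_mono.monotoneOn h (le_refl F.a) h
  rw [F.xl_zero] at h0
  rw [F.xl_last] at h1
  exact ⟨h0, h1⟩

lemma xr_mem (F : SegmentData S D p lo hi v₀) {j : ℕ} (h : j ≤ F.b) :
    F.xr j ∈ Icc lo hi := by
  have h0 := F.xr_mono.monotoneOn (Nat.zero_le F.b) h (Nat.zero_le j)
  have h1 := F.xr_mono.monotoneOn h (le_refl F.b) h
  rw [F.xr_zero] at h0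
  rw [F.xr_last] at h1
  exact ⟨h0, h1⟩

end SegmentData

namespace DiskContext

variable {S : Set PlaneCircle} {D : Set Plane} {p : Plane} {lo hi : ℝ} {C : PlaneCircle} {ρ : ℝ}
  {v₀ : ReebVertex S D} {F : SegmentData S D p lo hi v₀} {r : ℝ}

lemma pt_edge_carriers (d : DiskContext S D p lo hi C ρ v₀ F r) (e : ReebEdge S D)
    (h : p 0 ∈ Icc (e.strip d.mbc).s (e.strip d.mbc).t) :
    pt (p 0) ((e.strip d.mbc).A.f (p 0)) ∈ (e.strip d.mbc).A.C.carrier ∧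
    pt (p 0) ((e.strip d.mbc).B.f (p 0)) ∈ (e.strip d.mbc).B.C.carrier :=
  ⟨Arc.mem_carrier_f (Strip.sq_le_A _ h), Arc.mem_carrier_f (Strip.sq_le_B _ h)⟩

section

variable (d : DiskContext S D p lo hi C ρ v₀ F r)

/-- Translates the redirection of targets into geometry. The cases are the positions of the index of
the edge relative to `j₀` and `j₀ + 1`; redirected edges stay at distance at least `ρ` from `p` over
`p 0`, since their ends are on circles. -/
lemma entering_cases (e : ReebEdge S D) :
    (e.tgt ≠ v₀ ∧ F.oldTgt e = Sum.inl e.tgt) ∨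
    ((e.strip d.mbc).t = p 0 ∧ lo ≤ (e.strip d.mbc).A.f (p 0) ∧
      (e.strip d.mbc).B.f (p 0) ≤ p 1 - ρ ∧ ∃ h, F.oldTgt e = Sum.inr (.v3 h)) ∨
    (e = F.edge₁ ∧ F.oldTgt e = Sum.inr .v1) ∨ (e = F.edge₂ ∧ F.oldTgt e = Sum.inr .v2) ∨
    ((e.strip d.mbc).t = p 0 ∧ (e.strip d.mbc).B.f (p 0) ≤ hi ∧
      p 1 + ρ ≤ (e.strip d.mbc).A.f (p 0) ∧ ∃ h, F.oldTgt e = Sum.inr (.v4 h)) := by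
  by_cases h : e.tgt = v₀
  swap
  · exact Or.inl ⟨h, by unfold SegmentData.oldTgt; rw [dif_neg h]⟩
  obtain ⟨j, hj⟩ : ∃ j, F.el j = ⟨e, h⟩ := F.el.surjective _
  have hj' : F.el.symm ⟨e, h⟩ = j := by rw [← hj, Equiv.symm_apply_apply]
  have he : (F.el j).1 = e := by rw [hj]
  have hE := d.el_ends j
  have ht := d.t_eq h
  have hc := d.pt_edge_carriers e (ht ▸ Strip.right_mem _)
  rw [he] at hE
  have hlh := F.xl_mem j.2.2
  have hlh' := F.xl_mem (j := j.1 - 1) ((Nat.sub_le _ _).trans j.2.2)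
  rw [← hE.1] at hlh'
  rw [← hE.2] at hlh
  unfold SegmentData.oldTgt
  rw [dif_pos h]
  simp only [hj']
  rcases lt_trichotomy j.1 F.j₀ with h1 | h1 | h1
  · refine Or.inr (Or.inl ⟨ht, hlh'.1, d.le_sub (Strip.B_mem _) hc.2 ?_, ?_⟩)
    · rw [hE.2, ← F.xl_j₀]; exact F.xl_mono j.2.2 F.j₀_lt.le h1
    · rw [dif_pos h1]; exact ⟨Or.inl (lt_of_le_of_lt j.2.1 h1), rfl⟩
  · refine Or.inr (Or.inr (Or.inl ⟨?_, ?_⟩))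
    · rw [← he]; unfold SegmentData.edge₁; congr 2; exact Subtype.ext h1
    · rw [dif_neg (by omega), dif_neg (by omega), if_pos h1]
  · rcases eq_or_lt_of_le (show F.j₀ + 1 ≤ j.1 from h1) with h2 | h2
    · refine Or.inr (Or.inr (Or.inr (Or.inl ⟨?_, ?_⟩)))
      · rw [← he]; unfold SegmentData.edge₂; congr 2; exact Subtype.ext h2.symm
      · rw [dif_neg (by omega), dif_neg (by omega), if_neg (by omega)]
    · refine Or.inr (Or.inr (Or.inr (Or.inr ⟨ht, hlh.2, d.add_le (Strip.A_mem _) hc.1 ?_, ?_⟩)))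
      · rw [hE.1, ← F.xl_j₀]
        exact F.xl_mono F.j₀_lt.le ((Nat.sub_le _ _).trans j.2.2) (by omega)
      · rw [dif_neg (by omega), dif_pos h2]; exact ⟨Or.inl (lt_of_lt_of_le h2 j.2.2), rfl⟩

lemma departing_cases (e : ReebEdge S D) :
    (e.src ≠ v₀ ∧ F.oldSrc e = Sum.inl e.src) ∨
    ((e.strip d.mbc).s = p 0 ∧ lo ≤ (e.strip d.mbc).A.f (p 0) ∧
      (e.strip d.mbc).B.f (p 0) ≤ p 1 - ρ ∧ ∃ h, F.oldSrc e = Sum.inr (.v3 h)) ∨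
    (e = F.edge₃ ∧ F.oldSrc e = Sum.inl v₀) ∨
    ((e.strip d.mbc).s = p 0 ∧ (e.strip d.mbc).B.f (p 0) ≤ hi ∧
      p 1 + ρ ≤ (e.strip d.mbc).A.f (p 0) ∧ ∃ h, F.oldSrc e = Sum.inr (.v4 h)) := by
  by_cases h : e.src = v₀
  swap
  · exact Or.inl ⟨h, by unfold SegmentData.oldSrc; rw [dif_neg h]⟩
  obtain ⟨j, hj⟩ : ∃ j, F.er j = ⟨e, h⟩ := F.er.surjective _
  have hj' : F.er.symm ⟨e, h⟩ = j := by rw [← hj, Equiv.symm_apply_apply]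
  have he : (F.er j).1 = e := by rw [hj]
  have hE := d.er_ends j
  have ht := d.s_eq h
  have hc := d.pt_edge_carriers e (ht ▸ Strip.left_mem _)
  rw [he] at hE
  have hlh := F.xr_mem j.2.2
  have hlh' := F.xr_mem (j := j.1 - 1) ((Nat.sub_le _ _).trans j.2.2)
  rw [← hE.1] at hlh'
  rw [← hE.2] at hlh
  have hk := F.one_le_k₀
  have hkb := F.k₀_le
  unfold SegmentData.oldSrc
  rw [dif_pos h]
  simp only [hj']
  rcases lt_trichotomy j.1 F.k₀ with h1 | h1 | h1
  · refine Or.inr (Or.inl ⟨ht, hlh'.1, d.le_sub (Strip.B_mem _) hc.2 ?_, ?_⟩)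
    · rw [hE.2]
      exact (F.xr_mono.monotoneOn j.2.2 ((Nat.sub_le _ _).trans hkb)
        (show j.1 ≤ F.k₀ - 1 by omega)).trans_lt F.xr_lt
    · rw [dif_pos h1]; exact ⟨Or.inr (Or.inl (lt_of_le_of_lt j.2.1 h1)), rfl⟩
  · refine Or.inr (Or.inr (Or.inl ⟨?_, ?_⟩))
    · rw [← he]; unfold SegmentData.edge₃; congr 2; exact Subtype.ext h1
    · rw [dif_neg (by omega), dif_neg (by omega)]
  · refine Or.inr (Or.inr (Or.inr ⟨ht, hlh.2, d.add_le (Strip.A_mem _) hc.1 ?_, ?_⟩))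
    · rw [hE.1]
      exact F.lt_xr.trans_le (F.xr_mono.monotoneOn hkb ((Nat.sub_le _ _).trans j.2.2)
        (show F.k₀ ≤ j.1 - 1 by omega))
    · rw [dif_neg (by omega), dif_pos h1]; exact ⟨Or.inr (Or.inl (lt_of_lt_of_le h1 j.2.2)), rfl⟩

lemma edge₁_ends : (F.edge₁.strip d.mbc).A.f (p 0) = F.xl (F.j₀ - 1) ∧
    (F.edge₁.strip d.mbc).B.f (p 0) = p 1 := by
  rw [← F.xl_j₀]; exact d.el_ends _

lemma edge₂_ends : (F.edge₂.strip d.mbc).A.f (p 0) = p 1 ∧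
    (F.edge₂.strip d.mbc).B.f (p 0) = F.xl (F.j₀ + 1) := by
  rw [← F.xl_j₀]; exact d.el_ends _

lemma edge₃_ends : (F.edge₃.strip d.mbc).A.f (p 0) = F.xr (F.k₀ - 1) ∧
    (F.edge₃.strip d.mbc).B.f (p 0) = F.xr F.k₀ := d.er_ends _

lemma poleStrips :
    PoleStrips S D p (F.edge₁.strip d.mbc) (F.edge₂.strip d.mbc) (F.edge₃.strip d.mbc) where
  t₁ := d.t_eq (F.el _).2
  t₂ := d.t_eq (F.el _).2
  s₃ := d.s_eq (F.er _).2
  A₁ := by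
    rw [d.edge₁_ends.1, ← F.xl_j₀]
    exact F.xl_mono ((Nat.sub_le _ _).trans F.j₀_lt.le) F.j₀_lt.le
      (Nat.sub_lt F.one_le_j₀ Nat.one_pos)
  B₁ := d.edge₁_ends.2
  A₂ := d.edge₂_ends.1
  B₂ := by
    rw [d.edge₂_ends.2, ← F.xl_j₀]
    exact F.xl_mono F.j₀_lt.le F.j₀_lt (Nat.lt_succ_self _)
  A₃ := by rw [d.edge₃_ends.1]; exact F.xr_lt
  B₃ := by rw [d.edge₃_ends.2]; exact F.lt_xr

lemma lo_le_A₁ : (F.edge₁.strip d.mbc).A.f (p 0) ∈ Icc lo hi := by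
  rw [d.edge₁_ends.1]; exact F.xl_mem ((Nat.sub_le _ _).trans F.j₀_lt.le)

lemma B₂_le_hi : (F.edge₂.strip d.mbc).B.f (p 0) ∈ Icc lo hi := by
  rw [d.edge₂_ends.2]; exact F.xl_mem F.j₀_lt

lemma lo_le_A₃ : (F.edge₃.strip d.mbc).A.f (p 0) ∈ Icc lo hi := by
  rw [d.edge₃_ends.1]; exact F.xr_mem ((Nat.sub_le _ _).trans F.k₀_le)

lemma B₃_le_hi : (F.edge₃.strip d.mbc).B.f (p 0) ∈ Icc lo hi := by
  rw [d.edge₃_ends.2]; exact F.xr_mem F.k₀_le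

/-- Without `v₃` both `j₀` and `k₀` are `1`, so the lower boundaries on the left and on the right
meet at `lo`. The curve of the first new edge can then be continued across `p 0`. -/
lemma A_eq_lo (h : ¬ F.HasV3) : (F.edge₁.strip d.mbc).A.f (p 0) = lo ∧
    (F.edge₃.strip d.mbc).A.f (p 0) = lo := by
  unfold SegmentData.HasV3 at h
  push Not at h
  have h1 : F.j₀ - 1 = 0 := by omega
  have h2 : F.k₀ - 1 = 0 := by omega
  rw [d.edge₁_ends.1, d.edge₃_ends.1, h1, h2]
  exact ⟨F.xl_zero, F.xr_zero⟩

lemma B_eq_hi (h : ¬ F.HasV4) : (F.edge₂.strip d.mbc).B.f (p 0) = hi ∧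
    (F.edge₃.strip d.mbc).B.f (p 0) = hi := by
  unfold SegmentData.HasV4 at h
  push Not at h
  have h1 : F.j₀ + 1 = F.a := le_antisymm F.j₀_lt h.1
  have h2 : F.k₀ = F.b := le_antisymm F.k₀_le h.2.1
  rw [d.edge₂_ends.2, d.edge₃_ends.2, h1, h2]
  exact ⟨F.xl_last, F.xr_last⟩

lemma edge₃_ne (d : DiskContext S D p lo hi C ρ v₀ F r) : F.edge₃ ≠ F.edge₁ ∧ F.edge₃ ≠ F.edge₂ := by
  have h := d.poleStrips
  constructor <;> intro h' <;> rw [h'] at h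
  · have := (F.edge₁.strip d.mbc).lt; rw [h.t₁, h.s₃] at this; exact lt_irrefl _ this
  · have := (F.edge₂.strip d.mbc).lt; rw [h.t₂, h.s₃] at this; exact lt_irrefl _ this

/-- Only three edges and `v₀` meet the disk of radius `ρ`. -/
lemma edge_of_mem_ball {e : ReebEdge S D} {x y : ℝ}
    (hx : x ∈ Icc (e.strip d.mbc).s (e.strip d.mbc).t)
    (hy : y ∈ Icc ((e.strip d.mbc).A.f x) ((e.strip d.mbc).B.f x))
    (hb : pt x y ∈ Metric.ball p ρ) :
    ((e = F.edge₁ ∨ e = F.edge₂) ∧ x ≤ p 0) ∨ (e = F.edge₃ ∧ p 0 ≤ x) := by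
  have hρ := d.loc.pos
  have hP := d.poleStrips
  obtain ⟨h1, h2, h3, h4⟩ := d.abs_coord_lt hb
  simp only [pt_zero, pt_one] at h1 h2 h3 h4
  have hs := d.height_far e.src.2
  have ht := d.height_far e.tgt.2
  rw [← e.strip_s d.mbc] at hs
  rw [← e.strip_t d.mbc] at ht
  set z : closure D := ⟨pt x y, Strip.mem_closure _ hx hy⟩ with hz
  -- Within `ρ` of `p 0` vertices occur only over `p 0`. So off this line the point is in an open
  -- strip, and on it an end of the edge is `v₀` and the lists of edges at `v₀` apply.
  rcases lt_trichotomy x (p 0) with h0 | h0 | h0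
  · have hreg : z ∈ (e.strip d.mbc).region := by
      refine ⟨?_, by simpa [hz] using hy⟩
      simp only [hz, pt_zero]
      constructor
      · refine lt_of_le_of_ne hx.1 fun h => ?_
        rcases hs with h | h | h <;> linarith
      · refine lt_of_le_of_ne hx.2 fun h => ?_
        rcases ht with h | h | h <;> linarith
    refine Or.inl ⟨?_, h0.le⟩
    rcases d.ball_left hP (z := z) hb (by simpa [hz] using h0) with h | h
    · exact Or.inl (ReebEdge.eq_of_region d.mbc hreg h)
    · exact Or.inr (ReebEdge.eq_of_region d.mbc hreg h)
  · subst h0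
    have hv : reebMk D z = v₀.1 := d.mk_eq_v₀.2 ⟨by simp [hz], by
      have := d.lo_le; have := d.le_hi; simp only [hz, pt_one]; constructor <;> linarith⟩
    have hend : p 0 = (e.strip d.mbc).s ∨ p 0 = (e.strip d.mbc).t := by
      by_contra! hne
      refine Strip.notMem_vert d.mbc (e.strip d.mbc) (z := z) ⟨?_, by simpa [hz] using hy⟩
        (hv ▸ v₀.2)
      simp only [hz, pt_zero]
      exact ⟨lt_of_le_of_ne hx.1 (Ne.symm hne.1), lt_of_le_of_ne hx.2 hne.2⟩
    have hz' := (e.strip d.mbc).mk_eq_curve (z := z) (by simpa [hz] using hx)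
      (by simpa [hz] using hy)
    simp only [hz, pt_zero] at hz'
    rcases hend with h | h
    · have : e.src = v₀ := Subtype.ext (by rw [e.src_eq d.mbc, ← h, ← hz']; exact hv)
      rcases d.departing_cases e with h' | ⟨-, -, h', -⟩ | h' | ⟨-, -, h', -⟩
      · exact (h'.1 this).elim
      · linarith [hy.2]
      · exact Or.inr ⟨h'.1, le_rfl⟩
      · linarith [hy.1]
    · have : e.tgt = v₀ := Subtype.ext (by rw [e.tgt_eq d.mbc, ← h, ← hz']; exact hv)
      rcases d.entering_cases e with h' | ⟨-, -, h', -⟩ | h' | h' | ⟨-, -, h', -⟩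
      · exact (h'.1 this).elim
      · linarith [hy.2]
      · exact Or.inl ⟨Or.inl h'.1, le_rfl⟩
      · exact Or.inl ⟨Or.inr h'.1, le_rfl⟩
      · linarith [hy.1]
  · have hreg : z ∈ (e.strip d.mbc).region := by
      refine ⟨?_, by simpa [hz] using hy⟩
      simp only [hz, pt_zero]
      constructor
      · refine lt_of_le_of_ne hx.1 fun h => ?_
        rcases hs with h | h | h <;> linarith
      · refine lt_of_le_of_ne hx.2 fun h => ?_
        rcases ht with h | h | h <;> linarith
    have h := d.ball_right hP (z := z) hb (by simpa [hz] using h0)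
    exact Or.inr ⟨ReebEdge.eq_of_region d.mbc hreg h, h0.le⟩

lemma vert_of_mem_ball (d : DiskContext S D p lo hi C ρ v₀ F r) {z : closure D} (hz : reebMk D z ∈ reebVert S D)
    (hb : (z : Plane) ∈ Metric.ball p ρ) : reebMk D z = v₀.1 := by
  rcases lt_trichotomy ((z : Plane) 0) (p 0) with h0 | h0 | h0
  · rcases d.ball_left d.poleStrips hb h0 with h | h <;>
      exact (Strip.notMem_vert d.mbc _ h hz).elim
  · rw [d.v₀_eq, eq_comm, reebMk_eq_iff]; exact d.ball_mid hb h0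
  · exact (Strip.notMem_vert d.mbc _ (d.ball_right d.poleStrips hb h0) hz).elim

end

end DiskContext

/-- The first coordinate of the intersection of a circle `C` with the circle of radius `r` centred
at its right vertical pole `p`. -/
def chordX (p : Plane) (C : PlaneCircle) (r : ℝ) : ℝ := p 0 - r ^ 2 / (2 * C.radius)

/-- Half of the distance of the two points of intersection. -/
def chordH (C : PlaneCircle) (r : ℝ) : ℝ := √(r ^ 2 - (r ^ 2 / (2 * C.radius)) ^ 2)

lemma Strip.vis {S : Set PlaneCircle} {D : Set Plane} (T : Strip S D) {x y : ℝ}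
    (hx : x ∈ Icc T.s T.t) (hy : y ∈ Icc (T.A.f x) (T.B.f x)) {z : Plane} (h0 : z 0 = x)
    (h1 : z 1 ∈ Icc (T.A.f x) (T.B.f x)) : Vis (closure D) (pt x y) z := by
  have := Vis.of_Icc (K := closure D) (fun t ht => T.mem_closure hx ht) hy h1
  rwa [← h0, pt_eta, h0] at this

/-! ### The chord, the boundaries of the three strips, and visibility outside of the disk. -/

namespace DiskContext

variable {S : Set PlaneCircle} {D : Set Plane} {p : Plane} {lo hi : ℝ} {C : PlaneCircle} {ρ : ℝ}
  {v₀ : ReebVertex S D} {F : SegmentData S D p lo hi v₀} {r : ℝ}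

lemma chordX_mem (d : DiskContext S D p lo hi C ρ v₀ F r) : chordX p C r ∈ Ioo (p 0 - ρ) (p 0) := by
  have hR := C.radius_pos
  have h0 := d.r_pos
  have h1 : r ^ 2 / (2 * C.radius) < ρ := by
    rw [div_lt_iff₀ (by positivity)]
    nlinarith [d.r_lt, d.loc.le, d.loc.pos]
  have h2 : 0 < r ^ 2 / (2 * C.radius) := by positivity
  unfold chordX
  constructor <;> linarith

lemma chordH_sq (d : DiskContext S D p lo hi C ρ v₀ F r) :
    chordH C r ^ 2 = r ^ 2 - (r ^ 2 / (2 * C.radius)) ^ 2 :=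
  Real.sq_sqrt (d.loc.chord_pos d.r_pos d.r_lt).le

lemma chordH_pos (d : DiskContext S D p lo hi C ρ v₀ F r) : 0 < chordH C r :=
  Real.sqrt_pos.2 (d.loc.chord_pos d.r_pos d.r_lt)

lemma ball_subset (d : DiskContext S D p lo hi C ρ v₀ F r) :
    Metric.ball p r ⊆ Metric.ball p ρ := Metric.ball_subset_ball d.r_lt.le

/-- With `R` the radius of `C`, nonnegative power says that the squared distance from `p` is at
least `2 * R * (p 0 - z 0)`, and this is at least `r ^ 2` up to the chord. Left of the chord the
disk removes nothing. -/
lemma notMem_ball_of_le (d : DiskContext S D p lo hi C ρ v₀ F r) {z : Plane} (hz : z ∈ closure D)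
    (h : z 0 ≤ chordX p C r) : z ∉ Metric.ball p r := by
  have hR := C.radius_pos
  have h1 := d.loc.pw_nonneg hz
  rw [d.loc.pw_eq] at h1
  rw [mem_ball_plane d.r_pos]
  unfold chordX at h
  have h2 : r ^ 2 / (2 * C.radius) * (2 * C.radius) = r ^ 2 := by field_simp
  nlinarith

lemma notMem_ball_mid_iff (d : DiskContext S D p lo hi C ρ v₀ F r) {y : ℝ} :
    pt (p 0) y ∉ Metric.ball p r ↔ r ≤ |y - p 1| := by
  rw [mem_ball_plane d.r_pos, not_lt]
  simp only [pt_zero, pt_one, sub_self]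
  rw [← sq_abs (y - p 1)]
  constructor
  · intro h; exact le_of_sq_le_sq (by linarith) (abs_nonneg _)
  · intro h; have := pow_le_pow_left₀ d.r_pos.le h 2; linarith

/-- The points of the horizontal line through `p` near `p` are not in the new region. -/
lemma center_notMem (d : DiskContext S D p lo hi C ρ v₀ F r) {x : ℝ} (h1 : p 0 - ρ < x)
    (h2 : x < p 0 + r) : pt x (p 1) ∉ closure D \ Metric.ball p r := by
  rintro ⟨h3, h4⟩
  rcases lt_or_ge x (p 0) with h | h
  · exact d.horizontal_notMem h1 h h3
  · rw [mem_ball_plane d.r_pos] at h4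
    simp only [pt_zero, pt_one, sub_self] at h4
    nlinarith [d.r_pos]

lemma mem_strip₁ (d : DiskContext S D p lo hi C ρ v₀ F r) {x : ℝ} (h1 : p 0 - ρ < x)
    (h2 : x < p 0) : x ∈ Ioo (F.edge₁.strip d.mbc).s (F.edge₁.strip d.mbc).t :=
  ⟨(d.s₁_le d.poleStrips).trans_lt h1, d.poleStrips.t₁ ▸ h2⟩

lemma mem_strip₂ (d : DiskContext S D p lo hi C ρ v₀ F r) {x : ℝ} (h1 : p 0 - ρ < x)
    (h2 : x < p 0) : x ∈ Ioo (F.edge₂.strip d.mbc).s (F.edge₂.strip d.mbc).t :=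
  ⟨(d.s₂_le d.poleStrips).trans_lt h1, d.poleStrips.t₂ ▸ h2⟩

lemma mem_strip₃ (d : DiskContext S D p lo hi C ρ v₀ F r) {x : ℝ} (h1 : p 0 < x)
    (h2 : x < p 0 + ρ) : x ∈ Ioo (F.edge₃.strip d.mbc).s (F.edge₃.strip d.mbc).t :=
  ⟨d.poleStrips.s₃ ▸ h1, h2.trans_le (d.le_t₃ d.poleStrips)⟩

/-- In the large ball the boundary arc would have to be on `C`, but it lies strictly below both
halves of `C`. Over `p 0` the distance of circles from `p` is used instead. -/
lemma lower_left (d : DiskContext S D p lo hi C ρ v₀ F r) {x : ℝ} (h1 : p 0 - ρ < x)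
    (h2 : x ≤ p 0) : pt x ((F.edge₁.strip d.mbc).A.f x) ∈ closure D \ Metric.ball p ρ ∧
      (F.edge₁.strip d.mbc).A.f x < p 1 := by
  have hP := d.poleStrips
  rcases eq_or_lt_of_le h2 with rfl | h2
  · have hm : p 0 ∈ Icc (F.edge₁.strip d.mbc).s (F.edge₁.strip d.mbc).t :=
      hP.t₁ ▸ Strip.right_mem _
    refine ⟨⟨Strip.memA _ hm, fun hb => ?_⟩, hP.A₁⟩
    have h3 := d.le_sub (Strip.A_mem _) (d.pt_edge_carriers _ hm).1 hP.A₁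
    have := (d.abs_coord_lt hb).2.2.1
    simp only [pt_one] at this
    linarith
  · have hm := d.mem_strip₁ h1 h2
    have hr := (F.edge₁.strip d.mbc).reg x hm
    have hB := d.B₁_le hP x
    have hA := d.le_A₂ hP x
    refine ⟨⟨Strip.memA _ (Ioo_subset_Icc_self hm), fun hb => ?_⟩, hr.lt.trans_le hB⟩
    have h0 := d.eq_of_between (Strip.A_mem (F.edge₁.strip d.mbc)) hb
      (by simpa using hr.domA.le) (by simp)
    rw [d.pw_eq_mul hP (by simpa using h1) (by simpa using h2)] at h0
    simp only [pt_zero, pt_one] at h0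
    have := hr.lt
    nlinarith

lemma upper_left (d : DiskContext S D p lo hi C ρ v₀ F r) {x : ℝ} (h1 : p 0 - ρ < x)
    (h2 : x ≤ p 0) : pt x ((F.edge₂.strip d.mbc).B.f x) ∈ closure D \ Metric.ball p ρ ∧
      p 1 < (F.edge₂.strip d.mbc).B.f x := by
  have hP := d.poleStrips
  rcases eq_or_lt_of_le h2 with rfl | h2
  · have hm : p 0 ∈ Icc (F.edge₂.strip d.mbc).s (F.edge₂.strip d.mbc).t :=
      hP.t₂ ▸ Strip.right_mem _
    refine ⟨⟨Strip.memB _ hm, fun hb => ?_⟩, hP.B₂⟩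
    have h3 := d.add_le (Strip.B_mem _) (d.pt_edge_carriers _ hm).2 hP.B₂
    have := (d.abs_coord_lt hb).2.2.2
    simp only [pt_one] at this
    linarith
  · have hm := d.mem_strip₂ h1 h2
    have hr := (F.edge₂.strip d.mbc).reg x hm
    have hB := d.B₁_le hP x
    have hA := d.le_A₂ hP x
    refine ⟨⟨Strip.memB _ (Ioo_subset_Icc_self hm), fun hb => ?_⟩, hA.trans_lt hr.lt⟩
    have h0 := d.eq_of_between (Strip.B_mem (F.edge₂.strip d.mbc)) hb
      (by simpa using hr.domB.le) (by simp)
    rw [d.pw_eq_mul hP (by simpa using h1) (by simpa using h2)] at h0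
    simp only [pt_zero, pt_one] at h0
    have := hr.lt
    nlinarith

/-- In the ball only `C` is left, and for `p 0 ≤ x` its only point is `p`, which is excluded by the
height. -/
lemma arc_right (d : DiskContext S D p lo hi C ρ v₀ F r) {A : Arc} (hA : A.C ∈ S) {x : ℝ}
    (h1 : p 0 ≤ x) (hd : (x - A.C.center 0) ^ 2 ≤ A.C.radius ^ 2) (hne : A.f x ≠ p 1) :
    pt x (A.f x) ∉ Metric.ball p ρ := by
  intro hb
  have h0 := Arc.mem_carrier_f hd
  rw [d.loc.only _ hA _ hb h0, mem_carrier, d.loc.pw_eq] at h0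
  simp only [pt_zero, pt_one] at h0
  have h2 : 0 < (A.f x - p 1) ^ 2 := by
    have := sub_ne_zero.2 hne
    positivity
  nlinarith [mul_nonneg C.radius_pos.le (sub_nonneg.2 h1), sq_nonneg (x - p 0)]

lemma lower_right (d : DiskContext S D p lo hi C ρ v₀ F r) {x : ℝ} (h1 : p 0 ≤ x)
    (h2 : x < p 0 + ρ) : pt x ((F.edge₃.strip d.mbc).A.f x) ∈ closure D \ Metric.ball p ρ ∧
      (F.edge₃.strip d.mbc).A.f x < p 1 := by
  have hP := d.poleStrips
  have hm : x ∈ Icc (F.edge₃.strip d.mbc).s (F.edge₃.strip d.mbc).t :=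
    ⟨hP.s₃ ▸ h1, h2.le.trans (d.le_t₃ hP)⟩
  have h3 := (d.strip₃_between hP h1 h2).1
  exact ⟨⟨Strip.memA _ hm, d.arc_right (Strip.A_mem _) h1 (Strip.sq_le_A _ hm) h3.ne⟩, h3⟩

lemma upper_right (d : DiskContext S D p lo hi C ρ v₀ F r) {x : ℝ} (h1 : p 0 ≤ x)
    (h2 : x < p 0 + ρ) : pt x ((F.edge₃.strip d.mbc).B.f x) ∈ closure D \ Metric.ball p ρ ∧
      p 1 < (F.edge₃.strip d.mbc).B.f x := by
  have hP := d.poleStrips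
  have hm : x ∈ Icc (F.edge₃.strip d.mbc).s (F.edge₃.strip d.mbc).t :=
    ⟨hP.s₃ ▸ h1, h2.le.trans (d.le_t₃ hP)⟩
  have h3 := (d.strip₃_between hP h1 h2).2
  exact ⟨⟨Strip.memB _ hm, d.arc_right (Strip.B_mem _) h1 (Strip.sq_le_B _ hm) h3.ne'⟩, h3⟩

lemma sdiff_ball_mono (d : DiskContext S D p lo hi C ρ v₀ F r) {z : Plane}
    (h : z ∈ closure D \ Metric.ball p ρ) : z ∈ closure D \ Metric.ball p r :=
  ⟨h.1, fun hb => h.2 (d.ball_subset hb)⟩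

lemma chord_mem (d : DiskContext S D p lo hi C ρ v₀ F r) {y : ℝ}
    (hy : y = p 1 - chordH C r ∨ y = p 1 + chordH C r) :
    pt (chordX p C r) y ∈ (⟨p, r, d.r_pos⟩ : PlaneCircle).carrier ∧
    pt (chordX p C r) y ∈ C.carrier ∧
    pt (chordX p C r) y ∈ closure D \ Metric.ball p r := by
  have h := d.loc.inter_mem d.r_pos d.r_lt (y := y) (by
    rw [← d.chordH_sq]; rcases hy with rfl | rfl <;> ring)
  rwa [d.loc.closure_sdiff d.r_pos d.r_lt] at h

lemma chord_low_mem (d : DiskContext S D p lo hi C ρ v₀ F r)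
    (h : pt (chordX p C r) (p 1 - chordH C r) ∈ closure D) :
    (⟨_, h⟩ : closure D) ∈ (F.edge₁.strip d.mbc).region := by
  have hx := d.chordX_mem
  have hH := d.chordH_pos
  have h1 := (d.chord_mem (Or.inl rfl)).1
  have hb : pt (chordX p C r) (p 1 - chordH C r) ∈ Metric.ball p ρ := by
    rw [Metric.mem_ball]; exact (show _ = r from h1).trans_lt d.r_lt
  rcases d.ball_left d.poleStrips (z := ⟨_, h⟩) hb (by simpa using hx.2) with h2 | h2
  · exact h2
  · have h3 := h2.2.1
    have h4 := d.le_A₂ d.poleStrips (chordX p C r)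
    simp only [pt_zero, pt_one] at h3
    linarith

lemma chord_up_mem (d : DiskContext S D p lo hi C ρ v₀ F r)
    (h : pt (chordX p C r) (p 1 + chordH C r) ∈ closure D) :
    (⟨_, h⟩ : closure D) ∈ (F.edge₂.strip d.mbc).region := by
  have hx := d.chordX_mem
  have hH := d.chordH_pos
  have h1 := (d.chord_mem (Or.inr rfl)).1
  have hb : pt (chordX p C r) (p 1 + chordH C r) ∈ Metric.ball p ρ := by
    rw [Metric.mem_ball]; exact (show _ = r from h1).trans_lt d.r_lt
  rcases d.ball_left d.poleStrips (z := ⟨_, h⟩) hb (by simpa using hx.2) with h2 | h2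
  · have h3 := h2.2.2
    have h4 := d.B₁_le d.poleStrips (chordX p C r)
    simp only [pt_zero, pt_one] at h3
    linarith
  · exact h2

/-- The points in the three edges at the disk and in `v₀`. -/
def Near (d : DiskContext S D p lo hi C ρ v₀ F r) (z : closure D) : Prop :=
  z ∈ (F.edge₁.strip d.mbc).region ∨ z ∈ (F.edge₂.strip d.mbc).region ∨ reebMk D z = v₀.1 ∨
    z ∈ (F.edge₃.strip d.mbc).region

/-- The point and the lower boundary are in one old fibre, outside of the disk and both below its
horizontal diameter, so the segment between them misses the disk. The three variants below treat the
other quadrants. -/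
lemma vis_low_left (d : DiskContext S D p lo hi C ρ v₀ F r) {z : closure D} (hz : d.Near z)
    (hb : (z : Plane) ∉ Metric.ball p r) (h1 : p 0 - ρ < (z : Plane) 0)
    (h2 : (z : Plane) 0 ≤ p 0) (h : (z : Plane) 1 < p 1) :
    Vis (closure D \ Metric.ball p r)
      (pt ((z : Plane) 0) ((F.edge₁.strip d.mbc).A.f ((z : Plane) 0))) z := by
  have hP := d.poleStrips
  have hA := d.lower_left h1 h2
  refine Vis.sdiff_of_same_side d.r_pos ?_ (d.sdiff_ball_mono hA.1).2 hb
    (Or.inl ⟨by simpa using hA.2.le, h.le⟩)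
  rcases hz with hz | hz | hz | hz
  · exact Strip.vis _ (Ioo_subset_Icc_self hz.1)
      ⟨le_rfl, ((F.edge₁.strip d.mbc).reg _ hz.1).lt.le⟩ rfl hz.2
  · linarith [d.le_A₂ hP ((z : Plane) 0), hz.2.1]
  · obtain ⟨h3, h4⟩ := d.mk_eq_v₀.1 hz
    rw [h3]
    have := d.vis_mid d.lo_le_A₁ h4
    rwa [← h3, pt_eta, h3] at this
  · linarith [hz.1.1, hP.s₃]

lemma vis_up_left (d : DiskContext S D p lo hi C ρ v₀ F r) {z : closure D} (hz : d.Near z)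
    (hb : (z : Plane) ∉ Metric.ball p r) (h1 : p 0 - ρ < (z : Plane) 0)
    (h2 : (z : Plane) 0 ≤ p 0) (h : p 1 < (z : Plane) 1) :
    Vis (closure D \ Metric.ball p r)
      (pt ((z : Plane) 0) ((F.edge₂.strip d.mbc).B.f ((z : Plane) 0))) z := by
  have hP := d.poleStrips
  have hA := d.upper_left h1 h2
  refine Vis.sdiff_of_same_side d.r_pos ?_ (d.sdiff_ball_mono hA.1).2 hb
    (Or.inr ⟨by simpa using hA.2.le, h.le⟩)
  rcases hz with hz | hz | hz | hz
  · linarith [d.B₁_le hP ((z : Plane) 0), hz.2.2]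
  · exact Strip.vis _ (Ioo_subset_Icc_self hz.1)
      ⟨((F.edge₂.strip d.mbc).reg _ hz.1).lt.le, le_rfl⟩ rfl hz.2
  · obtain ⟨h3, h4⟩ := d.mk_eq_v₀.1 hz
    rw [h3]
    have := d.vis_mid d.B₂_le_hi h4
    rwa [← h3, pt_eta, h3] at this
  · linarith [hz.1.1, hP.s₃]

lemma vis_low_right (d : DiskContext S D p lo hi C ρ v₀ F r) {z : closure D} (hz : d.Near z)
    (hb : (z : Plane) ∉ Metric.ball p r) (h1 : p 0 ≤ (z : Plane) 0)
    (h2 : (z : Plane) 0 < p 0 + ρ) (h : (z : Plane) 1 < p 1) :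
    Vis (closure D \ Metric.ball p r)
      (pt ((z : Plane) 0) ((F.edge₃.strip d.mbc).A.f ((z : Plane) 0))) z := by
  have hP := d.poleStrips
  have hA := d.lower_right h1 h2
  refine Vis.sdiff_of_same_side d.r_pos ?_ (d.sdiff_ball_mono hA.1).2 hb
    (Or.inl ⟨by simpa using hA.2.le, h.le⟩)
  rcases hz with hz | hz | hz | hz
  · linarith [hz.1.2, hP.t₁]
  · linarith [hz.1.2, hP.t₂]
  · obtain ⟨h3, h4⟩ := d.mk_eq_v₀.1 hz
    rw [h3]
    have := d.vis_mid d.lo_le_A₃ h4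
    rwa [← h3, pt_eta, h3] at this
  · exact Strip.vis _ (Ioo_subset_Icc_self hz.1)
      ⟨le_rfl, ((F.edge₃.strip d.mbc).reg _ hz.1).lt.le⟩ rfl hz.2

lemma vis_up_right (d : DiskContext S D p lo hi C ρ v₀ F r) {z : closure D} (hz : d.Near z)
    (hb : (z : Plane) ∉ Metric.ball p r) (h1 : p 0 ≤ (z : Plane) 0)
    (h2 : (z : Plane) 0 < p 0 + ρ) (h : p 1 < (z : Plane) 1) :
    Vis (closure D \ Metric.ball p r)
      (pt ((z : Plane) 0) ((F.edge₃.strip d.mbc).B.f ((z : Plane) 0))) z := by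
  have hP := d.poleStrips
  have hA := d.upper_right h1 h2
  refine Vis.sdiff_of_same_side d.r_pos ?_ (d.sdiff_ball_mono hA.1).2 hb
    (Or.inr ⟨by simpa using hA.2.le, h.le⟩)
  rcases hz with hz | hz | hz | hz
  · linarith [hz.1.2, hP.t₁]
  · linarith [hz.1.2, hP.t₂]
  · obtain ⟨h3, h4⟩ := d.mk_eq_v₀.1 hz
    rw [h3]
    have := d.vis_mid d.B₃_le_hi h4
    rwa [← h3, pt_eta, h3] at this
  · exact Strip.vis _ (Ioo_subset_Icc_self hz.1)
      ⟨((F.edge₃.strip d.mbc).reg _ hz.1).lt.le, le_rfl⟩ rfl hz.2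

/-- The right vertical pole of the new circle. -/
lemma vis_end (d : DiskContext S D p lo hi C ρ v₀ F r) {y : ℝ}
    (hy : y ∈ Icc ((F.edge₃.strip d.mbc).A.f (p 0 + r)) ((F.edge₃.strip d.mbc).B.f (p 0 + r))) :
    Vis (closure D \ Metric.ball p r) (pt (p 0 + r) (p 1)) (pt (p 0 + r) y) := by
  have h0 := d.r_pos
  have h1 := d.r_lt
  have hm := d.mem_strip₃ (x := p 0 + r) (by linarith) (by linarith)
  have h3 := d.strip₃_between d.poleStrips (x := p 0 + r) (by linarith) (by linarith)
  refine Vis.sdiff_of_le_abs h0 ?_ (by simp [abs_of_pos h0])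
  exact Strip.vis _ (Ioo_subset_Icc_self hm) ⟨h3.1.le, h3.2.le⟩ (by simp) (by simpa using hy)

lemma end_mem (d : DiskContext S D p lo hi C ρ v₀ F r) :
    pt (p 0 + r) (p 1) ∈ closure D \ Metric.ball p r := by
  have h0 := d.r_pos
  have h1 := d.r_lt
  have h3 := d.strip₃_between d.poleStrips (x := p 0 + r) (by linarith) (by linarith)
  exact (d.vis_end (y := p 1) ⟨h3.1.le, h3.2.le⟩).left_mem

lemma end_mem_region (d : DiskContext S D p lo hi C ρ v₀ F r)
    (h : pt (p 0 + r) (p 1) ∈ closure D) :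
    (⟨_, h⟩ : closure D) ∈ (F.edge₃.strip d.mbc).region := by
  have h0 := d.r_pos
  have h1 := d.r_lt
  have h3 := d.strip₃_between d.poleStrips (x := p 0 + r) (by linarith) (by linarith)
  exact ⟨by simpa using d.mem_strip₃ (x := p 0 + r) (by linarith) (by linarith),
    by simpa using ⟨h3.1.le, h3.2.le⟩⟩

/-- The vertices other than `v₀` are not changed. -/
lemma vis_vert (d : DiskContext S D p lo hi C ρ v₀ F r) {z w : closure D}
    (hz : reebMk D z ∈ reebVert S D) (hne : reebMk D z ≠ v₀.1) (h : Vis (closure D) z w) :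
    Vis (closure D \ Metric.ball p r) z w := by
  refine h.sdiff fun q hq hb => hne ?_
  have h1 : reebMk D z = reebMk D ⟨q, hq.right_mem⟩ := reebMk_eq_iff.2 hq
  rw [h1]
  exact d.vert_of_mem_ball (h1 ▸ hz) (d.ball_subset hb)

end DiskContext

/-! ### Points and curves representing the modified V-digraph. -/

namespace SegmentData

variable {S : Set PlaneCircle} {D : Set Plane} {p : Plane} {lo hi : ℝ} {v₀ : ReebVertex S D}

open Classical in
/-- Points representing the vertices of the modified graph. -/
def vertexPoint (F : SegmentData S D p lo hi v₀) (C : PlaneCircle) (r : ℝ) :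
    ReebVertex S D ⊕ F.NewVertex → Plane
  | Sum.inl u =>
    if u = v₀ then pt (p 0 + r) (p 1) else ((reebMk_surjective D u.1).choose : closure D)
  | Sum.inr .v1 => pt (chordX p C r) (p 1 - chordH C r)
  | Sum.inr .v2 => pt (chordX p C r) (p 1 + chordH C r)
  | Sum.inr (.v3 _) => pt (p 0) lo
  | Sum.inr (.v4 _) => pt (p 0) hi

open Classical in
/-- Curves representing the edges of the modified graph. -/
def edgeCurve (F : SegmentData S D p lo hi v₀) (hM : IsMBC S D) :
    ReebEdge S D ⊕ F.NewEdge → ℝ → ℝ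
  | Sum.inl e => (e.strip hM).A.f
  -- If `v₃` is present, this edge stops over `p 0` and only the first branch matters. Otherwise the
  -- curve runs on below the disk to the new right pole, and the branches agree over `p 0`.
  | Sum.inr .from1 => fun x =>
    if x ≤ p 0 then (F.edge₁.strip hM).A.f x else (F.edge₃.strip hM).A.f x
  | Sum.inr .from2 => fun x =>
    if x ≤ p 0 then (F.edge₂.strip hM).B.f x else (F.edge₃.strip hM).B.f x
  | Sum.inr (.from3 _) => (F.edge₃.strip hM).A.f
  | Sum.inr (.from4 _) => (F.edge₃.strip hM).B.f

lemma vertexPoint_self (F : SegmentData S D p lo hi v₀) (C : PlaneCircle) (r : ℝ) :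
    F.vertexPoint C r (Sum.inl v₀) = pt (p 0 + r) (p 1) := if_pos rfl

lemma exists_vertexPoint (F : SegmentData S D p lo hi v₀) (C : PlaneCircle) (r : ℝ)
    {u : ReebVertex S D} (h : u ≠ v₀) :
    ∃ z : closure D, F.vertexPoint C r (Sum.inl u) = z ∧ reebMk D z = u.1 :=
  ⟨_, if_neg h, (reebMk_surjective D u.1).choose_spec⟩

lemma vertexPoint_zero (F : SegmentData S D p lo hi v₀) (C : PlaneCircle) (r : ℝ)
    {u : ReebVertex S D} (h : u ≠ v₀) :
    F.vertexPoint C r (Sum.inl u) 0 = reebHeight D u.1 := by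
  obtain ⟨z, h1, h2⟩ := F.exists_vertexPoint C r h
  rw [h1, ← h2, reebHeight_mk]

lemma newTgt_from1 (F : SegmentData S D p lo hi v₀) :
    (∃ h, F.newTgt .from1 = Sum.inr (.v3 h)) ∨ (¬ F.HasV3 ∧ F.newTgt .from1 = Sum.inl v₀) := by
  by_cases h : F.HasV3
  · exact Or.inl ⟨h, dif_pos h⟩
  · exact Or.inr ⟨h, dif_neg h⟩

lemma newTgt_from2 (F : SegmentData S D p lo hi v₀) :
    (∃ h, F.newTgt .from2 = Sum.inr (.v4 h)) ∨ (¬ F.HasV4 ∧ F.newTgt .from2 = Sum.inl v₀) := by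
  by_cases h : F.HasV4
  · exact Or.inl ⟨h, dif_pos h⟩
  · exact Or.inr ⟨h, dif_neg h⟩

instance (F : SegmentData S D p lo hi v₀) : Finite F.NewVertex := by
  classical
  refine Finite.of_injective (β := Fin 4)
    (fun | .v1 => 0 | .v2 => 1 | .v3 _ => 2 | .v4 _ => 3) ?_
  rintro (_ | _ | _ | _) (_ | _ | _ | _) h <;> first | rfl | simp at h

instance (F : SegmentData S D p lo hi v₀) : Finite F.NewEdge := by
  classical
  refine Finite.of_injective (β := Fin 4)
    (fun | .from1 => 0 | .from2 => 1 | .from3 _ => 2 | .from4 _ => 3) ?_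
  rintro (_ | _ | _ | _) (_ | _ | _ | _) h <;> first | rfl | simp at h

end SegmentData

namespace DiskContext

variable {S : Set PlaneCircle} {D : Set Plane} {p : Plane} {lo hi : ℝ} {C : PlaneCircle} {ρ : ℝ}
  {v₀ : ReebVertex S D} {F : SegmentData S D p lo hi v₀} {r : ℝ}

lemma lo_mem (d : DiskContext S D p lo hi C ρ v₀ F r) :
    pt (p 0) lo ∈ closure D \ Metric.ball p r := by
  have h1 := d.lo_le
  have h2 := d.r_lt
  refine ⟨d.fib.mem _ ⟨le_rfl, d.fib.le⟩, d.notMem_ball_mid_iff.2 ?_⟩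
  rw [abs_of_neg (by linarith [d.r_pos])]; linarith

lemma hi_mem (d : DiskContext S D p lo hi C ρ v₀ F r) :
    pt (p 0) hi ∈ closure D \ Metric.ball p r := by
  have h1 := d.le_hi
  have h2 := d.r_lt
  refine ⟨d.fib.mem _ ⟨d.fib.le, le_rfl⟩, d.notMem_ball_mid_iff.2 ?_⟩
  rw [abs_of_pos (by linarith [d.r_pos])]; linarith

lemma near_mid (d : DiskContext S D p lo hi C ρ v₀ F r) {z : closure D}
    (h : (z : Plane) 0 = p 0) (hz : d.Near z) : reebMk D z = v₀.1 := by
  rcases hz with hz | hz | hz | hz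
  · have := hz.1.2; rw [d.poleStrips.t₁, h] at this; exact (lt_irrefl _ this).elim
  · have := hz.1.2; rw [d.poleStrips.t₂, h] at this; exact (lt_irrefl _ this).elim
  · exact hz
  · have := hz.1.1; rw [d.poleStrips.s₃, h] at this; exact (lt_irrefl _ this).elim

lemma vis_lo (d : DiskContext S D p lo hi C ρ v₀ F r) {y : ℝ} (h1 : lo ≤ y) (h2 : y ≤ p 1 - r) :
    Vis (closure D \ Metric.ball p r) (pt (p 0) lo) (pt (p 0) y) := by
  have h3 := d.lt_hi
  have h4 := d.r_pos
  refine Vis.sdiff_of_same_side d.r_pos (d.vis_mid ⟨le_rfl, d.fib.le⟩ ⟨h1, by linarith⟩)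
    d.lo_mem.2 (d.notMem_ball_mid_iff.2 ?_) (Or.inl ⟨by simpa using d.lo_lt.le, by
      simp only [pt_one]; linarith⟩)
  rw [abs_of_neg (by linarith)]; linarith

lemma vis_hi (d : DiskContext S D p lo hi C ρ v₀ F r) {y : ℝ} (h1 : y ≤ hi) (h2 : p 1 + r ≤ y) :
    Vis (closure D \ Metric.ball p r) (pt (p 0) hi) (pt (p 0) y) := by
  have h3 := d.lo_lt
  have h4 := d.r_pos
  refine Vis.sdiff_of_same_side d.r_pos (d.vis_mid ⟨d.fib.le, le_rfl⟩ ⟨by linarith, h1⟩)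
    d.hi_mem.2 (d.notMem_ball_mid_iff.2 ?_) (Or.inr ⟨by simpa using d.lt_hi.le, by
      simp only [pt_one]; linarith⟩)
  rw [abs_of_pos (by linarith)]; linarith

/-- A point of the fibre of `p` outside of the disk. -/
lemma mid_cases (d : DiskContext S D p lo hi C ρ v₀ F r) {z : closure D}
    (hz : reebMk D z = v₀.1) (hb : (z : Plane) ∉ Metric.ball p r) :
    ((z : Plane) 1 < p 1 ∧ Vis (closure D \ Metric.ball p r) (pt (p 0) lo) z) ∨
    (p 1 < (z : Plane) 1 ∧ Vis (closure D \ Metric.ball p r) (pt (p 0) hi) z) := by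
  obtain ⟨h1, h2⟩ := d.mk_eq_v₀.1 hz
  have hr := d.r_pos
  have he : pt (p 0) ((z : Plane) 1) = z := by rw [← h1, pt_eta]
  rw [← he, d.notMem_ball_mid_iff] at hb
  rw [← he]
  simp only [pt_one]
  rcases le_abs.1 hb with h | h
  · exact Or.inr ⟨by linarith, d.vis_hi h2.2 (by linarith)⟩
  · exact Or.inl ⟨by linarith, d.vis_lo h2.1 (by linarith)⟩

lemma vertexPoint_mem (d : DiskContext S D p lo hi C ρ v₀ F r) (u) :
    F.vertexPoint C r u ∈ closure D \ Metric.ball p r := by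
  rcases u with u | (_ | _ | _ | _)
  · by_cases h : u = v₀
    · rw [h, F.vertexPoint_self]; exact d.end_mem
    · obtain ⟨z, h1, h2⟩ := F.exists_vertexPoint C r h
      rw [h1]
      exact (d.vis_vert (h2 ▸ u.2) (fun h' => h (Subtype.ext (h2 ▸ h'))) (Vis.refl z.2)).left_mem
  · exact (d.chord_mem (Or.inl rfl)).2.2
  · exact (d.chord_mem (Or.inr rfl)).2.2
  · exact d.lo_mem
  · exact d.hi_mem

/-- Only the edge departing at `p` gets a shorter interval. The others departing from `v₀` start in
the part of the cut segment below or above the disk, which `v₃` or `v₄` represents. -/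
lemma src_cases (d : DiskContext S D p lo hi C ρ v₀ F r) (e : ReebEdge S D) :
    (e ≠ F.edge₃ ∧ F.vertexPoint C r (F.oldSrc e) 0 = (e.strip d.mbc).s ∧
      Vis (closure D \ Metric.ball p r) (F.vertexPoint C r (F.oldSrc e))
        (pt (e.strip d.mbc).s ((e.strip d.mbc).A.f (e.strip d.mbc).s))) ∨
    (e = F.edge₃ ∧ F.vertexPoint C r (F.oldSrc e) = pt (p 0 + r) (p 1)) := by
  have hP := d.poleStrips
  have h0 := d.r_lt
  rcases d.departing_cases e with ⟨h1, h2⟩ | ⟨h1, h2, h3, h4, h5⟩ | ⟨h1, h2⟩ | ⟨h1, h2, h3, h4, h5⟩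
  · refine Or.inl ⟨?_, ?_, ?_⟩
    · rintro rfl; exact h1 (F.er _).2
    · rw [h2, F.vertexPoint_zero C r h1, e.strip_s]
    · obtain ⟨z, h3, h4⟩ := F.exists_vertexPoint C r h1
      rw [h2, h3]
      refine d.vis_vert (w := ⟨_, Strip.memA _ (Strip.left_mem _)⟩) (h4 ▸ e.src.2)
        (fun h' => h1 (Subtype.ext (h4 ▸ h'))) (reebMk_eq_iff.1 ?_)
      rw [h4, e.src_eq d.mbc, Strip.curve_of_mem _ (Strip.left_mem _)]
  · have hle := Strip.le _ (Strip.left_mem (e.strip d.mbc))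
    rw [h1] at hle ⊢
    rw [h5]
    refine Or.inl ⟨?_, pt_zero _ _, d.vis_lo h2 (by linarith)⟩
    rintro rfl
    linarith [hP.B₃, d.loc.pos]
  · exact Or.inr ⟨h1, by rw [h2, F.vertexPoint_self]⟩
  · have hle := Strip.le _ (Strip.left_mem (e.strip d.mbc))
    rw [h1] at hle ⊢
    rw [h5]
    refine Or.inl ⟨?_, pt_zero _ _, d.vis_hi (by linarith) (by linarith)⟩
    rintro rfl
    linarith [hP.A₃, d.loc.pos]

lemma tgt_cases (d : DiskContext S D p lo hi C ρ v₀ F r) (e : ReebEdge S D) :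
    (e ≠ F.edge₁ ∧ e ≠ F.edge₂ ∧ F.vertexPoint C r (F.oldTgt e) 0 = (e.strip d.mbc).t ∧
      Vis (closure D \ Metric.ball p r) (F.vertexPoint C r (F.oldTgt e))
        (pt (e.strip d.mbc).t ((e.strip d.mbc).A.f (e.strip d.mbc).t))) ∨
    (e = F.edge₁ ∧ F.oldTgt e = Sum.inr .v1) ∨ (e = F.edge₂ ∧ F.oldTgt e = Sum.inr .v2) := by
  have hP := d.poleStrips
  have h0 := d.r_lt
  rcases d.entering_cases e with ⟨h1, h2⟩ | ⟨h1, h2, h3, h4, h5⟩ | h1 | h1 | ⟨h1, h2, h3, h4, h5⟩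
  · refine Or.inl ⟨?_, ?_, ?_, ?_⟩
    · rintro rfl; exact h1 (F.el _).2
    · rintro rfl; exact h1 (F.el _).2
    · rw [h2, F.vertexPoint_zero C r h1, e.strip_t]
    · obtain ⟨z, h3, h4⟩ := F.exists_vertexPoint C r h1
      rw [h2, h3]
      refine d.vis_vert (w := ⟨_, Strip.memA _ (Strip.right_mem _)⟩) (h4 ▸ e.tgt.2)
        (fun h' => h1 (Subtype.ext (h4 ▸ h'))) (reebMk_eq_iff.1 ?_)
      rw [h4, e.tgt_eq d.mbc, Strip.curve_of_mem _ (Strip.right_mem _)]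
  · have hle := Strip.le _ (Strip.right_mem (e.strip d.mbc))
    rw [h1] at hle ⊢
    rw [h5]
    refine Or.inl ⟨?_, ?_, pt_zero _ _, d.vis_lo h2 (by linarith)⟩
    · rintro rfl; linarith [hP.B₁, d.loc.pos]
    · rintro rfl; linarith [hP.B₂, d.loc.pos]
  · exact Or.inr (Or.inl h1)
  · exact Or.inr (Or.inr h1)
  · have hle := Strip.le _ (Strip.right_mem (e.strip d.mbc))
    rw [h1] at hle ⊢
    rw [h5]
    refine Or.inl ⟨?_, ?_, pt_zero _ _, d.vis_hi (by linarith) (by linarith)⟩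
    · rintro rfl; linarith [hP.A₁, d.loc.pos]
    · rintro rfl; linarith [hP.A₂, d.loc.pos]

/-- The interval over which an old edge is unchanged. -/
lemma src_zero (d : DiskContext S D p lo hi C ρ v₀ F r) (e : ReebEdge S D) :
    (e ≠ F.edge₃ ∧ F.vertexPoint C r (F.oldSrc e) 0 = (e.strip d.mbc).s) ∨
    (e = F.edge₃ ∧ (e.strip d.mbc).s = p 0 ∧ F.vertexPoint C r (F.oldSrc e) 0 = p 0 + r) := by
  rcases d.src_cases e with h | ⟨rfl, h⟩
  · exact Or.inl ⟨h.1, h.2.1⟩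
  · exact Or.inr ⟨rfl, d.poleStrips.s₃, by rw [h, pt_zero]⟩

lemma tgt_zero (d : DiskContext S D p lo hi C ρ v₀ F r) (e : ReebEdge S D) :
    (e ≠ F.edge₁ ∧ e ≠ F.edge₂ ∧ F.vertexPoint C r (F.oldTgt e) 0 = (e.strip d.mbc).t) ∨
    ((e = F.edge₁ ∨ e = F.edge₂) ∧ (e.strip d.mbc).t = p 0 ∧ (e.strip d.mbc).s ≤ p 0 - ρ ∧
      F.vertexPoint C r (F.oldTgt e) 0 = chordX p C r) := by
  rcases d.tgt_cases e with h | ⟨rfl, h⟩ | ⟨rfl, h⟩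
  · exact Or.inl ⟨h.1, h.2.1, h.2.2.1⟩
  · exact Or.inr ⟨Or.inl rfl, d.poleStrips.t₁, d.s₁_le d.poleStrips, by rw [h]; exact pt_zero _ _⟩
  · exact Or.inr ⟨Or.inr rfl, d.poleStrips.t₂, d.s₂_le d.poleStrips, by rw [h]; exact pt_zero _ _⟩

/-- No edge is shortened at both ends, and the three edges at `p` extend over a length of at least
`ρ`, more than what is cut off. -/
lemma old_lt (d : DiskContext S D p lo hi C ρ v₀ F r) (e : ReebEdge S D) :
    F.vertexPoint C r (F.oldSrc e) 0 < F.vertexPoint C r (F.oldTgt e) 0 := by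
  have h1 := (e.strip d.mbc).lt
  have h2 := d.chordX_mem
  have h3 := d.edge₃_ne
  rcases d.src_zero e with ⟨-, h⟩ | ⟨he, h', h⟩ <;>
    rcases d.tgt_zero e with ⟨-, -, k⟩ | ⟨k', -, k'', k⟩
  · rw [h, k]; exact h1
  · rw [h, k]; exact k''.trans_lt h2.1
  · rw [h, k, he]; have := d.le_t₃ d.poleStrips; linarith [d.r_lt]
  · rw [he] at k'
    exact (k'.elim h3.1 h3.2).elim

lemma old_bounds (d : DiskContext S D p lo hi C ρ v₀ F r) (e : ReebEdge S D) :
    (e.strip d.mbc).s ≤ F.vertexPoint C r (F.oldSrc e) 0 ∧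
    F.vertexPoint C r (F.oldTgt e) 0 ≤ (e.strip d.mbc).t ∧
    (e = F.edge₁ ∨ e = F.edge₂ → F.vertexPoint C r (F.oldTgt e) 0 = chordX p C r) ∧
    (e = F.edge₃ → F.vertexPoint C r (F.oldSrc e) 0 = p 0 + r) := by
  have h2 := d.chordX_mem
  refine ⟨?_, ?_, ?_, ?_⟩
  · rcases d.src_zero e with ⟨-, h⟩ | ⟨-, h', h⟩
    · exact h.ge
    · rw [h, h']; linarith [d.r_pos]
  · rcases d.tgt_zero e with ⟨-, -, k⟩ | ⟨-, k', -, k⟩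
    · exact k.le
    · rw [k, k']; exact h2.2.le
  · rcases d.tgt_zero e with ⟨k, k', -⟩ | ⟨-, -, -, k⟩
    · rintro (h | h)
      exacts [(k h).elim, (k' h).elim]
    · exact fun _ => k
  · rcases d.src_zero e with ⟨h, -⟩ | ⟨-, -, h⟩
    · exact fun h' => (h h').elim
    · exact fun _ => h

/-- Among the edges only the three at `p` reach the disk. The entering two now stop at the chord, up
to which the disk does not meet the closure, and the departing one starts at the abscissa where the
disk ends. -/
lemma old_fiber (d : DiskContext S D p lo hi C ρ v₀ F r) (e : ReebEdge S D) {x y : ℝ}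
    (hx : x ∈ Icc (F.vertexPoint C r (F.oldSrc e) 0) (F.vertexPoint C r (F.oldTgt e) 0))
    (hy : y ∈ Icc ((e.strip d.mbc).A.f x) ((e.strip d.mbc).B.f x)) :
    pt x y ∈ closure D \ Metric.ball p r := by
  obtain ⟨h1, h2, h3, h4⟩ := d.old_bounds e
  have hx' : x ∈ Icc (e.strip d.mbc).s (e.strip d.mbc).t := ⟨h1.trans hx.1, hx.2.trans h2⟩
  have hK := Strip.mem_closure _ hx' hy
  refine ⟨hK, fun hb => ?_⟩
  rcases d.edge_of_mem_ball hx' hy (d.ball_subset hb) with ⟨h, -⟩ | ⟨h, -⟩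
  · exact d.notMem_ball_of_le hK (by rw [pt_zero, ← h3 h]; exact hx.2) hb
  · have h5 := hx.1
    rw [h4 h] at h5
    rw [mem_ball_plane d.r_pos] at hb
    simp only [pt_zero, pt_one] at hb
    nlinarith [sq_nonneg (y - p 1), d.r_pos]

end DiskContext

namespace DiskContext

variable {S : Set PlaneCircle} {D : Set Plane} {p : Plane} {lo hi : ℝ} {C : PlaneCircle} {ρ : ℝ}
  {v₀ : ReebVertex S D} {F : SegmentData S D p lo hi v₀} {r : ℝ}

lemma near_chord_low (d : DiskContext S D p lo hi C ρ v₀ F r) :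
    Vis (closure D \ Metric.ball p r) (pt (chordX p C r) (p 1 - chordH C r))
      (pt (chordX p C r) ((F.edge₁.strip d.mbc).A.f (chordX p C r))) := by
  have h1 := (d.chord_mem (Or.inl rfl)).2.2
  have hx := d.chordX_mem
  have := d.vis_low_left (z := ⟨_, h1.1⟩) (Or.inl (d.chord_low_mem h1.1)) h1.2
    (by simpa using hx.1) (by simpa using hx.2.le) (by simpa using d.chordH_pos)
  simp only [pt_zero] at this
  exact this.symm

lemma near_chord_up (d : DiskContext S D p lo hi C ρ v₀ F r) :
    Vis (closure D \ Metric.ball p r) (pt (chordX p C r) (p 1 + chordH C r))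
      (pt (chordX p C r) ((F.edge₂.strip d.mbc).B.f (chordX p C r))) := by
  have h1 := (d.chord_mem (Or.inr rfl)).2.2
  have hx := d.chordX_mem
  have := d.vis_up_left (z := ⟨_, h1.1⟩) (Or.inr (Or.inl (d.chord_up_mem h1.1))) h1.2
    (by simpa using hx.1) (by simpa using hx.2.le) (by simpa using d.chordH_pos)
  simp only [pt_zero] at this
  exact this.symm

lemma old_target_vis (d : DiskContext S D p lo hi C ρ v₀ F r) (e : ReebEdge S D) :
    Vis (closure D \ Metric.ball p r) (F.vertexPoint C r (F.oldTgt e))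
      (pt (F.vertexPoint C r (F.oldTgt e) 0)
        ((e.strip d.mbc).A.f (F.vertexPoint C r (F.oldTgt e) 0))) := by
  have hx := d.chordX_mem
  rcases d.tgt_cases e with ⟨-, -, h1, h2⟩ | ⟨rfl, h⟩ | ⟨rfl, h⟩
  · rw [h1]; exact h2
  · rw [h]
    simp only [SegmentData.vertexPoint, pt_zero]
    exact d.near_chord_low
  · rw [h]
    simp only [SegmentData.vertexPoint, pt_zero]
    have h1 := (d.chord_mem (Or.inr rfl)).2.2
    have hm := Ioo_subset_Icc_self (d.mem_strip₂ hx.1 hx.2)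
    have h3 := d.chord_up_mem h1.1
    have h4 := h3.2
    simp only [pt_zero, pt_one] at h4
    have hle := d.le_A₂ d.poleStrips (chordX p C r)
    refine Vis.sdiff_of_same_side d.r_pos
      (Strip.vis _ hm ⟨le_rfl, Strip.le _ hm⟩ (by simp) (by simpa using h4)).symm h1.2
      (d.notMem_ball_of_le (Strip.memA _ hm) (by simp)) (Or.inr ⟨?_, by simpa using hle⟩)
    simp only [pt_one]; linarith [d.chordH_pos]

lemma old_source_vis (d : DiskContext S D p lo hi C ρ v₀ F r) (e : ReebEdge S D) :
    Vis (closure D \ Metric.ball p r) (F.vertexPoint C r (F.oldSrc e))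
      (pt (F.vertexPoint C r (F.oldSrc e) 0)
        ((e.strip d.mbc).A.f (F.vertexPoint C r (F.oldSrc e) 0))) := by
  rcases d.src_cases e with ⟨-, h1, h2⟩ | ⟨rfl, h⟩
  · rw [h1]; exact h2
  · rw [h, pt_zero]
    refine d.vis_end ⟨le_rfl, ?_⟩
    have := d.strip₃_between d.poleStrips (x := p 0 + r) (by linarith [d.r_pos])
      (by linarith [d.r_lt])
    linarith

/-- The points of a curve of a new edge. -/
structure NewPoint (d : DiskContext S D p lo hi C ρ v₀ F r) (e : F.NewEdge) (x : ℝ) : Prop where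
  mem : pt x (F.edgeCurve d.mbc (Sum.inr e) x) ∈ closure D \ Metric.ball p r
  near : d.Near ⟨_, mem.1⟩
  side : (F.edgeCurve d.mbc (Sum.inr e) x < p 1 ∧ (e = .from1 ∨ ∃ h, e = .from3 h)) ∨
    (p 1 < F.edgeCurve d.mbc (Sum.inr e) x ∧ (e = .from2 ∨ ∃ h, e = .from4 h))

lemma near_of_left₁ (d : DiskContext S D p lo hi C ρ v₀ F r) {x : ℝ} (h1 : p 0 - ρ < x)
    (h2 : x ≤ p 0) (h : pt x ((F.edge₁.strip d.mbc).A.f x) ∈ closure D) : d.Near ⟨_, h⟩ := by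
  rcases eq_or_lt_of_le h2 with rfl | h2
  · exact Or.inr (Or.inr (Or.inl (d.mk_eq_v₀.2 ⟨by simp, by simpa using d.lo_le_A₁⟩)))
  · have hm := d.mem_strip₁ h1 h2
    exact Or.inl ⟨by simpa using hm, by simpa using Strip.le _ (Ioo_subset_Icc_self hm)⟩

lemma near_of_left₂ (d : DiskContext S D p lo hi C ρ v₀ F r) {x : ℝ} (h1 : p 0 - ρ < x)
    (h2 : x ≤ p 0) (h : pt x ((F.edge₂.strip d.mbc).B.f x) ∈ closure D) : d.Near ⟨_, h⟩ := by
  rcases eq_or_lt_of_le h2 with rfl | h2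
  · exact Or.inr (Or.inr (Or.inl (d.mk_eq_v₀.2 ⟨by simp, by simpa using d.B₂_le_hi⟩)))
  · have hm := d.mem_strip₂ h1 h2
    exact Or.inr (Or.inl ⟨by simpa using hm, by simpa using Strip.le _ (Ioo_subset_Icc_self hm)⟩)

lemma near_of_right (d : DiskContext S D p lo hi C ρ v₀ F r) {x y : ℝ} (h1 : p 0 ≤ x)
    (h2 : x < p 0 + ρ) (hy : y = (F.edge₃.strip d.mbc).A.f x ∨ y = (F.edge₃.strip d.mbc).B.f x)
    (h : pt x y ∈ closure D) : d.Near ⟨_, h⟩ := by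
  rcases eq_or_lt_of_le h1 with rfl | h1
  · refine Or.inr (Or.inr (Or.inl (d.mk_eq_v₀.2 ⟨by simp, ?_⟩)))
    simp only [pt_one]
    rcases hy with rfl | rfl
    exacts [d.lo_le_A₃, d.B₃_le_hi]
  · have hm := d.mem_strip₃ h1 h2
    have hle := Strip.le _ (Ioo_subset_Icc_self hm)
    refine Or.inr (Or.inr (Or.inr ⟨by simpa using hm, ?_⟩))
    simp only [pt_zero, pt_one]
    rcases hy with rfl | rfl
    exacts [⟨le_rfl, hle⟩, ⟨hle, le_rfl⟩]

lemma newPoint_from1 (d : DiskContext S D p lo hi C ρ v₀ F r) {x : ℝ} (h1 : p 0 - ρ < x)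
    (h2 : x < p 0 + ρ) : d.NewPoint .from1 x := by
  by_cases h : x ≤ p 0
  · have hA := d.lower_left h1 h
    have he : F.edgeCurve d.mbc (Sum.inr .from1) x = (F.edge₁.strip d.mbc).A.f x := if_pos h
    refine ⟨he ▸ d.sdiff_ball_mono hA.1, ?_, Or.inl ⟨he ▸ hA.2, Or.inl rfl⟩⟩
    simp only [he]
    exact d.near_of_left₁ h1 h _
  · have hA := d.lower_right (not_le.1 h).le h2
    have he : F.edgeCurve d.mbc (Sum.inr .from1) x = (F.edge₃.strip d.mbc).A.f x := if_neg h
    refine ⟨he ▸ d.sdiff_ball_mono hA.1, ?_, Or.inl ⟨he ▸ hA.2, Or.inl rfl⟩⟩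
    exact d.near_of_right (not_le.1 h).le h2 (Or.inl he) _

lemma newPoint_from2 (d : DiskContext S D p lo hi C ρ v₀ F r) {x : ℝ} (h1 : p 0 - ρ < x)
    (h2 : x < p 0 + ρ) : d.NewPoint .from2 x := by
  by_cases h : x ≤ p 0
  · have hA := d.upper_left h1 h
    have he : F.edgeCurve d.mbc (Sum.inr .from2) x = (F.edge₂.strip d.mbc).B.f x := if_pos h
    refine ⟨he ▸ d.sdiff_ball_mono hA.1, ?_, Or.inr ⟨he ▸ hA.2, Or.inl rfl⟩⟩
    simp only [he]
    exact d.near_of_left₂ h1 h _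
  · have hA := d.upper_right (not_le.1 h).le h2
    have he : F.edgeCurve d.mbc (Sum.inr .from2) x = (F.edge₃.strip d.mbc).B.f x := if_neg h
    refine ⟨he ▸ d.sdiff_ball_mono hA.1, ?_, Or.inr ⟨he ▸ hA.2, Or.inl rfl⟩⟩
    exact d.near_of_right (not_le.1 h).le h2 (Or.inr he) _

/-- The interval over which a new edge lies. -/
lemma new_bounds (d : DiskContext S D p lo hi C ρ v₀ F r) (e : F.NewEdge) :
    F.vertexPoint C r (F.newSrc e) 0 < F.vertexPoint C r (F.newTgt e) 0 ∧
    chordX p C r ≤ F.vertexPoint C r (F.newSrc e) 0 ∧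
    F.vertexPoint C r (F.newTgt e) 0 ≤ p 0 + r := by
  have h1 := d.chordX_mem.2
  have h2 := d.r_pos
  rcases e with _ | _ | _ | _
  · rcases F.newTgt_from1 with ⟨h, h'⟩ | ⟨h, h'⟩
    · rw [h']
      simp only [SegmentData.newSrc, SegmentData.vertexPoint, pt_zero]
      exact ⟨h1, le_rfl, by linarith⟩
    · rw [h', F.vertexPoint_self]
      simp only [SegmentData.newSrc, SegmentData.vertexPoint, pt_zero]
      exact ⟨by linarith, le_rfl, le_rfl⟩
  · rcases F.newTgt_from2 with ⟨h, h'⟩ | ⟨h, h'⟩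
    · rw [h']
      simp only [SegmentData.newSrc, SegmentData.vertexPoint, pt_zero]
      exact ⟨h1, le_rfl, by linarith⟩
    · rw [h', F.vertexPoint_self]
      simp only [SegmentData.newSrc, SegmentData.vertexPoint, pt_zero]
      exact ⟨by linarith, le_rfl, le_rfl⟩
  · have : F.newTgt (.from3 ‹_›) = Sum.inl v₀ := rfl
    rw [this, F.vertexPoint_self]
    simp only [SegmentData.newSrc, SegmentData.vertexPoint, pt_zero]
    exact ⟨by linarith, h1.le, le_rfl⟩
  · have : F.newTgt (.from4 ‹_›) = Sum.inl v₀ := rfl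
    rw [this, F.vertexPoint_self]
    simp only [SegmentData.newSrc, SegmentData.vertexPoint, pt_zero]
    exact ⟨by linarith, h1.le, le_rfl⟩

lemma newPoint (d : DiskContext S D p lo hi C ρ v₀ F r) {e : F.NewEdge} {x : ℝ}
    (hx : x ∈ Icc (F.vertexPoint C r (F.newSrc e) 0) (F.vertexPoint C r (F.newTgt e) 0)) :
    d.NewPoint e x := by
  obtain ⟨-, h1, h2⟩ := d.new_bounds e
  have h3 : p 0 - ρ < x := by linarith [d.chordX_mem.1, hx.1]
  have h4 : x < p 0 + ρ := by linarith [d.r_lt, hx.2]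
  rcases e with _ | _ | h | h
  · exact d.newPoint_from1 h3 h4
  · exact d.newPoint_from2 h3 h4
  · have hx0 : p 0 ≤ x := by simpa [SegmentData.newSrc, SegmentData.vertexPoint] using hx.1
    have hA := d.lower_right hx0 h4
    exact ⟨d.sdiff_ball_mono hA.1, d.near_of_right hx0 h4 (Or.inl rfl) _,
      Or.inl ⟨hA.2, Or.inr ⟨h, rfl⟩⟩⟩
  · have hx0 : p 0 ≤ x := by simpa [SegmentData.newSrc, SegmentData.vertexPoint] using hx.1
    have hA := d.upper_right hx0 h4
    exact ⟨d.sdiff_ball_mono hA.1, d.near_of_right hx0 h4 (Or.inr rfl) _,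
      Or.inr ⟨hA.2, Or.inr ⟨h, rfl⟩⟩⟩

/-- The only possible jump is over `p 0`. Either the interval ends there, because `v₃` or `v₄` is
present, or both branches pass through the same end of the segment. -/
lemma continuousOn_edgeCurve (d : DiskContext S D p lo hi C ρ v₀ F r) (e : F.NewEdge) :
    ContinuousOn (F.edgeCurve d.mbc (Sum.inr e))
      (Icc (F.vertexPoint C r (F.newSrc e) 0) (F.vertexPoint C r (F.newTgt e) 0)) := by
  rcases e with _ | _ | h | h
  · rcases F.newTgt_from1 with ⟨h, h'⟩ | ⟨h, -⟩
    · rw [h']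
      refine (Arc.continuous_f (F.edge₁.strip d.mbc).A).continuousOn.congr fun x hx => ?_
      exact if_pos (by simpa [SegmentData.vertexPoint] using hx.2)
    · refine Continuous.continuousOn (Continuous.if_le (Arc.continuous_f _) (Arc.continuous_f _)
        continuous_id continuous_const ?_)
      rintro x rfl
      exact (d.A_eq_lo h).1.trans (d.A_eq_lo h).2.symm
  · rcases F.newTgt_from2 with ⟨h, h'⟩ | ⟨h, -⟩
    · rw [h']
      refine (Arc.continuous_f (F.edge₂.strip d.mbc).B).continuousOn.congr fun x hx => ?_
      exact if_pos (by simpa [SegmentData.vertexPoint] using hx.2)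
    · refine Continuous.continuousOn (Continuous.if_le (Arc.continuous_f _) (Arc.continuous_f _)
        continuous_id continuous_const ?_)
      rintro x rfl
      exact (d.B_eq_hi h).1.trans (d.B_eq_hi h).2.symm
  · exact (Arc.continuous_f _).continuousOn
  · exact (Arc.continuous_f _).continuousOn

lemma end_vis_new (d : DiskContext S D p lo hi C ρ v₀ F r) {y : ℝ}
    (hy : y = (F.edge₃.strip d.mbc).A.f (p 0 + r) ∨ y = (F.edge₃.strip d.mbc).B.f (p 0 + r)) :
    Vis (closure D \ Metric.ball p r) (pt (p 0 + r) (p 1)) (pt (p 0 + r) y) := by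
  have := d.strip₃_between d.poleStrips (x := p 0 + r) (by linarith [d.r_pos])
      (by linarith [d.r_lt])
  refine d.vis_end ?_
  rcases hy with rfl | rfl
  exacts [⟨le_rfl, by linarith⟩, ⟨by linarith, le_rfl⟩]

lemma vis_mid_of_notMem (d : DiskContext S D p lo hi C ρ v₀ F r) {y : ℝ} (hy : y ∈ Icc lo hi)
    (hb : pt (p 0) y ∉ Metric.ball p ρ) :
    (y < p 1 → Vis (closure D \ Metric.ball p r) (pt (p 0) lo) (pt (p 0) y)) ∧
    (p 1 < y → Vis (closure D \ Metric.ball p r) (pt (p 0) hi) (pt (p 0) y)) := by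
  have hv : reebMk D ⟨pt (p 0) y, d.fib.mem _ hy⟩ = v₀.1 :=
    d.mk_eq_v₀.2 ⟨by simp, by simpa using hy⟩
  have h := d.mid_cases hv (fun h => hb (d.ball_subset h))
  simp only [pt_one] at h
  constructor <;> intro h' <;> rcases h with ⟨h1, h2⟩ | ⟨h1, h2⟩
  · exact h2
  · exact (lt_asymm h1 h').elim
  · exact (lt_asymm h1 h').elim
  · exact h2

lemma new_source_vis (d : DiskContext S D p lo hi C ρ v₀ F r) (e : F.NewEdge) :
    Vis (closure D \ Metric.ball p r) (F.vertexPoint C r (F.newSrc e))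
      (pt (F.vertexPoint C r (F.newSrc e) 0)
        (F.edgeCurve d.mbc (Sum.inr e) (F.vertexPoint C r (F.newSrc e) 0))) := by
  have hx := d.chordX_mem
  have hρ := d.loc.pos
  rcases e with _ | _ | h | h
  · simp only [SegmentData.newSrc, SegmentData.vertexPoint, pt_zero, SegmentData.edgeCurve,
      if_pos hx.2.le]
    exact d.near_chord_low
  · simp only [SegmentData.newSrc, SegmentData.vertexPoint, pt_zero, SegmentData.edgeCurve,
      if_pos hx.2.le]
    exact d.near_chord_up
  · simp only [SegmentData.newSrc, SegmentData.vertexPoint, pt_zero, SegmentData.edgeCurve]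
    exact (d.vis_mid_of_notMem d.lo_le_A₃ (d.lower_right le_rfl (by linarith)).1.2).1
      d.poleStrips.A₃
  · simp only [SegmentData.newSrc, SegmentData.vertexPoint, pt_zero, SegmentData.edgeCurve]
    exact (d.vis_mid_of_notMem d.B₃_le_hi (d.upper_right le_rfl (by linarith)).1.2).2
      d.poleStrips.B₃

lemma new_target_vis (d : DiskContext S D p lo hi C ρ v₀ F r) (e : F.NewEdge) :
    Vis (closure D \ Metric.ball p r) (F.vertexPoint C r (F.newTgt e))
      (pt (F.vertexPoint C r (F.newTgt e) 0)
        (F.edgeCurve d.mbc (Sum.inr e) (F.vertexPoint C r (F.newTgt e) 0))) := by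
  have hr := d.r_pos
  have hρ := d.loc.pos
  rcases e with _ | _ | h | h
  · rcases F.newTgt_from1 with ⟨h, h'⟩ | ⟨h, h'⟩
    · rw [h']
      simp only [SegmentData.vertexPoint, pt_zero, SegmentData.edgeCurve, if_pos le_rfl]
      exact (d.vis_mid_of_notMem d.lo_le_A₁ (d.lower_left (by linarith) le_rfl).1.2).1
        d.poleStrips.A₁
    · rw [h', F.vertexPoint_self, pt_zero]
      exact d.end_vis_new (Or.inl (if_neg (by linarith)))
  · rcases F.newTgt_from2 with ⟨h, h'⟩ | ⟨h, h'⟩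
    · rw [h']
      simp only [SegmentData.vertexPoint, pt_zero, SegmentData.edgeCurve, if_pos le_rfl]
      exact (d.vis_mid_of_notMem d.B₂_le_hi (d.upper_left (by linarith) le_rfl).1.2).2
        d.poleStrips.B₂
    · rw [h', F.vertexPoint_self, pt_zero]
      exact d.end_vis_new (Or.inr (if_neg (by linarith)))
  · rw [show F.newTgt (.from3 h) = Sum.inl v₀ from rfl, F.vertexPoint_self, pt_zero]
    exact d.end_vis_new (Or.inl rfl)
  · rw [show F.newTgt (.from4 h) = Sum.inl v₀ from rfl, F.vertexPoint_self, pt_zero]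
    exact d.end_vis_new (Or.inr rfl)

end DiskContext

/-! ### The representing points and curves belong to different classes. -/

namespace DiskContext

variable {S : Set PlaneCircle} {D : Set Plane} {p : Plane} {lo hi : ℝ} {C : PlaneCircle} {ρ : ℝ}
  {v₀ : ReebVertex S D} {F : SegmentData S D p lo hi v₀} {r : ℝ}

lemma same_side (d : DiskContext S D p lo hi C ρ v₀ F r) {a b : Plane}
    (h : Vis (closure D \ Metric.ball p r) a b) (h1 : p 0 - ρ < a 0) (h2 : a 0 < p 0 + r) :
    (a 1 < p 1 ∧ b 1 < p 1) ∨ (p 1 < a 1 ∧ p 1 < b 1) :=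
  h.same_side (d.center_notMem h1 h2)

/-- The vertices of the modified graph. -/
lemma vertex_cases (d : DiskContext S D p lo hi C ρ v₀ F r) (u : ReebVertex S D ⊕ F.NewVertex) :
    (∃ w, w ≠ v₀ ∧ u = Sum.inl w ∧ (∃ z : closure D, F.vertexPoint C r u = z ∧
      reebMk D z = w.1) ∧ (F.vertexPoint C r u 0 ≤ p 0 - ρ ∨ F.vertexPoint C r u 0 = p 0 ∨
        p 0 + ρ ≤ F.vertexPoint C r u 0)) ∨
    (u = Sum.inl v₀ ∧ F.vertexPoint C r u = pt (p 0 + r) (p 1)) ∨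
    (u = Sum.inr .v1 ∧ F.vertexPoint C r u = pt (chordX p C r) (p 1 - chordH C r)) ∨
    (u = Sum.inr .v2 ∧ F.vertexPoint C r u = pt (chordX p C r) (p 1 + chordH C r)) ∨
    (∃ h, u = Sum.inr (.v3 h) ∧ F.vertexPoint C r u = pt (p 0) lo) ∨
    (∃ h, u = Sum.inr (.v4 h) ∧ F.vertexPoint C r u = pt (p 0) hi) := by
  rcases u with u | (_ | _ | h | h)
  · by_cases h : u = v₀
    · subst h; exact Or.inr (Or.inl ⟨rfl, F.vertexPoint_self C r⟩)
    · refine Or.inl ⟨u, h, rfl, F.exists_vertexPoint C r h, ?_⟩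
      rw [F.vertexPoint_zero C r h]
      exact d.height_far u.2
  · exact Or.inr (Or.inr (Or.inl ⟨rfl, rfl⟩))
  · exact Or.inr (Or.inr (Or.inr (Or.inl ⟨rfl, rfl⟩)))
  · exact Or.inr (Or.inr (Or.inr (Or.inr (Or.inl ⟨h, rfl, rfl⟩))))
  · exact Or.inr (Or.inr (Or.inr (Or.inr (Or.inr ⟨h, rfl, rfl⟩))))

lemma mk_lo (d : DiskContext S D p lo hi C ρ v₀ F r) {z : closure D}
    (h : Vis (closure D) (pt (p 0) lo) z) : reebMk D z = v₀.1 := by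
  rw [d.v₀_eq, eq_comm, reebMk_eq_iff]
  exact (d.vis_iff.2 (by simpa using d.fib.le)).trans h

lemma mk_hi (d : DiskContext S D p lo hi C ρ v₀ F r) {z : closure D}
    (h : Vis (closure D) (pt (p 0) hi) z) : reebMk D z = v₀.1 := by
  rw [d.v₀_eq, eq_comm, reebMk_eq_iff]
  exact (d.vis_iff.2 (by simpa using d.fib.le)).trans h

/-- Old vertices are separated by their old classes, also from `v₃` and `v₄`, whose old class is
that of `v₀`. The abscissae of the chord, of `p` and of the new right pole differ, and old vertices
avoid the first and the last. The pairs `v₁`, `v₂` and `v₃`, `v₄` are separated by the horizontal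
diameter. -/
lemma vertexPoint_injective (d : DiskContext S D p lo hi C ρ v₀ F r)
    {u u' : ReebVertex S D ⊕ F.NewVertex}
    (h : Vis (closure D \ Metric.ball p r) (F.vertexPoint C r u) (F.vertexPoint C r u')) :
    u = u' := by
  have hx := d.chordX_mem
  have hr := d.r_pos
  have hrρ := d.r_lt
  have h0 := h.1
  have hH := d.chordH_pos
  have hlo := d.lo_lt
  have hhi := d.lt_hi
  have hK := h.mono sdiff_subset
  have hs := d.same_side h
  rcases d.vertex_cases u with ⟨w, hw, rfl, ⟨z, h1, h2⟩, h3⟩ | ⟨rfl, h1⟩ | ⟨rfl, h1⟩ | ⟨rfl, h1⟩ |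
      ⟨h2, rfl, h1⟩ | ⟨h2, rfl, h1⟩ <;>
    rcases d.vertex_cases u' with ⟨w', hw', rfl, ⟨z', k1, k2⟩, k3⟩ | ⟨rfl, k1⟩ | ⟨rfl, k1⟩ |
      ⟨rfl, k1⟩ | ⟨k2, rfl, k1⟩ | ⟨k2, rfl, k1⟩ <;>
    first
    | rfl
    | (rw [h1, k1] at hK
       have := reebMk_eq_iff.2 hK
       rw [h2, k2] at this
       rw [Subtype.ext this])
    | (rw [h1, k1] at hK
       exact (hw (Subtype.ext (h2 ▸ d.mk_lo hK.symm))).elim)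
    | (rw [h1, k1] at hK
       exact (hw (Subtype.ext (h2 ▸ d.mk_hi hK.symm))).elim)
    | (rw [h1, k1] at hK
       exact (hw' (Subtype.ext (k2 ▸ d.mk_lo hK))).elim)
    | (rw [h1, k1] at hK
       exact (hw' (Subtype.ext (k2 ▸ d.mk_hi hK))).elim)
    | (exfalso
       rw [h1, k1] at h0 hs
       try rw [h1] at h3
       try rw [k1] at k3
       simp only [pt_zero, pt_one] at *
       first
       | linarith [hx.1, hx.2]
       | (rcases h3 with h3 | h3 | h3 <;> linarith [hx.1, hx.2])
       | (rcases k3 with h3 | h3 | h3 <;> linarith [hx.1, hx.2])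
       | (rcases hs (by linarith [hx.1, hx.2]) (by linarith [hx.1, hx.2]) with h | h <;>
            linarith [h.1, h.2]))

/-- Strips with a common point are equal, so an old edge over its new interval can meet one of the
three edges at `p` only if it is that edge, and then only in the part which is kept. -/
lemma old_disjoint (d : DiskContext S D p lo hi C ρ v₀ F r) {e : ReebEdge S D} {x : ℝ}
    (hx : x ∈ Ioo (F.vertexPoint C r (F.oldSrc e) 0) (F.vertexPoint C r (F.oldTgt e) 0))
    {z : closure D} (hz : z ∈ (e.strip d.mbc).region) :
    reebMk D z ≠ v₀.1 ∧ (z ∈ (F.edge₁.strip d.mbc).region → x < chordX p C r) ∧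
    (z ∈ (F.edge₂.strip d.mbc).region → x < chordX p C r) ∧
    (z ∈ (F.edge₃.strip d.mbc).region → p 0 + r < x) := by
  obtain ⟨h1, h2, h3, h4⟩ := d.old_bounds e
  refine ⟨fun h => Strip.notMem_vert d.mbc _ hz (h ▸ v₀.2), fun h => ?_, fun h => ?_, fun h => ?_⟩
  · rw [← h3 (Or.inl (ReebEdge.eq_of_region d.mbc hz h))]; exact hx.2
  · rw [← h3 (Or.inr (ReebEdge.eq_of_region d.mbc hz h))]; exact hx.2
  · rw [← h4 (ReebEdge.eq_of_region d.mbc hz h)]; exact hx.1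

lemma old_region (d : DiskContext S D p lo hi C ρ v₀ F r) {e : ReebEdge S D} {x : ℝ}
    (hx : x ∈ Ioo (F.vertexPoint C r (F.oldSrc e) 0) (F.vertexPoint C r (F.oldTgt e) 0))
    {z : closure D} (hv : Vis (closure D) (pt x ((e.strip d.mbc).A.f x)) z) :
    z ∈ (e.strip d.mbc).region := by
  obtain ⟨h1, h2, -, -⟩ := d.old_bounds e
  have hm : x ∈ Ioo (e.strip d.mbc).s (e.strip d.mbc).t :=
    ⟨h1.trans_lt hx.1, hx.2.trans_le h2⟩
  refine Strip.region_of_vis d.mbc _ (z := ⟨_, Strip.memA _ (Ioo_subset_Icc_self hm)⟩)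
    ⟨by simpa using hm, ?_⟩ hv
  simpa using Strip.le _ (Ioo_subset_Icc_self hm)

/-- The representing point would lie in the open strip. Old vertices, `v₃` and `v₄` have vertices as
old classes, and the remaining three points are at the excluded ends of the shortened intervals. -/
lemma old_no_vertex (d : DiskContext S D p lo hi C ρ v₀ F r) {e : ReebEdge S D} {x : ℝ}
    (hx : x ∈ Ioo (F.vertexPoint C r (F.oldSrc e) 0) (F.vertexPoint C r (F.oldTgt e) 0))
    (u : ReebVertex S D ⊕ F.NewVertex) :
    ¬ Vis (closure D \ Metric.ball p r) (F.vertexPoint C r u)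
      (pt x ((e.strip d.mbc).A.f x)) := by
  intro h
  have hreg := d.old_region (z := ⟨_, (d.vertexPoint_mem u).1⟩) hx (h.mono sdiff_subset).symm
  have h0 := h.1
  rw [pt_zero] at h0
  obtain ⟨g0, g1, g2, g3⟩ := d.old_disjoint hx hreg
  have hK := (h.mono (sdiff_subset : closure D \ Metric.ball p r ⊆ _)).left_mem
  rcases d.vertex_cases u with ⟨w, hw, rfl, ⟨z, h1, h2⟩, -⟩ | ⟨rfl, h1⟩ | ⟨rfl, h1⟩ | ⟨rfl, h1⟩ |
      ⟨h2, rfl, h1⟩ | ⟨h2, rfl, h1⟩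
  · have : (⟨_, (d.vertexPoint_mem (Sum.inl w)).1⟩ : closure D) = z := Subtype.ext h1
    rw [this] at hreg
    exact Strip.notMem_vert d.mbc _ hreg (h2 ▸ w.2)
  · simp only [h1, pt_zero] at h0 g3
    have := g3 (d.end_mem_region d.end_mem.1)
    linarith
  · simp only [h1, pt_zero] at h0 g1
    have := g1 (d.chord_low_mem (d.chord_mem (Or.inl rfl)).2.2.1)
    linarith
  · simp only [h1, pt_zero] at h0 g2
    have := g2 (d.chord_up_mem (d.chord_mem (Or.inr rfl)).2.2.1)
    linarith
  · refine g0 (d.mk_lo ?_)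
    simp only [h1]; exact Vis.refl d.lo_mem.1
  · refine g0 (d.mk_hi ?_)
    simp only [h1]; exact Vis.refl d.hi_mem.1

/-- Strictly between the chord and the new right pole vertices occur only over `p 0`. An old one
would have the class of `v₀`; and if `v₃` or `v₄` is present, the new edges on its side of the disk
have an end over `p 0`. -/
lemma new_no_vertex (d : DiskContext S D p lo hi C ρ v₀ F r) {e : F.NewEdge} {x : ℝ}
    (hx : x ∈ Ioo (F.vertexPoint C r (F.newSrc e) 0) (F.vertexPoint C r (F.newTgt e) 0))
    (u : ReebVertex S D ⊕ F.NewVertex) :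
    ¬ Vis (closure D \ Metric.ball p r) (F.vertexPoint C r u)
      (pt x (F.edgeCurve d.mbc (Sum.inr e) x)) := by
  intro h
  have hN := d.newPoint (Ioo_subset_Icc_self hx)
  obtain ⟨-, b1, b2⟩ := d.new_bounds e
  have hX := d.chordX_mem
  have hrρ := d.r_lt
  have h0 := h.1
  have hx1 := hx.1
  have hx2 := hx.2
  rw [pt_zero] at h0
  have hs := d.same_side h (by rw [h0]; linarith [hX.1]) (by rw [h0]; linarith)
  simp only [pt_one] at hs
  rcases d.vertex_cases u with ⟨w, hw, rfl, ⟨z, h1, h2⟩, h3⟩ | ⟨rfl, h1⟩ | ⟨rfl, h1⟩ | ⟨rfl, h1⟩ |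
      ⟨h2, rfl, h1⟩ | ⟨h2, rfl, h1⟩
  · have hx0 : x = p 0 := by
      rw [h0] at h3
      rcases h3 with h3 | h3 | h3 <;> linarith [hX.1]
    have h4 := d.near_mid (by simpa using hx0) hN.near
    have h5 : reebMk D z = _ :=
      reebMk_eq_iff.2 (show Vis (closure D) z (⟨_, hN.mem.1⟩ : closure D) from
        h1 ▸ h.mono sdiff_subset)
    rw [h4, h2] at h5
    exact hw (Subtype.ext h5)
  · rw [h1, pt_zero] at h0; linarith
  · rw [h1, pt_zero] at h0; linarith
  · rw [h1, pt_zero] at h0; linarith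
  · rw [h1, pt_zero] at h0
    rcases hs with hs | hs
    · rcases hN.side with ⟨-, rfl | ⟨g, rfl⟩⟩ | ⟨k, -⟩
      · rw [show F.newTgt .from1 = Sum.inr (.v3 h2) from dif_pos h2, h1, pt_zero] at hx2
        linarith
      · rw [show F.newSrc (.from3 g) = Sum.inr (.v3 h2) from rfl, h1, pt_zero] at hx1
        linarith
      · linarith [hs.2]
    · rw [h1, pt_one] at hs; linarith [d.lo_lt, hs.1]
  · rw [h1, pt_zero] at h0
    rcases hs with hs | hs
    · rw [h1, pt_one] at hs; linarith [d.lt_hi, hs.1]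
    · rcases hN.side with ⟨k, -⟩ | ⟨-, rfl | ⟨g, rfl⟩⟩
      · linarith [hs.2]
      · rw [show F.newTgt .from2 = Sum.inr (.v4 h2) from dif_pos h2, h1, pt_zero] at hx2
        linarith
      · rw [show F.newSrc (.from4 g) = Sum.inr (.v4 h2) from rfl, h1, pt_zero] at hx1
        linarith

lemma old_new_disjoint (d : DiskContext S D p lo hi C ρ v₀ F r) {e : ReebEdge S D} {e' : F.NewEdge}
    {x : ℝ} (hx : x ∈ Ioo (F.vertexPoint C r (F.oldSrc e) 0) (F.vertexPoint C r (F.oldTgt e) 0))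
    (hx' : x ∈ Ioo (F.vertexPoint C r (F.newSrc e') 0) (F.vertexPoint C r (F.newTgt e') 0)) :
    ¬ Vis (closure D \ Metric.ball p r) (pt x ((e.strip d.mbc).A.f x))
      (pt x (F.edgeCurve d.mbc (Sum.inr e') x)) := by
  intro h
  have hN := d.newPoint (Ioo_subset_Icc_self hx')
  obtain ⟨-, b1, b2⟩ := d.new_bounds e'
  have hreg := d.old_region (z := ⟨_, hN.mem.1⟩) hx (h.mono sdiff_subset)
  obtain ⟨g0, g1, g2, g3⟩ := d.old_disjoint hx hreg
  have h1 := hx'.1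
  have h2 := hx'.2
  rcases hN.near with k | k | k | k
  · linarith [g1 k]
  · linarith [g2 k]
  · exact g0 k
  · linarith [g3 k]

/-- The horizontal diameter separates the edges below the disk from those above it; two edges on the
same side meet only over `p 0`, which is an end of both. -/
lemma new_injective (d : DiskContext S D p lo hi C ρ v₀ F r) {e e' : F.NewEdge} {x : ℝ}
    (hx : x ∈ Ioo (F.vertexPoint C r (F.newSrc e) 0) (F.vertexPoint C r (F.newTgt e) 0))
    (hx' : x ∈ Ioo (F.vertexPoint C r (F.newSrc e') 0) (F.vertexPoint C r (F.newTgt e') 0))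
    (h : Vis (closure D \ Metric.ball p r) (pt x (F.edgeCurve d.mbc (Sum.inr e) x))
      (pt x (F.edgeCurve d.mbc (Sum.inr e') x))) : e = e' := by
  have hN := (d.newPoint (Ioo_subset_Icc_self hx)).side
  have hN' := (d.newPoint (Ioo_subset_Icc_self hx')).side
  obtain ⟨-, b1, b2⟩ := d.new_bounds e
  have hX := d.chordX_mem
  have a1 := hx.1
  have a2 := hx.2
  have a1' := hx'.1
  have a2' := hx'.2
  have hs := d.same_side h (by rw [pt_zero]; linarith [hX.1]) (by rw [pt_zero]; linarith)
  simp only [pt_one] at hs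
  have t1 : ∀ g : F.HasV3, F.vertexPoint C r (F.newTgt .from1) 0 = p 0 := fun g => by
    rw [show F.newTgt .from1 = Sum.inr (.v3 g) from dif_pos g]; exact pt_zero _ _
  have t2 : ∀ g : F.HasV4, F.vertexPoint C r (F.newTgt .from2) 0 = p 0 := fun g => by
    rw [show F.newTgt .from2 = Sum.inr (.v4 g) from dif_pos g]; exact pt_zero _ _
  have t3 : ∀ g : F.HasV3, F.vertexPoint C r (F.newSrc (.from3 g)) 0 = p 0 := fun g => pt_zero _ _
  have t4 : ∀ g : F.HasV4, F.vertexPoint C r (F.newSrc (.from4 g)) 0 = p 0 := fun g => pt_zero _ _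
  rcases hN with ⟨k, rfl | ⟨g, rfl⟩⟩ | ⟨k, rfl | ⟨g, rfl⟩⟩ <;>
    rcases hN' with ⟨k', rfl | ⟨g', rfl⟩⟩ | ⟨k', rfl | ⟨g', rfl⟩⟩ <;>
    first
    | rfl
    | (exfalso; rcases hs with hs | hs <;> linarith [hs.1, hs.2])
    | (exfalso; linarith [t1 g, t3 g])
    | (exfalso; linarith [t1 g', t3 g'])
    | (exfalso; linarith [t2 g, t4 g])
    | (exfalso; linarith [t2 g', t4 g'])

/-- Without `v₃` the subdivisions have no points strictly between `lo` and the height of `p`, so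
`regular` excludes poles and double points there. The end `lo` is no pole, and being a double point
would itself produce `v₃`. -/
lemma hasV3_of_lt (d : DiskContext S D p lo hi C ρ v₀ F r) {y : ℝ} (hy : y ∈ Icc lo hi)
    (hlt : y < p 1)
    (hv : (∃ C ∈ S, C.IsVerticalPole (pt (p 0) y)) ∨ IsDoublePoint S (pt (p 0) y)) : F.HasV3 := by
  by_cases h : y = lo
  · subst h
    refine Or.inr (Or.inr (hv.resolve_left ?_))
    rintro ⟨C', hC', h'⟩
    exact (d.fib.isEnd_low (d.lo_lt.trans d.lt_hi)).not_isVerticalPole d.mbc C' hC' h'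
  by_contra hno
  unfold SegmentData.HasV3 at hno
  push Not at hno
  obtain ⟨h1, h2⟩ := F.regular y hy (by
    rintro ⟨i, hi', rfl⟩
    rw [← F.xl_j₀] at hlt
    have := (F.xl_mono.lt_iff_lt hi' F.j₀_lt.le).1 hlt
    obtain rfl : i = 0 := by omega
    exact h F.xl_zero) (by
    rintro ⟨i, hi', rfl⟩
    have := (F.xr_mono.lt_iff_lt hi' F.k₀_le).1 (hlt.trans F.lt_xr)
    obtain rfl : i = 0 := by omega
    exact h F.xr_zero)
  rcases hv with ⟨C', hC', h'⟩ | h'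
  · exact (h2 C' hC').1 h'
  · exact h1 h'

lemma hasV4_of_lt (d : DiskContext S D p lo hi C ρ v₀ F r) {y : ℝ} (hy : y ∈ Icc lo hi)
    (hlt : p 1 < y)
    (hv : (∃ C ∈ S, C.IsVerticalPole (pt (p 0) y)) ∨ IsDoublePoint S (pt (p 0) y)) : F.HasV4 := by
  by_cases h : y = hi
  · subst h
    refine Or.inr (Or.inr (hv.resolve_left ?_))
    rintro ⟨C', hC', h'⟩
    exact (d.fib.isEnd_up (d.lo_lt.trans d.lt_hi)).not_isVerticalPole d.mbc C' hC' h'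
  by_contra hno
  unfold SegmentData.HasV4 at hno
  push Not at hno
  obtain ⟨h1, h2⟩ := F.regular y hy (by
    rintro ⟨i, hi', rfl⟩
    rw [← F.xl_j₀] at hlt
    have := (F.xl_mono.lt_iff_lt F.j₀_lt.le hi').1 hlt
    have hi'' : i ≤ F.a := hi'
    obtain rfl : i = F.a := by omega
    exact h F.xl_last) (by
    rintro ⟨i, hi', rfl⟩
    have := (F.xr_mono.lt_iff_lt ((Nat.sub_le _ _).trans F.k₀_le) hi').1 (F.xr_lt.trans hlt)
    have hi'' : i ≤ F.b := hi'
    obtain rfl : i = F.b := by omega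
    exact h F.xr_last)
  rcases hv with ⟨C', hC', h'⟩ | h'
  · exact (h2 C' hC').1 h'
  · exact h1 h'

/-- A point outside of the disk in the class of a vertex. -/
lemma exists_vertex_of_special (d : DiskContext S D p lo hi C ρ v₀ F r) {q : Plane}
    (hq : q ∈ closure D \ Metric.ball p r)
    (hv : (∃ C ∈ S, C.IsVerticalPole q) ∨ IsDoublePoint S q) :
    ∃ u, Vis (closure D \ Metric.ball p r) (F.vertexPoint C r u) q := by
  have hvert : reebMk D ⟨q, hq.1⟩ ∈ reebVert S D := ⟨_, rfl, hv⟩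
  by_cases h : reebMk D ⟨q, hq.1⟩ = v₀.1
  · obtain ⟨h1, h2⟩ := d.mk_eq_v₀.1 h
    have he : pt (p 0) (q 1) = q := by rw [← h1, pt_eta]
    rw [← he] at hv
    rcases d.mid_cases h hq.2 with ⟨h3, h4⟩ | ⟨h3, h4⟩
    · exact ⟨Sum.inr (.v3 (d.hasV3_of_lt h2 h3 hv)), h4⟩
    · exact ⟨Sum.inr (.v4 (d.hasV4_of_lt h2 h3 hv)), h4⟩
  · have hne : (⟨_, hvert⟩ : ReebVertex S D) ≠ v₀ := fun h' => h (congrArg Subtype.val h')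
    obtain ⟨z, h1, h2⟩ := F.exists_vertexPoint C r hne
    refine ⟨Sum.inl ⟨_, hvert⟩, ?_⟩
    rw [h1]
    exact d.vis_vert (w := ⟨q, hq.1⟩) (by rw [h2]; exact hvert) (by rw [h2]; exact h)
      (reebMk_eq_iff.1 h2)

end DiskContext

/-! ### The representing points and curves exhaust the new Poincaré–Reeb space. -/

namespace DiskContext

variable {S : Set PlaneCircle} {D : Set Plane} {p : Plane} {lo hi : ℝ} {C : PlaneCircle} {ρ : ℝ}
  {v₀ : ReebVertex S D} {F : SegmentData S D p lo hi v₀} {r : ℝ}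

lemma chord_of_mem (d : DiskContext S D p lo hi C ρ v₀ F r) {q : Plane}
    (hq : q ∈ closure D \ Metric.ball p r) (h : q ∈ (⟨p, r, d.r_pos⟩ : PlaneCircle).carrier)
    {C₁ : PlaneCircle} (hC₁ : C₁ ∈ S) (h₁ : q ∈ C₁.carrier) :
    ∃ u, Vis (closure D \ Metric.ball p r) (F.vertexPoint C r u) q := by
  obtain ⟨-, h2, h3⟩ := d.loc.of_mem_sphere d.r_pos d.r_lt h hC₁ h₁
  rw [← d.chordH_sq] at h3
  have h2' : q 0 = chordX p C r := h2
  rcases sq_eq_sq_iff_eq_or_eq_neg.1 h3 with h4 | h4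
  · refine ⟨Sum.inr .v2, ?_⟩
    have : F.vertexPoint C r (Sum.inr .v2) = q := by
      rw [← pt_eta q, h2', show q 1 = p 1 + chordH C r by linarith]; rfl
    rw [this]; exact Vis.refl hq
  · refine ⟨Sum.inr .v1, ?_⟩
    have : F.vertexPoint C r (Sum.inr .v1) = q := by
      rw [← pt_eta q, h2', show q 1 = p 1 - chordH C r by linarith]; rfl
    rw [this]; exact Vis.refl hq

/-- Besides the old poles and double points there are the poles of the new circle and its
intersections with `C`. The right pole represents `v₀`, the left one is inside `C` and not in the
closure, and the intersections are `v₁` and `v₂`. -/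
lemma exists_vertex_of_new_special (d : DiskContext S D p lo hi C ρ v₀ F r) {q : Plane}
    (hq : q ∈ closure D \ Metric.ball p r)
    (hv : (∃ C ∈ insert (⟨p, r, d.r_pos⟩ : PlaneCircle) S, C.IsVerticalPole q) ∨
      IsDoublePoint (insert (⟨p, r, d.r_pos⟩ : PlaneCircle) S) q) :
    ∃ u, Vis (closure D \ Metric.ball p r) (F.vertexPoint C r u) q := by
  rcases hv with ⟨C', rfl | hC', h⟩ | ⟨C₁, hC₁, C₂, hC₂, hne, h1, h2⟩
  · rcases h with h | h
    · refine ⟨Sum.inl v₀, ?_⟩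
      rw [F.vertexPoint_self, h]
      exact Vis.refl d.end_mem
    · rw [h] at hq
      refine (d.center_notMem (x := p 0 - r) ?_ ?_ hq).elim <;> linarith [d.r_lt, d.r_pos]
  · exact d.exists_vertex_of_special hq (Or.inl ⟨C', hC', h⟩)
  · rcases hC₁ with rfl | hC₁ <;> rcases hC₂ with rfl | hC₂
    · exact (hne rfl).elim
    · exact d.chord_of_mem hq h1 hC₂ h2
    · exact d.chord_of_mem hq h2 hC₁ h1
    · exact d.exists_vertex_of_special hq (Or.inr ⟨C₁, hC₁, C₂, hC₂, hne, h1, h2⟩)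

lemma circle_ne (d : DiskContext S D p lo hi C ρ v₀ F r) :
    (⟨p, r, d.r_pos⟩ : PlaneCircle) ≠ C := by
  intro h
  have := d.loc.center0
  rw [← h] at this
  simp only at this
  linarith [d.r_pos]

/-- Shows that `v₃` is indeed a vertex: the first points `xl 1` and `xr 1` of the subdivisions are
poles below `p` if `1 < j₀` or `1 < k₀`, respectively, and `lo` serves in the remaining case. -/
lemma exists_pole_low (d : DiskContext S D p lo hi C ρ v₀ F r) (h : F.HasV3) :
    ∃ y, Vis (closure D \ Metric.ball p r) (pt (p 0) lo) (pt (p 0) y) ∧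
      ((∃ C ∈ S, C.IsVerticalPole (pt (p 0) y)) ∨ IsDoublePoint S (pt (p 0) y)) := by
  have key : ∀ y ∈ Icc lo hi, y < p 1 → (∃ C ∈ S, C.IsVerticalPole (pt (p 0) y)) →
      ∃ y, Vis (closure D \ Metric.ball p r) (pt (p 0) lo) (pt (p 0) y) ∧
        ((∃ C ∈ S, C.IsVerticalPole (pt (p 0) y)) ∨ IsDoublePoint S (pt (p 0) y)) := by
    rintro y hy hlt ⟨C', hC', h'⟩
    have := d.le_sub hC' (LocalPole.verticalPole_mem h').1 hlt
    exact ⟨y, d.vis_lo hy.1 (by linarith [d.r_lt]), Or.inl ⟨C', hC', h'⟩⟩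
  have hj := F.j₀_lt
  have hk := F.k₀_le
  rcases h with h | h | h
  · have hm : F.xl 1 ∈ F.xl '' Ioo 0 F.a := ⟨1, ⟨by omega, by omega⟩, rfl⟩
    rw [F.poles_l] at hm
    refine key _ hm.1 ?_ hm.2.2.1
    rw [← F.xl_j₀]
    exact F.xl_mono (show 1 ≤ F.a by omega) (show F.j₀ ≤ F.a by omega) h
  · have hm : F.xr 1 ∈ F.xr '' Ioo 0 F.b := ⟨1, ⟨by omega, by omega⟩, rfl⟩
    rw [F.poles_r] at hm
    refine key _ hm.1 (lt_of_le_of_lt ?_ F.xr_lt) hm.2.2.1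
    exact F.xr_mono.monotoneOn (show 1 ≤ F.b by omega) (show F.k₀ - 1 ≤ F.b by omega) (by omega)
  · exact ⟨lo, Vis.refl d.lo_mem, Or.inr h⟩

lemma exists_pole_up (d : DiskContext S D p lo hi C ρ v₀ F r) (h : F.HasV4) :
    ∃ y, Vis (closure D \ Metric.ball p r) (pt (p 0) hi) (pt (p 0) y) ∧
      ((∃ C ∈ S, C.IsVerticalPole (pt (p 0) y)) ∨ IsDoublePoint S (pt (p 0) y)) := by
  have key : ∀ y ∈ Icc lo hi, p 1 < y → (∃ C ∈ S, C.IsVerticalPole (pt (p 0) y)) →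
      ∃ y, Vis (closure D \ Metric.ball p r) (pt (p 0) hi) (pt (p 0) y) ∧
        ((∃ C ∈ S, C.IsVerticalPole (pt (p 0) y)) ∨ IsDoublePoint S (pt (p 0) y)) := by
    rintro y hy hlt ⟨C', hC', h'⟩
    have := d.add_le hC' (LocalPole.verticalPole_mem h').1 hlt
    exact ⟨y, d.vis_hi hy.2 (by linarith [d.r_lt]), Or.inl ⟨C', hC', h'⟩⟩
  have hj := F.j₀_lt
  have hk := F.one_le_k₀
  rcases h with h | h | h
  · have hm : F.xl (F.j₀ + 1) ∈ F.xl '' Ioo 0 F.a := ⟨_, ⟨by omega, h⟩, rfl⟩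
    rw [F.poles_l] at hm
    refine key _ hm.1 ?_ hm.2.2.1
    rw [← F.xl_j₀]
    exact F.xl_mono (show F.j₀ ≤ F.a by omega) (show F.j₀ + 1 ≤ F.a by omega) (by omega)
  · have hm : F.xr F.k₀ ∈ F.xr '' Ioo 0 F.b := ⟨_, ⟨by omega, h⟩, rfl⟩
    rw [F.poles_r] at hm
    exact key _ hm.1 F.lt_xr hm.2.2.1
  · exact ⟨hi, Vis.refl d.hi_mem, Or.inr h⟩

/-- Converse of `exists_vertex_of_new_special`. The fibre of an old vertex other than `v₀` misses
the disk, so its pole or double point is still visible. -/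
lemma exists_special (d : DiskContext S D p lo hi C ρ v₀ F r) (u : ReebVertex S D ⊕ F.NewVertex) :
    ∃ q, Vis (closure D \ Metric.ball p r) (F.vertexPoint C r u) q ∧
      ((∃ C ∈ insert (⟨p, r, d.r_pos⟩ : PlaneCircle) S, C.IsVerticalPole q) ∨
        IsDoublePoint (insert (⟨p, r, d.r_pos⟩ : PlaneCircle) S) q) := by
  have hsub : ∀ q, ((∃ C ∈ S, C.IsVerticalPole q) ∨ IsDoublePoint S q) →
      ((∃ C ∈ insert (⟨p, r, d.r_pos⟩ : PlaneCircle) S, C.IsVerticalPole q) ∨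
        IsDoublePoint (insert (⟨p, r, d.r_pos⟩ : PlaneCircle) S) q) := by
    rintro q (⟨C', hC', h⟩ | ⟨C₁, hC₁, C₂, hC₂, h⟩)
    · exact Or.inl ⟨C', mem_insert_of_mem _ hC', h⟩
    · exact Or.inr ⟨C₁, mem_insert_of_mem _ hC₁, C₂, mem_insert_of_mem _ hC₂, h⟩
  have hdouble : ∀ y, (y = p 1 - chordH C r ∨ y = p 1 + chordH C r) →
      IsDoublePoint (insert (⟨p, r, d.r_pos⟩ : PlaneCircle) S) (pt (chordX p C r) y) :=
    fun y hy => ⟨_, mem_insert _ _, C, mem_insert_of_mem _ d.loc.memS, d.circle_ne,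
      (d.chord_mem hy).1, (d.chord_mem hy).2.1⟩
  rcases d.vertex_cases u with ⟨w, hw, rfl, ⟨z, h1, h2⟩, -⟩ | ⟨rfl, h1⟩ | ⟨rfl, h1⟩ | ⟨rfl, h1⟩ |
      ⟨h2, rfl, h1⟩ | ⟨h2, rfl, h1⟩ <;> rw [h1]
  · obtain ⟨q, hq, hv⟩ := w.2
    refine ⟨q, d.vis_vert (by rw [h2]; exact w.2) (fun h => hw (Subtype.ext (h2 ▸ h)))
      (reebMk_eq_iff.1 (h2.trans hq.symm)), hsub _ hv⟩
  · exact ⟨_, Vis.refl d.end_mem, Or.inl ⟨_, mem_insert _ _, Or.inl rfl⟩⟩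
  · exact ⟨_, Vis.refl (d.chord_mem (Or.inl rfl)).2.2, Or.inr (hdouble _ (Or.inl rfl))⟩
  · exact ⟨_, Vis.refl (d.chord_mem (Or.inr rfl)).2.2, Or.inr (hdouble _ (Or.inr rfl))⟩
  · obtain ⟨y, hy, hv⟩ := d.exists_pole_low h2
    exact ⟨_, hy, hsub _ hv⟩
  · obtain ⟨y, hy, hv⟩ := d.exists_pole_up h2
    exact ⟨_, hy, hsub _ hv⟩

/-- A point over the interior of an edge of the modified graph, on the curve of this edge. -/
def Covered (d : DiskContext S D p lo hi C ρ v₀ F r) (z : Plane) : Prop :=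
  ∃ e : ReebEdge S D ⊕ F.NewEdge,
    z 0 ∈ Ioo (F.vertexPoint C r (Sum.elim F.oldSrc F.newSrc e) 0)
      (F.vertexPoint C r (Sum.elim F.oldTgt F.newTgt e) 0) ∧
    Vis (closure D \ Metric.ball p r) (pt (z 0) (F.edgeCurve d.mbc e (z 0))) z

/-- Over the shortened interval the whole old fibre misses the disk, so visibility in the strip is
not affected. -/
lemma covered_old (d : DiskContext S D p lo hi C ρ v₀ F r) {e : ReebEdge S D} {z : closure D}
    (hz : z ∈ (e.strip d.mbc).region) (h3 : e = F.edge₃ → p 0 + r < (z : Plane) 0)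
    (h12 : e = F.edge₁ ∨ e = F.edge₂ → (z : Plane) 0 < chordX p C r) : d.Covered z := by
  have hx : (z : Plane) 0 ∈ Ioo (F.vertexPoint C r (F.oldSrc e) 0)
      (F.vertexPoint C r (F.oldTgt e) 0) := by
    constructor
    · rcases d.src_zero e with ⟨-, h⟩ | ⟨he, -, h⟩
      · rw [h]; exact hz.1.1
      · rw [h]; exact h3 he
    · rcases d.tgt_zero e with ⟨-, -, h⟩ | ⟨he, -, -, h⟩
      · rw [h]; exact hz.1.2
      · rw [h]; exact h12 he
  refine ⟨Sum.inl e, hx, ?_⟩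
  have hm := Ioo_subset_Icc_self hz.1
  refine Vis.sdiff (Strip.vis _ hm ⟨le_rfl, Strip.le _ hm⟩ rfl hz.2) fun q hq => ?_
  have hreg := d.old_region (z := ⟨q, hq.right_mem⟩) hx hq
  have h0 := hq.1
  rw [pt_zero] at h0
  have h4 := hreg.2
  simp only [← h0] at h4
  have := d.old_fiber e (Ioo_subset_Icc_self hx) h4
  rw [h0, pt_eta] at this
  exact this.2

/-- Below the disk there are two new edges with `v₃` between them or one single edge. Each point is
visible from the lower boundary on its side of `p 0`; a point over `p 0` belongs to `v₃` if that is
present. -/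
lemma covered_low (d : DiskContext S D p lo hi C ρ v₀ F r) {z : closure D} (hz : d.Near z)
    (hb : (z : Plane) ∉ Metric.ball p r) (h1 : chordX p C r < (z : Plane) 0)
    (h2 : (z : Plane) 0 < p 0 + r) (h : (z : Plane) 1 < p 1)
    (hu : ∀ u, ¬ Vis (closure D \ Metric.ball p r) (F.vertexPoint C r u) z) : d.Covered z := by
  have hX := d.chordX_mem
  have hr := d.r_lt
  by_cases hV : F.HasV3
  · rcases lt_trichotomy ((z : Plane) 0) (p 0) with h0 | h0 | h0
    · refine ⟨Sum.inr .from1, ⟨h1, ?_⟩, ?_⟩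
      · simp only [Sum.elim_inr]
        rw [show F.newTgt .from1 = Sum.inr (.v3 hV) from dif_pos hV]
        simpa [SegmentData.vertexPoint] using h0
      · rw [show F.edgeCurve d.mbc (Sum.inr .from1) ((z : Plane) 0) = _ from if_pos h0.le]
        exact d.vis_low_left hz hb (by linarith [hX.1]) h0.le h
    · rcases d.mid_cases (d.near_mid h0 hz) hb with ⟨-, h3⟩ | ⟨h3, -⟩
      · exact (hu (Sum.inr (.v3 hV)) h3).elim
      · linarith
    · refine ⟨Sum.inr (.from3 hV), ⟨h0, ?_⟩, d.vis_low_right hz hb h0.le (by linarith) h⟩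
      simp only [Sum.elim_inr]
      rw [show F.newTgt (.from3 hV) = Sum.inl v₀ from rfl, F.vertexPoint_self, pt_zero]
      exact h2
  · refine ⟨Sum.inr .from1, ⟨h1, ?_⟩, ?_⟩
    · simp only [Sum.elim_inr]
      rw [show F.newTgt .from1 = Sum.inl v₀ from dif_neg hV, F.vertexPoint_self, pt_zero]
      exact h2
    · rcases le_or_gt ((z : Plane) 0) (p 0) with h0 | h0
      · rw [show F.edgeCurve d.mbc (Sum.inr .from1) ((z : Plane) 0) = _ from if_pos h0]
        exact d.vis_low_left hz hb (by linarith [hX.1]) h0 h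
      · rw [show F.edgeCurve d.mbc (Sum.inr .from1) ((z : Plane) 0) = _ from if_neg (not_le.2 h0)]
        exact d.vis_low_right hz hb h0.le (by linarith) h

lemma covered_up (d : DiskContext S D p lo hi C ρ v₀ F r) {z : closure D} (hz : d.Near z)
    (hb : (z : Plane) ∉ Metric.ball p r) (h1 : chordX p C r < (z : Plane) 0)
    (h2 : (z : Plane) 0 < p 0 + r) (h : p 1 < (z : Plane) 1)
    (hu : ∀ u, ¬ Vis (closure D \ Metric.ball p r) (F.vertexPoint C r u) z) : d.Covered z := by
  have hX := d.chordX_mem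
  have hr := d.r_lt
  by_cases hV : F.HasV4
  · rcases lt_trichotomy ((z : Plane) 0) (p 0) with h0 | h0 | h0
    · refine ⟨Sum.inr .from2, ⟨h1, ?_⟩, ?_⟩
      · simp only [Sum.elim_inr]
        rw [show F.newTgt .from2 = Sum.inr (.v4 hV) from dif_pos hV]
        simpa [SegmentData.vertexPoint] using h0
      · rw [show F.edgeCurve d.mbc (Sum.inr .from2) ((z : Plane) 0) = _ from if_pos h0.le]
        exact d.vis_up_left hz hb (by linarith [hX.1]) h0.le h
    · rcases d.mid_cases (d.near_mid h0 hz) hb with ⟨h3, -⟩ | ⟨-, h3⟩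
      · linarith
      · exact (hu (Sum.inr (.v4 hV)) h3).elim
    · refine ⟨Sum.inr (.from4 hV), ⟨h0, ?_⟩, d.vis_up_right hz hb h0.le (by linarith) h⟩
      simp only [Sum.elim_inr]
      rw [show F.newTgt (.from4 hV) = Sum.inl v₀ from rfl, F.vertexPoint_self, pt_zero]
      exact h2
  · refine ⟨Sum.inr .from2, ⟨h1, ?_⟩, ?_⟩
    · simp only [Sum.elim_inr]
      rw [show F.newTgt .from2 = Sum.inl v₀ from dif_neg hV, F.vertexPoint_self, pt_zero]
      exact h2
    · rcases le_or_gt ((z : Plane) 0) (p 0) with h0 | h0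
      · rw [show F.edgeCurve d.mbc (Sum.inr .from2) ((z : Plane) 0) = _ from if_pos h0]
        exact d.vis_up_left hz hb (by linarith [hX.1]) h0 h
      · rw [show F.edgeCurve d.mbc (Sum.inr .from2) ((z : Plane) 0) = _ from if_neg (not_le.2 h0)]
        exact d.vis_up_right hz hb h0.le (by linarith) h

lemma covered_near (d : DiskContext S D p lo hi C ρ v₀ F r) {z : closure D} (hz : d.Near z)
    (hb : (z : Plane) ∉ Metric.ball p r) (h1 : chordX p C r < (z : Plane) 0)
    (h2 : (z : Plane) 0 < p 0 + r)
    (hu : ∀ u, ¬ Vis (closure D \ Metric.ball p r) (F.vertexPoint C r u) z) : d.Covered z := by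
  rcases lt_trichotomy ((z : Plane) 1) (p 1) with h | h | h
  · exact d.covered_low hz hb h1 h2 h hu
  · refine (d.center_notMem (lt_trans d.chordX_mem.1 h1) h2 ?_).elim
    rw [← h, pt_eta]; exact ⟨z.2, hb⟩
  · exact d.covered_up hz hb h1 h2 h hu

/-- The old class decides. Vertices other than `v₀` and edges away from `p` persist; the three edges
at `p` are split at the chord or at the new right pole, and what lies between these, with the rest
of `v₀`, is covered by the new edges. -/
lemma covered (d : DiskContext S D p lo hi C ρ v₀ F r) {z : closure D}
    (hb : (z : Plane) ∉ Metric.ball p r)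
    (hu : ∀ u, ¬ Vis (closure D \ Metric.ball p r) (F.vertexPoint C r u) z) : d.Covered z := by
  have hX := d.chordX_mem
  have hr := d.r_pos
  have hP := d.poleStrips
  by_cases hv : reebMk D z ∈ reebVert S D
  · obtain ⟨q, hq, hs⟩ := hv
    by_cases h0 : reebMk D z = v₀.1
    · have h1 := (d.mk_eq_v₀.1 h0).1
      exact d.covered_near (Or.inr (Or.inr (Or.inl h0))) hb (by linarith [hX.2]) (by linarith) hu
    · have hv : reebMk D z ∈ reebVert S D := ⟨q, hq, hs⟩
      have hne : (⟨_, hv⟩ : ReebVertex S D) ≠ v₀ := fun h' => h0 (congrArg Subtype.val h')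
      obtain ⟨z', h1, h2⟩ := F.exists_vertexPoint C r hne
      refine (hu (Sum.inl ⟨_, hv⟩) ?_).elim
      rw [h1]
      exact d.vis_vert (by rw [h2]; exact hv) (by rw [h2]; exact h0) (reebMk_eq_iff.1 h2)
  obtain ⟨e, he⟩ := ReebEdge.exists_region d.mbc hv
  by_cases e3 : e = F.edge₃
  · subst e3
    rcases lt_trichotomy ((z : Plane) 0) (p 0 + r) with h | h | h
    · refine d.covered_near (Or.inr (Or.inr (Or.inr he))) hb ?_ h hu
      have := he.1.1
      rw [hP.s₃] at this
      linarith [hX.2]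
    · refine (hu (Sum.inl v₀) ?_).elim
      rw [F.vertexPoint_self]
      have h2 := he.2
      rw [h] at h2
      have := d.vis_end h2
      rwa [← h, pt_eta, h] at this
    · exact d.covered_old he (fun _ => h)
        (fun h' => (h'.elim d.edge₃_ne.1 d.edge₃_ne.2).elim)
  by_cases e1 : e = F.edge₁
  · subst e1
    have ht := he.1.2
    rw [hP.t₁] at ht
    rcases lt_trichotomy ((z : Plane) 0) (chordX p C r) with h | h | h
    · exact d.covered_old he (fun h' => (e3 h').elim) (fun _ => h)
    · refine (hu (Sum.inr .v1) ?_).elim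
      have h1 : (z : Plane) 1 < p 1 := by
        refine lt_of_le_of_ne (he.2.2.trans (d.B₁_le hP _)) fun h1 => ?_
        refine d.center_notMem (x := (z : Plane) 0) (by linarith [hX.1]) (by linarith) ?_
        rw [← h1, pt_eta]; exact ⟨z.2, hb⟩
      have := d.vis_low_left (Or.inl he) hb (by linarith [hX.1]) ht.le h1
      rw [h] at this
      exact d.near_chord_low.trans this
    · exact d.covered_near (Or.inl he) hb h (by linarith) hu
  by_cases e2 : e = F.edge₂
  · subst e2
    have ht := he.1.2
    rw [hP.t₂] at ht
    rcases lt_trichotomy ((z : Plane) 0) (chordX p C r) with h | h | h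
    · exact d.covered_old he (fun h' => (e3 h').elim) (fun _ => h)
    · refine (hu (Sum.inr .v2) ?_).elim
      have h1 : p 1 < (z : Plane) 1 := by
        refine lt_of_le_of_ne ((d.le_A₂ hP _).trans he.2.1) fun h1 => ?_
        refine d.center_notMem (x := (z : Plane) 0) (by linarith [hX.1]) (by linarith) ?_
        rw [h1, pt_eta]; exact ⟨z.2, hb⟩
      have := d.vis_up_left (Or.inr (Or.inl he)) hb (by linarith [hX.1]) ht.le h1
      rw [h] at this
      exact d.near_chord_up.trans this
    · exact d.covered_near (Or.inr (Or.inl he)) hb h (by linarith) hu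
  exact d.covered_old he (fun h => (e3 h).elim) (fun h => (h.elim e1 e2).elim)

lemma label_cases (d : DiskContext S D p lo hi C ρ v₀ F r) (α β : ℝ)
    (u : ReebVertex S D ⊕ F.NewVertex) :
    (F.newLabel α β u = F.vertexPoint C r u 0 ∧ (F.vertexPoint C r u 0 ≤ p 0 - ρ ∨
      F.vertexPoint C r u 0 = p 0 ∨ p 0 + ρ ≤ F.vertexPoint C r u 0)) ∨
    (F.newLabel α β u = β ∧ F.vertexPoint C r u 0 = p 0 + r) ∨
    (F.newLabel α β u = α ∧ F.vertexPoint C r u 0 = chordX p C r) := by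
  rcases u with u | (_ | _ | h | h)
  · by_cases h : u = v₀
    · subst h
      exact Or.inr (Or.inl ⟨if_pos rfl, by rw [F.vertexPoint_self, pt_zero]⟩)
    · rw [F.vertexPoint_zero C r h]
      exact Or.inl ⟨if_neg h, d.height_far u.2⟩
  · exact Or.inr (Or.inr ⟨rfl, pt_zero _ _⟩)
  · exact Or.inr (Or.inr ⟨rfl, pt_zero _ _⟩)
  · exact Or.inl ⟨d.height_v₀.trans (pt_zero _ _).symm, Or.inr (Or.inl (pt_zero _ _))⟩
  · exact Or.inl ⟨d.height_v₀.trans (pt_zero _ _).symm, Or.inr (Or.inl (pt_zero _ _))⟩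

/-- Both `α` and the abscissa of the chord lie in the vertex-free interval to the left of `p 0`, and
both `β` and `p 0 + r` in the one to the right, so the order is the same. -/
lemma label_le_iff (d : DiskContext S D p lo hi C ρ v₀ F r) {α β : ℝ}
    (hα : α ∈ Ioo (p 0 - ρ) (p 0)) (hβ : β ∈ Ioo (p 0) (p 0 + ρ))
    (u u' : ReebVertex S D ⊕ F.NewVertex) :
    F.newLabel α β u ≤ F.newLabel α β u' ↔ F.vertexPoint C r u 0 ≤ F.vertexPoint C r u' 0 := by
  have hX := d.chordX_mem
  have hr := d.r_pos
  have hrρ := d.r_lt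
  obtain ⟨x1, x2⟩ := hX
  obtain ⟨a1, a2⟩ := hα
  obtain ⟨b1, b2⟩ := hβ
  rcases d.label_cases α β u with ⟨h1, h | h | h⟩ | ⟨h1, h⟩ | ⟨h1, h⟩ <;>
    rcases d.label_cases α β u' with ⟨k1, k | k | k⟩ | ⟨k1, k⟩ | ⟨k1, k⟩ <;>
    constructor <;> intro hle <;> linarith

lemma modified_lt (d : DiskContext S D p lo hi C ρ v₀ F r) (e : ReebEdge S D ⊕ F.NewEdge) :
    F.vertexPoint C r (Sum.elim F.oldSrc F.newSrc e) 0 <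
      F.vertexPoint C r (Sum.elim F.oldTgt F.newTgt e) 0 := by
  rcases e with e | e
  · exact d.old_lt e
  · exact (d.new_bounds e).1

lemma compatible (d : DiskContext S D p lo hi C ρ v₀ F r) {α β : ℝ}
    (hα : α ∈ Ioo (p 0 - ρ) (p 0)) (hβ : β ∈ Ioo (p 0) (p 0 + ρ)) :
    (F.modified α β).Compatible := fun e =>
  lt_of_not_ge fun h => not_lt.2 ((d.label_le_iff hα hβ _ _).1 h) (d.modified_lt e)

/-- The Poincaré-Reeb graph of the region without the disk is the modified graph. -/
theorem nonempty_iso_modified (d : DiskContext S D p lo hi C ρ v₀ F r) {α β : ℝ}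
    (hα : α ∈ Ioo (p 0 - ρ) (p 0)) (hβ : β ∈ Ioo (p 0) (p 0 + ρ)) :
    Nonempty (VSpace.Iso (F.modified α β).realize
      (reebGraph (insert ⟨p, r, d.r_pos⟩ S) (D \ Metric.closedBall p r))) := by
  have hcl := d.loc.closure_sdiff d.r_pos d.r_lt
  have : Finite (F.modified α β).V := by
    have := (finite_reebVert d.mbc).to_subtype
    exact inferInstanceAs (Finite (ReebVertex S D ⊕ F.NewVertex))
  have : Finite (F.modified α β).E := by
    have := finite_reebEdge d.mbc
    exact inferInstanceAs (Finite (ReebEdge S D ⊕ F.NewEdge))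
  refine nonempty_iso_reebGraph (F.modified α β) (F.vertexPoint C r) (F.edgeCurve d.mbc)
    ?_ d.modified_lt ?_ ?_ ?_ ?_ ?_ ?_ ?_ ?_ ?_ (d.compatible hα hβ) (d.label_le_iff hα hβ) <;>
    try rw [hcl]
  · exact d.vertexPoint_mem
  · rintro (e | e)
    · exact (Arc.continuous_f _).continuousOn
    · exact d.continuousOn_edgeCurve e
  · rintro (e | e) x hx
    · refine d.old_fiber e hx ⟨le_rfl, Strip.le _ ?_⟩
      exact ⟨(d.old_bounds e).1.trans hx.1, hx.2.trans (d.old_bounds e).2.1⟩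
    · exact (d.newPoint hx).mem
  · rintro (e | e)
    · exact d.old_source_vis e
    · exact d.new_source_vis e
  · rintro (e | e)
    · exact d.old_target_vis e
    · exact d.new_target_vis e
  · exact fun u u' h => d.vertexPoint_injective h
  · intro z
    constructor
    · rintro ⟨q, hq, hv⟩
      have hqK : (q : Plane) ∈ closure D \ Metric.ball p r := hcl ▸ q.2
      obtain ⟨u, hu⟩ := d.exists_vertex_of_new_special hqK hv
      rw [← hcl] at hu
      exact ⟨u, hu.trans (reebMk_eq_iff.1 hq)⟩
    · rintro ⟨u, hu⟩
      obtain ⟨q, hq, hv⟩ := d.exists_special u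
      rw [← hcl] at hq
      exact ⟨⟨q, hq.right_mem⟩, reebMk_eq_iff.2 (hq.symm.trans hu), hv⟩
  · rintro (e | e) x hx u
    · exact d.old_no_vertex hx u
    · exact d.new_no_vertex hx u
  · rintro (e | e) (e' | e') x hx hx' h
    · have hreg := d.old_region hx (z := ⟨_, h.right_mem.1⟩) (h.mono sdiff_subset)
      have hreg' := d.old_region hx' (z := ⟨_, h.right_mem.1⟩) (Vis.refl h.right_mem.1)
      exact congrArg Sum.inl (ReebEdge.eq_of_region d.mbc hreg hreg')
    · exact (d.old_new_disjoint hx hx' h).elim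
    · exact (d.old_new_disjoint hx' hx h.symm).elim
    · exact congrArg Sum.inr (d.new_injective hx hx' h)
  · intro z hz hu
    exact d.covered (z := ⟨z, hz.1⟩) hz.2 hu

end DiskContext

/-! ### Choice of the radius and conclusion. -/

lemma exists_poleContext {S : Set PlaneCircle} {D : Set Plane} (hM : IsMBC S D) {p : Plane}
    (hp : IsTypeIPole S D p) {lo hi : ℝ} (hlo : lo < p 1) (hhi : p 1 < hi)
    (hf : IsFiber (closure D) (p 0) lo hi) : ∃ C ρ, PoleContext S D p lo hi C ρ := by
  obtain ⟨C, ρ, h⟩ := exists_localPole hM hp hlo hhi hf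
  -- There are finitely many vertex heights, so those different from `p 0` keep a positive distance
  -- `ε` from it; the radius is reduced to at most this distance.
  have hfin : ((reebHeight D '' reebVert S D) \ {p 0}).Finite :=
    ((finite_reebVert hM).image _).subset sdiff_subset
  obtain ⟨ε, hε, hball⟩ := Metric.mem_nhds_iff.1
    (hfin.isClosed.isOpen_compl.mem_nhds (show p 0 ∈ _ from fun h => h.2 rfl))
  refine ⟨C, min ρ ε, hM, hp.1, hlo, hhi, hf, h.mono (lt_min h.pos hε) (min_le_left _ _),
    fun w hw h1 h2 => ?_⟩
  by_contra hne
  have hmin := min_le_right ρ ε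
  refine hball (show reebHeight D w ∈ _ from ?_) ⟨mem_image_of_mem _ hw, hne⟩
  rw [Metric.mem_ball, Real.dist_eq, abs_lt]
  constructor <;> linarith

theorem theorem5 (S : Set PlaneCircle) (D : Set Plane) (hSD : IsMBC S D)
    (p : Plane) (hp : IsTypeIPole S D p)
    (lo hi : ℝ) (hlo : lo < p 1) (hhi : p 1 < hi)
    (hseg : connectedComponentIn (closure D ∩ {z | z 0 = p 0}) p =
      {z | z 0 = p 0 ∧ z 1 ∈ Set.Icc lo hi}) :
    Nonempty (SegmentData S D p lo hi (poleVertex hp.1 hp.2.1)) ∧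
    ∃ δ > (0 : ℝ), ∃ ρ > (0 : ℝ),
      ∀ F : SegmentData S D p lo hi (poleVertex hp.1 hp.2.1),
      ∀ α ∈ Set.Ioo (p 0 - δ) (p 0), ∀ β ∈ Set.Ioo (p 0) (p 0 + δ),
      (F.modified α β).Compatible ∧
      ∀ (r : ℝ) (hr : 0 < r), r < ρ →
        IsMBC (insert ⟨p, r, hr⟩ S) (D \ Metric.closedBall p r) ∧
        Nonempty (VSpace.Iso (F.modified α β).realize
          (reebGraph (insert ⟨p, r, hr⟩ S) (D \ Metric.closedBall p r))) := by
  refine ⟨nonempty_segmentData hSD p hp lo hi hlo hhi hseg, ?_⟩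
  obtain ⟨C, ρ, c⟩ := exists_poleContext hSD hp hlo hhi
    (isFiber_of_segment hp.1 hlo.le hhi.le hseg)
  have hρ := c.loc.pos
  refine ⟨ρ, hρ, ρ, hρ, fun F α hα β hβ => ?_⟩
  have hd : ∀ r, 0 < r → r < ρ → DiskContext S D p lo hi C ρ _ F r := fun r hr hrρ =>
    { c with v₀_eq := rfl, r_pos := hr, r_lt := hrρ }
  -- The compatibility of the labels does not involve `r`, but its proof compares them with the
  -- abscissae for a disk; any admissible radius will do.
  refine ⟨(hd (ρ / 2) (half_pos hρ) (half_lt_self hρ)).compatible hα hβ, fun r hr hrρ => ?_⟩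
  exact ⟨c.loc.isMBC_insert hSD hr hrρ, (hd r hr hrρ).nonempty_iso_modified hα hβ⟩

end
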